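/- Let $R$ be a commutative ring and let $k\ge 1$ be an integer such that $2$ and $k!$ are invertible in $R$. $K(R)$ is the Grothendieck ring of finitely generated projective (f.g.p.) $R$-modules, with product induced by $\otimes_R$; for an f.g.p. module $M$ let $\Psi^k(M)=Q_k(\lambda^1M,\dots,\lambda^kM)\in K(R)$ be the Adams operation, where $Q_k$ is the Newton polynomial expressing the power sum $\sum_i x_i^k$ through the elementary symmetric functions. **Clifford modules.** For a quadratic form $q$ on an $R$-module $V$ and a group $G$, a graded $G$-module over $C(V,q)$ is a $C(V,q)$-module $M$, f.g.p. over $C(V,q)$, with an involution $\varepsilon$ (the grading) anticommuting with $V$, and an $R$-linear action of $G$ commuting with $C(V,q)$ and $\varepsilon$. $K_G(C(V,q))$ is the group generated by these modules, with relations $[M\oplus N]=[M]+[N]$ (up to isomorphism) and $[M]=0$ whenever $M$ has an additional $G$-equivariant involution anticommuting with $\varepsilon$ and with $V$; that is, the cokernel of $K_G(C(V,q)\hat\otimes C^{0,2})\to K_G(C(V,q)\hat\otimes C^{0,1})$. Write $K(C(V,q))$ if $G$ is trivial. **Spinorial modules.** A spinorial module $(V,E)$ consists of an f.g.p. module $V$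 with a nondegenerate quadratic form $q$, an f.g.p. $\mathbb Z/2$-graded module $E$ with grading involution $\varepsilon$, and an isomorphism of $\mathbb Z/2$-graded algebras $C(V,q)\cong\mathrm{End}(E)$. (The orientation of $V$ is then the even element $u$ of $C(V,q)$ corresponding to $\varepsilon$; $u^2=1$ and $u$ anticommutes with $V$.) It gives the Morita map $\alpha:K(R)\to K(C(V,q))$, $[N]\mapsto[E\otimes N]$. If $v\in V$ acts on $E=E_0\oplus E_1$ by $\begin{pmatrix}0&\sigma(v)\\ \tau(v)&0\end{pmatrix}$, then $v\mapsto\begin{pmatrix}0&k\sigma(v)\\ \tau(v)&0\end{pmatrix}$ induces $C(V,kq)\cong\mathrm{End}(E)$, so that $((V,kq),E)$ is again spinorial; let $\alpha_k:K(R)\to K(C(V,kq))$ be its Morita map. The sum of $(V,E)$ and $(W,F)$ is $(V\oplus W,E\otimes F)$, where $(v,w)$ acts by $v\otimes1+\varepsilon\otimes w$. **The operation $\theta_k$.** The power map $P:K(C(V,q))\to K_{S_k}(C(V,kq))$ sends $[M]$ to the class of the $k$-th graded tensor power $M^{\hat\otimes k}$, on which $v\in V$ acts by $\sum_i\varepsilon^{\otimes(i-1)}\otimes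 v\otimes 1^{\otimes(k-i)}$ and the symmetric group $S_k$ permutes the factors with Koszul signs. The Adams character $\Psi:K_{S_k}(C(V,kq))\cong K(C(V,kq))\otimes R(S_k)\to K(C(V,kq))$ is $\Psi([T])=\sum_\pi\chi_\pi(c_k)\,[\mathrm{Hom}_{S_k}(\pi,T)]$, where $\pi$ runs through the irreducible representations of $S_k$ (integral forms of the rational ones), $\chi_\pi$ is the character of $\pi$ and $c_k=(1\,2\cdots k)$. Then $\alpha$ and $\alpha_k$ are isomorphisms and $P$ is well defined on classes, and we put $$\theta_k=\alpha_k^{-1}\circ\Psi\circ P\circ\alpha:K(R)\to K(R),\qquad \rho_k(V,E)=\theta_k(1).$$ **Theorem.** For every spinorial module $(V,E)$ and every f.g.p. $R$-module $M$, $$\theta_k(M)=\rho_k(V,E)\cdot\Psi^k(M)$$ in $K(R)$, and more generally $\theta_k([M]-[N])=\rho_k(V,E)\cdot(\Psi^k(M)-\Psi^k(N))$ for all f.g.p. $M,N$. Moreover, for all spinorial modules $(V,E)$ and $(W,F)$, $$\rho_k(V\oplus W,E\otimes F)=\rho_k(V,E)\cdot\rho_k(W,F)\quad\text{in }K(R).$$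 -/

import Mathlib

universe u

open TensorProduct CliffordAlgebra

namespace HermBott

/-! ## Finitely generated projective modules -/

/-- An `R`-module `M` with an action `f` of an `R`-algebra `A` is finitely generated and projective
as an `A`-module. -/
def IsFGProj {R A M : Type u} [CommRing R] [Ring A] [Algebra R A] [AddCommGroup M] [Module R M]
    (f : A →ₐ[R] Module.End R M) : Prop :=
  letI : Module A M := Module.compHom M f.toRingHom
  Module.Finite A M ∧ Module.Projective A M

section FGProj

variable {R A M N : Type u} [CommRing R] [Ring A] [Algebra R A]
  [AddCommGroup M] [Module R M] [AddCommGroup N] [Module R N]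

theorem isFGProj_of_retract {f : A →ₐ[R] Module.End R M} {g : A →ₐ[R] Module.End R N}
    (hf : IsFGProj f) (i : N →ₗ[R] M) (s : M →ₗ[R] N) (hsi : ∀ x, s (i x) = x)
    (hi : ∀ a x, i (g a x) = f a (i x)) (hs : ∀ a x, s (f a x) = g a (s x)) : IsFGProj g := by
  let : Module A M := Module.compHom M f.toRingHom
  let : Module A N := Module.compHom N g.toRingHom
  obtain ⟨h1, h2⟩ : Module.Finite A M ∧ Module.Projective A M := hf
  let i' : N →ₗ[A] M := { toFun := i, map_add' := i.map_add, map_smul' := hi }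
  let s' : M →ₗ[A] N := { toFun := s, map_add' := s.map_add, map_smul' := hs }
  exact ⟨Module.Finite.of_surjective s' fun x => ⟨i x, hsi x⟩,
    Module.Projective.of_split i' s' (LinearMap.ext hsi)⟩

theorem isFGProj_prod {f : A →ₐ[R] Module.End R M} {g : A →ₐ[R] Module.End R N}
    (hf : IsFGProj f) (hg : IsFGProj g) (h : A →ₐ[R] Module.End R (M × N))
    (hh : ∀ a x, h a x = (f a x.1, g a x.2)) : IsFGProj h := by
  let : Module A M := Module.compHom M f.toRingHom
  let : Module A N := Module.compHom N g.toRingHom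
  obtain ⟨h1, h2⟩ : Module.Finite A M ∧ Module.Projective A M := hf
  obtain ⟨h3, h4⟩ : Module.Finite A N ∧ Module.Projective A N := hg
  have key : Module.Finite A (M × N) ∧ Module.Projective A (M × N) := ⟨inferInstance, inferInstance⟩
  let m' : Module A (M × N) := Module.compHom (M × N) h.toRingHom
  have e : m' = Prod.instModule := by
    ext a x <;> simp only [HSMul.hSMul, SMul.smul] <;> exact congrArg _ (hh a x)
  change @Module.Finite A (M × N) _ _ m' ∧ @Module.Projective A _ (M × N) _ m'
  rw [e]; exact key

theorem isFGProj_subsingleton [Subsingleton M] (f : A →ₐ[R] Module.End R M) : IsFGProj f := by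
  let : Module A M := Module.compHom M f.toRingHom
  exact ⟨inferInstance, inferInstance⟩

/-- If `A` is finitely generated projective over `R`, so is every finitely generated projective
`A`-module. -/
theorem finite_projective_of_isFGProj [Module.Finite R A] [Module.Projective R A]
    {f : A →ₐ[R] Module.End R M} (hf : IsFGProj f) :
    Module.Finite R M ∧ Module.Projective R M := by
  let : Module A M := Module.compHom M f.toRingHom
  obtain ⟨h1, h2⟩ : Module.Finite A M ∧ Module.Projective A M := hf
  have : IsScalarTower R A M := ⟨fun r a x => by
    change f (r • a) x = r • f a x
    simp⟩
  obtain ⟨n, p, s, -, -, hsp⟩ := Module.Finite.exists_comp_eq_id_of_projective A M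
  refine ⟨Module.Finite.trans A M, ?_⟩
  have : Module.Projective R (Fin n → A) :=
    Module.Projective.of_equiv' (DirectSum.linearEquivFunOnFintype R (Fin n) fun _ => A)
  exact Module.Projective.of_split (M := Fin n → A) (s.restrictScalars R) (p.restrictScalars R)
    (LinearMap.ext fun x => LinearMap.congr_fun hsp x)

/-- A finitely generated projective module has a dual basis. -/
theorem exists_dual_basis (R E : Type u) [CommRing R] [AddCommGroup E] [Module R E]
    [Module.Finite R E] [Module.Projective R E] :
    ∃ (n : ℕ) (x : Fin n → E) (g : Fin n → Module.Dual R E), ∀ e, ∑ j, g j e • x j = e := by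
  obtain ⟨n, p, s, -, -, hsp⟩ := Module.Finite.exists_comp_eq_id_of_projective R E
  refine ⟨n, fun j => p (Pi.single j 1), fun j => LinearMap.proj j ∘ₗ s, fun e => ?_⟩
  have : p (s e) = e := LinearMap.congr_fun hsp e
  conv_rhs => rw [← this, ← Finset.univ_sum_single (s e), map_sum]
  refine Finset.sum_congr rfl fun j _ => ?_
  rw [← map_smul, ← Pi.single_smul]
  simp

/-- The trace ideal of a faithful finitely generated projective module is the unit ideal. -/
theorem exists_sum_dual_eq_one (R E : Type u) [CommRing R] [AddCommGroup E] [Module R E]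
    [Module.Finite R E] [Module.Projective R E] (hE : ∀ r : R, (∀ e : E, r • e = 0) → r = 0) :
    ∃ (m : ℕ) (y : Fin m → E) (f : Fin m → Module.Dual R E), ∑ i, f i (y i) = 1 := by
  obtain ⟨n, x, g, hx⟩ := exists_dual_basis R E
  let I : Ideal R := Ideal.span {r | ∃ (f : Module.Dual R E) (y : E), f y = r}
  have hI : (⊤ : Submodule R E) ≤ I • ⊤ := fun e _ => by
    rw [← hx e]
    exact Submodule.sum_mem _ fun j _ =>
      Submodule.smul_mem_smul (Ideal.subset_span ⟨_, _, rfl⟩) trivial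
  obtain ⟨r, hr, hr0⟩ := Submodule.exists_sub_one_mem_and_smul_eq_zero_of_fg_of_le_smul I
    (⊤ : Submodule R E) Module.Finite.fg_top hI
  have h1 : (1 : R) ∈ I := by
    have : r = 0 := hE r fun e => hr0 e trivial
    rw [this, zero_sub] at hr
    simpa using I.neg_mem hr
  have key : ∀ r ∈ I, ∃ (m : ℕ) (y : Fin m → E) (f : Fin m → Module.Dual R E),
      ∑ i, f i (y i) = r := by
    intro r hr
    induction hr using Submodule.span_induction with
    | mem r h => obtain ⟨f, y, rfl⟩ := h; exact ⟨1, fun _ => y, fun _ => f, by simp⟩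
    | zero => exact ⟨0, Fin.elim0, Fin.elim0, by simp⟩
    | add a b _ _ ha hb =>
      obtain ⟨m, y, f, rfl⟩ := ha
      obtain ⟨m', y', f', rfl⟩ := hb
      exact ⟨m + m', Fin.append y y', Fin.append f f', by simp [Fin.sum_univ_add]⟩
    | smul c a _ ha =>
      obtain ⟨m, y, f, rfl⟩ := ha
      exact ⟨m, y, fun i => c • f i, by simp [Finset.mul_sum]⟩
  exact key 1 h1

/-- Over an algebra isomorphic to the endomorphism algebra of a faithful finitely generated
projective module, a module is finitely generated projective as soon as it is so over `R`. -/
theorem isFGProj_of_algEquiv_end {E : Type u} [AddCommGroup E] [Module R E]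
    [Module.Finite R E] [Module.Projective R E] (hE : ∀ r : R, (∀ e : E, r • e = 0) → r = 0)
    (φ : A ≃ₐ[R] Module.End R E) [Module.Finite R M] [Module.Projective R M]
    (f : A →ₐ[R] Module.End R M) : IsFGProj f := by
  let : Module A M := Module.compHom M f.toRingHom
  have : IsScalarTower R A M := ⟨fun r a x => by
    change f (r • a) x = r • f a x
    simp⟩
  obtain ⟨n, x, g, hx⟩ := exists_dual_basis R E
  obtain ⟨m, y, h, hy⟩ := exists_sum_dual_eq_one R E hE
  let ψ : Module.Dual R E →ₗ[R] E →ₗ[R] A :=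
    (LinearMap.smulRightₗ (R := R) (M₂ := E) (M := E)).compr₂ φ.symm.toLinearMap
  have hψ : ∀ f e, ψ f e = φ.symm (f.smulRight e) := fun f e => rfl
  have hmul : ∀ (a : A) (f : Module.Dual R E) (e : E), a * ψ f e = ψ f (φ a e) := fun a f e => by
    apply φ.injective
    ext z
    simp [hψ]
  have hmul' : ∀ (a : A) (f : Module.Dual R E) (e : E), ψ f e * a = ψ (f ∘ₗ φ a) e :=
    fun a f e => by
    apply φ.injective
    ext z
    simp [hψ]
  have hid : ∑ j, ψ (g j) (x j) = 1 := by
    apply φ.injective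
    ext z
    simp [hψ, hx]
  have hcomp : ∀ (f f' : Module.Dual R E) (e e' : E), ψ f e * ψ f' e' = f e' • ψ f' e :=
    fun f f' e e' => by
    rw [hmul', ← map_smul]
    apply φ.injective
    ext z
    simp [hψ, smul_smul, mul_comm]
  let T : M → A ⊗[R] M := fun z => ∑ i, ∑ j, ψ (h i) (x j) ⊗ₜ[R] (ψ (g j) (y i) • z)
  have hT : ∀ (a : A) (z : M), T (a • z) = a • T z := fun a z => by
    have e1 : ∀ i j, ψ (h i) (φ a (x j)) = ∑ l, g l (φ a (x j)) • ψ (h i) (x l) := fun i j => by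
      conv_lhs => rw [← hx (φ a (x j))]
      simp only [map_sum, map_smul]
    have e2 : ∀ i l, ψ (g l ∘ₗ φ a) (y i) = ∑ j, g l (φ a (x j)) • ψ (g j) (y i) := fun i l => by
      have : g l ∘ₗ φ a = ∑ j, g l (φ a (x j)) • g j := by
        ext z
        conv_lhs => rw [← hx z]
        simp [mul_comm]
      rw [this]
      simp only [map_sum, map_smul, LinearMap.sum_apply, LinearMap.smul_apply]
    simp only [T, Finset.smul_sum, TensorProduct.smul_tmul', smul_eq_mul, hmul, e1, smul_smul,
      hmul', e2, Finset.sum_smul, TensorProduct.sum_tmul, TensorProduct.tmul_sum]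
    refine Finset.sum_congr rfl fun i _ => ?_
    rw [Finset.sum_comm]
    refine Finset.sum_congr rfl fun j _ => Finset.sum_congr rfl fun l _ => ?_
    rw [smul_assoc, TensorProduct.tmul_smul, TensorProduct.smul_tmul']
  let T' : M →ₗ[A] A ⊗[R] M :=
    { toFun := T
      map_add' := fun z w => by
        simp only [T, smul_add, TensorProduct.tmul_add, Finset.sum_add_distrib]
      map_smul' := hT }
  let μ : A ⊗[R] M →ₗ[A] M :=
    TensorProduct.AlgebraTensorModule.lift
      { toFun := fun a => (LinearMap.toSpanSingleton A (M →ₗ[R] M) LinearMap.id a)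
        map_add' := fun a b => by simp [add_smul]
        map_smul' := fun a b => by simp [mul_smul] }
  have hμ : ∀ a z, μ (a ⊗ₜ z) = a • z := fun a z => rfl
  refine ⟨Module.Finite.of_restrictScalars_finite R A M,
    Module.Projective.of_split (M := A ⊗[R] M) T' μ (LinearMap.ext fun z => ?_)⟩
  change μ (∑ i, ∑ j, ψ (h i) (x j) ⊗ₜ[R] (ψ (g j) (y i) • z)) = z
  simp only [map_sum, hμ, smul_smul, hcomp, ← Finset.sum_smul]
  simp only [← Finset.sum_smul, ← Finset.smul_sum, hid, hy, one_smul]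

end FGProj

/-! ## Spinorial modules -/

section Spinorial

variable {R V W : Type u} [CommRing R] [AddCommGroup V] [Module R V] [AddCommGroup W] [Module R W]

/-- A spinorial module `(V, E)`: a finitely generated projective module `V` with a nondegenerate
quadratic form `Q`, a finitely generated projective `ℤ/2`-graded module `E = E₀ ⊕ E₁` (the grading
being recorded by the involution `ε` which is `1` on `E₀` and `-1` on `E₁`) and an isomorphism of
`ℤ/2`-graded algebras `φ : C(V, Q) ≅ End(E)`.  The orientation of `V` is the element `u = φ⁻¹(ε)` of
the even Clifford algebra, see `Spinorial.orientation`. -/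
structure Spinorial (Q : QuadraticForm R V) where
  finite : Module.Finite R V
  projective : Module.Projective R V
  nondegenerate : Function.Bijective Q.polarBilin
  /-- the module of spinors -/
  E : Type u
  [addCommGroup : AddCommGroup E]
  [module : Module R E]
  finite_E : Module.Finite R E
  projective_E : Module.Projective R E
  /-- the grading of the module of spinors -/
  ε : Module.End R E
  ε_sq : ε * ε = 1
  /-- the isomorphism between the Clifford algebra and the endomorphism algebra -/
  φ : CliffordAlgebra Q ≃ₐ[R] Module.End R E
  φ_odd : ∀ v, ε * φ (ι Q v) = -(φ (ι Q v) * ε)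

attribute [instance] Spinorial.addCommGroup Spinorial.module Spinorial.finite_E
  Spinorial.projective_E

variable {Q : QuadraticForm R V} {Q' : QuadraticForm R W}

theorem polarBilin_smul_bijective (k : R) (hQ : Function.Bijective Q.polarBilin) (hk : IsUnit k) :
    Function.Bijective (k • Q).polarBilin := by
  obtain ⟨a, rfl⟩ := hk
  have : ∀ x, ((a : R) • Q).polarBilin x = a • Q.polarBilin x := fun x => by
    ext y
    simp [QuadraticMap.polar_smul, Units.smul_def]
  constructor
  · intro x y hxy
    rw [this, this] at hxy
    exact hQ.1 (MulAction.injective a hxy)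
  · intro f
    obtain ⟨x, hx⟩ := hQ.2 (a⁻¹ • f)
    exact ⟨x, by rw [this, hx, smul_inv_smul]⟩

namespace Spinorial

/-- The orientation `u` of a spinorial module. -/
def orientation (S : Spinorial Q) : CliffordAlgebra Q := S.φ.symm S.ε

theorem orientation_sq (S : Spinorial Q) : S.orientation * S.orientation = 1 := by
  apply S.φ.injective
  simp [orientation, S.ε_sq]

theorem orientation_anticomm (S : Spinorial Q) (v : V) :
    S.orientation * ι Q v = -(ι Q v * S.orientation) := by
  apply S.φ.injective
  simp [orientation, S.φ_odd]

theorem ε_mul_φ (S : Spinorial Q) (x : CliffordAlgebra Q) :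
    S.ε * S.φ x = S.φ (involute x) * S.ε := by
  induction x using CliffordAlgebra.induction with
  | algebraMap r => simp [Algebra.commutes]
  | ι v => simp [S.φ_odd]
  | mul a b ha hb => rw [map_mul, ← mul_assoc, ha, mul_assoc, hb, map_mul, map_mul, mul_assoc]
  | add a b ha hb => rw [map_add, mul_add, ha, hb, map_add, map_add, add_mul]

theorem involute_of_mem_even {x : CliffordAlgebra Q} (hx : x ∈ evenOdd Q 0) : involute x = x := by
  induction x, hx using CliffordAlgebra.even_induction with
  | algebraMap r => simp
  | add x y _ _ hx hy => rw [map_add, hx, hy]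
  | ι_mul_ι_mul a b x _ hx => simp [hx]

theorem involute_of_mem_odd {x : CliffordAlgebra Q} (hx : x ∈ evenOdd Q 1) :
    involute x = -x := by
  induction x, hx using CliffordAlgebra.odd_induction with
  | ι v => simp
  | add x y _ _ hx hy => rw [map_add, hx, hy, neg_add]
  | ι_mul_ι_mul a b x _ hx => simp [hx]

theorem orientation_even [Invertible (2 : R)] (S : Spinorial Q) :
    S.orientation ∈ evenOdd Q 0 := by
  have h1 : involute S.orientation = S.orientation := by
    have h := S.ε_mul_φ S.orientation
    apply S.φ.injective
    have h2 : S.φ S.orientation = S.ε := by simp [orientation]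
    rw [h2] at h ⊢
    calc S.φ (involute S.orientation) = S.φ (involute S.orientation) * S.ε * S.ε := by
          rw [mul_assoc, S.ε_sq, mul_one]
      _ = S.ε := by rw [← h, S.ε_sq, one_mul]
  obtain ⟨a, ha, b, hb, hab⟩ := Submodule.mem_sup.mp
    ((evenOdd_isCompl Q).sup_eq_top ▸ Submodule.mem_top : S.orientation ∈ evenOdd Q 0 ⊔ evenOdd Q 1)
  rw [← hab, map_add, involute_of_mem_even ha, involute_of_mem_odd hb] at h1
  have h3 : (2 : R) • b = 0 := by
    have : b + b = 0 := by
      have := add_left_cancel h1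
      nth_rewrite 1 [← this]; simp
    rw [two_smul, this]
  have h4 : b = 0 := by
    have := congrArg ((⅟2 : R) • ·) h3
    simpa [smul_smul] using this
  rw [← hab, h4, add_zero]
  exact ha

theorem faithful [Invertible (2 : R)] (S : Spinorial Q) (r : R) (hr : ∀ e : S.E, r • e = 0) :
    r = 0 := by
  have h1 : algebraMap R (CliffordAlgebra Q) r = 0 := by
    apply S.φ.injective
    ext e
    simp [hr]
  have h2 := congrArg (equivExterior Q) h1
  rw [map_zero] at h2
  have h3 : equivExterior Q (algebraMap R _ r) = algebraMap R _ r :=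
    changeForm_algebraMap changeForm.associated_neg_proof _
  rw [h3] at h2
  exact (ExteriorAlgebra.algebraMap_leftInverse V).injective (by simpa using h2)

theorem finite_end (S : Spinorial Q) : Module.Finite R (Module.End R S.E) :=
  Module.Finite.equiv (LinearEquiv.ofBijective _ (dualTensorHom_bijective (R := R) (M := S.E)
    (N := S.E)))

theorem projective_end (S : Spinorial Q) : Module.Projective R (Module.End R S.E) :=
  Module.Projective.of_equiv' (LinearEquiv.ofBijective _ (dualTensorHom_bijective (R := R)
    (M := S.E) (N := S.E)))

theorem finite_clifford (S : Spinorial Q) : Module.Finite R (CliffordAlgebra Q) :=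
  have := S.finite_end
  Module.Finite.equiv S.φ.symm.toLinearEquiv

theorem projective_clifford (S : Spinorial Q) : Module.Projective R (CliffordAlgebra Q) :=
  have := S.projective_end
  Module.Projective.of_equiv' S.φ.symm.toLinearEquiv

/-! ### The twisted spinorial module -/

/-- The endomorphism of `E = E₀ ⊕ E₁` which is `1` on `E₀` and `k` on `E₁`. -/
def twistEnd [Invertible (2 : R)] (S : Spinorial Q) (k : R) : Module.End R S.E :=
  (⅟2 : R) • ((1 + S.ε) + k • (1 - S.ε))

/-- The `k`-twisted map `fₖ : V → End(E)`, sending `v` to the matrix `(0, k σ(v); τ(v), 0)` if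
`v ∈ V ⊆ C(V, Q) ≅ End(E)` acts through the matrix `(0, σ(v); τ(v), 0)`. -/
def twistMap [Invertible (2 : R)] (S : Spinorial Q) (k : R) : V →ₗ[R] Module.End R S.E :=
  LinearMap.mulRight R (S.twistEnd k) ∘ₗ S.φ.toLinearMap ∘ₗ ι Q

variable [Invertible (2 : R)] (S : Spinorial Q) (k : R)

theorem twistEnd_comm : S.twistEnd k * S.ε = S.ε * S.twistEnd k := by
  simp only [twistEnd, smul_mul_assoc, mul_smul_comm, add_mul, mul_add, sub_mul, mul_sub, one_mul,
    mul_one]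

theorem twistEnd_mul (v : V) : S.twistEnd k * S.φ (ι Q v) =
    S.φ (ι Q v) * ((⅟2 : R) • ((1 - S.ε) + k • (1 + S.ε))) := by
  simp only [twistEnd, smul_mul_assoc, mul_smul_comm, add_mul, mul_add, one_mul, mul_one,
    sub_eq_add_neg, mul_neg, neg_mul, S.φ_odd, neg_neg]

theorem twistEnd_mul_twistEnd : ((⅟2 : R) • ((1 - S.ε) + k • (1 + S.ε))) * S.twistEnd k =
    k • (1 : Module.End R S.E) := by
  have h4 : (⅟2 : R) * ⅟2 * 4 = 1 := by
    rw [show (4 : R) = 2 * 2 by norm_num, ← mul_assoc, mul_assoc (⅟2 : R), invOf_mul_self, mul_one,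
      invOf_mul_self]
  have : ((1 - S.ε) + k • (1 + S.ε)) * ((1 + S.ε) + k • (1 - S.ε)) =
      (4 : R) • k • (1 : Module.End R S.E) := by
    simp only [smul_mul_assoc, mul_smul_comm, add_mul, mul_add, sub_mul, mul_sub, one_mul,
      mul_one, S.ε_sq]
    module
  rw [twistEnd, smul_mul_smul_comm, this, smul_smul, h4, one_smul]

theorem twistMap_apply (v : V) : S.twistMap k v = S.φ (ι Q v) * S.twistEnd k := rfl

theorem twistMap_mul (v w : V) :
    S.twistMap k v * S.twistMap k w = k • (S.φ (ι Q v) * S.φ (ι Q w)) := by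
  rw [twistMap_apply, twistMap_apply, mul_assoc, ← mul_assoc (S.twistEnd k), twistEnd_mul,
    mul_assoc, twistEnd_mul_twistEnd, mul_smul_comm, mul_smul_comm, mul_one]

theorem twistMap_sq (v : V) :
    S.twistMap k v * S.twistMap k v = algebraMap R _ ((k • Q) v) := by
  rw [twistMap_mul, ← map_mul, ι_sq_scalar, AlgEquiv.commutes, Algebra.algebraMap_eq_smul_one,
    Algebra.algebraMap_eq_smul_one, smul_smul]
  rfl

/-- The homomorphism `C(V, kQ) → End(E)` induced by the `k`-twisted map. -/
def twistHom : CliffordAlgebra (k • Q) →ₐ[R] Module.End R S.E :=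
  CliffordAlgebra.lift (k • Q) ⟨S.twistMap k, S.twistMap_sq k⟩

theorem twistHom_ι (v : V) : S.twistHom k (ι (k • Q) v) = S.φ (ι Q v) * S.twistEnd k := by
  simp [twistHom, twistMap_apply]

theorem twistHom_bijective (hk : IsUnit k) : Function.Bijective (S.twistHom k) := by
  obtain ⟨l, hl⟩ : ∃ l, l * k = 1 := hk.exists_left_inv
  have hmem : ∀ v w, S.φ (ι Q v) * S.φ (ι Q w) ∈ (S.twistHom k).range := fun v w => by
    refine ⟨l • (ι (k • Q) v * ι (k • Q) w), ?_⟩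
    change S.twistHom k _ = _
    rw [map_smul, map_mul, twistHom_ι, twistHom_ι]
    have := S.twistMap_mul k v w
    rw [twistMap_apply, twistMap_apply] at this
    rw [this, smul_smul, hl, one_smul]
  have heven : ∀ x ∈ evenOdd Q 0, S.φ x ∈ (S.twistHom k).range := fun x hx => by
    induction x, hx using CliffordAlgebra.even_induction with
    | algebraMap r => rw [AlgEquiv.commutes]; exact Subalgebra.algebraMap_mem _ _
    | add x y _ _ hx hy => rw [map_add]; exact add_mem hx hy
    | ι_mul_ι_mul a b x _ hx => rw [map_mul, map_mul]; exact mul_mem (hmem a b) hx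
  have hε : S.ε ∈ (S.twistHom k).range := by
    simpa [orientation] using heven _ S.orientation_even
  have hv : ∀ v, S.φ (ι Q v) ∈ (S.twistHom k).range := fun v => by
    have h1 : (l • (⅟2 : R) • ((1 - S.ε) + k • (1 + S.ε))) ∈ (S.twistHom k).range :=
      Subalgebra.smul_mem _ (Subalgebra.smul_mem _ (add_mem (sub_mem (one_mem _) hε)
        (Subalgebra.smul_mem _ (add_mem (one_mem _) hε) _)) _) _
    have h2 : S.twistEnd k * (l • (⅟2 : R) • ((1 - S.ε) + k • (1 + S.ε))) = 1 := by
      have h3 : S.twistEnd k * ((⅟2 : R) • ((1 - S.ε) + k • (1 + S.ε))) =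
          ((⅟2 : R) • ((1 - S.ε) + k • (1 + S.ε))) * S.twistEnd k := by
        have := S.twistEnd_comm k
        simp only [smul_mul_assoc, mul_smul_comm, add_mul, mul_add, sub_mul, mul_sub, one_mul,
          mul_one, this]
      rw [mul_smul_comm, h3, twistEnd_mul_twistEnd, smul_smul, hl, one_smul]
    have h4 : S.φ (ι Q v) = S.twistHom k (ι (k • Q) v) *
        (l • (⅟2 : R) • ((1 - S.ε) + k • (1 + S.ε))) := by
      rw [twistHom_ι, mul_assoc, h2, mul_one]
    rw [h4]
    exact mul_mem ⟨_, rfl⟩ h1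
  have hsurj : Function.Surjective (S.twistHom k) := by
    rw [← AlgHom.range_eq_top, eq_top_iff]
    intro y _
    obtain ⟨x, rfl⟩ := S.φ.surjective y
    induction x using CliffordAlgebra.induction with
    | algebraMap r => rw [AlgEquiv.commutes]; exact Subalgebra.algebraMap_mem _ _
    | ι v => exact hv v
    | mul a b ha hb => rw [map_mul]; exact mul_mem (ha trivial) (hb trivial)
    | add a b ha hb => rw [map_add]; exact add_mem (ha trivial) (hb trivial)
  let e : CliffordAlgebra (k • Q) ≃ₗ[R] Module.End R S.E :=
    (equivExterior (k • Q)).trans ((equivExterior Q).symm.trans S.φ.toLinearEquiv)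
  refine ⟨?_, hsurj⟩
  have := S.finite_end
  have h5 : Function.Injective ((S.twistHom k).toLinearMap ∘ₗ e.symm.toLinearMap) :=
    OrzechProperty.injective_of_surjective_endomorphism _ (hsurj.comp e.symm.surjective)
  intro a b hab
  have := @h5 (e a) (e b) (by simpa using hab)
  exact e.injective this

/-- The spinorial module `(V, kQ)`, with the same module of spinors `E`, whose Clifford algebra acts
on `E` through the `k`-twisted map. -/
noncomputable def twist (hk : IsUnit k) : Spinorial (k • Q) where
  finite := S.finite
  projective := S.projective
  nondegenerate := polarBilin_smul_bijective k S.nondegenerate hk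
  E := S.E
  finite_E := S.finite_E
  projective_E := S.projective_E
  ε := S.ε
  ε_sq := S.ε_sq
  φ := AlgEquiv.ofBijective (S.twistHom k) (S.twistHom_bijective k hk)
  φ_odd v := by
    simp only [AlgEquiv.ofBijective_apply, twistHom_ι]
    rw [← mul_assoc, S.φ_odd, neg_mul, mul_assoc, mul_assoc, twistEnd_comm]

/-! ### The sum of two spinorial modules -/

end Spinorial

theorem homTensorHomMap_bijective (E F : Type u) [AddCommGroup E] [Module R E] [AddCommGroup F]
    [Module R F] [Module.Finite R E] [Module.Projective R E] [Module.Finite R F]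
    [Module.Projective R F] :
    Function.Bijective (TensorProduct.homTensorHomMap (.id R) E F E F) := by
  obtain ⟨n, x, g, hx⟩ := exists_dual_basis R E
  obtain ⟨m, y, h, hy⟩ := exists_dual_basis R F
  let ν : Fin n → Fin m → E ⊗[R] F →ₗ[R] Module.End R E ⊗[R] Module.End R F := fun i j =>
    TensorProduct.map (LinearMap.smulRightₗ (g i)) (LinearMap.smulRightₗ (h j))
  let s : Module.End R (E ⊗[R] F) →ₗ[R] Module.End R E ⊗[R] Module.End R F :=
    ∑ i, ∑ j, ν i j ∘ₗ LinearMap.applyₗ (x i ⊗ₜ[R] y j)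
  have h1 : s ∘ₗ TensorProduct.homTensorHomMap (.id R) E F E F = LinearMap.id := by
    ext a b
    have ha : ∑ i, (g i).smulRight (a (x i)) = a := by
      ext e
      conv_rhs => rw [← hx e]
      simp
    have hb : ∑ i, (h i).smulRight (b (y i)) = b := by
      ext e
      conv_rhs => rw [← hy e]
      simp
    simp only [s, ν, LinearMap.sum_apply, LinearMap.comp_apply,
      TensorProduct.AlgebraTensorModule.curry_apply, LinearMap.restrictScalars_self,
      TensorProduct.curry_apply, TensorProduct.homTensorHomMap_apply, LinearMap.applyₗ_apply_apply,
      TensorProduct.map_tmul, LinearMap.id_apply]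
    conv_rhs => rw [← ha, ← hb]
    simp only [TensorProduct.sum_tmul, TensorProduct.tmul_sum]
    rw [Finset.sum_comm]
    rfl
  have h2 : TensorProduct.homTensorHomMap (.id R) E F E F ∘ₗ s = LinearMap.id := by
    refine LinearMap.ext fun T => TensorProduct.ext' fun e f => ?_
    have key : ∀ i j (z : E ⊗[R] F),
        TensorProduct.homTensorHomMap (.id R) E F E F (ν i j z) (e ⊗ₜ f) = (g i e * h j f) • z := by
      intro i j z
      induction z with
      | zero => simp
      | add a b ha hb => simp [ha, hb]
      | tmul a b =>
        simp only [ν, TensorProduct.map_tmul, TensorProduct.homTensorHomMap_apply]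
        exact TensorProduct.smul_tmul_smul _ _ _ _
    simp only [s, LinearMap.comp_apply, LinearMap.sum_apply, map_sum, LinearMap.applyₗ_apply_apply,
      key, LinearMap.id_apply]
    conv_rhs => rw [← hx e, ← hy f]
    simp only [TensorProduct.sum_tmul, TensorProduct.tmul_sum, map_sum,
      TensorProduct.smul_tmul_smul, map_smul]
    rw [Finset.sum_comm]
  exact ⟨Function.LeftInverse.injective (g := s) (LinearMap.congr_fun h1),
    Function.RightInverse.surjective (g := s) (LinearMap.congr_fun h2)⟩

theorem polarBilin_prod_bijective (hQ : Function.Bijective Q.polarBilin)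
    (hQ' : Function.Bijective Q'.polarBilin) : Function.Bijective (Q.prod Q').polarBilin := by
  have h : ∀ x y, (Q.prod Q').polarBilin x y = Q.polarBilin x.1 y.1 + Q'.polarBilin x.2 y.2 :=
    fun x y => by
    simp [QuadraticMap.polar]
  constructor
  · intro x y hxy
    refine Prod.ext (hQ.1 ?_) (hQ'.1 ?_)
    · ext z
      simpa [h] using LinearMap.congr_fun hxy (z, 0)
    · ext z
      simpa [h] using LinearMap.congr_fun hxy (0, z)
  · intro f
    obtain ⟨x, hx⟩ := hQ.2 (f ∘ₗ LinearMap.inl R V W)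
    obtain ⟨y, hy⟩ := hQ'.2 (f ∘ₗ LinearMap.inr R V W)
    refine ⟨(x, y), LinearMap.ext fun z => ?_⟩
    rw [h, hx, hy]
    simp [← map_add]

namespace Spinorial

/-- The map `V ⊕ W → End(E ⊗ F)`, `(v, w) ↦ v ⊗ 1 + ε ⊗ w`; this is the action of `V ⊕ W` on the
graded tensor product of `E` and `F`, that is, `w (e ⊗ f) = (-1)^{|e|} e ⊗ w f`. -/
noncomputable def sumMap (S : Spinorial Q) (S' : Spinorial Q') :
    V × W →ₗ[R] Module.End R (S.E ⊗[R] S'.E) :=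
  LinearMap.coprod
    (LinearMap.rTensorHom S'.E ∘ₗ S.φ.toLinearMap ∘ₗ ι Q)
    (LinearMap.mulLeft R (LinearMap.rTensor S'.E S.ε) ∘ₗ LinearMap.lTensorHom S.E ∘ₗ
      S'.φ.toLinearMap ∘ₗ ι Q')

theorem sumMap_apply (S : Spinorial Q) (S' : Spinorial Q') (v : V) (w : W) :
    S.sumMap S' (v, w) = TensorProduct.map (S.φ (ι Q v)) 1 +
      TensorProduct.map S.ε (S'.φ (ι Q' w)) := by
  simp only [sumMap, LinearMap.coprod_apply]
  congr 1
  refine TensorProduct.ext' fun e f => ?_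
  simp

theorem sumMap_sq (S : Spinorial Q) (S' : Spinorial Q') (v : V × W) :
    S.sumMap S' v * S.sumMap S' v = algebraMap R _ ((Q.prod Q') v) := by
  obtain ⟨v, w⟩ := v
  have h1 : S.φ (ι Q v) * S.φ (ι Q v) = algebraMap R _ (Q v) := by
    rw [← map_mul, ι_sq_scalar, AlgEquiv.commutes]
  have h2 : S'.φ (ι Q' w) * S'.φ (ι Q' w) = algebraMap R _ (Q' w) := by
    rw [← map_mul, ι_sq_scalar, AlgEquiv.commutes]
  rw [sumMap_apply, add_mul, mul_add, mul_add, ← TensorProduct.map_mul, ← TensorProduct.map_mul,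
    ← TensorProduct.map_mul, ← TensorProduct.map_mul, h1, h2, S.ε_sq, S.φ_odd]
  refine TensorProduct.ext' fun e f => ?_
  simp [TensorProduct.neg_tmul, TensorProduct.smul_tmul']

/-- The homomorphism `C(V ⊕ W) → End(E ⊗ F)`. -/
noncomputable def sumHom (S : Spinorial Q) (S' : Spinorial Q') :
    CliffordAlgebra (Q.prod Q') →ₐ[R] Module.End R (S.E ⊗[R] S'.E) :=
  CliffordAlgebra.lift (Q.prod Q') ⟨S.sumMap S', S.sumMap_sq S'⟩

theorem sumHom_ι (S : Spinorial Q) (S' : Spinorial Q') (v : V) (w : W) :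
    S.sumHom S' (ι _ (v, w)) = TensorProduct.map (S.φ (ι Q v)) 1 +
      TensorProduct.map S.ε (S'.φ (ι Q' w)) := by
  simp [sumHom, sumMap_apply]

theorem sumHom_bijective [Invertible (2 : R)] (S : Spinorial Q) (S' : Spinorial Q') :
    Function.Bijective (S.sumHom S') := by
  have hl : ∀ a : Module.End R S.E, TensorProduct.map a 1 ∈ (S.sumHom S').range := fun a => by
    obtain ⟨x, rfl⟩ := S.φ.surjective a
    induction x using CliffordAlgebra.induction with
    | algebraMap r =>
      refine ⟨algebraMap R _ r, ?_⟩
      refine TensorProduct.ext' fun e f => ?_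
      simp [TensorProduct.smul_tmul']
    | ι v => exact ⟨ι _ (v, 0), by simp [sumHom_ι]⟩
    | mul a b ha hb =>
      have : TensorProduct.map (S.φ (a * b)) (1 : Module.End R S'.E) =
          TensorProduct.map (S.φ a) 1 * TensorProduct.map (S.φ b) 1 := by
        rw [← TensorProduct.map_mul, map_mul, mul_one]
      rw [this]
      exact mul_mem ha hb
    | add a b ha hb => rw [map_add, TensorProduct.map_add_left]; exact add_mem ha hb
  have hr : ∀ b : Module.End R S'.E, TensorProduct.map 1 b ∈ (S.sumHom S').range := fun b => by
    obtain ⟨x, rfl⟩ := S'.φ.surjective b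
    induction x using CliffordAlgebra.induction with
    | algebraMap r =>
      refine ⟨algebraMap R _ r, ?_⟩
      refine TensorProduct.ext' fun e f => ?_
      simp [TensorProduct.smul_tmul']
    | ι w =>
      have : TensorProduct.map (1 : Module.End R S.E) (S'.φ (ι Q' w)) =
          TensorProduct.map S.ε 1 * TensorProduct.map S.ε (S'.φ (ι Q' w)) := by
        rw [← TensorProduct.map_mul, S.ε_sq, one_mul]
      rw [this]
      exact mul_mem (hl _) ⟨ι _ (0, w), by simp [sumHom_ι]⟩
    | mul a b ha hb =>
      have : TensorProduct.map (1 : Module.End R S.E) (S'.φ (a * b)) =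
          TensorProduct.map 1 (S'.φ a) * TensorProduct.map 1 (S'.φ b) := by
        rw [← TensorProduct.map_mul, map_mul, mul_one]
      rw [this]
      exact mul_mem ha hb
    | add a b ha hb => rw [map_add, TensorProduct.map_add_right]; exact add_mem ha hb
  let h := LinearEquiv.ofBijective _ (homTensorHomMap_bijective (R := R) S.E S'.E)
  have hsurj : Function.Surjective (S.sumHom S') := by
    rw [← AlgHom.range_eq_top, eq_top_iff]
    intro T _
    obtain ⟨t, rfl⟩ := h.surjective T
    induction t with
    | zero => rw [map_zero]; exact zero_mem _
    | add a b ha hb => rw [map_add]; exact add_mem (ha trivial) (hb trivial)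
    | tmul a b =>
      have : h (a ⊗ₜ b) = TensorProduct.map a 1 * TensorProduct.map 1 b := by
        rw [← TensorProduct.map_mul, mul_one, one_mul]
        rfl
      rw [this]
      exact mul_mem (hl a) (hr b)
  let e : CliffordAlgebra (Q.prod Q') ≃ₗ[R] Module.End R (S.E ⊗[R] S'.E) :=
    (prodEquiv Q Q').toLinearEquiv.trans
      ((GradedTensorProduct.of R (evenOdd Q) (evenOdd Q')).symm.trans
        ((TensorProduct.congr S.φ.toLinearEquiv S'.φ.toLinearEquiv).trans h))
  have := S.finite_end
  have := S'.finite_end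
  have : Module.Finite R (Module.End R (S.E ⊗[R] S'.E)) := Module.Finite.equiv h
  refine ⟨?_, hsurj⟩
  have h5 : Function.Injective ((S.sumHom S').toLinearMap ∘ₗ e.symm.toLinearMap) :=
    OrzechProperty.injective_of_surjective_endomorphism _ (hsurj.comp e.symm.surjective)
  intro a b hab
  have := @h5 (e a) (e b) (by simpa using hab)
  exact e.injective this

/-- The sum `(V, E) + (W, F) = (V ⊕ W, E ⊗ F)` of two spinorial modules. -/
noncomputable def sum [Invertible (2 : R)] (S : Spinorial Q) (S' : Spinorial Q') :
    Spinorial (Q.prod Q') where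
  finite := have := S.finite; have := S'.finite; inferInstance
  projective := have := S.projective; have := S'.projective; inferInstance
  nondegenerate := polarBilin_prod_bijective S.nondegenerate S'.nondegenerate
  E := S.E ⊗[R] S'.E
  finite_E := inferInstance
  projective_E := inferInstance
  ε := TensorProduct.map S.ε S'.ε
  ε_sq := by
    rw [← TensorProduct.map_mul, S.ε_sq, S'.ε_sq, TensorProduct.map_one]
  φ := AlgEquiv.ofBijective (S.sumHom S') (S.sumHom_bijective S')
  φ_odd v := by
    obtain ⟨v, w⟩ := v
    simp only [AlgEquiv.ofBijective_apply, sumHom_ι, mul_add, add_mul, ← TensorProduct.map_mul,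
      S.φ_odd, S'.φ_odd, mul_one, one_mul]
    refine TensorProduct.ext' fun e f => ?_
    simp [TensorProduct.neg_tmul, TensorProduct.tmul_neg, add_comm]

end Spinorial

end Spinorial

/-! ## The Grothendieck ring `K(R)` and its Adams operations -/

section KRing

/-- Finitely generated projective modules over `R`. -/
structure FGProj (R : Type u) [CommRing R] where
  carrier : Type u
  [addCommGroup : AddCommGroup carrier]
  [module : Module R carrier]
  [finite : Module.Finite R carrier]
  [projective : Module.Projective R carrier]

attribute [instance] FGProj.addCommGroup FGProj.module FGProj.finite FGProj.projective

variable {R : Type u} [CommRing R]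

/-- Isomorphism of finitely generated projective modules. -/
instance FGProj.setoid (R : Type u) [CommRing R] : Setoid (FGProj R) where
  r M N := Nonempty (M.carrier ≃ₗ[R] N.carrier)
  iseqv := ⟨fun _ => ⟨.refl _ _⟩, fun ⟨e⟩ => ⟨e.symm⟩, fun ⟨e⟩ ⟨f⟩ => ⟨e.trans f⟩⟩

/-- Isomorphism classes of finitely generated projective modules. -/
def IsoClass (R : Type u) [CommRing R] : Type (u + 1) := Quotient (FGProj.setoid R)

/-- Tensor product of finitely generated projective modules. -/
def FGProj.tensor (M N : FGProj R) : FGProj R := ⟨M.carrier ⊗[R] N.carrier⟩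

/-- The multiplication of isomorphism classes is given by the tensor product. -/
instance : CommMonoid (IsoClass R) where
  mul := Quotient.map₂ FGProj.tensor fun _ _ ⟨e⟩ _ _ ⟨f⟩ => ⟨TensorProduct.congr e f⟩
  mul_assoc a b c := by
    induction a using Quotient.inductionOn
    induction b using Quotient.inductionOn
    induction c using Quotient.inductionOn
    exact Quotient.sound ⟨TensorProduct.assoc R _ _ _⟩
  one := Quotient.mk _ ⟨R⟩
  one_mul a := by
    induction a using Quotient.inductionOn
    exact Quotient.sound ⟨TensorProduct.lid R _⟩
  mul_one a := by
    induction a using Quotient.inductionOn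
    exact Quotient.sound ⟨TensorProduct.rid R _⟩
  mul_comm a b := by
    induction a using Quotient.inductionOn
    induction b using Quotient.inductionOn
    exact Quotient.sound ⟨TensorProduct.comm R _ _⟩

/-- The isomorphism class of a module, as a generator of the free abelian group (with the ring
structure extending the tensor product). -/
def FGProj.gen (M : FGProj R) : FreeAbelianGroup (IsoClass R) :=
  FreeAbelianGroup.of (Quotient.mk _ M)

/-- The relations `[L] = [M] + [N]` for `L ≅ M ⊕ N`. -/
def kRel (R : Type u) [CommRing R] : Set (FreeAbelianGroup (IsoClass R)) :=
  {x | ∃ L M N : FGProj R, Nonempty ((M.carrier × N.carrier) ≃ₗ[R] L.carrier) ∧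
    x = L.gen - M.gen - N.gen}

/-- The Grothendieck ring `K(R)` of finitely generated projective `R`-modules. (The subgroup
generated by the relations is an ideal, see `kRel_span`.) -/
abbrev K (R : Type u) [CommRing R] : Type (u + 1) :=
  FreeAbelianGroup (IsoClass R) ⧸ Ideal.span (kRel R)

/-- The class of a module in `K(R)`. -/
def FGProj.cls (M : FGProj R) : K R := Ideal.Quotient.mk _ M.gen

theorem kRel_mul (x y : FreeAbelianGroup (IsoClass R)) (hy : y ∈ AddSubgroup.closure (kRel R)) :
    x * y ∈ AddSubgroup.closure (kRel R) := by
  induction hy using AddSubgroup.closure_induction with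
  | mem y hy =>
    obtain ⟨L, M, N, ⟨e⟩, rfl⟩ := hy
    induction x using FreeAbelianGroup.induction_on with
    | zero => simp
    | of a =>
      induction a using Quotient.inductionOn with | _ P
      refine AddSubgroup.subset_closure ⟨P.tensor L, P.tensor M, P.tensor N, ⟨?_⟩, ?_⟩
      · exact (TensorProduct.prodRight R R P.carrier M.carrier N.carrier).symm.trans
          (TensorProduct.congr (.refl R _) e)
      · simp only [mul_sub, FGProj.gen]
        rfl
    | neg a ha => rw [neg_mul]; exact neg_mem ha
    | add a b ha hb => rw [add_mul]; exact add_mem ha hb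
  | zero => simp
  | add a b _ _ ha hb => rw [mul_add]; exact add_mem ha hb
  | neg a _ ha => rw [mul_neg]; exact neg_mem ha

theorem kRel_span (x : FreeAbelianGroup (IsoClass R)) :
    x ∈ Ideal.span (kRel R) ↔ x ∈ AddSubgroup.closure (kRel R) := by
  constructor
  · intro hx
    induction hx using Submodule.span_induction with
    | mem x h => exact AddSubgroup.subset_closure h
    | zero => exact zero_mem _
    | add a b _ _ ha hb => exact add_mem ha hb
    | smul c a _ ha => exact kRel_mul c a ha
  · intro hx
    exact (AddSubgroup.closure_le (K := (Ideal.span (kRel R)).toAddSubgroup)).mpr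
      Submodule.subset_span hx

/-- Extension of a function on modules to the free abelian group on the isomorphism classes. -/
def freeLift {G : Type*} [AddCommGroup G] (f : FGProj R → G)
    (hiso : ∀ M N : FGProj R, Nonempty (M.carrier ≃ₗ[R] N.carrier) → f M = f N) :
    FreeAbelianGroup (IsoClass R) →+ G :=
  FreeAbelianGroup.lift fun x : IsoClass R => Quotient.lift f hiso x

theorem freeLift_gen {G : Type*} [AddCommGroup G] (f : FGProj R → G) (hiso) (M : FGProj R) :
    freeLift f hiso M.gen = f M :=
  FreeAbelianGroup.lift_apply_of _ _

/-- A function on modules which is invariant under isomorphism and additive extends to `K(R)`. -/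
def K.lift {G : Type*} [AddCommGroup G] (f : FGProj R → G)
    (hiso : ∀ M N : FGProj R, Nonempty (M.carrier ≃ₗ[R] N.carrier) → f M = f N)
    (hadd : ∀ L M N : FGProj R, Nonempty ((M.carrier × N.carrier) ≃ₗ[R] L.carrier) →
      f L = f M + f N) : K R →+ G :=
  QuotientAddGroup.lift (Ideal.span (kRel R)).toAddSubgroup
    (freeLift f hiso) (by
      intro x hx
      replace hx := (kRel_span x).mp hx
      induction hx using AddSubgroup.closure_induction with
      | mem x hx =>
        obtain ⟨L, M, N, e, rfl⟩ := hx
        have : f L = f M + f N := hadd L M N e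
        rw [AddMonoidHom.mem_ker, map_sub, map_sub, freeLift_gen, freeLift_gen, freeLift_gen, this,
          add_sub_cancel_left, sub_self]
      | zero => exact zero_mem _
      | add a b _ _ ha hb => exact add_mem ha hb
      | neg a _ ha => exact neg_mem ha)

theorem K.lift_cls {G : Type*} [AddCommGroup G] (f : FGProj R → G) (hiso) (hadd)
    (M : FGProj R) : K.lift f hiso hadd M.cls = f M :=
  freeLift_gen f hiso M

/-- The exterior powers of a finitely generated projective module. -/
def FGProj.exteriorPower (n : ℕ) (M : FGProj R) : FGProj R where
  carrier := ⋀[R]^n M.carrier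
  projective := by
    obtain ⟨m, p, s, -, -, hps⟩ := Module.Finite.exists_comp_eq_id_of_projective R M.carrier
    refine Module.Projective.of_split (M := ⋀[R]^n (Fin m → R)) (exteriorPower.map n s)
      (exteriorPower.map n p) ?_
    rw [← exteriorPower.map_comp, hps, exteriorPower.map_id]

/-- The `k`-th Newton polynomial `Q_k`, expressing the power sum `∑ xᵢ ^ k` in `k` variables through
the elementary symmetric polynomials; the variable `Xᵢ`, for `i = 0, …, k - 1`, stands for the
elementary symmetric polynomial of degree `i + 1`. -/
noncomputable def newton (k : ℕ) : MvPolynomial (Fin k) ℤ :=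
  (MvPolynomial.esymmAlgEquiv (Fin k) ℤ (Fintype.card_fin k)).symm
    ⟨MvPolynomial.psum (Fin k) ℤ k, MvPolynomial.psum_isSymmetric (Fin k) ℤ k⟩

/-- The Adams operation `Ψᵏ(M) = Q_k(λ¹(M), …, λᵏ(M))` in `K(R)`. -/
noncomputable def adams (k : ℕ) (M : FGProj R) : K R :=
  MvPolynomial.aeval (fun i : Fin k => (M.exteriorPower (i + 1)).cls) (newton k)

end KRing

/-! ## Graded Grothendieck groups of Clifford algebras -/

section GrK

variable {R V : Type u} [CommRing R] [AddCommGroup V] [Module R V]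

/-- A finitely generated projective `ℤ/2`-graded module over the Clifford algebra `C(V, Q)`, with a
compatible action of a group `G`.  The grading `M = M₀ ⊕ M₁` is recorded by the involution `ε` which
is `1` on `M₀` and `-1` on `M₁`; equivalently, this is a module over the graded tensor product of
`C(V, Q)` and `C^{0,1} = R[ε]/(ε² - 1)`. -/
structure GrMod (Q : QuadraticForm R V) (G : Type) [Group G] where
  carrier : Type u
  [addCommGroup : AddCommGroup carrier]
  [module : Module R carrier]
  /-- the action of the Clifford algebra -/
  act : CliffordAlgebra Q →ₐ[R] Module.End R carrier
  fgProj : IsFGProj act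
  /-- the grading -/
  ε : Module.End R carrier
  ε_sq : ε * ε = 1
  ε_act : ∀ v, ε * act (ι Q v) = -(act (ι Q v) * ε)
  /-- the action of the group -/
  ρ : Representation R G carrier
  ρ_act : ∀ g v, ρ g * act (ι Q v) = act (ι Q v) * ρ g
  ρ_ε : ∀ g, ρ g * ε = ε * ρ g

attribute [instance] GrMod.addCommGroup GrMod.module

variable {Q : QuadraticForm R V} {G : Type} [Group G]

namespace GrMod

/-- `L` is isomorphic to the direct sum of `M` and `N`. -/
def IsSum (L M N : GrMod Q G) : Prop :=
  ∃ e : (M.carrier × N.carrier) ≃ₗ[R] L.carrier,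
    (∀ v x, e (M.act (ι Q v) x.1, N.act (ι Q v) x.2) = L.act (ι Q v) (e x)) ∧
    (∀ x, e (M.ε x.1, N.ε x.2) = L.ε (e x)) ∧
    (∀ g x, e (M.ρ g x.1, N.ρ g x.2) = L.ρ g (e x))

/-- `M` is the restriction of a module over the graded tensor product of `C(V, Q)` and `C^{0,2}`:
there is a second odd involution `e`, anticommuting with `ε` and with the vectors of `V`. -/
def IsElementary (M : GrMod Q G) : Prop :=
  ∃ e : Module.End R M.carrier, e * e = 1 ∧ e * M.ε = -(M.ε * e) ∧
    (∀ v, e * M.act (ι Q v) = -(M.act (ι Q v) * e)) ∧ ∀ g, e * M.ρ g = M.ρ g * e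

end GrMod

/-- The relations defining the graded Grothendieck group: those of the Grothendieck group of modules
over `C(V, Q) ⊗ C^{0,1}`, and the vanishing of the modules that come from `C(V, Q) ⊗ C^{0,2}`. -/
def grRel (Q : QuadraticForm R V) (G : Type) [Group G] : Set (FreeAbelianGroup (GrMod Q G)) :=
  {x | ∃ L M N : GrMod Q G, L.IsSum M N ∧
    x = FreeAbelianGroup.of L - FreeAbelianGroup.of M - FreeAbelianGroup.of N} ∪
  {x | ∃ M : GrMod Q G, M.IsElementary ∧ x = FreeAbelianGroup.of M}

/-- The `G`-equivariant graded Grothendieck group `K_G(C(V, Q))`: the cokernel of the restriction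
`K_G(C(V, Q) ⊗ C^{0,2}) → K_G(C(V, Q) ⊗ C^{0,1})`. The group `G` acts trivially on `C(V, Q)`. -/
abbrev GrK (Q : QuadraticForm R V) (G : Type) [Group G] : Type (u + 1) :=
  FreeAbelianGroup (GrMod Q G) ⧸ AddSubgroup.closure (grRel Q G)

namespace GrMod

/-- The class of a module in `K_G(C(V, Q))`. -/
def cls (M : GrMod Q G) : GrK Q G := QuotientAddGroup.mk (FreeAbelianGroup.of M)

theorem cls_of_isSum {L M N : GrMod Q G} (h : L.IsSum M N) : L.cls = M.cls + N.cls := by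
  have : FreeAbelianGroup.of L - FreeAbelianGroup.of M - FreeAbelianGroup.of N ∈
      AddSubgroup.closure (grRel Q G) := AddSubgroup.subset_closure (Or.inl ⟨L, M, N, h, rfl⟩)
  have h2 := (QuotientAddGroup.eq_zero_iff _).mpr this
  have h3 : L.cls - M.cls - N.cls = 0 := h2
  rw [sub_sub, sub_eq_zero] at h3
  exact h3

theorem cls_of_isElementary {M : GrMod Q G} (h : M.IsElementary) : M.cls = 0 :=
  (QuotientAddGroup.eq_zero_iff _).mpr (AddSubgroup.subset_closure (Or.inr ⟨M, h, rfl⟩))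

end GrMod

/-- Extension of a function on modules to the graded Grothendieck group. -/
def GrK.lift {H : Type*} [AddCommGroup H] (f : GrMod Q G → H)
    (hadd : ∀ L M N : GrMod Q G, L.IsSum M N → f L = f M + f N)
    (hel : ∀ M : GrMod Q G, M.IsElementary → f M = 0) : GrK Q G →+ H :=
  QuotientAddGroup.lift _ (FreeAbelianGroup.lift f) (by
    intro x hx
    induction hx using AddSubgroup.closure_induction with
    | mem x hx =>
      obtain ⟨L, M, N, e, rfl⟩ | ⟨M, hM, rfl⟩ := hx
      · simp [hadd L M N e]
      · simp [hel M hM]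
    | zero => exact zero_mem _
    | add a b _ _ ha hb => exact add_mem ha hb
    | neg a _ ha => exact neg_mem ha)

theorem GrK.lift_cls {H : Type*} [AddCommGroup H] (f : GrMod Q G → H) (hadd) (hel)
    (M : GrMod Q G) : GrK.lift f hadd hel M.cls = f M := by
  change FreeAbelianGroup.lift _ (FreeAbelianGroup.of _) = _
  simp

namespace GrMod

/-- The zero module. -/
def zero (Q : QuadraticForm R V) (G : Type) [Group G] : GrMod Q G where
  carrier := PUnit
  act := CliffordAlgebra.lift Q ⟨0, fun _ => Subsingleton.elim _ _⟩
  fgProj := isFGProj_subsingleton _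
  ε := 0
  ε_sq := Subsingleton.elim _ _
  ε_act _ := Subsingleton.elim _ _
  ρ := 1
  ρ_act _ _ := Subsingleton.elim _ _
  ρ_ε _ := Subsingleton.elim _ _

/-- The direct sum of two modules. -/
noncomputable def add (M N : GrMod Q G) : GrMod Q G where
  carrier := M.carrier × N.carrier
  act := (LinearMap.prodMapAlgHom R M.carrier N.carrier).comp (M.act.prod N.act)
  fgProj := isFGProj_prod M.fgProj N.fgProj _ fun _ _ => rfl
  ε := M.ε.prodMap N.ε
  ε_sq := by rw [LinearMap.prodMap_mul, M.ε_sq, N.ε_sq, LinearMap.prodMap_one]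
  ε_act v := by
    change M.ε.prodMap N.ε * (M.act (ι Q v)).prodMap (N.act (ι Q v)) =
      -((M.act (ι Q v)).prodMap (N.act (ι Q v)) * M.ε.prodMap N.ε)
    rw [LinearMap.prodMap_mul, LinearMap.prodMap_mul, M.ε_act, N.ε_act]
    rfl
  ρ := M.ρ.prod N.ρ
  ρ_act g v := by
    change (M.ρ g).prodMap (N.ρ g) * (M.act (ι Q v)).prodMap (N.act (ι Q v)) =
      (M.act (ι Q v)).prodMap (N.act (ι Q v)) * (M.ρ g).prodMap (N.ρ g)
    rw [LinearMap.prodMap_mul, LinearMap.prodMap_mul, M.ρ_act, N.ρ_act]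
  ρ_ε g := by
    change (M.ρ g).prodMap (N.ρ g) * M.ε.prodMap N.ε = M.ε.prodMap N.ε * (M.ρ g).prodMap (N.ρ g)
    rw [LinearMap.prodMap_mul, LinearMap.prodMap_mul, M.ρ_ε, N.ρ_ε]

theorem add_isSum (M N : GrMod Q G) : (M.add N).IsSum M N :=
  ⟨.refl _ _, fun _ _ => rfl, fun _ => rfl, fun _ _ => rfl⟩

/-- The same module with the opposite grading. -/
def shift (M : GrMod Q G) : GrMod Q G where
  carrier := M.carrier
  act := M.act
  fgProj := M.fgProj
  ε := -M.ε
  ε_sq := by rw [neg_mul_neg, M.ε_sq]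
  ε_act v := by rw [neg_mul, M.ε_act, mul_neg]
  ρ := M.ρ
  ρ_act := M.ρ_act
  ρ_ε g := by rw [mul_neg, M.ρ_ε, neg_mul]

theorem add_shift_isElementary (M : GrMod Q G) : (M.add M.shift).IsElementary := by
  have h1 : ∀ x, M.ε (M.ε x) = x := fun x => LinearMap.congr_fun M.ε_sq x
  have h2 : ∀ v x, M.ε (M.act (ι Q v) x) = -M.act (ι Q v) (M.ε x) := fun v x =>
    LinearMap.congr_fun (M.ε_act v) x
  have h3 : ∀ g x, M.ρ g (M.ε x) = M.ε (M.ρ g x) := fun g x => LinearMap.congr_fun (M.ρ_ε g) x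
  let e : Module.End R (M.carrier × M.carrier) :=
    LinearMap.prod (M.ε ∘ₗ LinearMap.snd R _ _) (M.ε ∘ₗ LinearMap.fst R _ _)
  refine ⟨e, ?_, ?_, fun v => ?_, fun g => ?_⟩ <;> refine LinearMap.ext fun x => ?_
  · exact Prod.ext (h1 _) (h1 _)
  · refine Prod.ext ?_ ?_
    · change M.ε (-M.ε x.2) = -(M.ε (M.ε x.2))
      rw [map_neg]
    · change M.ε (M.ε x.1) = -(-M.ε (M.ε x.1))
      rw [neg_neg]
  · exact Prod.ext (h2 _ _) (h2 _ _)
  · exact Prod.ext (h3 _ _).symm (h3 _ _).symm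

theorem cls_zero : (GrMod.zero Q G).cls = 0 := by
  have : Subsingleton (GrMod.zero Q G).carrier := inferInstanceAs (Subsingleton PUnit)
  refine cls_of_isElementary ⟨0, ?_, ?_, ?_, ?_⟩ <;> intros <;> exact Subsingleton.elim _ _

/-- Every element of the graded Grothendieck group is the class of a module. -/
theorem cls_surjective : Function.Surjective (cls : GrMod Q G → GrK Q G) := by
  have hadd : ∀ M N : GrMod Q G, M.cls + N.cls = (M.add N).cls := fun M N =>
    (cls_of_isSum (add_isSum M N)).symm
  have hneg : ∀ M : GrMod Q G, -M.cls = M.shift.cls := fun M => by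
    rw [neg_eq_iff_add_eq_zero, hadd]
    exact cls_of_isElementary (add_shift_isElementary M)
  intro x
  obtain ⟨x, rfl⟩ := QuotientAddGroup.mk_surjective x
  induction x using FreeAbelianGroup.induction_on with
  | zero => exact ⟨GrMod.zero Q G, cls_zero⟩
  | of M => exact ⟨M, rfl⟩
  | neg M _ => exact ⟨M.shift, (hneg M).symm⟩
  | add x y hx hy =>
    obtain ⟨M, hM⟩ := hx
    obtain ⟨N, hN⟩ := hy
    exact ⟨M.add N, by rw [← hadd, hM, hN]; rfl⟩

end GrMod

end GrK

/-! ## Graded tensor powers -/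

section Koszul

/-- The sign `(-1) ^ a`. -/
def degSign (a : ZMod 2) : ℤˣ := if a = 0 then 1 else -1

/-- The Koszul sign `(-1) ^ (a b)` of the exchange of two elements of degrees `a` and `b`. -/
def swapSign (a b : ZMod 2) : ℤˣ := if a = 1 ∧ b = 1 then -1 else 1

/-- The Koszul sign of a permutation `σ` acting on a tensor product of homogeneous elements of
degrees `d₁, …, d_k`: the product of the signs `(-1) ^ (dᵢ dⱼ)` over the inversions of `σ`. -/
def koszulSign {k : ℕ} (σ : Equiv.Perm (Fin k)) (d : Fin k → ZMod 2) : ℤˣ :=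
  ∏ p : Fin k × Fin k with p.1 < p.2 ∧ σ p.2 < σ p.1, swapSign (d p.1) (d p.2)

theorem koszulSign_one {k : ℕ} (d : Fin k → ZMod 2) : koszulSign 1 d = 1 := by
  refine Finset.prod_eq_one fun p hp => ?_
  have hp := (Finset.mem_filter.mp hp).2
  exact absurd hp.1 (lt_asymm hp.2)

theorem swapSign_comm (a b : ZMod 2) : swapSign a b = swapSign b a := by
  simp only [swapSign, and_comm]

theorem prod_pairs_perm {k : ℕ} (τ : Equiv.Perm (Fin k)) (F : Fin k → Fin k → ℤˣ)
    (hF : ∀ i j, F i j = F j i) :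
    ∏ p : Fin k × Fin k with p.1 < p.2, F (τ p.1) (τ p.2) =
      ∏ p : Fin k × Fin k with p.1 < p.2, F p.1 p.2 := by
  refine Finset.prod_bij' (fun p _ => if τ p.1 < τ p.2 then (τ p.1, τ p.2) else (τ p.2, τ p.1))
    (fun p _ => if τ.symm p.1 < τ.symm p.2 then (τ.symm p.1, τ.symm p.2)
      else (τ.symm p.2, τ.symm p.1)) ?_ ?_ ?_ ?_ ?_
  · rintro ⟨a, b⟩ h
    simp only [Finset.mem_filter, Finset.mem_univ, true_and] at h ⊢
    have : τ a ≠ τ b := τ.injective.ne h.ne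
    split_ifs with h1
    · exact h1
    · exact lt_of_le_of_ne (not_lt.mp h1) this.symm
  · rintro ⟨a, b⟩ h
    simp only [Finset.mem_filter, Finset.mem_univ, true_and] at h ⊢
    have : τ.symm a ≠ τ.symm b := τ.symm.injective.ne h.ne
    split_ifs with h1
    · exact h1
    · exact lt_of_le_of_ne (not_lt.mp h1) this.symm
  · rintro ⟨a, b⟩ h
    simp only [Finset.mem_filter, Finset.mem_univ, true_and] at h
    split_ifs with h1 h2 h2 <;> simp_all [h.asymm]
  · rintro ⟨a, b⟩ h
    simp only [Finset.mem_filter, Finset.mem_univ, true_and] at h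
    split_ifs with h1 h2 h2 <;> simp_all [h.asymm]
  · rintro ⟨a, b⟩ h
    dsimp only
    split_ifs with h1
    · rfl
    · exact hF _ _

theorem koszulSign_mul {k : ℕ} (σ τ : Equiv.Perm (Fin k)) (d : Fin k → ZMod 2) :
    koszulSign (σ * τ) d = koszulSign σ (fun i => d (τ.symm i)) * koszulSign τ d := by
  have h : ∀ (π : Equiv.Perm (Fin k)) (d : Fin k → ZMod 2), koszulSign π d =
      ∏ p : Fin k × Fin k with p.1 < p.2,
        if (p.1 < p.2 ↔ π p.2 < π p.1) then swapSign (d p.1) (d p.2) else 1 := fun π d => by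
    rw [koszulSign, ← Finset.filter_filter, Finset.prod_filter]
    refine Finset.prod_congr rfl fun p hp => ?_
    simp only [Finset.mem_filter, Finset.mem_univ, true_and] at hp
    simp [hp]
  rw [h σ, ← prod_pairs_perm τ (fun a b => if (a < b ↔ σ b < σ a) then
    swapSign (d (τ.symm a)) (d (τ.symm b)) else 1), h, h, ← Finset.prod_mul_distrib]
  · refine Finset.prod_congr rfl fun p hp => ?_
    simp only [Finset.mem_filter, Finset.mem_univ, true_and] at hp
    simp only [Equiv.symm_apply_apply, hp, true_iff, Equiv.Perm.coe_mul, Function.comp_apply]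
    have h1 : τ p.1 ≠ τ p.2 := τ.injective.ne hp.ne
    have h2 : σ (τ p.1) ≠ σ (τ p.2) := σ.injective.ne h1
    rcases lt_or_gt_of_ne h1 with h3 | h3 <;> rcases lt_or_gt_of_ne h2 with h4 | h4 <;>
      simp [h3, h4, h3.asymm, h4.asymm, Int.units_mul_self]
  · intro i j
    by_cases hij : i = j
    · rw [hij]
    have h2 : σ i ≠ σ j := σ.injective.ne hij
    rw [swapSign_comm]
    refine if_congr ?_ rfl rfl
    rcases lt_or_gt_of_ne hij with h3 | h3 <;> rcases lt_or_gt_of_ne h2 with h4 | h4 <;>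
      simp [h3, h4, h3.asymm, h4.asymm]

theorem swapSign_add_one (a b : ZMod 2) : swapSign (a + 1) b = swapSign a b * degSign b := by
  revert a b; decide

theorem koszulSign_update {k : ℕ} (σ : Equiv.Perm (Fin k)) (d : Fin k → ZMod 2) (i : Fin k) :
    (∏ j, if j < i then degSign (d j) else 1) * koszulSign σ (Function.update d i (d i + 1)) =
      koszulSign σ d * ∏ j, if σ j < σ i then degSign (d j) else 1 := by
  have h1 : koszulSign σ (Function.update d i (d i + 1)) = koszulSign σ d *
      ((∏ j, if i < j ∧ σ j < σ i then degSign (d j) else 1) *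
        ∏ j, if j < i ∧ σ i < σ j then degSign (d j) else 1) := by
    have h2 : (∏ j, if i < j ∧ σ j < σ i then degSign (d j) else 1) =
        ∏ p : Fin k × Fin k with p.1 < p.2 ∧ σ p.2 < σ p.1,
          if p.1 = i then degSign (d p.2) else 1 := by
      symm
      rw [Finset.prod_filter, Fintype.prod_prod_type, Finset.prod_eq_single i]
      · exact Finset.prod_congr rfl fun j _ => by simp
      · intro b _ hb
        exact Finset.prod_eq_one fun j _ => by simp [hb]
      · simp
    have h3 : (∏ j, if j < i ∧ σ i < σ j then degSign (d j) else 1) =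
        ∏ p : Fin k × Fin k with p.1 < p.2 ∧ σ p.2 < σ p.1,
          if p.2 = i then degSign (d p.1) else 1 := by
      symm
      rw [Finset.prod_filter, Fintype.prod_prod_type_right, Finset.prod_eq_single i]
      · exact Finset.prod_congr rfl fun j _ => by simp
      · intro b _ hb
        exact Finset.prod_eq_one fun j _ => by simp [hb]
      · simp
    rw [h2, h3, koszulSign, koszulSign, ← Finset.prod_mul_distrib, ← Finset.prod_mul_distrib]
    refine Finset.prod_congr rfl fun p hp => ?_
    simp only [Finset.mem_filter, Finset.mem_univ, true_and] at hp
    by_cases ha : p.1 = i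
    · have hb : p.2 ≠ i := fun hb => hp.1.ne (ha.trans hb.symm)
      simp [ha, hb, swapSign_add_one]
    · by_cases hb : p.2 = i
      · simp only [hb, Function.update_self, ne_eq, ha, not_false_eq_true, Function.update_of_ne,
          if_true, if_false, one_mul]
        rw [swapSign_comm, swapSign_add_one, swapSign_comm]
      · simp [ha, hb]
  rw [h1, mul_left_comm, ← Finset.prod_mul_distrib, ← Finset.prod_mul_distrib]
  congr 1
  refine Finset.prod_congr rfl fun j _ => ?_
  by_cases hij : i = j
  · simp [hij]
  have h2 : σ i ≠ σ j := σ.injective.ne hij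
  rcases lt_or_gt_of_ne hij with h3 | h3 <;> rcases lt_or_gt_of_ne h2 with h4 | h4 <;>
    simp [h3, h4, h3.asymm, h4.asymm, Int.units_mul_self]

/-- A sign, as an element of the ring `R`. -/
def sgn (R : Type u) [CommRing R] : ℤˣ →* R :=
  (Int.castRingHom R).toMonoidHom.comp (Units.coeHom ℤ)

variable {R M : Type u} [CommRing R] [AddCommGroup M] [Module R M]

/-- The projection of `M = M₀ ⊕ M₁` on the summand of degree `a`. -/
def gradeProj [Invertible (2 : R)] (ε : Module.End R M) (a : ZMod 2) : Module.End R M :=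
  (⅟2 : R) • (1 + sgn R (degSign a) • ε)

/-- The action of a permutation `σ` on the graded tensor power: on homogeneous elements, this is the
permutation of the factors, up to the Koszul sign. -/
noncomputable def koszulAct [Invertible (2 : R)] (ε : Module.End R M) {k : ℕ}
    (σ : Equiv.Perm (Fin k)) : Module.End R (PiTensorProduct R fun _ : Fin k => M) :=
  (PiTensorProduct.reindex R (fun _ => M) σ).toLinearMap ∘ₗ
    ∑ d : Fin k → ZMod 2, sgn R (koszulSign σ d) • PiTensorProduct.map fun i => gradeProj ε (d i)

/-- The action of `V` on the graded tensor power of a graded Clifford module on which `V` acts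
through `c`: the vector `v` acts by `∑ᵢ ε ⊗ ⋯ ⊗ ε ⊗ c(v) ⊗ 1 ⊗ ⋯ ⊗ 1` with `c(v)` at the
`i`-th place, which is the action of the diagonal element `(v, …, v)` of `Vᵏ`. -/
noncomputable def powMap {V : Type u} [AddCommGroup V] [Module R V] (ε : Module.End R M)
    (c : V →ₗ[R] Module.End R M) (k : ℕ) :
    V →ₗ[R] Module.End R (PiTensorProduct R fun _ : Fin k => M) :=
  ∑ i : Fin k, (PiTensorProduct.mapMultilinear R (fun _ => M) (fun _ => M)).toLinearMap
    (fun j => if j < i then ε else 1) i ∘ₗ c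

/-- The family `m` consists of homogeneous elements of degrees `d`. -/
def IsHomog (ε : Module.End R M) {k : ℕ} (d : Fin k → ZMod 2) (m : Fin k → M) : Prop :=
  ∀ i, ε (m i) = sgn R (degSign (d i)) • m i

theorem IsHomog.perm {ε : Module.End R M} {k : ℕ} {d : Fin k → ZMod 2} {m : Fin k → M} (hm : IsHomog ε d m)
    (σ : Equiv.Perm (Fin k)) : IsHomog ε (fun i => d (σ.symm i)) (fun i => m (σ.symm i)) :=
  fun i => hm (σ.symm i)

theorem tprod_sgn_smul {k : ℕ} (c : Fin k → ℤˣ) (m : Fin k → M) :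
    PiTensorProduct.tprod R (fun i => sgn R (c i) • m i) =
      sgn R (∏ i, c i) • PiTensorProduct.tprod R m := by
  rw [map_prod]
  exact MultilinearMap.map_smul_univ (PiTensorProduct.tprod R) (fun i => sgn R (c i)) m

theorem sgn_mul_self (u : ℤˣ) : sgn R u * sgn R u = 1 := by
  rw [← map_mul, Int.units_mul_self, map_one]

theorem sgn_neg_one : sgn R (-1) = -1 := by
  simp [sgn]

section

variable [Invertible (2 : R)] {ε : Module.End R M} {k : ℕ}

theorem half_add_half (x : M) : (⅟2 : R) • (x + x) = x := by
  rw [← two_smul R, smul_smul, invOf_mul_self, one_smul]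

theorem gradeProj_apply {a b : ZMod 2} {x : M} (hx : ε x = sgn R (degSign b) • x) :
    gradeProj ε a x = if a = b then x else 0 := by
  simp only [gradeProj, LinearMap.smul_apply, LinearMap.add_apply, Module.End.one_apply, hx,
    smul_smul, ← map_mul]
  have : ∀ a b : ZMod 2, degSign a * degSign b = if a = b then 1 else -1 := by decide
  rw [this]
  split_ifs
  · rw [map_one, one_smul, half_add_half]
  · simp [sgn_neg_one]

theorem gradeProj_homog (hε : ε * ε = 1) (a : ZMod 2) (x : M) :
    ε (gradeProj ε a x) = sgn R (degSign a) • gradeProj ε a x := by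
  have h : ∀ x, ε (ε x) = x := fun x => LinearMap.congr_fun hε x
  simp only [gradeProj, LinearMap.smul_apply, LinearMap.add_apply, Module.End.one_apply, map_smul,
    map_add, smul_add, h, smul_smul]
  rw [mul_left_comm, sgn_mul_self, mul_one, add_comm, mul_comm]

theorem gradeProj_sum (x : M) : ∑ a : ZMod 2, gradeProj ε a x = x := by
  have h0 : degSign 0 = 1 := rfl
  have h1 : degSign 1 = -1 := rfl
  have h2 : (Finset.univ : Finset (ZMod 2)) = {0, 1} := rfl
  rw [h2, Finset.sum_pair (by decide)]
  simp only [gradeProj, h0, h1, map_one, sgn_neg_one, one_smul, neg_smul, LinearMap.smul_apply,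
    LinearMap.add_apply, LinearMap.neg_apply, Module.End.one_apply]
  rw [← smul_add]
  convert half_add_half (R := R) x using 2
  abel

theorem ext_homog (hε : ε * ε = 1) {N : Type u} [AddCommGroup N] [Module R N]
    {f g : (PiTensorProduct R fun _ : Fin k => M) →ₗ[R] N}
    (h : ∀ d m, IsHomog ε d m → f (PiTensorProduct.tprod R m) = g (PiTensorProduct.tprod R m)) :
    f = g := by
  refine PiTensorProduct.ext (MultilinearMap.ext fun m => ?_)
  have hm : PiTensorProduct.tprod R m = ∑ d : Fin k → ZMod 2,
      PiTensorProduct.tprod R fun i => gradeProj ε (d i) (m i) := by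
    conv_lhs => rw [← funext fun i => gradeProj_sum (ε := ε) (m i)]
    exact MultilinearMap.map_sum _ _
  simp only [LinearMap.compMultilinearMap_apply]
  rw [hm, map_sum, map_sum]
  exact Finset.sum_congr rfl fun d _ => h d _ fun i => gradeProj_homog hε _ _

theorem koszulAct_tprod {d : Fin k → ZMod 2} {m : Fin k → M} (hm : IsHomog ε d m)
    (σ : Equiv.Perm (Fin k)) : koszulAct ε σ (PiTensorProduct.tprod R m) =
      sgn R (koszulSign σ d) • PiTensorProduct.tprod R fun i => m (σ.symm i) := by
  have : (∑ d : Fin k → ZMod 2, sgn R (koszulSign σ d) • PiTensorProduct.map fun i => gradeProj ε (d i))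
      (PiTensorProduct.tprod R m) = sgn R (koszulSign σ d) • PiTensorProduct.tprod R m := by
    rw [LinearMap.sum_apply, Finset.sum_eq_single d]
    · rw [LinearMap.smul_apply, PiTensorProduct.map_tprod]
      congr 2
      funext i
      rw [gradeProj_apply (hm i), if_pos rfl]
    · intro d' _ hd
      obtain ⟨i, hi⟩ := Function.ne_iff.mp hd
      rw [LinearMap.smul_apply, PiTensorProduct.map_tprod,
        MultilinearMap.map_coord_zero _ i (by rw [gradeProj_apply (hm i), if_neg hi]), smul_zero]
    · simp
  rw [koszulAct, LinearMap.comp_apply, this, map_smul]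
  simp

/-- The action of the symmetric group on the graded tensor power. -/
noncomputable def koszulRep (ε : Module.End R M) (hε : ε * ε = 1) (k : ℕ) :
    Representation R (Equiv.Perm (Fin k)) (PiTensorProduct R fun _ : Fin k => M) where
  toFun := koszulAct ε
  map_one' := ext_homog hε fun d m hm => by
    rw [koszulAct_tprod hm, koszulSign_one, map_one, one_smul]
    rfl
  map_mul' σ τ := ext_homog hε fun d m hm => by
    rw [Module.End.mul_apply, koszulAct_tprod hm, koszulAct_tprod hm, koszulSign_mul,
      map_smul, koszulAct_tprod (hm.perm τ), smul_smul, ← map_mul, mul_comm]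
    rfl

variable {V : Type u} [AddCommGroup V] [Module R V]

theorem koszulAct_map (hε : ε * ε = 1) (σ : Equiv.Perm (Fin k)) :
    koszulAct ε σ * PiTensorProduct.map (fun _ => ε) =
      PiTensorProduct.map (fun _ => ε) * koszulAct ε σ := by
  have h : ∀ (d : Fin k → ZMod 2) m, IsHomog ε d m →
      PiTensorProduct.map (fun _ => ε) (PiTensorProduct.tprod R m) =
        sgn R (∏ i, degSign (d i)) • PiTensorProduct.tprod R m := fun d m hm => by
    rw [PiTensorProduct.map_tprod, ← tprod_sgn_smul]
    exact congrArg _ (funext hm)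
  refine ext_homog hε fun d m hm => ?_
  rw [Module.End.mul_apply, Module.End.mul_apply, h d m hm, map_smul, koszulAct_tprod hm, map_smul,
    h _ _ (hm.perm σ), smul_comm, Equiv.prod_comp σ.symm (fun i => degSign (d i))]

theorem powMap_tprod {d : Fin k → ZMod 2} {m : Fin k → M} (hm : IsHomog ε d m)
    (c : V →ₗ[R] Module.End R M) (v : V) : powMap ε c k v (PiTensorProduct.tprod R m) =
      ∑ i, sgn R (∏ j, if j < i then degSign (d j) else 1) •
        PiTensorProduct.tprod R (Function.update m i (c v (m i))) := by
  simp only [powMap, LinearMap.sum_apply, LinearMap.comp_apply]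
  refine Finset.sum_congr rfl fun i _ => ?_
  rw [← tprod_sgn_smul]
  change PiTensorProduct.map (Function.update (fun j => if j < i then ε else 1) i (c v))
    (PiTensorProduct.tprod R m) = _
  rw [PiTensorProduct.map_tprod]
  congr 1
  funext j
  by_cases hj : j = i
  · subst hj
    simp
  · rw [Function.update_of_ne hj, Function.update_of_ne hj]
    split_ifs
    · exact hm j
    · simp

theorem IsHomog.update {d : Fin k → ZMod 2} {m : Fin k → M} (hm : IsHomog ε d m) (i : Fin k)
    {f : Module.End R M} (hf : ε * f = -(f * ε)) :
    IsHomog ε (Function.update d i (d i + 1)) (Function.update m i (f (m i))) := by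
  intro j
  by_cases hj : j = i
  · subst hj
    have h1 : ε (f (m j)) = -f (ε (m j)) := LinearMap.congr_fun hf (m j)
    have h2 : ∀ a, degSign (a + 1) = -degSign a := by decide
    have h3 : ∀ a : ℤˣ, sgn R (-a) = -sgn R a := fun a => by simp [sgn]
    rw [Function.update_self, Function.update_self, h1, hm j, map_smul, h2, h3, neg_smul]
  · rw [Function.update_of_ne hj, Function.update_of_ne hj]
    exact hm j

theorem koszulAct_powMap (hε : ε * ε = 1) (c : V →ₗ[R] Module.End R M)
    (hc : ∀ v, ε * c v = -(c v * ε)) (σ : Equiv.Perm (Fin k)) (v : V) :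
    koszulAct ε σ * powMap ε c k v = powMap ε c k v * koszulAct ε σ := by
  refine ext_homog hε fun d m hm => ?_
  rw [Module.End.mul_apply, Module.End.mul_apply, powMap_tprod hm, koszulAct_tprod hm, map_smul,
    powMap_tprod (hm.perm σ), map_sum, Finset.smul_sum]
  refine Eq.trans ?_ (Equiv.sum_comp σ _)
  refine Finset.sum_congr rfl fun i _ => ?_
  rw [map_smul, koszulAct_tprod (hm.update i (hc v)), smul_smul, smul_smul, ← map_mul, ← map_mul,
    koszulSign_update, ← Equiv.prod_comp σ (fun j => if j < σ i then degSign (d (σ.symm j)) else 1)]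
  simp only [Equiv.symm_apply_apply]
  congr 2
  funext j
  by_cases hj : j = σ i
  · subst hj
    simp
  · rw [Function.update_of_ne hj, Function.update_of_ne]
    rintro rfl
    simp at hj

end

/-- The `i`-th summand of the action of `V` on the graded tensor power. -/
theorem powMap_apply {V : Type u} [AddCommGroup V] [Module R V] (ε : Module.End R M)
    (c : V →ₗ[R] Module.End R M) (k : ℕ) (v : V) : powMap ε c k v =
      ∑ i : Fin k, PiTensorProduct.map
        (Function.update (fun j => if j < i then ε else 1) i (c v)) := by
  simp only [powMap, LinearMap.sum_apply, LinearMap.comp_apply]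
  rfl

theorem map_update_neg {k : ℕ} (f : Fin k → Module.End R M) (i : Fin k) (g : Module.End R M) :
    PiTensorProduct.map (Function.update f i (-g)) =
      -PiTensorProduct.map (Function.update f i g) := by
  have := (PiTensorProduct.mapMultilinear R (fun _ : Fin k => M) (fun _ => M)).map_update_neg f i g
  exact this

theorem map_eq_neg {k : ℕ} (f g : Fin k → Module.End R M) (i : Fin k) (hi : f i = -g i)
    (h : ∀ j, j ≠ i → f j = g j) : PiTensorProduct.map f = -PiTensorProduct.map g := by
  rw [← Function.update_eq_self i g, ← map_update_neg]
  congr 1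
  funext j
  by_cases hj : j = i
  · subst hj; simp [hi]
  · simp [hj, h j hj]

section

variable {V : Type u} [AddCommGroup V] [Module R V] {ε : Module.End R M}
  {c : V →ₗ[R] Module.End R M} {k : ℕ}

theorem map_mul_powMap (hc : ∀ v, ε * c v = -(c v * ε)) (v : V) :
    PiTensorProduct.map (fun _ => ε) * powMap ε c k v =
      -(powMap ε c k v * PiTensorProduct.map (fun _ => ε)) := by
  rw [powMap_apply, Finset.mul_sum, Finset.sum_mul, ← Finset.sum_neg_distrib]
  refine Finset.sum_congr rfl fun i _ => ?_
  rw [← PiTensorProduct.map_mul, ← PiTensorProduct.map_mul]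
  refine map_eq_neg _ _ i ?_ fun j hj => ?_
  · simp [hc]
  · simp only [Function.update_of_ne hj]
    split_ifs <;> simp

theorem powMap_sq {Q : QuadraticForm R V} (hε : ε * ε = 1) (hc : ∀ v, ε * c v = -(c v * ε))
    (hQ : ∀ v, c v * c v = algebraMap R _ (Q v)) (v : V) :
    powMap ε c k v * powMap ε c k v = algebraMap R _ (((k : R) • Q) v) := by
  let C : Fin k → Module.End R (PiTensorProduct R fun _ : Fin k => M) := fun i =>
    PiTensorProduct.map (Function.update (fun j => if j < i then ε else 1) i (c v))
  have hlt : ∀ i j, i < j → C j * C i = -(C i * C j) := fun i j hij => by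
    simp only [C]
    rw [← PiTensorProduct.map_mul, ← PiTensorProduct.map_mul]
    refine map_eq_neg _ _ i ?_ fun l hl => ?_
    · simp [hij.ne, hij, hc]
    · by_cases hlj : l = j
      · subst hlj
        simp [hij.ne', hij.asymm]
      · simp only [Function.update_of_ne hl, Function.update_of_ne hlj]
        split_ifs <;> simp
  have hne : ∀ i j, i ≠ j → C i * C j + C j * C i = 0 := fun i j hij => by
    rcases lt_or_gt_of_ne hij with h | h
    · rw [hlt i j h, add_neg_cancel]
    · rw [hlt j i h, neg_add_cancel]
  have hself : ∀ i, C i * C i = Q v • 1 := fun i => by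
    simp only [C]
    rw [← PiTensorProduct.map_mul]
    have : (fun l => Function.update (fun j => if j < i then ε else 1) i (c v) l *
        Function.update (fun j => if j < i then ε else 1) i (c v) l) =
        Function.update (fun _ => (1 : Module.End R M)) i (Q v • 1) := by
      funext l
      by_cases hl : l = i
      · subst hl
        simp [hQ, Algebra.algebraMap_eq_smul_one]
      · simp only [Function.update_of_ne hl]
        split_ifs <;> simp [hε]
    rw [this, PiTensorProduct.map_update_smul, Function.update_eq_self, PiTensorProduct.map_one]
  have hsum : powMap ε c k v = ∑ i, C i := powMap_apply ε c k v
  rw [hsum, Finset.sum_mul_sum, ← Finset.sum_product', Finset.univ_product_univ,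
    ← Finset.sum_filter_add_sum_filter_not _ (fun p : Fin k × Fin k => p.1 = p.2)]
  have h1 : ∑ p : Fin k × Fin k with ¬ p.1 = p.2, C p.1 * C p.2 = 0 := by
    refine Finset.sum_involution (fun p _ => p.swap) (fun p hp => ?_) (fun p hp _ h => ?_)
      (fun p hp => ?_) (fun p _ => Prod.swap_swap p)
    · exact hne _ _ (Finset.mem_filter.mp hp).2
    · exact (Finset.mem_filter.mp hp).2 (congrArg Prod.snd h)
    · have := (Finset.mem_filter.mp hp).2
      exact Finset.mem_filter.mpr ⟨Finset.mem_univ _, fun h => this h.symm⟩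
  have h2 : ∑ p : Fin k × Fin k with p.1 = p.2, C p.1 * C p.2 = ∑ i, C i * C i := by
    rw [Finset.sum_filter, Fintype.sum_prod_type]
    simp
  rw [h1, h2, add_zero]
  simp only [hself, Finset.sum_const, Finset.card_univ, Fintype.card_fin]
  rw [Algebra.algebraMap_eq_smul_one, ← Nat.cast_smul_eq_nsmul R, smul_smul]
  rfl

end

end Koszul

/-! ## The power map -/

section Power

variable {R V : Type u} [CommRing R] [AddCommGroup V] [Module R V]

theorem projective_piTensorProduct (M : Type u) [AddCommGroup M] [Module R M] [Module.Finite R M]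
    [Module.Projective R M] (k : ℕ) :
    Module.Projective R (PiTensorProduct R fun _ : Fin k => M) := by
  obtain ⟨n, p, s, -, -, hps⟩ := Module.Finite.exists_comp_eq_id_of_projective R M
  have : Module.Free R (PiTensorProduct R fun _ : Fin k => (Fin n → R)) :=
    Module.Free.of_basis (Basis.piTensorProduct fun _ => Pi.basisFun R (Fin n))
  refine Module.Projective.of_split (M := PiTensorProduct R fun _ : Fin k => (Fin n → R))
    (PiTensorProduct.map fun _ => s) (PiTensorProduct.map fun _ => p) ?_
  rw [← PiTensorProduct.map_comp]
  simp only [hps]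
  exact PiTensorProduct.map_id

variable [Invertible (2 : R)] {Q : QuadraticForm R V}

/-- The `k`-th graded tensor power of a graded module over `C(V, Q)`, restricted to `C(V, kQ)` along
the homomorphism `C(V, kQ) → C(V, Q)^{⊗ k}` induced by the diagonal of `V`, with the action of the
symmetric group by permutation of the factors. -/
noncomputable def powerObj (S : Spinorial Q) (k : ℕ) (hk : IsUnit (k : R)) (M : GrMod Q Unit) :
    GrMod ((k : R) • Q) (Equiv.Perm (Fin k)) :=
  have hc : ∀ v, M.ε * (M.act.toLinearMap ∘ₗ ι Q) v = -((M.act.toLinearMap ∘ₗ ι Q) v * M.ε) :=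
    M.ε_act
  have hQ : ∀ v, (M.act.toLinearMap ∘ₗ ι Q) v * (M.act.toLinearMap ∘ₗ ι Q) v =
      algebraMap R _ (Q v) := fun v => by
    change M.act (ι Q v) * M.act (ι Q v) = _
    rw [← map_mul, ι_sq_scalar, AlgHom.commutes]
  { carrier := PiTensorProduct R fun _ : Fin k => M.carrier
    act := CliffordAlgebra.lift ((k : R) • Q)
      ⟨powMap M.ε (M.act.toLinearMap ∘ₗ ι Q) k, powMap_sq M.ε_sq hc hQ⟩
    fgProj := by
      have := S.finite_clifford
      have := S.projective_clifford
      obtain ⟨h1, h2⟩ := finite_projective_of_isFGProj M.fgProj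
      have := projective_piTensorProduct (R := R) M.carrier k
      exact isFGProj_of_algEquiv_end (E := (S.twist (k : R) hk).E) S.faithful
        (S.twist (k : R) hk).φ _
    ε := PiTensorProduct.map fun _ => M.ε
    ε_sq := by
      rw [← PiTensorProduct.map_mul]
      simp only [M.ε_sq]
      exact PiTensorProduct.map_id
    ε_act := fun v => by
      rw [CliffordAlgebra.lift_ι_apply]
      exact map_mul_powMap hc v
    ρ := koszulRep M.ε M.ε_sq k
    ρ_act := fun σ v => by
      rw [CliffordAlgebra.lift_ι_apply]
      exact koszulAct_powMap M.ε_sq _ hc σ v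
    ρ_ε := fun σ => koszulAct_map M.ε_sq σ }

/-- The `k`-th power map `P : K(C(V, Q)) → K_{S_k}(C(V, kQ))`, which sends the class of a module `M`
to the class of its `k`-th graded tensor power. Every element of `K(C(V, Q))` is the class of a
module. -/
noncomputable def powerMap (S : Spinorial Q) (k : ℕ) (hk : IsUnit (k : R)) (x : GrK Q Unit) :
    GrK ((k : R) • Q) (Equiv.Perm (Fin k)) :=
  (powerObj S k hk (Function.surjInv GrMod.cls_surjective x)).cls

end Power

/-! ## The Adams character -/

section Character

/-- An integral form of an irreducible rational representation of the symmetric group `S_k`. -/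
structure IntIrrep (k : ℕ) where
  n : ℕ
  /-- the representation on `ℤⁿ` -/
  ρ : Equiv.Perm (Fin k) →* Matrix (Fin n) (Fin n) ℤ
  irreducible : Representation.IsIrreducible
    ((Matrix.toLinAlgEquiv' : Matrix (Fin n) (Fin n) ℚ ≃ₐ[ℚ] _).toMonoidHom.comp
      ((Int.castRingHom ℚ).mapMatrix.toMonoidHom.comp ρ) : Representation ℚ _ (Fin n → ℚ))

/-- The representation on `Rⁿ` given by an integral representation. -/
noncomputable def IntIrrep.toRep {k : ℕ} (π : IntIrrep k) (R : Type*) [CommRing R] :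
    Representation R (Equiv.Perm (Fin k)) (Fin π.n → R) :=
  (Matrix.toLinAlgEquiv' : Matrix (Fin π.n) (Fin π.n) R ≃ₐ[R] _).toMonoidHom.comp
    ((Int.castRingHom R).mapMatrix.toMonoidHom.comp π.ρ)

/-- Isomorphism of the underlying rational representations. -/
instance IntIrrep.setoid (k : ℕ) : Setoid (IntIrrep k) where
  r π π' := Nonempty ((π.toRep ℚ).Equiv (π'.toRep ℚ))
  iseqv := ⟨fun _ => ⟨.refl _⟩, fun ⟨e⟩ => ⟨e.symm⟩, fun ⟨e⟩ ⟨f⟩ => ⟨e.trans f⟩⟩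

/-- The set of isomorphism classes of irreducible representations of the symmetric group. -/
def Irr (k : ℕ) : Type := Quotient (IntIrrep.setoid k)

variable {R V : Type u} [CommRing R] [AddCommGroup V] [Module R V] {Q : QuadraticForm R V} {k : ℕ}

section

variable {M M' N : Type u} [AddCommGroup M] [Module R M] [AddCommGroup M'] [Module R M']
  [AddCommGroup N] [Module R N] {G : Type} [Group G]

/-- The module of equivariant homomorphisms. -/
noncomputable def equivHom (σ : Representation R G N) (ρ : Representation R G M) : Submodule R (N →ₗ[R] M) :=
  (Representation.linHom σ ρ).invariants

theorem mem_equivHom (σ : Representation R G N) (ρ : Representation R G M) (f : N →ₗ[R] M) :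
    f ∈ equivHom σ ρ ↔ ∀ g x, f (σ g x) = ρ g (f x) := by
  rw [equivHom, Representation.mem_invariants]
  constructor
  · intro h g x
    have := LinearMap.congr_fun (h g) (σ g x)
    rw [Representation.linHom_apply] at this
    simpa using this.symm
  · intro h g
    ext x
    rw [Representation.linHom_apply]
    simp [← h]

/-- Composition of equivariant homomorphisms with an equivariant map. -/
noncomputable def equivHomMap (σ : Representation R G N) (ρ : Representation R G M) (ρ' : Representation R G M')
    (a : M →ₗ[R] M') (ha : ∀ g x, a (ρ g x) = ρ' g (a x)) :
    equivHom σ ρ →ₗ[R] equivHom σ ρ' :=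
  (LinearMap.compRight R a).restrict fun f hf => by
    rw [mem_equivHom] at hf ⊢
    intro g x
    simp [hf, ha]

end

/-- The action of `C(V, Q)` commutes with the action of the group. -/
theorem GrMod.ρ_act_comm {G : Type} [Group G] (T : GrMod Q G) (g : G) (x : CliffordAlgebra Q)
    (m : T.carrier) : T.act x (T.ρ g m) = T.ρ g (T.act x m) := by
  have : T.act x * T.ρ g = T.ρ g * T.act x := by
    induction x using CliffordAlgebra.induction with
    | algebraMap r => rw [AlgHom.commutes]; exact Algebra.commutes _ _
    | ι v => exact (T.ρ_act g v).symm
    | mul a b ha hb => rw [map_mul, mul_assoc, hb, ← mul_assoc, ha, mul_assoc]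
    | add a b ha hb => rw [map_add, mul_add, add_mul, ha, hb]
  exact LinearMap.congr_fun this m

theorem GrMod.ρ_ε_comm {G : Type} [Group G] (T : GrMod Q G) (g : G) (m : T.carrier) :
    T.ε (T.ρ g m) = T.ρ g (T.ε m) :=
  (LinearMap.congr_fun (T.ρ_ε g) m).symm

/-- The diagonal action on a power of a module. -/
def piAct {A M : Type u} [Ring A] [Algebra R A] [AddCommGroup M] [Module R M] (n : ℕ)
    (f : A →ₐ[R] Module.End R M) : A →ₐ[R] Module.End R (Fin n → M) :=
  AlgHom.ofLinearMap
    { toFun := fun x => (f x).compLeft (Fin n)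
      map_add' := fun x y => by ext; simp
      map_smul' := fun r x => by ext; simp }
    (by ext; simp) (fun x y => by ext; simp)

theorem isFGProj_pi {A M : Type u} [Ring A] [Algebra R A] [AddCommGroup M] [Module R M] (n : ℕ)
    {f : A →ₐ[R] Module.End R M} (hf : IsFGProj f) (h : A →ₐ[R] Module.End R (Fin n → M))
    (hh : ∀ a x, h a x = fun i => f a (x i)) : IsFGProj h := by
  let : Module A M := Module.compHom M f.toRingHom
  obtain ⟨h1, h2⟩ : Module.Finite A M ∧ Module.Projective A M := hf
  have key : Module.Finite A (Fin n → M) ∧ Module.Projective A (Fin n → M) :=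
    ⟨inferInstance,
      Module.Projective.of_equiv' (DirectSum.linearEquivFunOnFintype A (Fin n) fun _ => M)⟩
  let m' : Module A (Fin n → M) := Module.compHom (Fin n → M) h.toRingHom
  have e : m' = Pi.module _ _ _ := by
    ext a x i
    exact congrFun (hh a x) i
  change @Module.Finite A (Fin n → M) _ _ m' ∧ @Module.Projective A _ (Fin n → M) _ m'
  rw [e]; exact key

/-- The action of `C(V, Q)` on `Hom_{S_k}(π, T)`. -/
noncomputable def homAct (π : IntIrrep k) (T : GrMod Q (Equiv.Perm (Fin k))) :
    CliffordAlgebra Q →ₐ[R] Module.End R (equivHom (π.toRep R) T.ρ) :=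
  AlgHom.ofLinearMap
    { toFun := fun x => equivHomMap (π.toRep R) T.ρ T.ρ (T.act x) fun g m => T.ρ_act_comm g x m
      map_add' := fun x y => by ext; simp [equivHomMap]
      map_smul' := fun r x => by ext; simp [equivHomMap] }
    (by ext; simp [equivHomMap])
    (fun x y => by ext; simp [equivHomMap])

theorem homAct_apply (π : IntIrrep k) (T : GrMod Q (Equiv.Perm (Fin k))) (x : CliffordAlgebra Q)
    (f : equivHom (π.toRep R) T.ρ) : ((homAct π T x f : equivHom (π.toRep R) T.ρ) :
      (Fin π.n → R) →ₗ[R] T.carrier) = T.act x ∘ₗ f.1 := rfl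

theorem homAct_fgProj [Invertible ((k.factorial : ℕ) : R)] (π : IntIrrep k)
    (T : GrMod Q (Equiv.Perm (Fin k))) : IsFGProj (homAct π T) := by
  have hcard : (Fintype.card (Equiv.Perm (Fin k)) : R) = (k.factorial : ℕ) := by
    rw [Fintype.card_perm, Fintype.card_fin]
  let : Invertible (Fintype.card (Equiv.Perm (Fin k)) : R) :=
    Invertible.copy ‹_› _ hcard
  let σ := Representation.linHom (π.toRep R) T.ρ
  let b : (Fin π.n → T.carrier) ≃ₗ[R] ((Fin π.n → R) →ₗ[R] T.carrier) :=
    (Pi.basisFun R (Fin π.n)).constr R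
  have hb : ∀ x t, b (fun j => T.act x (t j)) = T.act x ∘ₗ b t := fun x t => by
    refine (Pi.basisFun R (Fin π.n)).ext fun j => ?_
    rw [LinearMap.comp_apply, Module.Basis.constr_basis, Module.Basis.constr_basis]
  refine isFGProj_of_retract (isFGProj_pi π.n T.fgProj (piAct π.n T.act) fun _ _ => rfl)
    (b.symm.toLinearMap ∘ₗ (equivHom (π.toRep R) T.ρ).subtype)
    ((σ.averageMap.codRestrict (equivHom (π.toRep R) T.ρ) σ.averageMap_invariant) ∘ₗ
      b.toLinearMap) (fun f => ?_) (fun x f => ?_) (fun x t => ?_)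
  · refine Subtype.ext ?_
    change σ.averageMap (b (b.symm f.1)) = f.1
    rw [b.apply_symm_apply]
    exact σ.averageMap_id _ f.2
  · apply b.injective
    change b (b.symm (T.act x ∘ₗ f.1)) = b (fun j => T.act x (b.symm f.1 j))
    rw [b.apply_symm_apply, hb, b.apply_symm_apply]
  · refine Subtype.ext ?_
    change σ.averageMap (b (fun j => T.act x (t j))) = T.act x ∘ₗ σ.averageMap (b t)
    rw [hb]
    have key : ∀ f, σ.averageMap f = ⅟(Fintype.card (Equiv.Perm (Fin k)) : R) • ∑ g, σ g f :=
      fun f => by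
      simp [Representation.averageMap, GroupAlgebra.average, map_smul, map_sum]
    rw [key, key]
    refine LinearMap.ext fun j => ?_
    simp only [LinearMap.comp_apply, LinearMap.smul_apply, LinearMap.sum_apply, map_smul, map_sum]
    congr 1
    refine Finset.sum_congr rfl fun g _ => ?_
    simp only [σ, Representation.linHom_apply, LinearMap.comp_apply]
    exact (T.ρ_act_comm g x _).symm

/-- The graded module `Hom_{S_k}(π, T)` over `C(V, Q)`. -/
noncomputable def homObj [Invertible ((k.factorial : ℕ) : R)] (π : IntIrrep k)
    (T : GrMod Q (Equiv.Perm (Fin k))) : GrMod Q Unit where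
  carrier := equivHom (π.toRep R) T.ρ
  act := homAct π T
  fgProj := homAct_fgProj π T
  ε := equivHomMap (π.toRep R) T.ρ T.ρ T.ε T.ρ_ε_comm
  ε_sq := by
    ext f x
    exact LinearMap.congr_fun T.ε_sq _
  ε_act v := by
    ext f x
    exact LinearMap.congr_fun (T.ε_act v) _
  ρ := 1
  ρ_act _ _ := by simp
  ρ_ε _ := by simp

theorem homObj_isSum [Invertible ((k.factorial : ℕ) : R)] (π : IntIrrep k)
    {L M N : GrMod Q (Equiv.Perm (Fin k))} (h : L.IsSum M N) :
    (homObj π L).IsSum (homObj π M) (homObj π N) := by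
  obtain ⟨e, h1, h2, h3⟩ := h
  have h4 : ∀ g x, e.symm (L.ρ g x) = (M.ρ g (e.symm x).1, N.ρ g (e.symm x).2) := fun g x => by
    rw [LinearEquiv.symm_apply_eq, h3, e.apply_symm_apply]
  let F : (equivHom (π.toRep R) M.ρ × equivHom (π.toRep R) N.ρ) →ₗ[R] equivHom (π.toRep R) L.ρ :=
    (equivHomMap (π.toRep R) M.ρ L.ρ (e.toLinearMap ∘ₗ LinearMap.inl R _ _) fun g x => by
      simp [← h3]).coprod
    (equivHomMap (π.toRep R) N.ρ L.ρ (e.toLinearMap ∘ₗ LinearMap.inr R _ _) fun g x => by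
      simp [← h3])
  let F' : equivHom (π.toRep R) L.ρ →ₗ[R] (equivHom (π.toRep R) M.ρ × equivHom (π.toRep R) N.ρ) :=
    (equivHomMap (π.toRep R) L.ρ M.ρ (LinearMap.fst R _ _ ∘ₗ e.symm.toLinearMap) fun g x => by
      simp [h4]).prod
    (equivHomMap (π.toRep R) L.ρ N.ρ (LinearMap.snd R _ _ ∘ₗ e.symm.toLinearMap) fun g x => by
      simp [h4])
  have hF : ∀ f x, (F f).1 x = e (f.1.1 x, f.2.1 x) := fun f x => by
    change e (f.1.1 x, 0) + e (0, f.2.1 x) = _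
    rw [← map_add, Prod.mk_add_mk, add_zero, zero_add]
  have hF' : ∀ f x, ((F' f).1.1 x, (F' f).2.1 x) = e.symm (f.1 x) := fun f x => rfl
  refine ⟨LinearEquiv.ofLinearMap F F' ?_ ?_, fun v f => ?_, fun f => ?_, fun g f => rfl⟩
  · refine LinearMap.ext fun f => Subtype.ext (LinearMap.ext fun x => ?_)
    exact (hF (F' f) x).trans ((congrArg e (hF' f x)).trans (e.apply_symm_apply _))
  · refine LinearMap.ext fun f => ?_
    have : ∀ x, ((F' (F f)).1.1 x, (F' (F f)).2.1 x) = (f.1.1 x, f.2.1 x) := fun x =>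
      (hF' (F f) x).trans ((congrArg e.symm (hF f x)).trans (e.symm_apply_apply _))
    exact Prod.ext (Subtype.ext (LinearMap.ext fun x => congrArg Prod.fst (this x)))
      (Subtype.ext (LinearMap.ext fun x => congrArg Prod.snd (this x)))
  · refine Subtype.ext (LinearMap.ext fun x => ?_)
    exact (hF (homAct π M (ι Q v) f.1, homAct π N (ι Q v) f.2) x).trans
      ((h1 v (f.1.1 x, f.2.1 x)).trans (congrArg (L.act (ι Q v)) (hF f x).symm))
  · refine Subtype.ext (LinearMap.ext fun x => ?_)
    exact (hF ((homObj π M).ε f.1, (homObj π N).ε f.2) x).trans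
      ((h2 (f.1.1 x, f.2.1 x)).trans (congrArg L.ε (hF f x).symm))

theorem homObj_isElementary [Invertible ((k.factorial : ℕ) : R)] (π : IntIrrep k)
    {M : GrMod Q (Equiv.Perm (Fin k))} (h : M.IsElementary) : (homObj π M).IsElementary := by
  obtain ⟨e, h1, h2, h3, h4⟩ := h
  refine ⟨equivHomMap (π.toRep R) M.ρ M.ρ e fun g x => LinearMap.congr_fun (h4 g) x,
    LinearMap.ext fun f => ?_, LinearMap.ext fun f => ?_, fun v => LinearMap.ext fun f => ?_,
    fun g => LinearMap.ext fun f => rfl⟩ <;>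
  refine Subtype.ext (LinearMap.ext fun x => ?_)
  · exact LinearMap.congr_fun h1 (f.1 x)
  · exact LinearMap.congr_fun h2 (f.1 x)
  · exact LinearMap.congr_fun (h3 v) (f.1 x)

/-- The homomorphism `K_{S_k}(C(V, Q)) → K(C(V, Q))`, `T ↦ Hom_{S_k}(π, T)`. -/
noncomputable def homK [Invertible ((k.factorial : ℕ) : R)] (π : IntIrrep k) :
    GrK Q (Equiv.Perm (Fin k)) →+ GrK Q Unit :=
  GrK.lift (fun T => (homObj π T).cls) (fun _ _ _ h => GrMod.cls_of_isSum (homObj_isSum π h))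
    fun _ h => GrMod.cls_of_isElementary (homObj_isElementary π h)

/-- The Adams character `K_{S_k}(C(V, Q)) ≅ K(C(V, Q)) ⊗ R(S_k) → K(C(V, Q))`. The isomorphism sends
the class of `T` to `∑ [Hom_{S_k}(π, T)] ⊗ [π]`, the sum being over the irreducible representations
`π` of `S_k`, and `R(S_k) → ℤ` is the trace at the cycle `(1, 2, …, k)`. -/
noncomputable def adamsChar [Invertible ((k.factorial : ℕ) : R)]
    (x : GrK Q (Equiv.Perm (Fin k))) : GrK Q Unit :=
  ∑ᶠ π : Irr k, Matrix.trace ((Quotient.out π : IntIrrep k).ρ (finRotate k)) •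
    homK (Quotient.out π) x

end Character

/-! ## Morita equivalence and the hermitian Bott class -/

section Theta

theorem isUnit_of_factorial {R : Type u} [CommRing R] {k : ℕ} (hk : 0 < k) [Invertible ((k.factorial : ℕ) : R)] :
    IsUnit (k : R) :=
  isUnit_of_dvd_unit (Nat.cast_dvd_cast (Nat.dvd_factorial hk le_rfl))
    (isUnit_of_invertible ((k.factorial : ℕ) : R))

variable {R V : Type u} [CommRing R] [Invertible (2 : R)] [AddCommGroup V] [Module R V]
  {Q : QuadraticForm R V}

/-- The graded module `E ⊗ N` over `C(V, Q)`. -/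
noncomputable def Spinorial.moritaObj (S : Spinorial Q) (N : FGProj R) : GrMod Q Unit where
  carrier := S.E ⊗[R] N.carrier
  act := (Module.End.rTensorAlgHom R S.E N.carrier).comp S.φ.toAlgHom
  fgProj := isFGProj_of_algEquiv_end S.faithful S.φ _
  ε := LinearMap.rTensor N.carrier S.ε
  ε_sq := by
    rw [← LinearMap.rTensor_mul, S.ε_sq]
    exact LinearMap.rTensor_id _ _
  ε_act v := by
    change LinearMap.rTensor N.carrier S.ε * LinearMap.rTensor N.carrier (S.φ (ι Q v)) =
      -(LinearMap.rTensor N.carrier (S.φ (ι Q v)) * LinearMap.rTensor N.carrier S.ε)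
    rw [← LinearMap.rTensor_mul, ← LinearMap.rTensor_mul, S.φ_odd, LinearMap.rTensor_neg]
  ρ := 1
  ρ_act _ _ := by simp
  ρ_ε _ := by simp

theorem Spinorial.moritaObj_isSum (S : Spinorial Q) {L M N : FGProj R}
    (e : (M.carrier × N.carrier) ≃ₗ[R] L.carrier) :
    (S.moritaObj L).IsSum (S.moritaObj M) (S.moritaObj N) := by
  let d := TensorProduct.prodRight R R S.E M.carrier N.carrier
  let F := d.symm.trans (TensorProduct.congr (.refl R S.E) e)
  have key : ∀ (a : Module.End R S.E) (x : S.E ⊗[R] M.carrier × S.E ⊗[R] N.carrier),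
      F (LinearMap.rTensor _ a x.1, LinearMap.rTensor _ a x.2) = LinearMap.rTensor _ a (F x) := by
    intro a x
    obtain ⟨z, rfl⟩ := d.surjective x
    have h : (LinearMap.rTensor _ a (d z).1, LinearMap.rTensor _ a (d z).2) =
        d (LinearMap.rTensor _ a z) := by
      induction z with
      | zero => simp
      | add x y hx hy =>
        simp only [map_add, ← hx, ← hy, Prod.fst_add, Prod.snd_add, Prod.mk_add_mk]
      | tmul x y => simp [d]
    rw [h]
    simp only [F, LinearEquiv.trans_apply, LinearEquiv.symm_apply_apply]
    clear h
    induction z with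
    | zero => simp
    | add x y hx hy => simp only [map_add, hx, hy]
    | tmul x y => simp
  exact ⟨F, fun v x => key _ x, fun x => key _ x, fun g x => rfl⟩

theorem Spinorial.moritaObj_isSum_of_equiv (S : Spinorial Q) {M N : FGProj R}
    (e : M.carrier ≃ₗ[R] N.carrier) :
    (S.moritaObj N).IsSum (S.moritaObj M) (GrMod.zero Q Unit) := by
  let F : S.E ⊗[R] M.carrier ≃ₗ[R] S.E ⊗[R] N.carrier := TensorProduct.congr (.refl R S.E) e
  have key : ∀ (a : Module.End R S.E) (x : S.E ⊗[R] M.carrier),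
      F (LinearMap.rTensor _ a x) = LinearMap.rTensor _ a (F x) := by
    intro a x
    induction x with
    | zero => simp
    | add x y hx hy => simp only [map_add, hx, hy]
    | tmul x y => simp [F]
  exact ⟨(LinearEquiv.prodUnique (M₂ := PUnit.{u + 1})).trans F, fun v x => key _ x.1,
    fun x => key _ x.1, fun g x => rfl⟩

/-- The Morita isomorphism `K(R) → K(C(V, Q))`, sending the class of `N` to the class of `E ⊗ N`. -/
noncomputable def Spinorial.morita (S : Spinorial Q) : K R →+ GrK Q Unit :=
  K.lift (fun N => (S.moritaObj N).cls)
    (fun M N h => by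
      obtain ⟨e⟩ := h
      have h0 : (S.moritaObj N).IsSum (S.moritaObj M) (GrMod.zero Q Unit) :=
        S.moritaObj_isSum_of_equiv e
      have h1 := GrMod.cls_of_isSum h0
      rw [h1, GrMod.cls_zero, add_zero])
    (fun L M N h => by
      obtain ⟨e⟩ := h
      exact GrMod.cls_of_isSum (S.moritaObj_isSum e))

/-- The operation `θₖ`, the composite
`K(R) ≅ K(C(V, Q)) → K_{S_k}(C(V, kQ)) → K(C(V, kQ)) ≅ K(R)` of the Morita isomorphism of `(V, E)`,
of the `k`-th power map, of the Adams character and of the inverse of the Morita isomorphism of the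
`k`-twisted spinorial module. -/
noncomputable def Spinorial.theta (S : Spinorial Q) {k : ℕ} (hk : 0 < k)
    [Invertible ((k.factorial : ℕ) : R)] (x : K R) : K R :=
  Function.invFun (S.twist (k : R) (isUnit_of_factorial hk)).morita
    (adamsChar (powerMap S k (isUnit_of_factorial hk) (S.morita x)))

/-- The hermitian Bott class `ρₖ(V, E) = θₖ(1)`. -/
noncomputable def Spinorial.bott (S : Spinorial Q) {k : ℕ} (hk : 0 < k)
    [Invertible ((k.factorial : ℕ) : R)] : K R :=
  S.theta hk 1

end Theta

end HermBott

namespace HermBott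

/-! ## Classes in the Grothendieck ring -/

section KClass

variable {R : Type u} [CommRing R]

theorem FGProj.cls_eq_of_equiv {M N : FGProj R} (e : M.carrier ≃ₗ[R] N.carrier) :
    M.cls = N.cls :=
  congrArg (fun x : IsoClass R => Ideal.Quotient.mk (Ideal.span (kRel R)) (FreeAbelianGroup.of x))
    (Quotient.sound (s := FGProj.setoid R) ⟨e⟩)

theorem FGProj.cls_eq_add {L M N : FGProj R} (e : (M.carrier × N.carrier) ≃ₗ[R] L.carrier) :
    L.cls = M.cls + N.cls := by
  have h : Ideal.Quotient.mk (Ideal.span (kRel R)) (L.gen - M.gen - N.gen) = 0 :=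
    Ideal.Quotient.eq_zero_iff_mem.mpr (Submodule.subset_span ⟨L, M, N, ⟨e⟩, rfl⟩)
  rw [map_sub, map_sub, sub_sub, sub_eq_zero] at h
  exact h

theorem FGProj.cls_tensor (M N : FGProj R) : (M.tensor N).cls = M.cls * N.cls := by
  have h : (M.tensor N).gen = M.gen * N.gen :=
    FreeAbelianGroup.of_mul (α := IsoClass R) (Quotient.mk _ M) (Quotient.mk _ N)
  rw [FGProj.cls, h, map_mul]
  rfl

theorem FGProj.cls_self : (FGProj.mk R : FGProj R).cls = 1 := rfl

theorem FGProj.cls_of_subsingleton (M : FGProj R) [Subsingleton M.carrier] : M.cls = 0 := by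
  have : M.cls = M.cls + M.cls := FGProj.cls_eq_add
    { toFun := fun x => x.1, map_add' := fun _ _ => rfl, map_smul' := fun _ _ => rfl,
      invFun := fun x => (x, x), left_inv := fun _ => Subsingleton.elim _ _,
      right_inv := fun _ => rfl }
  simpa using this

theorem projective_pi {J : Type} [Finite J] (B : J → Type u) [∀ j, AddCommGroup (B j)]
    [∀ j, Module R (B j)] [∀ j, Module.Projective R (B j)] : Module.Projective R (∀ j, B j) := by
  classical
  have := Fintype.ofFinite J
  exact Module.Projective.of_equiv' (DirectSum.linearEquivFunOnFintype R J B)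

theorem FGProj.cls_pi : ∀ (J : Type) [Fintype J] (B : J → FGProj R) (A : FGProj R),
    (A.carrier ≃ₗ[R] ∀ j, (B j).carrier) → A.cls = ∑ j, (B j).cls := by
  refine Fintype.induction_empty_option ?_ ?_ ?_
  · intro α β _ e ih B A f
    let : Fintype α := Fintype.ofEquiv β e.symm
    rw [ih (fun a => B (e a)) A (f.trans (LinearEquiv.piCongrLeft R (fun j => (B j).carrier) e).symm)]
    exact Equiv.sum_comp e fun b => (B b).cls
  · intro B A f
    have : Subsingleton A.carrier := f.toEquiv.subsingleton
    simp [FGProj.cls_of_subsingleton]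
  · intro α _ ih B A f
    have := projective_pi (R := R) fun a : α => (B (some a)).carrier
    let P : FGProj R := ⟨∀ a : α, (B (some a)).carrier⟩
    have h := FGProj.cls_eq_add (L := A) (M := B none) (N := P)
      (f.trans (LinearEquiv.piOptionEquivProd (M := fun j => (B j).carrier) R)).symm
    rw [h, ih (fun a => B (some a)) P (.refl R _), Fintype.sum_option]

theorem FGProj.cls_eq_sum {J : Type} [Fintype J] [DecidableEq J] (A : FGProj R) (B : J → FGProj R)
    (i : ∀ j, (B j).carrier →ₗ[R] A.carrier) (s : ∀ j, A.carrier →ₗ[R] (B j).carrier)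
    (h1 : ∀ j x, s j (i j x) = x) (h2 : ∀ j l, j ≠ l → ∀ x, s j (i l x) = 0)
    (h3 : ∀ x, ∑ j, i j (s j x) = x) : A.cls = ∑ j, (B j).cls := by
  refine FGProj.cls_pi J B A (LinearEquiv.ofLinearMap (LinearMap.pi s)
    (LinearMap.lsum R (fun j => (B j).carrier) R i) ?_ ?_)
  · refine LinearMap.ext fun x => funext fun j => ?_
    simp only [LinearMap.comp_apply, LinearMap.lsum_apply, LinearMap.pi_apply, LinearMap.sum_apply,
      map_sum, LinearMap.proj_apply, LinearMap.id_apply]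
    rw [Finset.sum_eq_single j (fun l _ hl => h2 j l hl.symm _) (by simp), h1]
  · refine LinearMap.ext fun x => ?_
    simpa using h3 x

end KClass

/-! ## Super modules -/

/-- A finitely generated projective `ℤ/2`-graded module, the grading being recorded by an
involution. -/
structure SMod (R : Type u) [CommRing R] where
  carrier : Type u
  [addCommGroup : AddCommGroup carrier]
  [module : Module R carrier]
  [finite : Module.Finite R carrier]
  [projective : Module.Projective R carrier]
  /-- the grading -/
  η : Module.End R carrier
  η_sq : ∀ x, η (η x) = x

attribute [instance] SMod.addCommGroup SMod.module SMod.finite SMod.projective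

section SMod

variable {R : Type u} [CommRing R]

/-- A module concentrated in degree `a`. -/
abbrev FGProj.toSMod (N : FGProj R) (a : ZMod 2) : SMod R where
  carrier := N.carrier
  η := sgn R (degSign a) • 1
  η_sq x := by
    simp only [LinearMap.smul_apply, Module.End.one_apply, smul_smul, sgn_mul_self, one_smul]

/-- The tensor product of super modules. -/
noncomputable abbrev SMod.tensor (M N : SMod R) : SMod R where
  carrier := M.carrier ⊗[R] N.carrier
  η := TensorProduct.map M.η N.η
  η_sq x := by
    rw [← LinearMap.comp_apply, ← TensorProduct.map_comp]
    have h1 : M.η ∘ₗ M.η = LinearMap.id := LinearMap.ext M.η_sq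
    have h2 : N.η ∘ₗ N.η = LinearMap.id := LinearMap.ext N.η_sq
    rw [h1, h2, TensorProduct.map_id, LinearMap.id_apply]

theorem SMod.η_mul (N : SMod R) : N.η * N.η = 1 := LinearMap.ext N.η_sq

/-- The homogeneous part of degree `a`. -/
def SMod.homog (N : SMod R) (a : ZMod 2) : Submodule R N.carrier :=
  LinearMap.eqLocus N.η (sgn R (degSign a) • 1)

theorem SMod.mem_homog {N : SMod R} {a : ZMod 2} {x : N.carrier} :
    x ∈ N.homog a ↔ N.η x = sgn R (degSign a) • x := Iff.rfl

/-- The map induced by an even map on the homogeneous parts. -/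
def SMod.homogMap {M N : SMod R} (f : M.carrier →ₗ[R] N.carrier) (hf : ∀ x, f (M.η x) = N.η (f x))
    (a : ZMod 2) : M.homog a →ₗ[R] N.homog a :=
  f.restrict fun x hx => by
    rw [SMod.mem_homog] at hx ⊢
    rw [← hf, hx, map_smul]

variable [Invertible (2 : R)]

/-- The projection on the homogeneous part. -/
def SMod.toHomog (N : SMod R) (a : ZMod 2) : N.carrier →ₗ[R] N.homog a :=
  (gradeProj N.η a).codRestrict _ fun x => gradeProj_homog N.η_mul a x

theorem SMod.toHomog_coe (N : SMod R) (a : ZMod 2) (x : N.homog a) : N.toHomog a x = x :=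
  Subtype.ext ((gradeProj_apply x.2).trans (if_pos rfl))

theorem SMod.toHomog_coe_of_ne (N : SMod R) {a b : ZMod 2} (h : a ≠ b) (x : N.homog b) :
    N.toHomog a x = 0 :=
  Subtype.ext ((gradeProj_apply x.2).trans (if_neg h))

theorem SMod.sum_toHomog (N : SMod R) (x : N.carrier) : ∑ a, (N.toHomog a x : N.carrier) = x :=
  gradeProj_sum x

instance SMod.finite_homog (N : SMod R) (a : ZMod 2) : Module.Finite R (N.homog a) :=
  Module.Finite.of_surjective (N.toHomog a) fun x => ⟨x, N.toHomog_coe a x⟩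

instance SMod.projective_homog (N : SMod R) (a : ZMod 2) : Module.Projective R (N.homog a) :=
  Module.Projective.of_split (N.homog a).subtype (N.toHomog a)
    (LinearMap.ext fun x => N.toHomog_coe a x)

/-- The homogeneous part, as a finitely generated projective module. -/
abbrev SMod.part (N : SMod R) (a : ZMod 2) : FGProj R := ⟨N.homog a⟩

/-- The class `[N₀] - [N₁]` of a super module. -/
def SMod.sK (N : SMod R) : K R := (N.part 0).cls - (N.part 1).cls

theorem SMod.sK_eq_sum {J : Type} [Fintype J] [DecidableEq J] (A : SMod R) (B : J → SMod R)
    (i : ∀ j, (B j).carrier →ₗ[R] A.carrier) (s : ∀ j, A.carrier →ₗ[R] (B j).carrier)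
    (hi : ∀ j x, i j ((B j).η x) = A.η (i j x)) (hs : ∀ j x, s j (A.η x) = (B j).η (s j x))
    (h1 : ∀ j x, s j (i j x) = x) (h2 : ∀ j l, j ≠ l → ∀ x, s j (i l x) = 0)
    (h3 : ∀ x, ∑ j, i j (s j x) = x) : A.sK = ∑ j, (B j).sK := by
  have key : ∀ a, (A.part a).cls = ∑ j, ((B j).part a).cls := fun a => by
    refine FGProj.cls_eq_sum _ _ (fun j => SMod.homogMap (i j) (hi j) a)
      (fun j => SMod.homogMap (s j) (hs j) a) ?_ ?_ ?_
    · exact fun j x => Subtype.ext (h1 j x.1)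
    · exact fun j l hjl x => Subtype.ext (h2 j l hjl x.1)
    · refine fun x => Subtype.ext ?_
      change ((∑ j, _ : A.homog a) : A.carrier) = _
      rw [Submodule.coe_sum]
      exact h3 x.1
  rw [SMod.sK, key, key, ← Finset.sum_sub_distrib]
  rfl

theorem SMod.sK_congr {M N : SMod R} (e : M.carrier ≃ₗ[R] N.carrier)
    (he : ∀ x, e (M.η x) = N.η (e x)) : M.sK = N.sK := by
  have h := N.sK_eq_sum (J := Unit) (fun _ => M) (fun _ => e.toLinearMap)
    (fun _ => e.symm.toLinearMap) (fun _ x => he x)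
    (fun _ x => by
      change e.symm _ = M.η (e.symm x)
      rw [LinearEquiv.symm_apply_eq, he, e.apply_symm_apply])
    (fun _ x => e.symm_apply_apply x) (fun j l h => absurd rfl h) (fun x => by simp)
  simpa using h.symm

theorem SMod.sK_prod {L M N : SMod R} (e : (M.carrier × N.carrier) ≃ₗ[R] L.carrier)
    (he : ∀ x, e (M.η x.1, N.η x.2) = L.η (e x)) : L.sK = M.sK + N.sK := by
  have he' : ∀ x, e.symm (L.η x) = (M.η (e.symm x).1, N.η (e.symm x).2) := fun x => by
    rw [LinearEquiv.symm_apply_eq, he, e.apply_symm_apply]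
  have h := L.sK_eq_sum (J := Bool) (fun b => match b with | true => M | false => N)
    (fun b => match b with
      | true => e.toLinearMap ∘ₗ LinearMap.inl R _ _
      | false => e.toLinearMap ∘ₗ LinearMap.inr R _ _)
    (fun b => match b with
      | true => LinearMap.fst R _ _ ∘ₗ e.symm.toLinearMap
      | false => LinearMap.snd R _ _ ∘ₗ e.symm.toLinearMap)
    (fun b => match b with
      | true => fun x => by simp [← he]
      | false => fun x => by simp [← he])
    (fun b => match b with
      | true => fun x => by simp [he']
      | false => fun x => by simp [he'])
    (fun b => match b with
      | true => fun x => by simp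
      | false => fun x => by simp)
    (fun b c => match b, c with
      | true, true => fun h => absurd rfl h
      | false, false => fun h => absurd rfl h
      | true, false => fun h x => by simp
      | false, true => fun h x => by simp)
    (fun x => by simp [← map_add])
  simpa using h

theorem SMod.sK_const (N : SMod R) (a : ZMod 2) (h : ∀ x, N.η x = sgn R (degSign a) • x) :
    N.sK = (degSign a : ℤ) • (FGProj.mk N.carrier : FGProj R).cls := by
  have h1 : (N.part a).cls = (FGProj.mk N.carrier : FGProj R).cls :=
    FGProj.cls_eq_of_equiv ((LinearEquiv.ofEq _ _ (eq_top_iff.mpr fun x _ => h x)).trans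
      Submodule.topEquiv)
  have h2 : ∀ b, b ≠ a → (N.part b).cls = 0 := fun b hb => by
    have : Subsingleton (N.part b).carrier := by
      refine ⟨fun x y => ?_⟩
      have : ∀ x : N.homog b, x = 0 := fun x => by
        rw [← N.toHomog_coe b x]
        exact N.toHomog_coe_of_ne hb ⟨x.1, h x.1⟩
      exact (this x).trans (this y).symm
    exact FGProj.cls_of_subsingleton _
  have h01 : ∀ a : ZMod 2, a = 0 ∨ a = 1 := by decide
  obtain rfl | rfl := h01 a
  · rw [SMod.sK, h1, h2 1 (by decide)]
    simp [degSign]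
  · rw [SMod.sK, h1, h2 0 (by decide)]
    simp [degSign]

theorem FGProj.sK_toSMod (N : FGProj R) (a : ZMod 2) :
    (N.toSMod a).sK = (degSign a : ℤ) • N.cls :=
  SMod.sK_const _ a fun _ => rfl

theorem SMod.sK_eq_sum_homog (N : SMod R) : N.sK = ∑ a, ((N.part a).toSMod a).sK := by
  have h2 : (Finset.univ : Finset (ZMod 2)) = {0, 1} := rfl
  rw [h2, Finset.sum_pair (by decide), FGProj.sK_toSMod, FGProj.sK_toSMod, SMod.sK]
  simp [degSign, sub_eq_add_neg]

theorem SMod.sK_tensor (M N : SMod R) : (M.tensor N).sK = M.sK * N.sK := by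
  have key : (M.tensor N).sK = ∑ p : ZMod 2 × ZMod 2,
      (((M.part p.1).toSMod p.1).tensor ((N.part p.2).toSMod p.2)).sK := by
    refine SMod.sK_eq_sum _ _
      (fun p => TensorProduct.map (M.homog p.1).subtype (N.homog p.2).subtype)
      (fun p => TensorProduct.map (M.toHomog p.1) (N.toHomog p.2)) ?_ ?_ ?_ ?_ ?_
    · intro p x
      change _ = TensorProduct.map M.η N.η _
      change (TensorProduct.map _ _ ∘ₗ TensorProduct.map _ _) x =
        (TensorProduct.map _ _ ∘ₗ TensorProduct.map _ _) x
      rw [← TensorProduct.map_comp, ← TensorProduct.map_comp]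
      congr 2 <;> refine LinearMap.ext fun x => x.2.symm
    · intro p x
      change (TensorProduct.map _ _ ∘ₗ TensorProduct.map _ _) x =
        (TensorProduct.map _ _ ∘ₗ TensorProduct.map _ _) x
      rw [← TensorProduct.map_comp, ← TensorProduct.map_comp]
      have h : ∀ (M : SMod R) a, M.toHomog a ∘ₗ M.η =
          (sgn R (degSign a) • 1 : Module.End R (M.homog a)) ∘ₗ M.toHomog a := fun M a => by
        refine LinearMap.ext fun x => Subtype.ext ?_
        change gradeProj M.η a (M.η x) = sgn R (degSign a) • gradeProj M.η a x
        rw [← gradeProj_homog M.η_mul]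
        simp [gradeProj]
      rw [h, h]
    · intro p x
      rw [← LinearMap.comp_apply, ← TensorProduct.map_comp]
      have h : ∀ (M : SMod R) a, M.toHomog a ∘ₗ (M.homog a).subtype = LinearMap.id := fun M a =>
        LinearMap.ext fun x => M.toHomog_coe a x
      rw [h, h]
      exact LinearMap.congr_fun (TensorProduct.map_id) x
    · intro p q hpq x
      rw [← LinearMap.comp_apply, ← TensorProduct.map_comp]
      by_cases h1 : p.1 = q.1
      · have h2 : p.2 ≠ q.2 := fun h => hpq (Prod.ext h1 h)
        have : N.toHomog p.2 ∘ₗ (N.homog q.2).subtype = 0 :=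
          LinearMap.ext fun x => N.toHomog_coe_of_ne h2 x
        rw [this, TensorProduct.map_zero_right]
        rfl
      · have : M.toHomog p.1 ∘ₗ (M.homog q.1).subtype = 0 :=
          LinearMap.ext fun x => M.toHomog_coe_of_ne h1 x
        rw [this, TensorProduct.map_zero_left]
        rfl
    · intro x
      change ∑ p : ZMod 2 × ZMod 2, TensorProduct.map (M.homog p.1).subtype (N.homog p.2).subtype
        (TensorProduct.map (M.toHomog p.1) (N.toHomog p.2) x) = x
      induction x using TensorProduct.induction_on with
      | zero => simp
      | add x y hx hy =>
        simp only [map_add, Finset.sum_add_distrib]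
        exact congrArg₂ (· + ·) hx hy
      | tmul x y =>
        conv_rhs => rw [← M.sum_toHomog x, ← N.sum_toHomog y]
        rw [Fintype.sum_prod_type, TensorProduct.sum_tmul]
        refine Finset.sum_congr rfl fun a _ => ?_
        rw [TensorProduct.tmul_sum]
        rfl
  have hc : ∀ a b, (((M.part a).toSMod a).tensor ((N.part b).toSMod b)).sK =
      ((M.part a).toSMod a).sK * ((N.part b).toSMod b).sK := fun a b => by
    rw [SMod.sK_const _ (a + b), FGProj.sK_toSMod, FGProj.sK_toSMod, smul_mul_smul_comm,
      ← FGProj.cls_tensor]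
    · have : ∀ a b, (degSign (a + b) : ℤ) = degSign a * degSign b := by decide
      rw [this]
      rfl
    · intro x
      have : ∀ a b, degSign (a + b) = degSign a * degSign b := by decide
      rw [this, map_mul]
      change TensorProduct.map (sgn R (degSign a) • 1) (sgn R (degSign b) • 1) x = _
      rw [TensorProduct.map_smul_left, TensorProduct.map_smul_right, smul_smul]
      exact congrArg _ (LinearMap.congr_fun (TensorProduct.map_id) x)
  rw [key, SMod.sK_eq_sum_homog M, SMod.sK_eq_sum_homog N, Finset.sum_mul_sum,
    Fintype.sum_prod_type]
  simp only [hc]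

theorem SMod.sK_eq_zero_of_odd (N : SMod R) (e : Module.End R N.carrier) (he : ∀ x, e (e x) = x)
    (h : ∀ x, e (N.η x) = -N.η (e x)) : N.sK = 0 := by
  have h' : ∀ a b, b = a + 1 → ∀ x ∈ N.homog a, e x ∈ N.homog b := fun a b hab x hx => by
    rw [SMod.mem_homog] at hx ⊢
    have h2 : ∀ a, degSign (a + 1) = -degSign a := by decide
    rw [← neg_inj, ← h, hx, map_smul, hab, h2, ← neg_smul]
    congr 1
    simp [sgn]
  rw [SMod.sK, sub_eq_zero]
  refine FGProj.cls_eq_of_equiv (LinearEquiv.ofLinearMap (e.restrict (h' 0 1 (by decide)))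
    (e.restrict (h' 1 0 (by decide))) ?_ ?_)
  · exact LinearMap.ext fun x => Subtype.ext (he x.1)
  · exact LinearMap.ext fun x => Subtype.ext (he x.1)

end SMod

/-! ## Equality in the graded Grothendieck groups -/

section GrIso

variable {R V : Type u} [CommRing R] [AddCommGroup V] [Module R V] {Q : QuadraticForm R V}
  {G : Type} [Group G]

namespace GrMod

/-- Isomorphism of graded modules. -/
def Iso (M N : GrMod Q G) : Prop :=
  ∃ e : M.carrier ≃ₗ[R] N.carrier,
    (∀ v x, e (M.act (ι Q v) x) = N.act (ι Q v) (e x)) ∧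
    (∀ x, e (M.ε x) = N.ε (e x)) ∧ (∀ g x, e (M.ρ g x) = N.ρ g (e x))

theorem Iso.refl (M : GrMod Q G) : M.Iso M :=
  ⟨.refl R _, fun _ _ => rfl, fun _ => rfl, fun _ _ => rfl⟩

theorem Iso.symm {M N : GrMod Q G} : M.Iso N → N.Iso M := fun ⟨e, h1, h2, h3⟩ =>
  ⟨e.symm, fun v x => by rw [LinearEquiv.symm_apply_eq, h1, e.apply_symm_apply],
    fun x => by rw [LinearEquiv.symm_apply_eq, h2, e.apply_symm_apply],
    fun g x => by rw [LinearEquiv.symm_apply_eq, h3, e.apply_symm_apply]⟩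

theorem Iso.trans {L M N : GrMod Q G} : L.Iso M → M.Iso N → L.Iso N :=
  fun ⟨e, h1, h2, h3⟩ ⟨f, k1, k2, k3⟩ =>
  ⟨e.trans f, fun v x => (congrArg f (h1 v x)).trans (k1 v _),
    fun x => (congrArg f (h2 x)).trans (k2 _), fun g x => (congrArg f (h3 g x)).trans (k3 g _)⟩

theorem Iso.add {M M' N N' : GrMod Q G} : M.Iso M' → N.Iso N' → (M.add N).Iso (M'.add N') :=
  fun ⟨e, h1, h2, h3⟩ ⟨f, k1, k2, k3⟩ =>
  ⟨e.prodCongr f, fun v x => Prod.ext (h1 v x.1) (k1 v x.2),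
    fun x => Prod.ext (h2 x.1) (k2 x.2), fun g x => Prod.ext (h3 g x.1) (k3 g x.2)⟩

theorem Iso.shift {M N : GrMod Q G} : M.Iso N → M.shift.Iso N.shift := fun ⟨e, h1, h2, h3⟩ =>
  ⟨e, h1, fun x => (map_neg e (M.ε x)).trans (congrArg Neg.neg (h2 x)), h3⟩

theorem iso_add_comm (M N : GrMod Q G) : (M.add N).Iso (N.add M) :=
  ⟨LinearEquiv.prodComm R _ _, fun _ _ => rfl, fun _ => rfl, fun _ _ => rfl⟩

theorem iso_add_assoc (L M N : GrMod Q G) : ((L.add M).add N).Iso (L.add (M.add N)) :=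
  ⟨LinearEquiv.prodAssoc R _ _ _, fun _ _ => rfl, fun _ => rfl, fun _ _ => rfl⟩

theorem iso_zero_add (M : GrMod Q G) : ((zero Q G).add M).Iso M :=
  ⟨LinearEquiv.uniqueProd (M₂ := PUnit.{u + 1}), fun _ _ => rfl, fun _ => rfl, fun _ _ => rfl⟩

theorem iso_add_add_comm (A B C D : GrMod Q G) :
    ((A.add B).add (C.add D)).Iso ((A.add C).add (B.add D)) :=
  ⟨LinearEquiv.prodProdProdComm R _ _ _ _, fun _ _ => rfl, fun _ => rfl, fun _ _ => rfl⟩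

theorem iso_shift_add (M N : GrMod Q G) : (M.add N).shift.Iso (M.shift.add N.shift) :=
  ⟨.refl R _, fun _ _ => rfl, fun _ => rfl, fun _ _ => rfl⟩

theorem IsSum.iso {L M N : GrMod Q G} : L.IsSum M N → (M.add N).Iso L := fun ⟨e, h1, h2, h3⟩ =>
  ⟨e, h1, h2, h3⟩

theorem Iso.isSum {L M N : GrMod Q G} : (M.add N).Iso L → L.IsSum M N := fun ⟨e, h1, h2, h3⟩ =>
  ⟨e, h1, h2, h3⟩

theorem Iso.cls_eq {M N : GrMod Q G} (h : M.Iso N) : M.cls = N.cls := by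
  have := cls_of_isSum ((iso_zero_add M).trans h).isSum
  rw [this, cls_zero, zero_add]

theorem isElementary_zero : (zero Q G).IsElementary := by
  have : Subsingleton (GrMod.zero Q G).carrier := inferInstanceAs (Subsingleton PUnit)
  refine ⟨0, ?_, ?_, ?_, ?_⟩ <;> intros <;> exact Subsingleton.elim _ _

theorem IsElementary.add {M N : GrMod Q G} :
    M.IsElementary → N.IsElementary → (M.add N).IsElementary :=
  fun ⟨e, h1, h2, h3, h4⟩ ⟨f, k1, k2, k3, k4⟩ =>
  ⟨e.prodMap f,
    LinearMap.ext fun x => Prod.ext (LinearMap.congr_fun h1 x.1) (LinearMap.congr_fun k1 x.2),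
    LinearMap.ext fun x => Prod.ext (LinearMap.congr_fun h2 x.1) (LinearMap.congr_fun k2 x.2),
    fun v => LinearMap.ext fun x =>
      Prod.ext (LinearMap.congr_fun (h3 v) x.1) (LinearMap.congr_fun (k3 v) x.2),
    fun g => LinearMap.ext fun x =>
      Prod.ext (LinearMap.congr_fun (h4 g) x.1) (LinearMap.congr_fun (k4 g) x.2)⟩

theorem IsElementary.shift {M : GrMod Q G} : M.IsElementary → M.shift.IsElementary :=
  fun ⟨e, h1, h2, h3, h4⟩ => ⟨e, h1, by
    change e * -M.ε = -(-M.ε * e)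
    rw [mul_neg, h2, neg_mul], h3, h4⟩

/-- Isomorphism up to the addition of elementary modules. -/
def StableIso (M N : GrMod Q G) : Prop :=
  ∃ S T : GrMod Q G, S.IsElementary ∧ T.IsElementary ∧ (M.add S).Iso (N.add T)

theorem Iso.stableIso {M N : GrMod Q G} (h : M.Iso N) : M.StableIso N :=
  ⟨_, _, isElementary_zero, isElementary_zero, h.add (.refl _)⟩

variable (Q G) in
/-- The setoid of stable isomorphism. -/
def stableSetoid : Setoid (GrMod Q G) where
  r := StableIso
  iseqv :=
    { refl := fun M => (Iso.refl M).stableIso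
      symm := fun ⟨S, T, hS, hT, h⟩ => ⟨T, S, hT, hS, h.symm⟩
      trans := fun {L M N} ⟨S, T, hS, hT, h⟩ ⟨S', T', hS', hT', h'⟩ =>
        ⟨S.add S', T'.add T, hS.add hS', hT'.add hT,
          (iso_add_assoc L S S').symm.trans <| (h.add (.refl S')).trans <|
            (iso_add_assoc M T S').trans <| ((Iso.refl M).add (iso_add_comm T S')).trans <|
            (iso_add_assoc M S' T).symm.trans <| (h'.add (.refl T)).trans (iso_add_assoc N T' T)⟩ }

variable (Q G) in
/-- Stable isomorphism classes. -/
def StableClass := Quotient (stableSetoid Q G)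

/-- The stable isomorphism class of a module. -/
def stableClass (M : GrMod Q G) : StableClass Q G := Quotient.mk (stableSetoid Q G) M

theorem stableClass_eq {M N : GrMod Q G} (h : M.StableIso N) : M.stableClass = N.stableClass :=
  Quotient.sound (s := stableSetoid Q G) h

theorem isElementary_shift_add (M : GrMod Q G) : (M.shift.add M).StableIso (zero Q G) :=
  ⟨zero Q G, M.add M.shift, isElementary_zero, add_shift_isElementary M,
    (iso_add_comm _ _).trans ((Iso.refl _).add (iso_add_comm _ _))⟩

noncomputable instance : AddCommGroup (StableClass Q G) :=
  let : Add (StableClass Q G) := ⟨Quotient.map₂ GrMod.add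
    fun _ _ ⟨S, T, hS, hT, h⟩ _ _ ⟨S', T', hS', hT', h'⟩ =>
    ⟨S.add S', T.add T', hS.add hS', hT.add hT',
      (iso_add_add_comm _ _ _ _).trans ((h.add h').trans (iso_add_add_comm _ _ _ _))⟩⟩
  let : Neg (StableClass Q G) := ⟨Quotient.map GrMod.shift fun _ _ ⟨S, T, hS, hT, h⟩ =>
    ⟨S.shift, T.shift, hS.shift, hT.shift,
      (iso_shift_add _ _).symm.trans (h.shift.trans (iso_shift_add _ _))⟩⟩
  let : Zero (StableClass Q G) := ⟨(zero Q G).stableClass⟩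
  { AddGroup.ofLeftAxioms (G := StableClass Q G)
      (fun a b c => Quotient.inductionOn₃ a b c fun L M N =>
        stableClass_eq (iso_add_assoc L M N).stableIso)
      (fun a => Quotient.inductionOn a fun M => stableClass_eq (iso_zero_add M).stableIso)
      (fun a => Quotient.inductionOn a fun M => stableClass_eq (isElementary_shift_add M)) with
    add_comm := fun a b => Quotient.inductionOn₂ a b fun M N =>
      stableClass_eq (iso_add_comm M N).stableIso }

/-- Modules with the same class are isomorphic up to the addition of elementary modules. -/
theorem stableIso_of_cls_eq {M N : GrMod Q G} (h : M.cls = N.cls) : M.StableIso N := by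
  let f : GrK Q G →+ StableClass Q G := GrK.lift stableClass
    (fun _ _ _ h => (stableClass_eq h.iso.stableIso).symm)
    (fun M hM => stableClass_eq (M := M) (N := zero Q G)
      ⟨zero Q G, M, isElementary_zero, hM, iso_add_comm _ _⟩)
  have h1 : ∀ M : GrMod Q G, f M.cls = M.stableClass := GrK.lift_cls _ _ _
  have h2 : M.stableClass = N.stableClass := by rw [← h1, ← h1, h]
  exact Quotient.exact (s := stableSetoid Q G) h2

/-! ### Direct summands -/

/-- An endomorphism commuting with vectors commutes with the Clifford algebra. -/
theorem commute_act {M N : GrMod Q G} (f : M.carrier →ₗ[R] N.carrier)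
    (h : ∀ v x, f (M.act (ι Q v) x) = N.act (ι Q v) (f x)) (c : CliffordAlgebra Q)
    (x : M.carrier) : f (M.act c x) = N.act c (f x) := by
  induction c using CliffordAlgebra.induction generalizing x with
  | algebraMap r => simp [AlgHom.commutes]
  | ι v => exact h v x
  | mul a b ha hb => simp [ha, hb]
  | add a b ha hb => simp [ha, hb]

/-- An idempotent endomorphism of a graded module. -/
structure Idem (L : GrMod Q G) where
  /-- the underlying endomorphism -/
  p : Module.End R L.carrier
  idem : ∀ x, p (p x) = p x
  p_act : ∀ v x, p (L.act (ι Q v) x) = L.act (ι Q v) (p x)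
  p_ε : ∀ x, p (L.ε x) = L.ε (p x)
  p_ρ : ∀ g x, p (L.ρ g x) = L.ρ g (p x)

variable {L : GrMod Q G}

theorem Idem.apply_coe (P : L.Idem) (x : LinearMap.range P.p) : P.p x = x := by
  obtain ⟨y, hy⟩ := x.2
  rw [← hy, P.idem]

/-- The restriction of an endomorphism commuting with an idempotent. -/
def Idem.res (P : L.Idem) (f : Module.End R L.carrier) (h : ∀ x, P.p (f x) = f (P.p x)) :
    Module.End R (LinearMap.range P.p) :=
  f.restrict fun x hx => by
    obtain ⟨y, rfl⟩ := hx
    exact ⟨f y, h y⟩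

/-- The complementary idempotent. -/
def Idem.compl (P : L.Idem) : L.Idem where
  p := 1 - P.p
  idem x := by simp [P.idem]
  p_act v x := by simp [P.p_act]
  p_ε x := by simp [P.p_ε]
  p_ρ g x := by simp [P.p_ρ]

/-- The image of an idempotent endomorphism. -/
abbrev Idem.image (P : L.Idem) : GrMod Q G where
  carrier := LinearMap.range P.p
  act := AlgHom.ofLinearMap
    { toFun := fun c => P.res (L.act c) (commute_act P.p P.p_act c)
      map_add' := fun x y => by ext; simp [Idem.res]
      map_smul' := fun r x => by ext; simp [Idem.res] }
    (by ext; simp [Idem.res]) (fun x y => by ext; simp [Idem.res])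
  fgProj := isFGProj_of_retract L.fgProj (LinearMap.range P.p).subtype P.p.rangeRestrict
    (fun x => Subtype.ext (P.apply_coe x)) (fun _ _ => rfl)
    (fun c x => Subtype.ext (commute_act P.p P.p_act c x))
  ε := P.res L.ε P.p_ε
  ε_sq := LinearMap.ext fun x => Subtype.ext (LinearMap.congr_fun L.ε_sq x)
  ε_act v := LinearMap.ext fun x => Subtype.ext (LinearMap.congr_fun (L.ε_act v) x)
  ρ :=
    { toFun := fun g => P.res (L.ρ g) (P.p_ρ g)
      map_one' := by ext; simp [Idem.res]
      map_mul' := fun g h => by ext; simp [Idem.res] }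
  ρ_act g v := LinearMap.ext fun x => Subtype.ext (LinearMap.congr_fun (L.ρ_act g v) x)
  ρ_ε g := LinearMap.ext fun x => Subtype.ext (LinearMap.congr_fun (L.ρ_ε g) x)

/-- A module splits as the sum of a retract and of the image of the complementary idempotent. -/
theorem Idem.cls_eq (P : L.Idem) {M : GrMod Q G} (i : M.carrier →ₗ[R] L.carrier)
    (s : L.carrier →ₗ[R] M.carrier) (hsi : ∀ x, s (i x) = x) (his : ∀ x, i (s x) = P.p x)
    (h1 : ∀ v x, i (M.act (ι Q v) x) = L.act (ι Q v) (i x))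
    (h2 : ∀ x, i (M.ε x) = L.ε (i x)) (h3 : ∀ g x, i (M.ρ g x) = L.ρ g (i x)) :
    L.cls = M.cls + P.compl.image.cls := by
  refine cls_of_isSum ?_
  have hs : ∀ x, s (P.p x) = s x := fun x => by rw [← his, hsi]
  have hi : ∀ x, P.p (i x) = i x := fun x => by rw [← his, hsi]
  have h0 : ∀ x : LinearMap.range P.compl.p, P.p (x : L.carrier) = 0 := fun x => by
    have h : (x : L.carrier) - P.p x = x := P.compl.apply_coe x
    simpa using h
  refine ⟨LinearEquiv.ofLinearMap (i.coprod (LinearMap.range P.compl.p).subtype)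
    (s.prod P.compl.p.rangeRestrict) ?_ ?_, ?_, ?_, ?_⟩
  · refine LinearMap.ext fun x => ?_
    change i (s x) + (x - P.p x) = x
    rw [his]
    abel
  · refine LinearMap.ext fun x => Prod.ext ?_ (Subtype.ext ?_)
    · change s (i x.1 + x.2) = x.1
      rw [map_add, hsi, ← hs x.2, h0, map_zero, add_zero]
    · change (i x.1 + x.2) - P.p (i x.1 + x.2) = x.2
      rw [map_add, hi, h0]
      abel
  · exact fun v x => (congrArg₂ (· + ·) (h1 v x.1) rfl).trans (map_add (L.act (ι Q v)) (i x.1) x.2.1).symm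
  · exact fun x => (congrArg₂ (· + ·) (h2 x.1) rfl).trans (map_add L.ε (i x.1) x.2.1).symm
  · exact fun g x => (congrArg₂ (· + ·) (h3 g x.1) rfl).trans (map_add (L.ρ g) (i x.1) x.2.1).symm

end GrMod

end GrIso

/-! ## Young symmetrizers -/

section Young

/-- A numbering of the cells of a shape, all of whose columns start in the first row. -/
structure Tableau (k : ℕ) where
  /-- the row of an entry -/
  row : Fin k → ℕ
  /-- the column of an entry -/
  col : Fin k → ℕ
  inj : ∀ x y, row x = row y → col x = col y → x = y
  down : ∀ x i, i < row x → ∃ y, row y = i ∧ col y = col x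

namespace Tableau

variable {k : ℕ} (t : Tableau k)

/-- The height of a column. -/
def height (j : ℕ) : ℕ := (Finset.univ.filter fun y => t.col y = j).card

theorem lt_height_iff (i j : ℕ) : i < t.height j ↔ ∃ y, t.row y = i ∧ t.col y = j := by
  let I : Finset ℕ := (Finset.univ.filter fun y => t.col y = j).image t.row
  have hI : I.card = t.height j := Finset.card_image_of_injOn fun x hx y hy h =>
    t.inj x y h ((Finset.mem_filter.mp hx).2.trans (Finset.mem_filter.mp hy).2.symm)
  have hmem : ∀ i, i ∈ I ↔ ∃ y, t.row y = i ∧ t.col y = j := fun i => by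
    simp only [I, Finset.mem_image, Finset.mem_filter, Finset.mem_univ, true_and]
    exact exists_congr fun y => and_comm
  have hdown : ∀ a ∈ I, ∀ i ≤ a, i ∈ I := fun a ha i hi => by
    obtain rfl | hi := hi.eq_or_lt
    · exact ha
    · obtain ⟨y, rfl, rfl⟩ := (hmem a).mp ha
      exact (hmem i).mpr (t.down y i hi)
  rw [← hmem, ← hI]
  constructor
  · intro h
    by_contra hi
    have : I ⊆ Finset.range i := fun a ha => by
      rw [Finset.mem_range]
      by_contra h2
      exact hi (hdown a ha i (not_lt.mp h2))
    have := Finset.card_le_card this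
    rw [Finset.card_range] at this
    exact absurd h (not_lt.mpr this)
  · intro h
    have : Finset.range (i + 1) ⊆ I := fun a ha =>
      hdown i h a (Nat.lt_succ_iff.mp (Finset.mem_range.mp ha))
    have := Finset.card_le_card this
    rwa [Finset.card_range] at this

/-- Among the configurations of `k` cells with given column heights, the shape of a tableau
minimizes the sum of the row indices. -/
theorem sum_row_add_card_le (f : Fin k → ℕ × ℕ) (hf : Function.Injective f)
    (h : ∑ x, t.height (f x).2 = ∑ y, t.height (t.col y)) :
    ∑ y, t.row y ≤ ∑ x, (f x).1 ∧ (∑ y, t.row y = ∑ x, (f x).1 →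
      ∀ x, ∃ y, t.row y = (f x).1 ∧ t.col y = (f x).2) := by
  let S := Finset.univ.image f
  let T := Finset.univ.image fun y => (t.row y, t.col y)
  let w : ℕ × ℕ → ℤ := fun p => (p.1 : ℤ) - t.height p.2
  have hT : ∀ p, p ∈ T ↔ p.1 < t.height p.2 := fun p => by
    simp only [lt_height_iff, T, Finset.mem_image, Finset.mem_univ, true_and, Prod.ext_iff]
  have hinj : Function.Injective fun y => (t.row y, t.col y) := fun x y hxy =>
    t.inj x y (congrArg Prod.fst hxy) (congrArg Prod.snd hxy)
  have hS1 : ∑ p ∈ S, w p = ∑ x, ((f x).1 : ℤ) - ∑ x, (t.height (f x).2 : ℤ) := by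
    rw [Finset.sum_image hf.injOn, ← Finset.sum_sub_distrib]
  have hT1 : ∑ p ∈ T, w p = ∑ y, (t.row y : ℤ) - ∑ y, (t.height (t.col y) : ℤ) := by
    rw [Finset.sum_image hinj.injOn, ← Finset.sum_sub_distrib]
  have hc : (S \ T).card = (T \ S).card := Finset.card_sdiff_comm (by
    rw [Finset.card_image_of_injective _ hf, Finset.card_image_of_injective _ hinj])
  have h1 : 0 ≤ ∑ p ∈ S \ T, w p := Finset.sum_nonneg fun p hp => by
    have := (hT p).not.mp (Finset.mem_sdiff.mp hp).2
    simp only [w]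
    omega
  have h2 : ∑ p ∈ T \ S, w p ≤ ∑ p ∈ T \ S, (-1 : ℤ) := Finset.sum_le_sum fun p hp => by
    have := (hT p).mp (Finset.mem_sdiff.mp hp).1
    simp only [w]
    omega
  have h3 := Finset.sum_sdiff_sub_sum_sdiff (s₁ := S) (s₂ := T) (f := w)
  rw [Finset.sum_const, smul_neg, nsmul_one] at h2
  have h' : ∑ x, (t.height (f x).2 : ℤ) = ∑ y, (t.height (t.col y) : ℤ) := by exact_mod_cast h
  have key : (∑ y, t.row y : ℤ) + (S \ T).card ≤ ∑ x, ((f x).1 : ℤ) := by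
    rw [hc]
    linarith
  refine ⟨?_, fun heq x => ?_⟩
  · have : (∑ y, t.row y : ℤ) ≤ ∑ x, ((f x).1 : ℤ) := by linarith [(S \ T).card.cast_nonneg (α := ℤ)]
    exact_mod_cast this
  · have heq' : (∑ y, t.row y : ℤ) = ∑ x, ((f x).1 : ℤ) := by exact_mod_cast heq
    have h0 : (S \ T).card = 0 := by
      have : ((S \ T).card : ℤ) ≤ 0 := by linarith
      omega
    have hx : f x ∈ T := Finset.sdiff_eq_empty_iff_subset.mp (Finset.card_eq_zero.mp h0)
      (Finset.mem_image_of_mem f (Finset.mem_univ x))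
    simpa only [T, Finset.mem_image, Finset.mem_univ, true_and, Prod.ext_iff] using hx

theorem sum_height_comp (g : Equiv.Perm (Fin k)) :
    ∑ x, t.height (t.col (g x)) = ∑ y, t.height (t.col y) :=
  Equiv.sum_comp g fun y => t.height (t.col y)

local notation "A" => MonoidAlgebra ℚ (Equiv.Perm (Fin k))

/-- The group element, as an element of the group algebra. -/
noncomputable abbrev gp (g : Equiv.Perm (Fin k)) : A := MonoidAlgebra.of ℚ _ g

/-- The row symmetrizer. -/
noncomputable def rowSum : A := ∑ σ : Equiv.Perm (Fin k) with ∀ x, t.row (σ x) = t.row x, gp σ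

/-- The column antisymmetrizer. -/
noncomputable def colSum : A :=
  ∑ σ : Equiv.Perm (Fin k) with ∀ x, t.col (σ x) = t.col x,
    ((Equiv.Perm.sign σ : ℤ) : ℚ) • gp σ

theorem gp_mul_rowSum (τ : Equiv.Perm (Fin k)) (hτ : ∀ x, t.row (τ x) = t.row x) :
    gp τ * t.rowSum = t.rowSum := by
  rw [rowSum, Finset.mul_sum]
  refine Finset.sum_equiv (Equiv.mulLeft τ) (fun σ => ?_) (fun σ _ => ?_)
  · simp [hτ]
  · rw [← map_mul]
    rfl

theorem colSum_mul_gp (τ : Equiv.Perm (Fin k)) (hτ : ∀ x, t.col (τ x) = t.col x) :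
    t.colSum * gp τ = ((Equiv.Perm.sign τ : ℤ) : ℚ) • t.colSum := by
  rw [colSum, Finset.sum_mul, Finset.smul_sum]
  refine Finset.sum_equiv (Equiv.mulRight τ) (fun σ => ?_) (fun σ _ => ?_)
  · simp only [Finset.mem_filter, Finset.mem_univ, true_and, Equiv.coe_mulRight,
      Equiv.Perm.mul_apply]
    constructor
    · intro h x
      rw [h, hτ]
    · intro h x
      have h1 := h (τ.symm x)
      have h2 := hτ (τ.symm x)
      rw [Equiv.apply_symm_apply] at h1 h2
      rw [h1, h2]
  · rw [smul_mul_assoc, ← map_mul, smul_smul, Equiv.coe_mulRight]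
    congr 1
    have h2 : ((Equiv.Perm.sign τ : ℤ) : ℚ) * ((Equiv.Perm.sign τ : ℤ) : ℚ) = 1 := by
      rw [← Int.cast_mul, Int.units_coe_mul_self, Int.cast_one]
    change _ = _ * ((Equiv.Perm.sign (σ * τ) : ℤ) : ℚ)
    rw [map_mul, Units.val_mul, Int.cast_mul, mul_left_comm, h2, mul_one]

variable {t} in
theorem injective_of_colSum_mul_rowSum_ne_zero {t' : Tableau k} {g : Equiv.Perm (Fin k)}
    (h : t'.colSum * gp g * t.rowSum ≠ 0) :
    Function.Injective fun x => (t.row x, t'.col (g x)) := by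
  intro i j hij
  by_contra hne
  have h1 : t.row i = t.row j := congrArg Prod.fst hij
  have h2 : t'.col (g i) = t'.col (g j) := congrArg Prod.snd hij
  refine h ?_
  have hτ : gp (Equiv.swap i j) * t.rowSum = t.rowSum := t.gp_mul_rowSum _ fun x => by
    by_cases hx : x = i
    · rw [hx, Equiv.swap_apply_left, h1]
    · by_cases hx' : x = j
      · rw [hx', Equiv.swap_apply_right, h1]
      · rw [Equiv.swap_apply_of_ne_of_ne hx hx']
  have hτ' : t'.colSum * gp (Equiv.swap (g i) (g j)) = -t'.colSum := by
    rw [t'.colSum_mul_gp, Equiv.Perm.sign_swap (g.injective.ne hne)]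
    · simp
    · intro x
      by_cases hx : x = g i
      · rw [hx, Equiv.swap_apply_left, h2]
      · by_cases hx' : x = g j
        · rw [hx', Equiv.swap_apply_right, h2]
        · rw [Equiv.swap_apply_of_ne_of_ne hx hx']
  have hc : g * Equiv.swap i j = Equiv.swap (g i) (g j) * g := by
    rw [Equiv.mul_swap_eq_swap_mul]
  have : t'.colSum * gp g * t.rowSum = -(t'.colSum * gp g * t.rowSum) := by
    conv_lhs => rw [← hτ, mul_assoc, ← mul_assoc (gp g), ← map_mul, hc, map_mul, mul_assoc,
      ← mul_assoc, hτ', neg_mul, ← mul_assoc]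
  rw [eq_neg_iff_add_eq_zero, ← two_smul ℚ] at this
  exact (smul_eq_zero.mp this).resolve_left two_ne_zero

theorem exists_perm_of_injective {t t' : Tableau k} {g : Equiv.Perm (Fin k)}
    (h : Function.Injective fun x => (t.row x, t'.col (g x)))
    (hs : ∑ y, t'.row y = ∑ x, t.row x) :
    ∃ p : Equiv.Perm (Fin k), ∀ x, t'.row (p x) = t.row x ∧ t'.col (p x) = t'.col (g x) := by
  choose p hp using (t'.sum_row_add_card_le _ h (t'.sum_height_comp g)).2 hs
  have hinj : Function.Injective p := fun x y hxy => h (Prod.ext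
    ((hp x).1.symm.trans ((congrArg t'.row hxy).trans (hp y).1))
    ((hp x).2.symm.trans ((congrArg t'.col hxy).trans (hp y).2)))
  exact ⟨Equiv.ofBijective p (Finite.injective_iff_bijective.mp hinj), hp⟩

theorem exists_smul_colSum_mul_rowSum (x : A) :
    ∃ c : ℚ, t.colSum * x * t.rowSum = c • (t.colSum * t.rowSum) := by
  induction x using MonoidAlgebra.induction_on with
  | of g =>
    by_cases h : t.colSum * gp g * t.rowSum = 0
    · exact ⟨0, by rw [zero_smul]; exact h⟩
    · obtain ⟨p, hp⟩ := exists_perm_of_injective (injective_of_colSum_mul_rowSum_ne_zero h) rfl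
      have hg : g = (g * p⁻¹) * p := by simp
      refine ⟨((Equiv.Perm.sign (g * p⁻¹) : ℤ) : ℚ), ?_⟩
      conv_lhs => rw [hg, map_mul, mul_assoc, mul_assoc]
      have h1 : (MonoidAlgebra.of ℚ (Equiv.Perm (Fin k))) p * t.rowSum = t.rowSum :=
        t.gp_mul_rowSum p fun x => (hp x).1
      have h2 : t.colSum * (MonoidAlgebra.of ℚ (Equiv.Perm (Fin k))) (g * p⁻¹) =
          ((Equiv.Perm.sign (g * p⁻¹) : ℤ) : ℚ) • t.colSum :=
        t.colSum_mul_gp (g * p⁻¹) fun x => by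
        have := (hp (p.symm x)).2
        rw [Equiv.apply_symm_apply] at this
        exact this.symm
      rw [h1, ← mul_assoc, h2, smul_mul_assoc]
  | add x y hx hy =>
    obtain ⟨c, hc⟩ := hx
    obtain ⟨d, hd⟩ := hy
    exact ⟨c + d, by rw [mul_add, add_mul, hc, hd, add_smul]⟩
  | smul r x hx =>
    obtain ⟨c, hc⟩ := hx
    exact ⟨r * c, by rw [mul_smul_comm, smul_mul_assoc, hc, smul_smul]⟩

theorem colSum_mul_rowSum_ne_zero : t.colSum * t.rowSum ≠ 0 := by
  intro h
  have h1 : (t.colSum * t.rowSum).coeff 1 = 1 := by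
    have hone : ∀ q p : Equiv.Perm (Fin k), (∀ x, t.col (q x) = t.col x) →
        (∀ x, t.row (p x) = t.row x) → q * p = 1 → q = 1 := fun q p hq hp h => by
      refine Equiv.ext fun x => t.inj _ _ ?_ (hq x)
      have hqp : ∀ y, q (p y) = y := fun y => Equiv.congr_fun h y
      have : p (q x) = x := q.injective (by rw [hqp])
      rw [← hp (q x), this]
      rfl
    have hsum : (t.colSum * t.rowSum).coeff 1 =
        ∑ q : Equiv.Perm (Fin k) with ∀ x, t.col (q x) = t.col x,
        ∑ p : Equiv.Perm (Fin k) with ∀ x, t.row (p x) = t.row x,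
          if q * p = 1 then ((Equiv.Perm.sign q : ℤ) : ℚ) else 0 := by
      rw [colSum, rowSum, Finset.sum_mul_sum, MonoidAlgebra.coeff_sum, Finset.sum_apply']
      refine Finset.sum_congr rfl fun q _ => ?_
      rw [MonoidAlgebra.coeff_sum, Finset.sum_apply']
      refine Finset.sum_congr rfl fun p _ => ?_
      rw [smul_mul_assoc, ← map_mul, MonoidAlgebra.coeff_smul_apply, MonoidAlgebra.of_apply,
        MonoidAlgebra.coeff_single, Finsupp.single_apply]
      simp
    rw [hsum, Finset.sum_eq_single 1, Finset.sum_eq_single 1]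
    · simp
    · exact fun p _ hp => if_neg (by simpa using hp)
    · simp
    · intro q hq hq1
      refine Finset.sum_eq_zero fun p hp => if_neg fun h => hq1 ?_
      exact hone q p (Finset.mem_filter.mp hq).2 (Finset.mem_filter.mp hp).2 h
    · simp
  rw [h] at h1
  exact zero_ne_one h1

section Simple

variable {M : Type*} [AddCommGroup M] [Module (MonoidAlgebra ℚ (Equiv.Perm (Fin k))) M]
  [IsSimpleModule (MonoidAlgebra ℚ (Equiv.Perm (Fin k))) M]

theorem exists_smul_eq_of_ne_zero {m : M} (hm : m ≠ 0) (n : M) : ∃ x : A, x • m = n :=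
  IsSimpleModule.toSpanSingleton_surjective A hm n

/-- A simple module on which a Young symmetrizer does not vanish is absolutely simple. -/
theorem exists_end_eq_smul {m : M} (hm : (t.colSum * t.rowSum) • m ≠ 0) (φ : M →ₗ[A] M) :
    ∃ c : ℚ, ∀ x, φ x = (algebraMap ℚ A c) • x := by
  have h0 : t.rowSum • m ≠ 0 := fun h => hm (by rw [mul_smul, h, smul_zero])
  obtain ⟨x, hx⟩ := exists_smul_eq_of_ne_zero (k := k) h0 (φ (t.rowSum • m))
  obtain ⟨c, hc⟩ := t.exists_smul_colSum_mul_rowSum x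
  have h1 : φ ((t.colSum * t.rowSum) • m) = (algebraMap ℚ A c) • ((t.colSum * t.rowSum) • m) := by
    rw [mul_smul, map_smul, ← hx, ← mul_smul, ← mul_smul, hc, Algebra.smul_def,
      mul_smul, mul_smul]
  refine ⟨c, fun y => ?_⟩
  obtain ⟨z, rfl⟩ := exists_smul_eq_of_ne_zero (k := k) hm y
  rw [map_smul, h1, ← mul_smul, ← Algebra.commutes, mul_smul]

theorem exists_colSum_mul_rowSum_ne_zero {t t' : Tableau k} {m m' : M}
    (hm : (t.colSum * t.rowSum) • m ≠ 0) (hm' : (t'.colSum * t'.rowSum) • m' ≠ 0) :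
    ∃ g, t'.colSum * gp g * t.rowSum ≠ 0 := by
  by_contra! h
  have h1 : ∀ x : A, t'.colSum * x * t.rowSum = 0 := fun x => by
    induction x using MonoidAlgebra.induction_on with
    | of g => exact h g
    | add x y hx hy => rw [mul_add, add_mul, hx, hy, add_zero]
    | smul r x hx => rw [mul_smul_comm, smul_mul_assoc, hx, smul_zero]
  have h0 : t.rowSum • m ≠ 0 := fun h => hm (by rw [mul_smul, h, smul_zero])
  obtain ⟨x, hx⟩ := exists_smul_eq_of_ne_zero (k := k) h0 (t'.rowSum • m')
  rw [mul_smul, ← hx, ← mul_smul, ← mul_smul, h1, zero_smul] at hm'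
  exact hm' rfl

/-- The shape of a tableau whose Young symmetrizer does not vanish on a given simple module is
determined by the module. -/
theorem card_row_eq {t t' : Tableau k} {m m' : M}
    (hm : (t.colSum * t.rowSum) • m ≠ 0) (hm' : (t'.colSum * t'.rowSum) • m' ≠ 0) (i : ℕ) :
    (Finset.univ.filter fun x => t.row x = i).card =
      (Finset.univ.filter fun x => t'.row x = i).card := by
  obtain ⟨g, hg⟩ := exists_colSum_mul_rowSum_ne_zero hm hm'
  obtain ⟨g', hg'⟩ := exists_colSum_mul_rowSum_ne_zero hm' hm
  have h1 := injective_of_colSum_mul_rowSum_ne_zero hg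
  have h2 := injective_of_colSum_mul_rowSum_ne_zero hg'
  obtain ⟨p, hp⟩ := exists_perm_of_injective h1 (le_antisymm
    (t'.sum_row_add_card_le _ h1 (t'.sum_height_comp g)).1
    (t.sum_row_add_card_le _ h2 (t.sum_height_comp g')).1)
  refine Finset.card_bij (fun x _ => p x) (fun x hx => ?_) (fun x _ y _ h => p.injective h)
    (fun y hy => ⟨p.symm y, ?_, p.apply_symm_apply y⟩)
  · simpa [(hp x).1] using hx
  · have := (hp (p.symm y)).1
    rw [p.apply_symm_apply] at this
    simpa [← this] using hy

end Simple

/-- There is a tableau with given row lengths. -/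
theorem exists_of_list (w : List ℕ) (hw : w.SortedGE) (hk : w.sum = k) :
    ∃ t : Tableau k, ∀ i, (Finset.univ.filter fun x => t.row x = i).card = w.getD i 0 := by
  have hcard : Fintype.card ((i : Fin w.length) × Fin (w.get i)) = k := by
    rw [Fintype.card_sigma]
    simp only [Fintype.card_fin]
    rw [← hk]
    exact Fin.sum_univ_getElem w
  let e : Fin k ≃ (i : Fin w.length) × Fin (w.get i) := (Fintype.equivFinOfCardEq hcard).symm
  refine ⟨⟨fun x => (e x).1, fun x => (e x).2, fun x y h1 h2 => ?_, fun x i hi => ?_⟩, fun i => ?_⟩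
  · refine e.injective (Sigma.ext (Fin.ext h1) ?_)
    exact (Fin.heq_ext_iff (congrArg w.get (Fin.ext h1))).mpr h2
  · have h1 : w.get (e x).1 ≤ w.get ⟨i, hi.trans (e x).1.2⟩ := hw.antitone_get (Fin.le_def.mpr hi.le)
    exact ⟨e.symm ⟨⟨i, hi.trans (e x).1.2⟩, ⟨(e x).2, (e x).2.2.trans_le h1⟩⟩,
      by rw [e.apply_symm_apply], by rw [e.apply_symm_apply]⟩
  · rw [Finset.card_filter, ← Equiv.sum_comp e.symm]
    simp only [Equiv.apply_symm_apply]
    rw [Fintype.sum_sigma]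
    have hin : ∀ j : Fin w.length, (∑ _x : Fin (w.get j), if (j : ℕ) = i then 1 else 0) =
        w.get j * if (j : ℕ) = i then 1 else 0 := fun j => by
      rw [Finset.sum_const, Finset.card_univ, Fintype.card_fin, smul_eq_mul]
    refine (Finset.sum_congr rfl fun j _ => hin j).trans ?_
    by_cases h : i < w.length
    · rw [Finset.sum_eq_single ⟨i, h⟩]
      · simp [h]
      · intro j _ hj
        rw [if_neg fun h => hj (Fin.ext h), mul_zero]
      · simp
    · rw [List.getD_eq_default _ _ (not_lt.mp h)]
      exact Finset.sum_eq_zero fun j _ => by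
        rw [if_neg fun h' : (j : ℕ) = i => h (h' ▸ j.2), mul_zero]

end Tableau

end Young

/-! ## Integral forms of rational representations -/

section Integral

/-- The rational representation given by an integral matrix representation. -/
noncomputable abbrev ratRep {G : Type*} [Group G] {n : ℕ} (m : G →* Matrix (Fin n) (Fin n) ℤ) :
    Representation ℚ G (Fin n → ℚ) :=
  (Matrix.toLinAlgEquiv' : Matrix (Fin n) (Fin n) ℚ ≃ₐ[ℚ] _).toMonoidHom.comp
    ((Int.castRingHom ℚ).mapMatrix.toMonoidHom.comp m)

/-- A rational representation of a finite group has an integral form. -/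
theorem exists_integral_form {G V : Type*} [Group G] [Finite G] [AddCommGroup V] [Module ℚ V]
    [Module.Finite ℚ V] (ρ : Representation ℚ G V) :
    ∃ (n : ℕ) (m : G →* Matrix (Fin n) (Fin n) ℤ), Nonempty (ρ.Equiv (ratRep m)) := by
  let b := Module.finBasis ℚ V
  let S : Set V := Set.range fun p : G × Fin (Module.finrank ℚ V) => ρ p.1 (b p.2)
  let L : Submodule ℤ V := Submodule.span ℤ S
  have : Submodule.IsLattice ℚ L :=
    { fg := Submodule.fg_span (Set.finite_range _)
      span_eq_top := by
        rw [eq_top_iff, ← b.span_eq]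
        refine Submodule.span_mono ?_
        rintro _ ⟨i, rfl⟩
        exact Submodule.subset_span ⟨(1, i), by simp⟩ }
  have : Module.Free ℤ L := Submodule.IsLattice.free ℚ L
  have hL : ∀ g, ∀ x ∈ L, ρ g x ∈ L := fun g x hx => by
    induction hx using Submodule.span_induction with
    | mem x hx =>
      obtain ⟨p, rfl⟩ := hx
      exact Submodule.subset_span ⟨(g * p.1, p.2), by simp⟩
    | zero => rw [map_zero]; exact zero_mem _
    | add x y _ _ hx hy => rw [map_add]; exact add_mem hx hy
    | smul a x _ hx => rw [map_zsmul]; exact Submodule.smul_mem _ _ hx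
  let c := Module.finBasis ℤ L
  let ρL : G →* Module.End ℤ L :=
    { toFun := fun g => ((ρ g).toAddMonoidHom.toIntLinearMap).restrict (hL g)
      map_one' := by ext; simp
      map_mul' := fun g h => LinearMap.ext fun x => Subtype.ext
        (LinearMap.congr_fun (map_mul ρ g h) x.1) }
  let m : G →* Matrix (Fin (Module.finrank ℤ L)) (Fin (Module.finrank ℤ L)) ℤ :=
    (LinearMap.toMatrixAlgEquiv c).toMonoidHom.comp ρL
  let c' := c.extendOfIsLattice ℚ
  refine ⟨_, m, ⟨.mk c'.equivFun fun g => c'.ext fun j => ?_⟩⟩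
  have h1 : ρ g (c' j) = ∑ i, (m g i j : ℚ) • c' i := by
    have h2 : (ρL g (c j) : V) = ∑ i, m g i j • (c i : V) := by
      have : ρL g (c j) = ∑ i, m g i j • c i := by
        rw [← c.sum_repr (ρL g (c j))]
        exact Finset.sum_congr rfl fun i _ => by rw [← LinearMap.toMatrixAlgEquiv_apply]; rfl
      rw [this]
      simp
    simp only [c', Module.Basis.extendOfIsLattice_apply]
    rw [show ρ g (c j : V) = (ρL g (c j) : V) from rfl, h2]
    exact Finset.sum_congr rfl fun i _ => (Int.cast_smul_eq_zsmul ℚ _ _).symm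
  rw [LinearMap.comp_apply, LinearMap.comp_apply, h1]
  refine funext fun i => ?_
  simp only [map_sum, map_smul, Finset.sum_apply, Pi.smul_apply, LinearEquiv.coe_coe,
    Module.Basis.equivFun_apply, Module.Basis.repr_self, Finsupp.single_eq_pi_single, smul_eq_mul]
  rw [Finset.sum_eq_single i (fun a _ ha => by simp [ha.symm]) (by simp)]
  change _ = ((m g).map (Int.castRingHom ℚ)).mulVec (Pi.single j 1) i
  rw [Matrix.mulVec_single_one]
  simp

theorem isIrreducible_of_equiv {G V W : Type*} [Group G] [AddCommGroup V] [Module ℚ V]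
    [AddCommGroup W] [Module ℚ W] {ρ : Representation ℚ G V} {σ : Representation ℚ G W}
    (e : ρ.Equiv σ) (h : ρ.IsIrreducible) : σ.IsIrreducible := by
  rw [Representation.irreducible_iff_isSimpleModule_asModule] at h ⊢
  let f := Representation.IntertwiningMap.equivLinearMapAsModule ρ σ e.toIntertwiningMap
  exact IsSimpleModule.congr (LinearEquiv.ofBijective f e.toLinearEquiv.bijective).symm

theorem asAlgebraHom_equiv {G V W : Type*} [Group G] [AddCommGroup V] [Module ℚ V]
    [AddCommGroup W] [Module ℚ W] {ρ : Representation ℚ G V} {σ : Representation ℚ G W}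
    (e : ρ.Equiv σ) (a : MonoidAlgebra ℚ G) (x : V) :
    e (ρ.asAlgebraHom a x) = σ.asAlgebraHom a (e x) := by
  induction a using MonoidAlgebra.induction_on generalizing x with
  | of g => simpa using Representation.IntertwiningMap.isIntertwining ρ σ e.toIntertwiningMap g x
  | add a b ha hb => simp [ha, hb]
  | smul a b hb => simp [hb]

local notation "A[" k "]" => MonoidAlgebra ℚ (Equiv.Perm (Fin k))

/-- A nonzero element of the group algebra acts nontrivially on some irreducible representation. -/
theorem exists_irreducible_of_ne_zero {k : ℕ} (z : MonoidAlgebra ℚ (Equiv.Perm (Fin k)))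
    (hz : z ≠ 0) : ∃ π : IntIrrep k, (π.toRep ℚ).asAlgebraHom z ≠ 0 := by
  obtain ⟨M, hM, m, hm, hzm⟩ : ∃ M : Submodule A[k] A[k], IsSimpleModule A[k] M ∧ ∃ m ∈ M, z * m ≠ 0 := by
    by_contra! h
    have key : ∀ x : A[k], x ∈ (⊤ : Submodule A[k] A[k]) → z * x = 0 := by
      rw [← IsSemisimpleModule.sSup_simples_eq_top A[k] A[k], sSup_eq_iSup']
      intro x hx
      refine Submodule.iSup_induction' _ (motive := fun x _ => z * x = 0) ?_ ?_ ?_ hx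
      · exact fun M x hx => h M.1 M.2 x hx
      · exact mul_zero z
      · intro x y _ _ hx hy
        rw [mul_add, hx, hy, add_zero]
    exact hz (by simpa using key 1 trivial)
  let ρ : Representation ℚ (Equiv.Perm (Fin k)) M := Representation.ofModule' M
  have hact : ∀ (a : A[k]) (x : M), ρ.asAlgebraHom a x = a • x := fun a x => by
    induction a using MonoidAlgebra.induction_on generalizing x with
    | of g => 
      rw [MonoidAlgebra.of_apply, Representation.asAlgebraHom_single_one]
      rfl
    | add a b ha hb => rw [map_add, LinearMap.add_apply, ha, hb, add_smul]
    | smul r b hb => rw [map_smul, LinearMap.smul_apply, hb, smul_assoc]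
  have hρ : ρ.IsIrreducible := by
    rw [Representation.irreducible_iff_isSimpleModule_asModule]
    let e : ρ.asModule ≃ₗ[A[k]] M :=
      { ρ.asModuleEquiv with
        map_smul' := fun a x => (ρ.asModuleEquiv_map_smul a x).trans (hact a _) }
    exact IsSimpleModule.congr e
  have : Module.Finite ℚ M := Module.Finite.trans A[k] M
  obtain ⟨n, r, ⟨e⟩⟩ := exists_integral_form ρ
  refine ⟨⟨n, r, isIrreducible_of_equiv e hρ⟩, fun h => hzm ?_⟩
  have h2 : ρ.asAlgebraHom z ⟨m, hm⟩ = 0 := by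
    apply e.toLinearEquiv.injective
    rw [map_zero]
    exact (asAlgebraHom_equiv e z _).trans (LinearMap.congr_fun h _)
  rw [hact] at h2
  exact congrArg Subtype.val h2

end Integral

/-! ## The irreducible representations of the symmetric group -/

section Splitting

variable {k : ℕ}

theorem exists_symmetrizer_smul_ne_zero (t : Tableau k) :
    ∃ (π : IntIrrep k) (m : (π.toRep ℚ).asModule), (t.colSum * t.rowSum) • m ≠ 0 := by
  obtain ⟨π, hπ⟩ := exists_irreducible_of_ne_zero _ t.colSum_mul_rowSum_ne_zero
  obtain ⟨m, hm⟩ : ∃ m, (π.toRep ℚ).asAlgebraHom (t.colSum * t.rowSum) m ≠ 0 := by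
    by_contra! h
    exact hπ (LinearMap.ext h)
  exact ⟨π, (π.toRep ℚ).asModuleEquiv.symm m, hm⟩

instance (π : IntIrrep k) : (π.toRep ℚ).IsIrreducible := π.irreducible

theorem eq_of_getD_eq {l m : List ℕ} (hl : ∀ x ∈ l, 0 < x) (hm : ∀ x ∈ m, 0 < x)
    (h : ∀ i, l.getD i 0 = m.getD i 0) : l = m := by
  have hlen : ∀ (l m : List ℕ), (∀ x ∈ l, 0 < x) → (∀ i, l.getD i 0 = m.getD i 0) →
      l.length ≤ m.length := fun l m hl h => by
    by_contra! hlt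
    have h1 := h m.length
    rw [List.getD_eq_default _ _ le_rfl, List.getD_eq_getElem _ _ hlt] at h1
    exact (hl _ (List.getElem_mem hlt)).ne' h1
  refine List.ext_getElem (le_antisymm (hlen l m hl h) (hlen m l hm fun i => (h i).symm)) ?_
  intro i h1 h2
  have := h i
  rwa [List.getD_eq_getElem _ _ h1, List.getD_eq_getElem _ _ h2] at this

/-- The parts of a partition, in decreasing order. -/
def partsList {n : ℕ} (p : n.Partition) : List ℕ := p.parts.sort (· ≥ ·)

theorem exists_tableau (p : (Fintype.card (Fin k)).Partition) :
    ∃ t : Tableau k, ∀ i, (Finset.univ.filter fun x => t.row x = i).card =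
      (partsList p).getD i 0 := by
  refine Tableau.exists_of_list _ (Multiset.pairwise_sort _ _).sortedGE ?_
  rw [← Multiset.sum_coe, partsList, Multiset.sort_eq, p.parts_sum, Fintype.card_fin]

/-- A tableau whose shape is a given partition. -/
noncomputable def tableauOf (p : (Fintype.card (Fin k)).Partition) : Tableau k :=
  (exists_tableau p).choose

/-- The Specht module of a partition. -/
noncomputable def specht (p : (Fintype.card (Fin k)).Partition) : IntIrrep k :=
  (exists_symmetrizer_smul_ne_zero (tableauOf p)).choose

theorem specht_spec (p : (Fintype.card (Fin k)).Partition) :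
    ∃ m : ((specht p).toRep ℚ).asModule,
      ((tableauOf p).colSum * (tableauOf p).rowSum) • m ≠ 0 :=
  (exists_symmetrizer_smul_ne_zero (tableauOf p)).choose_spec

theorem specht_injective (p q : (Fintype.card (Fin k)).Partition)
    (h : Nonempty (((specht p).toRep ℚ).Equiv ((specht q).toRep ℚ))) : p = q := by
  obtain ⟨e⟩ := h
  obtain ⟨m, hm⟩ := specht_spec p
  obtain ⟨m', hm'⟩ := specht_spec q
  have hm1 : ((tableauOf p).colSum * (tableauOf p).rowSum) •
      (((specht q).toRep ℚ).asModuleEquiv.symm (e (((specht p).toRep ℚ).asModuleEquiv m))) ≠ 0 := by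
    intro h0
    have h1 := (asAlgebraHom_equiv e ((tableauOf p).colSum * (tableauOf p).rowSum)
      (((specht p).toRep ℚ).asModuleEquiv m)).trans h0
    exact hm (e.toLinearEquiv.injective (h1.trans (map_zero e.toLinearEquiv).symm))
  have h2 : partsList p = partsList q := eq_of_getD_eq
    (fun x hx => p.parts_pos ((Multiset.mem_sort _).mp hx))
    (fun x hx => q.parts_pos ((Multiset.mem_sort _).mp hx)) fun i => by
      rw [← (exists_tableau p).choose_spec i, ← (exists_tableau q).choose_spec i]
      exact Tableau.card_row_eq hm1 hm' i
  refine Nat.Partition.ext ?_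
  have := congrArg (fun l : List ℕ => (l : Multiset ℕ)) h2
  simpa only [partsList, Multiset.sort_eq] using this

theorem exists_eq_smul_specht (p : (Fintype.card (Fin k)).Partition)
    (f : Representation.IntertwiningMap ((specht p).toRep ℚ) ((specht p).toRep ℚ)) :
    ∃ c : ℚ, ∀ x, f x = c • x := by
  obtain ⟨m, hm⟩ := specht_spec p
  obtain ⟨c, hc⟩ := Tableau.exists_end_eq_smul _ hm
    (Representation.IntertwiningMap.equivLinearMapAsModule _ _ f)
  refine ⟨c, fun x => (hc x).trans ?_⟩
  exact (((specht p).toRep ℚ).asModuleEquiv_map_smul _ x).trans (by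
    rw [AlgHom.commutes]
    rfl)

/-- The character of an integral representation. -/
def IntIrrep.char (π : IntIrrep k) (g : Equiv.Perm (Fin k)) : ℤ := (π.ρ g).trace

theorem IntIrrep.character_eq (π : IntIrrep k) (g : Equiv.Perm (Fin k)) :
    (π.toRep ℚ).character g = π.char g := by
  rw [IntIrrep.char, Representation.character]
  change LinearMap.trace ℚ _ (Matrix.toLin' ((π.ρ g).map (Int.castRingHom ℚ))) = _
  rw [Matrix.trace_toLin'_eq, Matrix.trace, Matrix.trace]
  simp

theorem IntIrrep.char_conj (π : IntIrrep k) (g h : Equiv.Perm (Fin k)) :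
    π.char (h * g * h⁻¹) = π.char g := by
  rw [IntIrrep.char, map_mul, Matrix.trace_mul_comm, ← map_mul, inv_mul_cancel_left]
  rfl

theorem IntIrrep.char_inv (π : IntIrrep k) (g : Equiv.Perm (Fin k)) : π.char g⁻¹ = π.char g := by
  obtain ⟨h, hh⟩ := isConj_iff.mp ((Equiv.Perm.isConj_iff_cycleType_eq).mpr g.cycleType_inv.symm)
  rw [← hh, π.char_conj]

theorem sum_char_mul_char (π π' : IntIrrep k) : (∑ g, π.char g * π'.char g : ℤ) =
    k.factorial * Module.finrank ℚ (Representation.IntertwiningMap (π'.toRep ℚ) (π.toRep ℚ)) := by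
  have hcard : (Nat.card (Equiv.Perm (Fin k)) : ℚ) = k.factorial := by
    rw [Nat.card_eq_fintype_card, Fintype.card_perm, Fintype.card_fin]
  have h0 : (k.factorial : ℚ) ≠ 0 := Nat.cast_ne_zero.mpr k.factorial_ne_zero
  have : Invertible (Nat.card (Equiv.Perm (Fin k)) : ℚ) := invertibleOfNonzero (by rwa [hcard])
  have h := Representation.card_inv_mul_sum_char_mul_char_eq_finrank (π'.toRep ℚ) (π.toRep ℚ)
  rw [hcard, inv_mul_eq_iff_eq_mul₀ h0] at h
  simp only [IntIrrep.character_eq, IntIrrep.char_inv] at h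
  exact_mod_cast h

theorem finrank_intertwiningMap_self_pos (π : IntIrrep k) :
    0 < Module.finrank ℚ (Representation.IntertwiningMap (π.toRep ℚ) (π.toRep ℚ)) := by
  have h1 : Nontrivial (Subrepresentation (π.toRep ℚ)) := inferInstance
  have h2 : Nontrivial (Fin π.n → ℚ) := by
    by_contra h
    rw [not_nontrivial_iff_subsingleton] at h
    obtain ⟨a, b, hab⟩ := h1
    exact hab (Subrepresentation.toSubmodule_injective (Subsingleton.elim _ _))
  obtain ⟨x, hx⟩ := exists_ne (0 : Fin π.n → ℚ)
  have : Nontrivial (Representation.IntertwiningMap (π.toRep ℚ) (π.toRep ℚ)) :=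
    ⟨.id _, 0, fun h => hx (congrArg (fun f : Representation.IntertwiningMap (π.toRep ℚ)
      (π.toRep ℚ) => f x) h)⟩
  exact Module.finrank_pos

theorem finrank_intertwiningMap_of_ne {π π' : IntIrrep k}
    (h : ¬ Nonempty ((π.toRep ℚ).Equiv (π'.toRep ℚ))) :
    Module.finrank ℚ (Representation.IntertwiningMap (π.toRep ℚ) (π'.toRep ℚ)) = 0 := by
  have := not_nonempty_iff.mp h
  exact Module.finrank_zero_of_subsingleton

theorem card_irr_le (s : Finset (Irr k)) :
    s.card ≤ Fintype.card (Fintype.card (Fin k)).Partition := by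
  let F : s → ConjClasses (Equiv.Perm (Fin k)) → ℚ := fun q =>
    Quotient.lift (fun g => ((Quotient.out q.1 : IntIrrep k).char g : ℚ)) fun g h hgh => by
      obtain ⟨c, rfl⟩ := isConj_iff.mp hgh
      simp only [IntIrrep.char_conj]
  have hF : ∀ q g, F q (ConjClasses.mk g) = (Quotient.out q.1 : IntIrrep k).char g :=
    fun q g => rfl
  have hli : LinearIndependent ℚ F := by
    rw [Fintype.linearIndependent_iff]
    intro c hc q
    have h1 : ∑ q', c q' * ∑ g, ((Quotient.out q'.1 : IntIrrep k).char g : ℚ) *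
        (Quotient.out q.1 : IntIrrep k).char g = 0 := by
      simp only [Finset.mul_sum]
      rw [Finset.sum_comm]
      refine Finset.sum_eq_zero fun g _ => ?_
      have := congrFun hc (ConjClasses.mk g)
      simp only [Finset.sum_apply, Pi.smul_apply, hF, smul_eq_mul, Pi.zero_apply] at this
      simp only [← mul_assoc]
      rw [← Finset.sum_mul, this, zero_mul]
    have h2 : ∀ π π' : IntIrrep k, ∑ g, (π.char g : ℚ) * π'.char g = k.factorial *
        Module.finrank ℚ (Representation.IntertwiningMap (π'.toRep ℚ) (π.toRep ℚ)) :=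
      fun π π' => by exact_mod_cast sum_char_mul_char π π'
    simp only [h2] at h1
    rw [Finset.sum_eq_single q] at h1
    · have h3 := finrank_intertwiningMap_self_pos (Quotient.out q.1 : IntIrrep k)
      refine (mul_eq_zero.mp h1).resolve_right (mul_ne_zero ?_ ?_)
      · exact Nat.cast_ne_zero.mpr k.factorial_ne_zero
      · exact Nat.cast_ne_zero.mpr h3.ne'
    · intro q' _ hq'
      rw [finrank_intertwiningMap_of_ne, Nat.cast_zero, mul_zero, mul_zero]
      intro h
      refine hq' (Subtype.ext ?_)
      rw [← Quotient.out_eq q'.1, ← Quotient.out_eq q.1]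
      exact (Quotient.sound (s := IntIrrep.setoid k) h).symm
    · simp
  have h1 := hli.fintype_card_le_finrank
  rw [Fintype.card_coe, Module.finrank_fintype_fun_eq_card] at h1
  refine h1.trans (Fintype.card_le_of_injective
    (Quotient.lift Equiv.Perm.partition fun g h hgh => Equiv.Perm.partition_eq_of_isConj.mp hgh) ?_)
  intro a b
  refine Quotient.inductionOn₂ a b fun g h hgh => ?_
  exact Quotient.sound (Equiv.Perm.partition_eq_of_isConj.mpr hgh)

instance : Finite (Irr k) := by
  by_contra h
  rw [not_finite_iff_infinite] at h
  obtain ⟨s, hs⟩ := Infinite.exists_subset_card_eq (Irr k)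
    (Fintype.card (Fintype.card (Fin k)).Partition + 1)
  have := card_irr_le s
  omega

noncomputable instance : Fintype (Irr k) := Fintype.ofFinite _

theorem specht_surjective (π : IntIrrep k) :
    ∃ p, Nonempty (((specht p).toRep ℚ).Equiv (π.toRep ℚ)) := by
  let f : (Fintype.card (Fin k)).Partition → Irr k := fun p => Quotient.mk _ (specht p)
  have hf : Function.Injective f := fun p q h =>
    specht_injective p q (Quotient.exact (s := IntIrrep.setoid k) h)
  have hf' : Function.Bijective f := (Fintype.bijective_iff_injective_and_card f).mpr
    ⟨hf, le_antisymm (Fintype.card_le_of_injective f hf)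
      (by simpa using card_irr_le (Finset.univ : Finset (Irr k)))⟩
  obtain ⟨p, hp⟩ := hf'.2 (Quotient.mk _ π)
  exact ⟨p, Quotient.exact (s := IntIrrep.setoid k) hp⟩

/-- The irreducible rational representations of the symmetric group are absolutely irreducible. -/
theorem exists_eq_smul (π : IntIrrep k)
    (f : Representation.IntertwiningMap (π.toRep ℚ) (π.toRep ℚ)) : ∃ c : ℚ, ∀ x, f x = c • x := by
  obtain ⟨p, ⟨e⟩⟩ := specht_surjective π
  obtain ⟨c, hc⟩ := exists_eq_smul_specht p
    (e.symm.toIntertwiningMap.comp (f.comp e.toIntertwiningMap))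
  refine ⟨c, fun x => ?_⟩
  have h := hc (e.symm x)
  have h1 : e.symm (f (e (e.symm x))) = c • e.symm x := h
  rw [e.apply_symm_apply] at h1
  have h2 := congrArg e h1
  rw [e.apply_symm_apply] at h2
  rw [h2]
  have h3 := map_smul e.toLinearEquiv c (e.symm x)
  exact h3.trans (congrArg (c • ·) (e.apply_symm_apply x))

/-- The rational matrices of an integral representation. -/
noncomputable def IntIrrep.ratMatrix (π : IntIrrep k) (g : Equiv.Perm (Fin k)) :
    Matrix (Fin π.n) (Fin π.n) ℚ := (π.ρ g).map (Int.castRingHom ℚ)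

theorem IntIrrep.ratMatrix_mul (π : IntIrrep k) (g h : Equiv.Perm (Fin k)) :
    π.ratMatrix (g * h) = π.ratMatrix g * π.ratMatrix h := by
  rw [ratMatrix, map_mul, Matrix.map_mul]
  rfl

theorem IntIrrep.ratMatrix_one (π : IntIrrep k) : π.ratMatrix 1 = 1 := by
  rw [ratMatrix, map_one, Matrix.map_one _ (map_zero _) (map_one _)]

/-- An intertwining map given by a matrix. -/
theorem exists_intertwiningMap {π π' : IntIrrep k} (Y : Matrix (Fin π'.n) (Fin π.n) ℚ)
    (h : ∀ g, Y * π.ratMatrix g = π'.ratMatrix g * Y) :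
    ∃ f : Representation.IntertwiningMap (π.toRep ℚ) (π'.toRep ℚ), ∀ x, f x = Y.mulVec x := by
  refine ⟨⟨Matrix.toLin' Y, fun g => ?_⟩, fun x => rfl⟩
  change Matrix.toLin' Y ∘ₗ Matrix.toLin' _ = Matrix.toLin' _ ∘ₗ Matrix.toLin' Y
  rw [← Matrix.toLin'_mul, ← Matrix.toLin'_mul]
  exact congrArg _ (h g)

theorem sum_conj_comm {π π' : IntIrrep k} (X : Matrix (Fin π'.n) (Fin π.n) ℚ)
    (g : Equiv.Perm (Fin k)) :
    (∑ h, π'.ratMatrix h⁻¹ * X * π.ratMatrix h) * π.ratMatrix g =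
      π'.ratMatrix g * ∑ h, π'.ratMatrix h⁻¹ * X * π.ratMatrix h := by
  rw [Matrix.sum_mul, Matrix.mul_sum, ← Equiv.sum_comp (Equiv.mulRight g)
    fun h => π'.ratMatrix g * (π'.ratMatrix h⁻¹ * X * π.ratMatrix h)]
  refine Finset.sum_congr rfl fun h _ => ?_
  simp only [Equiv.coe_mulRight]
  rw [mul_inv_rev, IntIrrep.ratMatrix_mul, IntIrrep.ratMatrix_mul, ← Matrix.mul_assoc,
    ← Matrix.mul_assoc, ← Matrix.mul_assoc, ← Matrix.mul_assoc, ← IntIrrep.ratMatrix_mul π' g,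
    mul_inv_cancel, IntIrrep.ratMatrix_one, Matrix.one_mul]

theorem sum_conj_single_apply {π π' : IntIrrep k} (a b : Fin π'.n) (c d : Fin π.n) :
    (∑ h, π'.ratMatrix h⁻¹ * Matrix.single b c (1 : ℚ) * π.ratMatrix h) a d =
      ((∑ h, π'.ρ h⁻¹ a b * π.ρ h c d : ℤ) : ℚ) := by
  rw [Matrix.sum_apply, Int.cast_sum]
  refine Finset.sum_congr rfl fun h _ => ?_
  rw [Matrix.mul_apply, Finset.sum_eq_single c]
  · simp [IntIrrep.ratMatrix]
  · intro j _ hj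
    rw [Matrix.mul_single_apply_of_ne _ _ _ _ _ hj, zero_mul]
  · simp

/-- Schur orthogonality for nonisomorphic representations. -/
theorem schur_of_ne {π π' : IntIrrep k} (h : ¬ Nonempty ((π.toRep ℚ).Equiv (π'.toRep ℚ)))
    (a b : Fin π'.n) (c d : Fin π.n) : ∑ g, π'.ρ g⁻¹ a b * π.ρ g c d = 0 := by
  obtain ⟨f, hf⟩ := exists_intertwiningMap
    (∑ h, π'.ratMatrix h⁻¹ * Matrix.single b c (1 : ℚ) * π.ratMatrix h) (sum_conj_comm _)
  have := not_nonempty_iff.mp h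
  have hf0 : f = 0 := Subsingleton.elim _ _
  have h1 := congrFun (hf (Pi.single d 1)) a
  rw [hf0, Matrix.mulVec_single_one, Matrix.col_apply, sum_conj_single_apply] at h1
  exact_mod_cast h1.symm.trans (show _ = (0 : ℚ) from rfl)

/-- Schur orthogonality for the matrix coefficients of a representation. -/
theorem schur_self (π : IntIrrep k) (a b c d : Fin π.n) :
    π.n * ∑ g, π.ρ g⁻¹ a b * π.ρ g c d = if a = d ∧ b = c then (k.factorial : ℤ) else 0 := by
  let Y := ∑ h, π.ratMatrix h⁻¹ * Matrix.single b c (1 : ℚ) * π.ratMatrix h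
  obtain ⟨f, hf⟩ := exists_intertwiningMap Y (sum_conj_comm _)
  obtain ⟨r, hr⟩ := exists_eq_smul π f
  have hY : ∀ i j, Y i j = if i = j then r else 0 := fun i j => by
    have h1 := congrFun ((hf (Pi.single j 1)).symm.trans (hr _)) i
    rw [Matrix.mulVec_single_one, Matrix.col_apply] at h1
    rw [h1]
    simp [Pi.single_apply]
  have htr : (π.n : ℚ) * r = if b = c then (k.factorial : ℚ) else 0 := by
    have h1 : Y.trace = π.n * r := by
      simp [Matrix.trace, hY]
    rw [← h1, Matrix.trace_sum]
    have h2 : ∀ h, (π.ratMatrix h⁻¹ * Matrix.single b c (1 : ℚ) * π.ratMatrix h).trace =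
        if b = c then 1 else 0 := fun h => by
      rw [Matrix.trace_mul_comm, ← Matrix.mul_assoc, ← IntIrrep.ratMatrix_mul, mul_inv_cancel,
        IntIrrep.ratMatrix_one, Matrix.one_mul]
      split_ifs with hbc
      · rw [hbc, Matrix.trace_single_eq_same]
      · exact Matrix.trace_single_eq_of_ne _ _ _ hbc
    simp only [h2, Finset.sum_const, Finset.card_univ, Fintype.card_perm, Fintype.card_fin,
      nsmul_eq_mul, mul_ite, mul_one, mul_zero]
  have h3 : (π.n : ℚ) * ((∑ g, π.ρ g⁻¹ a b * π.ρ g c d : ℤ) : ℚ) =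
      if a = d ∧ b = c then (k.factorial : ℚ) else 0 := by
    rw [← sum_conj_single_apply]
    change _ * Y a d = _
    rw [hY]
    by_cases had : a = d
    · simp [had, htr]
    · simp [had]
  exact_mod_cast h3

/-- Schur orthogonality for a set of representatives of the irreducible representations. -/
theorem schur_out_of_ne {q q' : Irr k} (h : q ≠ q') (a b : Fin (Quotient.out q' : IntIrrep k).n)
    (c d : Fin (Quotient.out q : IntIrrep k).n) :
    ∑ g, (Quotient.out q' : IntIrrep k).ρ g⁻¹ a b * (Quotient.out q : IntIrrep k).ρ g c d = 0 := by
  refine schur_of_ne (fun h' => h ?_) a b c d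
  rw [← Quotient.out_eq q, ← Quotient.out_eq q']
  exact Quotient.sound (s := IntIrrep.setoid k) h'

/-- The character of the regular representation. -/
theorem sum_dim_mul_char (g : Equiv.Perm (Fin k)) :
    ∑ q : Irr k, ((Quotient.out q : IntIrrep k).n : ℤ) * (Quotient.out q : IntIrrep k).char g =
      if g = 1 then (k.factorial : ℤ) else 0 := by
  let f : Equiv.Perm (Fin k) → ℤ := fun g => ∑ q : Irr k, ((Quotient.out q : IntIrrep k).n : ℤ) *
    (Quotient.out q : IntIrrep k).char g - if g = 1 then (k.factorial : ℤ) else 0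
  let z : MonoidAlgebra ℚ (Equiv.Perm (Fin k)) := ∑ g, (f g : ℚ) • MonoidAlgebra.of ℚ _ g⁻¹
  have hz : z = 0 := by
    by_contra hz
    obtain ⟨π, hπ⟩ := exists_irreducible_of_ne_zero z hz
    let q₀ : Irr k := Quotient.mk _ π
    obtain ⟨e⟩ : Nonempty (((Quotient.out q₀ : IntIrrep k).toRep ℚ).Equiv (π.toRep ℚ)) :=
      Quotient.exact (s := IntIrrep.setoid k) (Quotient.out_eq q₀)
    have hπ₀ : ((Quotient.out q₀ : IntIrrep k).toRep ℚ).asAlgebraHom z = 0 := by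
      have h1 : ∀ c d, ∑ g, f g * (Quotient.out q₀ : IntIrrep k).ρ g⁻¹ c d = 0 := fun c d => by
        simp only [f, sub_mul, Finset.sum_sub_distrib, Finset.sum_mul, ite_mul, zero_mul]
        rw [Finset.sum_comm, Finset.sum_eq_single q₀]
        · simp only [IntIrrep.char, Matrix.trace, Matrix.diag_apply, Finset.mul_sum,
            Finset.sum_mul]
          rw [Finset.sum_comm]
          have h2 : ∀ a, ∑ g, ((Quotient.out q₀ : IntIrrep k).n : ℤ) *
              (Quotient.out q₀ : IntIrrep k).ρ g a a * (Quotient.out q₀ : IntIrrep k).ρ g⁻¹ c d =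
              if c = a ∧ d = a then (k.factorial : ℤ) else 0 := fun a => by
            rw [← schur_self, Finset.mul_sum]
            exact Finset.sum_congr rfl fun g _ => by ring
          simp only [h2]
          simp [Matrix.one_apply, ite_and, eq_comm]
        · intro q _ hq
          simp only [IntIrrep.char, Matrix.trace, Matrix.diag_apply, Finset.mul_sum,
            Finset.sum_mul]
          rw [Finset.sum_comm]
          refine Finset.sum_eq_zero fun a _ => ?_
          have h2 := schur_out_of_ne hq c d a a
          rw [← mul_zero ((Quotient.out q : IntIrrep k).n : ℤ), ← h2, Finset.mul_sum]
          exact Finset.sum_congr rfl fun g _ => by ring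
        · simp
      simp only [z, map_sum, map_smul, Representation.asAlgebraHom_of]
      refine LinearMap.pi_ext' fun d => LinearMap.ext_ring (funext fun c => ?_)
      have h3 := h1 c d
      have h4 : ∀ g, ((Quotient.out q₀ : IntIrrep k).toRep ℚ g) (Pi.single d 1) c =
          ((Quotient.out q₀ : IntIrrep k).ρ g c d : ℚ) := fun g => by
        change ((Quotient.out q₀ : IntIrrep k).ratMatrix g).mulVec (Pi.single d 1) c = _
        rw [Matrix.mulVec_single_one]
        rfl
      simp only [LinearMap.comp_apply, LinearMap.sum_apply, LinearMap.smul_apply,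
        LinearMap.coe_single, Finset.sum_apply, Pi.smul_apply, h4, smul_eq_mul]
      simp only [LinearMap.zero_apply, Pi.zero_apply]
      exact_mod_cast h3
    refine hπ (LinearMap.ext fun x => ?_)
    have h5 := asAlgebraHom_equiv e z (e.symm x)
    rw [hπ₀, e.apply_symm_apply] at h5
    exact h5.symm.trans (map_zero e.toLinearEquiv)
  have h6 : z.coeff g⁻¹ = f g := by
    simp only [z]
    rw [MonoidAlgebra.coeff_sum, Finset.sum_apply']
    rw [Finset.sum_eq_single g]
    · simp
    · intro h _ hh
      have : h⁻¹ ≠ g⁻¹ := fun h' => hh (inv_injective h')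
      simp [this]
    · simp
  rw [hz] at h6
  have h7 : f g = 0 := by exact_mod_cast h6.symm.trans (show _ = (0 : ℚ) by simp)
  exact sub_eq_zero.mp h7

end Splitting

/-! ## Super representations -/

section SRep

/-- A super module with an even action of a group. -/
structure SRep (R : Type u) [CommRing R] (G : Type) [Group G] extends SMod R where
  /-- the action of the group -/
  ρ : Representation R G carrier
  ρ_η : ∀ g x, ρ g (η x) = η (ρ g x)

variable {R : Type u} [CommRing R] {G : Type} [Group G]

namespace SRep

/-- A decomposition of a super representation as a direct sum. -/
structure Splitting (A : SRep R G) {J : Type} [Fintype J] (B : J → SRep R G) where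
  /-- the inclusions -/
  i : ∀ j, (B j).carrier →ₗ[R] A.carrier
  /-- the projections -/
  s : ∀ j, A.carrier →ₗ[R] (B j).carrier
  i_η : ∀ j x, i j ((B j).η x) = A.η (i j x)
  s_η : ∀ j x, s j (A.η x) = (B j).η (s j x)
  i_ρ : ∀ j g x, i j ((B j).ρ g x) = A.ρ g (i j x)
  s_ρ : ∀ j g x, s j (A.ρ g x) = (B j).ρ g (s j x)
  s_i : ∀ j x, s j (i j x) = x
  s_i_of_ne : ∀ j l, j ≠ l → ∀ x, s j (i l x) = 0
  sum_i_s : ∀ x, ∑ j, i j (s j x) = x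

/-- An isomorphism is a decomposition with one summand. -/
def Splitting.ofEquiv {A B : SRep R G} (e : B.carrier ≃ₗ[R] A.carrier)
    (hη : ∀ x, e (B.η x) = A.η (e x)) (hρ : ∀ g x, e (B.ρ g x) = A.ρ g (e x)) :
    Splitting A fun _ : Unit => B where
  i _ := e.toLinearMap
  s _ := e.symm.toLinearMap
  i_η _ := hη
  s_η _ x := by
    change e.symm _ = B.η (e.symm x)
    rw [LinearEquiv.symm_apply_eq, hη, e.apply_symm_apply]
  i_ρ _ := hρ
  s_ρ _ g x := by
    change e.symm _ = B.ρ g (e.symm x)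
    rw [LinearEquiv.symm_apply_eq, hρ, e.apply_symm_apply]
  s_i _ := e.symm_apply_apply
  s_i_of_ne _ _ h := absurd rfl h
  sum_i_s x := by simp

/-- The trivial action on a super module. -/
abbrev triv (G : Type) [Group G] (T : SMod R) : SRep R G where
  toSMod := T
  ρ := 1
  ρ_η _ _ := rfl

section Matrix

variable {ι : Type} [Fintype ι] [DecidableEq ι]

/-- The action of a group on the tensor product of an integral representation and of a
representation. -/
def matRep (L : G →* Matrix ι ι ℤ) {M : Type u} [AddCommGroup M] [Module R M]
    (ρ : Representation R G M) : Representation R G (ι → M) where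
  toFun g := LinearMap.pi fun x => ∑ y, L g x y • (ρ g ∘ₗ LinearMap.proj y)
  map_one' := by
    refine LinearMap.ext fun a => funext fun x => ?_
    simp [Matrix.one_apply, ite_smul]
  map_mul' g h := by
    refine LinearMap.ext fun a => funext fun x => ?_
    simp only [map_mul, Matrix.mul_apply, LinearMap.pi_apply, LinearMap.sum_apply,
      LinearMap.smul_apply, LinearMap.comp_apply, LinearMap.proj_apply, Module.End.mul_apply,
      map_sum, map_zsmul, Finset.sum_smul, Finset.smul_sum, smul_smul]
    exact Finset.sum_comm

theorem matRep_apply (L : G →* Matrix ι ι ℤ) {M : Type u} [AddCommGroup M] [Module R M]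
    (ρ : Representation R G M) (g : G) (a : ι → M) (x : ι) :
    matRep L ρ g a x = ∑ y, L g x y • ρ g (a y) := by
  simp [matRep, LinearMap.sum_apply]

instance finite_pi_smod (B : SMod R) : Module.Finite R (ι → B.carrier) := inferInstance

/-- The tensor product of an integral representation and of a super representation. -/
abbrev tw (L : G →* Matrix ι ι ℤ) (B : SRep R G) : SRep R G where
  carrier := ι → B.carrier
  projective := projective_pi (R := R) fun _ : ι => B.carrier
  η := B.η.compLeft ι
  η_sq x := funext fun _ => B.η_sq _
  ρ := matRep L B.ρ
  ρ_η g a := funext fun x => by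
    simp only [matRep_apply, LinearMap.compLeft_apply, Function.comp_apply, map_sum, map_zsmul,
      B.ρ_η]

theorem tw_ρ (L : G →* Matrix ι ι ℤ) (B : SRep R G) (g : G) (a : ι → B.carrier) (x : ι) :
    (B.tw L).ρ g a x = ∑ y, L g x y • B.ρ g (a y) := matRep_apply L B.ρ g a x

/-- The decomposition of a tensor product. -/
def Splitting.tw {A : SRep R G} {J : Type} [Fintype J] {B : J → SRep R G} (S : A.Splitting B)
    (L : G →* Matrix ι ι ℤ) : (A.tw L).Splitting fun j => (B j).tw L where
  i j := (S.i j).compLeft ι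
  s j := (S.s j).compLeft ι
  i_η j x := funext fun _ => S.i_η j _
  s_η j x := funext fun _ => S.s_η j _
  i_ρ j g a := funext fun x => by
    simp only [matRep_apply, LinearMap.compLeft_apply, Function.comp_apply, map_sum, map_zsmul,
      S.i_ρ]
  s_ρ j g a := funext fun x => by
    simp only [matRep_apply, LinearMap.compLeft_apply, Function.comp_apply, map_sum, map_zsmul,
      S.s_ρ]
  s_i j x := funext fun _ => S.s_i j _
  s_i_of_ne j l h x := funext fun _ => S.s_i_of_ne j l h _
  sum_i_s a := funext fun x => by
    rw [Finset.sum_apply]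
    exact S.sum_i_s _

/-- The tensor product of two integral representations. -/
def kron {κ : Type} [Fintype κ] [DecidableEq κ] (L : G →* Matrix ι ι ℤ) (L' : G →* Matrix κ κ ℤ) :
    G →* Matrix (ι × κ) (ι × κ) ℤ where
  toFun g := Matrix.kroneckerMap (· * ·) (L g) (L' g)
  map_one' := by rw [map_one, map_one, Matrix.one_kronecker_one]
  map_mul' g h := by rw [map_mul, map_mul, Matrix.mul_kronecker_mul]

theorem trace_kron {κ : Type} [Fintype κ] [DecidableEq κ] (L : G →* Matrix ι ι ℤ)
    (L' : G →* Matrix κ κ ℤ) (g : G) : (kron L L' g).trace = (L g).trace * (L' g).trace :=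
  Matrix.trace_kronecker _ _

/-- Associativity of the tensor product with integral representations. -/
noncomputable def splittingTwTw {κ : Type} [Fintype κ] [DecidableEq κ] (L : G →* Matrix ι ι ℤ)
    (L' : G →* Matrix κ κ ℤ) (B : SRep R G) :
    ((B.tw L').tw L).Splitting fun _ : Unit => B.tw (kron L L') :=
  Splitting.ofEquiv (LinearEquiv.curry R B.carrier ι κ) (fun x => rfl) fun g a => by
    funext x y
    have h1 : (((B.tw L').tw L).ρ g (LinearEquiv.curry R B.carrier ι κ a)) x =
        ∑ x', L g x x' • (B.tw L').ρ g fun y' => a (x', y') := tw_ρ L (B.tw L') g _ x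
    rw [h1, Finset.sum_apply]
    refine (tw_ρ (kron L L') B g a (x, y)).trans ((Fintype.sum_prod_type _).trans ?_)
    refine Finset.sum_congr rfl fun x' _ => ?_
    refine Eq.trans ?_ (congrArg (L g x x' • ·) (tw_ρ L' B g (fun y' => a (x', y')) y)).symm
    simp only [Finset.smul_sum, smul_smul]
    rfl

end Matrix

section Fix

variable [Fintype G] [Invertible (Fintype.card G : R)]

instance finite_invariants (B : SRep R G) : Module.Finite R B.ρ.invariants :=
  Module.Finite.of_surjective (B.ρ.averageMap.codRestrict _ B.ρ.averageMap_invariant) fun x =>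
    ⟨x, Subtype.ext (B.ρ.averageMap_id x x.2)⟩

instance projective_invariants (B : SRep R G) : Module.Projective R B.ρ.invariants :=
  Module.Projective.of_split B.ρ.invariants.subtype
    (B.ρ.averageMap.codRestrict _ B.ρ.averageMap_invariant)
    (LinearMap.ext fun x => Subtype.ext (B.ρ.averageMap_id x x.2))

/-- The invariants of a super representation. -/
noncomputable abbrev fix (B : SRep R G) : SMod R where
  carrier := B.ρ.invariants
  η := B.η.restrict fun x hx g => by rw [B.ρ_η, hx g]
  η_sq x := Subtype.ext (B.η_sq x.1)

variable [Invertible (2 : R)]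

theorem Splitting.sK_fix {A : SRep R G} {J : Type} [Fintype J] [DecidableEq J] {B : J → SRep R G}
    (S : A.Splitting B) : A.fix.sK = ∑ j, (B j).fix.sK := by
  refine SMod.sK_eq_sum A.fix (fun j => (B j).fix)
    (fun j => (S.i j).restrict fun x hx g => by rw [← S.i_ρ, hx g])
    (fun j => (S.s j).restrict fun x hx g => by rw [← S.s_ρ, hx g]) ?_ ?_ ?_ ?_ ?_
  · exact fun j x => Subtype.ext (S.i_η j x.1)
  · exact fun j x => Subtype.ext (S.s_η j x.1)
  · exact fun j x => Subtype.ext (S.s_i j x.1)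
  · exact fun j l h x => Subtype.ext (S.s_i_of_ne j l h x.1)
  · intro x
    refine Subtype.ext ?_
    rw [Submodule.coe_sum]
    exact S.sum_i_s x.1

end Fix

end SRep

/-- A rank factorization of an integral matrix which is idempotent up to a factor. -/
theorem exists_rank_factorization {ι : Type*} [Fintype ι] [DecidableEq ι] (P : Matrix ι ι ℤ) (N : ℤ)
    (hP : P * P = N • P) : ∃ (m : ℕ) (B : Matrix ι (Fin m) ℤ) (A : Matrix (Fin m) ι ℤ),
      B * A = P ∧ A * B = N • 1 := by
  let L := LinearMap.range (Matrix.toLin' P)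
  let b := Module.finBasis ℤ L
  let A : Matrix (Fin (Module.finrank ℤ L)) ι ℤ :=
    Matrix.of fun j x => b.repr ⟨Matrix.toLin' P (Pi.single x 1), ⟨_, rfl⟩⟩ j
  let B : Matrix ι (Fin (Module.finrank ℤ L)) ℤ := Matrix.of fun x j => (b j : ι → ℤ) x
  refine ⟨_, B, A, ?_, ?_⟩
  · ext x y
    have h := congrArg (fun z : L => (z : ι → ℤ) x)
      (b.sum_repr ⟨Matrix.toLin' P (Pi.single y 1), ⟨_, rfl⟩⟩)
    simp only [Submodule.coe_sum, Finset.sum_apply, Submodule.coe_smul, Pi.smul_apply,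
      smul_eq_mul] at h
    rw [Matrix.mul_apply]
    refine (Finset.sum_congr rfl fun j _ => mul_comm _ _).trans (h.trans ?_)
    rw [Matrix.toLin'_apply, Matrix.mulVec_single_one]
    rfl
  · have hb : ∀ j, Matrix.toLin' P (b j) = N • (b j : ι → ℤ) := fun j => by
      obtain ⟨y, hy⟩ := (b j).2
      rw [← hy, ← LinearMap.comp_apply, ← Matrix.toLin'_mul, hP, map_smul]
      rfl
    ext i j
    have h1 : ∑ x, (b j : ι → ℤ) x • (⟨Matrix.toLin' P (Pi.single x 1), ⟨_, rfl⟩⟩ : L) =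
        N • b j := by
      refine Subtype.ext ?_
      rw [Submodule.coe_sum, Submodule.coe_smul, ← hb]
      conv_rhs => rw [pi_eq_sum_univ' (b j : ι → ℤ), map_sum]
      refine Finset.sum_congr rfl fun x _ => ?_
      rw [map_smul]
      rfl
    have h2 := congrArg (fun z => b.repr z i) h1
    simp only [map_sum, map_smul, Finsupp.coe_finsetSum, Finset.sum_apply, Finsupp.smul_apply,
      smul_eq_mul, Module.Basis.repr_self] at h2
    rw [Matrix.mul_apply]
    refine (Finset.sum_congr rfl fun x _ => mul_comm _ _).trans (h2.trans ?_)
    rw [Matrix.smul_apply, Matrix.one_apply, Finsupp.single_apply, smul_eq_mul]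
    simp only [eq_comm]

namespace SRep

theorem mem_fix_tw {ι : Type} [Fintype ι] [DecidableEq ι] {L : G →* Matrix ι ι ℤ} {B : SRep R G}
    {a : ι → B.carrier} :
    a ∈ (B.tw L).ρ.invariants ↔ ∀ g x, ∑ y, L g x y • B.ρ g (a y) = a x := by
  rw [Representation.mem_invariants]
  refine forall_congr' fun g => ?_
  rw [funext_iff]
  exact forall_congr' fun x => by rw [tw_ρ]

/-- The multiplicity of the trivial representation in an integral representation. -/
theorem exists_mult [Fintype G] {ι : Type} [Fintype ι] [DecidableEq ι] (L : G →* Matrix ι ι ℤ) :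
    ∃ m : ℕ, (Fintype.card G * m : ℤ) = ∑ g, (L g).trace ∧
      ∀ (R : Type u) [CommRing R] [Invertible (2 : R)] [Invertible (Fintype.card G : R)]
        (T : SMod R), ((triv G T).tw L).fix.sK = m • T.sK := by
  let P := ∑ g, L g
  have hLP : ∀ g, L g * P = P := fun g => by
    rw [Finset.mul_sum]
    refine Eq.trans ?_ (Equiv.sum_comp (Equiv.mulLeft g) fun h => L h)
    exact Finset.sum_congr rfl fun h _ => (map_mul L g h).symm
  have hP : P * P = (Fintype.card G : ℤ) • P := by
    conv_lhs => rw [show P * P = ∑ g, L g * P from Finset.sum_mul _ _ _]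
    simp [hLP]
  obtain ⟨m, B, A, hBA, hAB⟩ := exists_rank_factorization P _ hP
  have h0 : (Fintype.card G : ℤ) ≠ 0 := Nat.cast_ne_zero.mpr Fintype.card_ne_zero
  have hLB : ∀ g, L g * B = B := fun g => by
    have h1 : L g * B * (A * B) = B * (A * B) := by
      rw [Matrix.mul_assoc (L g), ← Matrix.mul_assoc B, hBA, ← Matrix.mul_assoc, hLP]
    rw [hAB, Matrix.mul_smul, Matrix.mul_smul, Matrix.mul_one, Matrix.mul_one] at h1
    exact smul_right_injective _ h0 h1
  refine ⟨m, ?_, fun R _ _ _ T => ?_⟩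
  · have h1 := congrArg Matrix.trace hAB
    rw [Matrix.trace_mul_comm, hBA, Matrix.trace_sum, Matrix.trace_smul, Matrix.trace_one] at h1
    rw [h1]
    simp
  · have hinv : ∀ x : T.carrier, (⅟(Fintype.card G : R)) • ((Fintype.card G : ℤ) • x) = x :=
      fun x => by
      rw [← Int.cast_smul_eq_zsmul R, smul_smul, Int.cast_natCast, invOf_mul_self, one_smul]
    have hmem : ∀ (j : Fin m) (t : T.carrier),
        (LinearMap.pi fun x => B x j • (LinearMap.id : T.carrier →ₗ[R] T.carrier)) t ∈
          ((triv G T).tw L).ρ.invariants := fun j t => by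
      rw [mem_fix_tw]
      intro g x
      have h1 := congrFun (congrFun (hLB g) x) j
      rw [Matrix.mul_apply] at h1
      change ∑ y, L g x y • B y j • t = B x j • t
      rw [← h1, Finset.sum_smul]
      exact Finset.sum_congr rfl fun y _ => smul_smul _ _ _
    have key := SMod.sK_eq_sum ((triv G T).tw L).fix (fun _ : Fin m => T)
      (fun j => LinearMap.codRestrict _ (LinearMap.pi fun x => B x j • LinearMap.id)
        fun t => hmem j t)
      (fun j => ((⅟(Fintype.card G : R)) • ∑ x, A j x • LinearMap.proj x) ∘ₗ Submodule.subtype _)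
      ?_ ?_ ?_ ?_ ?_
    · simpa using key
    · exact fun j x => Subtype.ext (funext fun y => (map_zsmul T.η _ _).symm)
    · intro j x
      simp only [LinearMap.comp_apply, LinearMap.smul_apply, LinearMap.sum_apply, map_smul, map_sum,
        map_zsmul]
      rfl
    · intro j t
      simp only [LinearMap.comp_apply, LinearMap.smul_apply, LinearMap.sum_apply]
      refine Eq.trans ?_ (hinv t)
      congr 1
      have h1 := congrFun (congrFun hAB j) j
      rw [Matrix.mul_apply, Matrix.smul_apply, Matrix.one_apply_eq, smul_eq_mul, mul_one] at h1
      rw [← h1, Finset.sum_smul]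
      exact Finset.sum_congr rfl fun x _ => smul_smul _ _ _
    · intro j l hjl t
      simp only [LinearMap.comp_apply, LinearMap.smul_apply, LinearMap.sum_apply]
      have h1 := congrFun (congrFun hAB j) l
      rw [Matrix.mul_apply, Matrix.smul_apply, Matrix.one_apply_ne hjl, smul_zero] at h1
      have h2 : ∑ x, A j x • B x l • t = 0 := by
        simp only [smul_smul]
        rw [← Finset.sum_smul, h1, zero_smul]
      exact (congrArg (⅟(Fintype.card G : R) • ·) h2).trans (smul_zero _)
    · intro a
      refine Subtype.ext (funext fun x => ?_)
      rw [Submodule.coe_sum, Finset.sum_apply]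
      have h1 : ∀ j, (B x j • ((⅟(Fintype.card G : R)) • ∑ y, A j y • a.1 y) : T.carrier) =
          (⅟(Fintype.card G : R)) • ∑ y, (B x j * A j y) • a.1 y := fun j => by
        rw [smul_comm, Finset.smul_sum]
        simp only [smul_smul]
      refine Eq.trans (Finset.sum_congr rfl fun j _ => ?_)
        (Eq.trans (Finset.sum_congr rfl fun j _ => h1 j) ?_)
      · simp only [LinearMap.comp_apply, LinearMap.smul_apply, LinearMap.sum_apply]
        rfl
      · rw [← Finset.smul_sum, Finset.sum_comm]
        simp only [← Finset.sum_smul]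
        have h2 : ∀ y, ∑ j, B x j * A j y = ∑ g, L g x y := fun y => by
          
          rw [← Matrix.mul_apply, hBA]
          exact Matrix.sum_apply x y _ _
        simp only [h2, Finset.sum_smul]
        rw [Finset.sum_comm]
        have h3 := mem_fix_tw.mp a.2
        have h4 : ∀ g, ∑ y, L g x y • a.1 y = a.1 x := fun g => h3 g x
        simp only [h4, Finset.sum_const, Finset.card_univ]
        rw [← natCast_zsmul]
        exact hinv _

/-- The multiplicity of the trivial representation in an integral representation. -/
def mult [Fintype G] {ι : Type} [Fintype ι] [DecidableEq ι]
    (L : G →* Matrix ι ι ℤ) : ℕ :=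
  ((∑ g, (L g).trace) / Fintype.card G).toNat

theorem mult_eq [Fintype G] {ι : Type} [Fintype ι] [DecidableEq ι] (L : G →* Matrix ι ι ℤ) (m : ℕ)
    (h : (Fintype.card G * m : ℤ) = ∑ g, (L g).trace) : mult L = m := by
  have h0 : (Fintype.card G : ℤ) ≠ 0 := Nat.cast_ne_zero.mpr Fintype.card_ne_zero
  rw [mult, ← h, Int.mul_ediv_cancel_left _ h0, Int.toNat_natCast]

theorem card_mul_mult [Fintype G] {ι : Type} [Fintype ι] [DecidableEq ι] (L : G →* Matrix ι ι ℤ) :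
    (Fintype.card G * mult L : ℤ) = ∑ g, (L g).trace := by
  obtain ⟨m, h, -⟩ := exists_mult.{0} L
  rw [mult_eq L m h, h]

theorem sK_fix_tw_triv [Fintype G] {ι : Type} [Fintype ι] [DecidableEq ι] [Invertible (2 : R)]
    [Invertible (Fintype.card G : R)] (L : G →* Matrix ι ι ℤ) (T : SMod R) :
    ((triv G T).tw L).fix.sK = mult L • T.sK := by
  obtain ⟨m, h, h'⟩ := exists_mult.{u} L
  rw [mult_eq L m h, h']

end SRep

end SRep

/-! ## Isotypic components -/

section Isotypic

variable {R : Type u} [CommRing R] {k : ℕ}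

instance invertibleCardPerm [h : Invertible ((k.factorial : ℕ) : R)] :
    Invertible (Fintype.card (Equiv.Perm (Fin k)) : R) :=
  h.copy _ (by rw [Fintype.card_perm, Fintype.card_fin])

/-- The dual representation. -/
def IntIrrep.dual (π : IntIrrep k) : Equiv.Perm (Fin k) →* Matrix (Fin π.n) (Fin π.n) ℤ where
  toFun g := (π.ρ g⁻¹).transpose
  map_one' := by rw [inv_one, map_one, Matrix.transpose_one]
  map_mul' g h := by rw [mul_inv_rev, map_mul, Matrix.transpose_mul]

variable [Invertible ((k.factorial : ℕ) : R)]

/-- The multiplicity module of an irreducible representation. -/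
noncomputable abbrev isotyp (B : SRep R (Equiv.Perm (Fin k))) (π : IntIrrep k) : SMod R :=
  (B.tw π.dual).fix

theorem sum_ρ_mul_ρ_inv (π : IntIrrep k) (g : Equiv.Perm (Fin k)) (x z : Fin π.n) :
    ∑ y, π.ρ g x y * π.ρ g⁻¹ y z = if x = z then 1 else 0 := by
  rw [← Matrix.mul_apply, ← map_mul, mul_inv_cancel, map_one, Matrix.one_apply]

omit [Invertible ((k.factorial : ℕ) : R)] in
theorem ρ_apply_of_mem {B : SRep R (Equiv.Perm (Fin k))} {π : IntIrrep k}
    {a : Fin π.n → B.carrier} (ha : a ∈ (B.tw π.dual).ρ.invariants) (g : Equiv.Perm (Fin k))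
    (z : Fin π.n) : B.ρ g (a z) = ∑ x, π.ρ g x z • a x := by
  rw [SRep.mem_fix_tw] at ha
  have h : ∀ x, π.ρ g x z • a x = ∑ y, (π.ρ g⁻¹ y x * π.ρ g x z) • B.ρ g (a y) := fun x => by
    rw [← ha g x, Finset.smul_sum]
    refine Finset.sum_congr rfl fun y _ => ?_
    rw [smul_smul, mul_comm]
    rfl
  simp only [h]
  rw [Finset.sum_comm]
  simp only [← Finset.sum_smul]
  have h2 : ∀ y, ∑ x, π.ρ g⁻¹ y x * π.ρ g x z = if y = z then 1 else 0 := fun y => by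
    have := sum_ρ_mul_ρ_inv π g⁻¹ y z
    rwa [inv_inv] at this
  simp [h2, ite_smul]

omit [Invertible ((k.factorial : ℕ) : R)] in
theorem mem_of_ρ_apply {B : SRep R (Equiv.Perm (Fin k))} {π : IntIrrep k}
    {a : Fin π.n → B.carrier}
    (ha : ∀ g z, B.ρ g (a z) = ∑ x, π.ρ g x z • a x) : a ∈ (B.tw π.dual).ρ.invariants := by
  rw [SRep.mem_fix_tw]
  intro g x
  change ∑ y, π.ρ g⁻¹ y x • B.ρ g (a y) = a x
  simp only [ha, Finset.smul_sum, smul_smul]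
  rw [Finset.sum_comm]
  simp only [← Finset.sum_smul]
  have h2 : ∀ y, ∑ z, π.ρ g⁻¹ z x * π.ρ g y z = if y = x then 1 else 0 := fun y => by
    rw [← sum_ρ_mul_ρ_inv π g y x]
    exact Finset.sum_congr rfl fun z _ => mul_comm _ _
  simp [h2, ite_smul]

/-- The matrix coefficients of the action on an element. -/
noncomputable def coeffMap (B : SRep R (Equiv.Perm (Fin k))) (π : IntIrrep k) (x : Fin π.n) :
    B.carrier →ₗ[R] Fin π.n → B.carrier :=
  LinearMap.pi fun y => (⅟((k.factorial : ℕ) : R)) • (π.n : ℤ) • ∑ g, π.ρ g⁻¹ x y • B.ρ g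

theorem coeffMap_apply (B : SRep R (Equiv.Perm (Fin k))) (π : IntIrrep k) (x y : Fin π.n)
    (b : B.carrier) : coeffMap B π x b y =
      (⅟((k.factorial : ℕ) : R)) • (π.n : ℤ) • ∑ g, π.ρ g⁻¹ x y • B.ρ g b := by
  simp only [coeffMap, LinearMap.pi_apply, LinearMap.smul_apply, LinearMap.sum_apply]

theorem coeffMap_mem (B : SRep R (Equiv.Perm (Fin k))) (π : IntIrrep k) (x : Fin π.n)
    (b : B.carrier) : coeffMap B π x b ∈ (B.tw π.dual).ρ.invariants := by
  refine mem_of_ρ_apply fun h z => ?_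
  simp only [coeffMap_apply, map_smul, map_zsmul, map_sum]
  have e : ∀ y, π.ρ h y z • (⅟((k.factorial : ℕ) : R)) • (π.n : ℤ) •
      ∑ g, π.ρ g⁻¹ x y • B.ρ g b = (⅟((k.factorial : ℕ) : R)) • (π.n : ℤ) •
      π.ρ h y z • ∑ g, π.ρ g⁻¹ x y • B.ρ g b := fun y => by
    rw [smul_comm (π.ρ h y z), smul_comm (π.ρ h y z)]
  simp only [e, ← Finset.smul_sum]
  congr 2
  simp only [Finset.smul_sum, smul_smul]
  rw [Finset.sum_comm]
  refine Eq.trans ?_ (Equiv.sum_comp (Equiv.mulLeft h) fun g =>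
    ∑ y, (π.ρ h y z * π.ρ g⁻¹ x y) • B.ρ g b)
  refine Finset.sum_congr rfl fun g _ => ?_
  rw [← Finset.sum_smul, ← Module.End.mul_apply, ← map_mul]
  simp only [Equiv.coe_mulLeft]
  congr 1
  simp only [mul_comm (π.ρ h _ z)]
  rw [← Matrix.mul_apply, ← map_mul, mul_inv_rev, inv_mul_cancel_right]

theorem coeffMap_apply_of_mem {B : SRep R (Equiv.Perm (Fin k))} {π π' : IntIrrep k}
    {a : Fin π'.n → B.carrier} (ha : a ∈ (B.tw π'.dual).ρ.invariants) (x y : Fin π.n)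
    (z : Fin π'.n) : coeffMap B π x (a z) y = (⅟((k.factorial : ℕ) : R)) •
      ∑ w, ((π.n : ℤ) * ∑ g, π.ρ g⁻¹ x y * π'.ρ g w z) • a w := by
  rw [coeffMap_apply]
  congr 1
  simp only [ρ_apply_of_mem ha, Finset.smul_sum, smul_smul, Finset.mul_sum, Finset.sum_smul]
  exact Finset.sum_comm

/-- The isotypic decomposition. -/
noncomputable def isotypSplitting (B : SRep R (Equiv.Perm (Fin k))) :
    B.Splitting fun q : Irr k => (SRep.triv (Equiv.Perm (Fin k))
      (isotyp B (Quotient.out q))).tw (Quotient.out q : IntIrrep k).ρ where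
  i q := ∑ x, LinearMap.proj x ∘ₗ Submodule.subtype _ ∘ₗ LinearMap.proj x
  s q := LinearMap.pi fun x => (coeffMap B (Quotient.out q) x).codRestrict _
    (coeffMap_mem B (Quotient.out q) x)
  i_η q u := by
    simp only [LinearMap.sum_apply, LinearMap.comp_apply, map_sum]
    rfl
  s_η q b := by
    funext x
    refine Subtype.ext (funext fun y => ?_)
    refine (coeffMap_apply B _ x y _).trans ?_
    refine Eq.trans ?_ (congrArg B.η (coeffMap_apply B _ x y b)).symm
    simp only [map_smul, map_zsmul, map_sum, B.ρ_η]
  i_ρ q g u := by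
    simp only [LinearMap.sum_apply, LinearMap.comp_apply, map_sum, LinearMap.proj_apply]
    have h1 : ∀ x, (((SRep.triv (Equiv.Perm (Fin k)) (isotyp B (Quotient.out q))).tw
        (Quotient.out q : IntIrrep k).ρ).ρ g u x).1 x =
        ∑ y, (Quotient.out q : IntIrrep k).ρ g x y • (u y).1 x := fun x => by
      rw [SRep.tw_ρ, Submodule.coe_sum, Finset.sum_apply]
      rfl
    refine (Finset.sum_congr rfl fun x _ => h1 x).trans ?_
    rw [Finset.sum_comm]
    exact Finset.sum_congr rfl fun y _ => (ρ_apply_of_mem (u y).2 g y).symm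
  s_ρ q h b := by
    funext x
    refine Eq.trans ?_ (SRep.tw_ρ _ _ _ _ _).symm
    refine Subtype.ext (funext fun y => ?_)
    rw [Submodule.coe_sum, Finset.sum_apply]
    refine (coeffMap_apply B _ x y _).trans ?_
    refine Eq.trans ?_ (Finset.sum_congr rfl fun z _ => congrArg
      ((Quotient.out q : IntIrrep k).ρ h x z • ·) (coeffMap_apply B _ z y b)).symm
    have e : ∀ z, (Quotient.out q : IntIrrep k).ρ h x z • (⅟((k.factorial : ℕ) : R)) •
        ((Quotient.out q : IntIrrep k).n : ℤ) • ∑ g, (Quotient.out q : IntIrrep k).ρ g⁻¹ z y •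
        B.ρ g b = (⅟((k.factorial : ℕ) : R)) • ((Quotient.out q : IntIrrep k).n : ℤ) •
        (Quotient.out q : IntIrrep k).ρ h x z • ∑ g, (Quotient.out q : IntIrrep k).ρ g⁻¹ z y •
          B.ρ g b := fun z => by
      rw [smul_comm ((Quotient.out q : IntIrrep k).ρ h x z),
        smul_comm ((Quotient.out q : IntIrrep k).ρ h x z)]
    simp only [e, ← Finset.smul_sum]
    congr 2
    simp only [Finset.smul_sum, smul_smul]
    rw [Finset.sum_comm]
    refine Eq.trans ?_ (Equiv.sum_comp (Equiv.mulRight h) fun g =>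
      ∑ z, ((Quotient.out q : IntIrrep k).ρ h x z * (Quotient.out q : IntIrrep k).ρ g⁻¹ z y) •
        B.ρ g b)
    refine Finset.sum_congr rfl fun g _ => ?_
    rw [← Finset.sum_smul, ← Module.End.mul_apply, ← map_mul]
    simp only [Equiv.coe_mulRight]
    congr 1
    rw [← Matrix.mul_apply, ← map_mul, mul_inv_rev, mul_inv_cancel_left]
  s_i q u := by
    funext x
    refine Subtype.ext (funext fun y => ?_)
    change coeffMap B _ x ((∑ z, LinearMap.proj z ∘ₗ Submodule.subtype _ ∘ₗ LinearMap.proj z :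
      (Fin (Quotient.out q : IntIrrep k).n → (isotyp B (Quotient.out q)).carrier) →ₗ[R]
        B.carrier) u) y = (u x).1 y
    rw [LinearMap.sum_apply, map_sum, Finset.sum_apply]
    have h : ∀ z, coeffMap B (Quotient.out q) x ((u z).1 z) y =
        if x = z then (u x).1 y else 0 := fun z => by
      rw [coeffMap_apply_of_mem (u z).2]
      simp only [schur_self]
      split_ifs with hxz
      · subst hxz
        rw [Finset.sum_eq_single y (fun w _ hw => by simp [hw.symm]) (by simp)]
        rw [if_pos ⟨rfl, rfl⟩, ← Int.cast_smul_eq_zsmul R, smul_smul, Int.cast_natCast,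
          invOf_mul_self, one_smul]
      · simp [hxz]
    exact (Finset.sum_congr rfl fun z _ => h z).trans (by simp)
  s_i_of_ne q q' hq u := by
    funext x
    refine Subtype.ext (funext fun y => ?_)
    change coeffMap B _ x ((∑ z, LinearMap.proj z ∘ₗ Submodule.subtype _ ∘ₗ LinearMap.proj z :
      (Fin (Quotient.out q' : IntIrrep k).n → (isotyp B (Quotient.out q')).carrier) →ₗ[R]
        B.carrier) u) y = 0
    rw [LinearMap.sum_apply, map_sum, Finset.sum_apply]
    refine Finset.sum_eq_zero fun z _ => ?_
    refine (coeffMap_apply_of_mem (u z).2 x y z).trans ?_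
    simp [schur_out_of_ne hq.symm]
  sum_i_s b := by
    have h : ∀ q : Irr k, (∑ x, coeffMap B (Quotient.out q) x b x) = (⅟((k.factorial : ℕ) : R)) •
        ∑ g, (((Quotient.out q : IntIrrep k).n : ℤ) * (Quotient.out q : IntIrrep k).char g⁻¹) •
          B.ρ g b := fun q => by
      simp only [coeffMap_apply, ← Finset.smul_sum]
      rw [Finset.sum_comm]
      simp only [← Finset.sum_smul, mul_smul, ← Finset.smul_sum]
      rfl
    refine Eq.trans (b := ∑ q : Irr k, ∑ x, coeffMap B (Quotient.out q) x b x)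
      (Finset.sum_congr rfl fun q _ => ?_) ?_
    · rw [LinearMap.sum_apply]
      rfl
    · simp only [h]
      rw [← Finset.smul_sum, Finset.sum_comm]
      simp only [← Finset.sum_smul, sum_dim_mul_char, inv_eq_one, ite_smul, zero_smul]
      rw [Finset.sum_ite_eq' Finset.univ (1 : Equiv.Perm (Fin k)), if_pos (Finset.mem_univ _),
        map_one, Module.End.one_apply, ← Int.cast_smul_eq_zsmul R, smul_smul, Int.cast_natCast,
        invOf_mul_self, one_smul]

variable [Invertible (2 : R)]

/-- The value of the Adams character on a super representation of the symmetric group. -/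
noncomputable def sX (B : SRep R (Equiv.Perm (Fin k))) : K R :=
  ∑ q : Irr k, (Quotient.out q : IntIrrep k).char (finRotate k) •
    (isotyp B (Quotient.out q)).sK

theorem sK_fix_tw {ι : Type} [Fintype ι] [DecidableEq ι]
    (L : Equiv.Perm (Fin k) →* Matrix ι ι ℤ) (B : SRep R (Equiv.Perm (Fin k))) :
    (B.tw L).fix.sK = ∑ q : Irr k, SRep.mult (SRep.kron L (Quotient.out q : IntIrrep k).ρ) •
      (isotyp B (Quotient.out q)).sK := by
  classical
  rw [((isotypSplitting B).tw L).sK_fix]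
  refine Finset.sum_congr rfl fun q _ => ?_
  rw [(SRep.splittingTwTw L _ _).sK_fix, Fintype.sum_unique, SRep.sK_fix_tw_triv]

/-- Conjugacy to the standard cycle. -/
theorem sum_mul_conj_indicator (hk : 0 < k) (χ : Equiv.Perm (Fin k) → ℤ)
    (hχ : ∀ g h, χ (h * g * h⁻¹) = χ g) :
    ∑ g, (if IsConj g (finRotate k) then (k : ℤ) else 0) * χ g =
      k.factorial * χ (finRotate k) := by
  have hcard : (Finset.univ.filter fun g => IsConj g (finRotate k)).card = (k - 1).factorial := by
    obtain rfl | h2 : k = 1 ∨ 2 ≤ k := by omega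
    · have : (Finset.univ.filter fun g : Equiv.Perm (Fin 1) => IsConj g (finRotate 1)) =
          Finset.univ := by
        refine Finset.filter_true_of_mem fun g _ => ?_
        rw [Subsingleton.elim g (finRotate 1)]
      rw [this]
      rfl
    · have h3 := Equiv.Perm.card_of_cycleType_singleton (α := Fin k) h2 (by simp)
      rw [Fintype.card_fin, Nat.choose_self, mul_one] at h3
      rw [← h3]
      congr 1
      ext g
      simp only [Finset.mem_filter, Finset.mem_univ, true_and]
      rw [Equiv.Perm.isConj_iff_cycleType_eq, cycleType_finRotate_of_le h2]
  have h1 : ∀ g, (if IsConj g (finRotate k) then (k : ℤ) else 0) * χ g =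
      if IsConj g (finRotate k) then (k : ℤ) * χ (finRotate k) else 0 := fun g => by
    split_ifs with h
    · obtain ⟨h, hh⟩ := isConj_iff.mp h
      rw [← hh, hχ]
    · rw [zero_mul]
  simp only [h1]
  rw [← Finset.sum_filter, Finset.sum_const, hcard, nsmul_eq_mul, ← mul_assoc,
    ← Nat.mul_factorial_pred hk.ne']
  push_cast
  ring

/-- A virtual representation whose character is supported by the conjugacy class of the standard
cycle. -/
structure CycleFamily (k : ℕ) (J : Type) [Fintype J] where
  ι : J → Type
  [fintype : ∀ j, Fintype (ι j)]
  [decEq : ∀ j, DecidableEq (ι j)]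
  L : ∀ j, Equiv.Perm (Fin k) →* Matrix (ι j) (ι j) ℤ
  c : J → ℤ
  sum_trace : ∀ g, ∑ j, c j * (L j g).trace = if IsConj g (finRotate k) then (k : ℤ) else 0

attribute [instance] CycleFamily.fintype CycleFamily.decEq

theorem CycleFamily.sum_mult {J : Type} [Fintype J] (F : CycleFamily k J) (hk : 0 < k) {κ : Type}
    [Fintype κ] [DecidableEq κ] (L' : Equiv.Perm (Fin k) →* Matrix κ κ ℤ) :
    ∑ j, F.c j * (SRep.mult (SRep.kron (F.L j) L') : ℤ) = (L' (finRotate k)).trace := by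
  have h0 : (k.factorial : ℤ) ≠ 0 := Nat.cast_ne_zero.mpr k.factorial_ne_zero
  refine mul_left_cancel₀ h0 ?_
  rw [← sum_mul_conj_indicator hk (fun g => (L' g).trace), Finset.mul_sum]
  · have h1 : ∀ j, (k.factorial : ℤ) * (F.c j * (SRep.mult (SRep.kron (F.L j) L') : ℤ)) =
        ∑ g, F.c j * (F.L j g).trace * (L' g).trace := fun j => by
      have h2 := SRep.card_mul_mult (SRep.kron (F.L j) L')
      rw [Fintype.card_perm, Fintype.card_fin] at h2
      rw [mul_left_comm, h2, Finset.mul_sum]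
      simp only [SRep.trace_kron, mul_assoc]
    simp only [h1]
    rw [Finset.sum_comm]
    simp only [← Finset.sum_mul, F.sum_trace]
  · intro g h
    rw [map_mul, Matrix.trace_mul_comm, ← map_mul, inv_mul_cancel_left]

theorem CycleFamily.sX_eq {J : Type} [Fintype J] (F : CycleFamily k J) (hk : 0 < k)
    (B : SRep R (Equiv.Perm (Fin k))) : sX B = ∑ j, F.c j • (B.tw (F.L j)).fix.sK := by
  have h0 : ∀ j, F.c j • (B.tw (F.L j)).fix.sK = ∑ q : Irr k, F.c j •
      SRep.mult (SRep.kron (F.L j) (Quotient.out q : IntIrrep k).ρ) •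
        (isotyp B (Quotient.out q)).sK := fun j => by rw [sK_fix_tw, Finset.smul_sum]
  simp only [h0]
  rw [Finset.sum_comm]
  refine Finset.sum_congr rfl fun q _ => ?_
  have h : ∀ j, F.c j • SRep.mult (SRep.kron (F.L j) (Quotient.out q : IntIrrep k).ρ) •
      (isotyp B (Quotient.out q)).sK = (F.c j * (SRep.mult (SRep.kron (F.L j)
        (Quotient.out q : IntIrrep k).ρ) : ℤ)) • (isotyp B (Quotient.out q)).sK := fun j => by
    rw [mul_smul, natCast_zsmul]
  simp only [h]
  rw [← Finset.sum_smul, F.sum_mult hk]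
  rfl

theorem SRep.Splitting.sX_eq {A : SRep R (Equiv.Perm (Fin k))} {J : Type} [Fintype J]
    [DecidableEq J] {B : J → SRep R (Equiv.Perm (Fin k))} (S : A.Splitting B) :
    sX A = ∑ j, sX (B j) := by
  simp only [sX]
  rw [Finset.sum_comm]
  refine Finset.sum_congr rfl fun q _ => ?_
  rw [(S.tw _).sK_fix, Finset.smul_sum]

theorem CycleFamily.sX_tw_triv {J : Type} [Fintype J] (F : CycleFamily k J) (hk : 0 < k) {κ : Type}
    [Fintype κ] [DecidableEq κ] (L : Equiv.Perm (Fin k) →* Matrix κ κ ℤ) (T : SMod R) :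
    sX ((SRep.triv (Equiv.Perm (Fin k)) T).tw L) = (L (finRotate k)).trace • T.sK := by
  rw [F.sX_eq hk]
  have h : ∀ j, F.c j • (((SRep.triv (Equiv.Perm (Fin k)) T).tw L).tw (F.L j)).fix.sK =
      (F.c j * (SRep.mult (SRep.kron (F.L j) L) : ℤ)) • T.sK := fun j => by
    rw [(SRep.splittingTwTw (F.L j) L _).sK_fix, Fintype.sum_unique, SRep.sK_fix_tw_triv, mul_smul,
      natCast_zsmul]
  simp only [h]
  rw [← Finset.sum_smul, F.sum_mult hk]

end Isotypic

/-! ## Monomial matrices -/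

section Monomial

variable {X : Type} [Fintype X] [DecidableEq X]

/-- The monomial matrix of a signed permutation. -/
def mono (a : Equiv.Perm X) (s : X → ℤˣ) : Matrix X X ℤ :=
  Matrix.of fun x y => if x = a y then (s y : ℤ) else 0

theorem mono_mul (a b : Equiv.Perm X) (s t : X → ℤˣ) :
    mono a s * mono b t = mono (a * b) fun x => s (b x) * t x := by
  ext x y
  rw [Matrix.mul_apply, Finset.sum_eq_single (b y)]
  · simp only [mono, Matrix.of_apply, if_true, ite_mul, zero_mul, Units.val_mul]
    rfl
  · intro z _ hz
    simp [mono, hz]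
  · simp

omit [Fintype X] in
theorem mono_one : mono (1 : Equiv.Perm X) 1 = 1 := by
  ext x y
  rw [Matrix.one_apply]
  rfl

omit [Fintype X] in
theorem neg_mono (a : Equiv.Perm X) (s : X → ℤˣ) : -mono a s = mono a (-s) := by
  ext x y
  simp only [mono, Matrix.neg_apply, Matrix.of_apply, Pi.neg_apply, Units.val_neg]
  split_ifs <;> simp

theorem trace_mono (a : Equiv.Perm X) (s : X → ℤˣ) :
    (mono a s).trace = ∑ x, if a x = x then (s x : ℤ) else 0 := by
  simp [mono, Matrix.trace, eq_comm]

theorem diagonal_mul_mono (w : X → ℤ) (a : Equiv.Perm X) (s : X → ℤˣ) :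
    Matrix.diagonal w * mono a s = mono a s * Matrix.diagonal (w ∘ a) := by
  ext x y
  rw [Matrix.diagonal_mul, Matrix.mul_diagonal]
  simp only [mono, Matrix.of_apply, Function.comp_apply]
  split_ifs with h
  · rw [h, mul_comm]
  · simp

/-- The representation by monomial matrices given by an action and a cocycle. -/
def monoRep {G : Type} [Group G] (a : G →* Equiv.Perm X) (s : G → X → ℤˣ) (h1 : ∀ x, s 1 x = 1)
    (hmul : ∀ g h x, s (g * h) x = s g (a h x) * s h x) : G →* Matrix X X ℤ where
  toFun g := mono (a g) (s g)
  map_one' := by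
    rw [map_one, ← mono_one]
    exact congrArg _ (funext h1)
  map_mul' g h := by
    rw [map_mul, mono_mul]
    exact congrArg _ (funext (hmul g h))

end Monomial

section Exterior

variable {k : ℕ}

/-- The action of permutations on degrees. -/
def degAct (k : ℕ) : Equiv.Perm (Fin k) →* Equiv.Perm (Fin k → ZMod 2) where
  toFun g := g.arrowCongr (.refl _)
  map_one' := rfl
  map_mul' _ _ := rfl

theorem degAct_apply (g : Equiv.Perm (Fin k)) (d : Fin k → ZMod 2) (i : Fin k) :
    degAct k g d i = d (g.symm i) := rfl

/-- The exterior algebra of the permutation representation. -/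
def extRep (k : ℕ) : Equiv.Perm (Fin k) →* Matrix (Fin k → ZMod 2) (Fin k → ZMod 2) ℤ :=
  monoRep (degAct k) koszulSign koszulSign_one fun g h d => koszulSign_mul g h d

/-- The total degree. -/
def wt (d : Fin k → ZMod 2) : Fin (k + 1) :=
  ⟨(Finset.univ.filter fun i => d i = 1).card,
    Nat.lt_succ_of_le ((Finset.card_le_univ _).trans_eq (Fintype.card_fin k))⟩

theorem coe_wt (d : Fin k → ZMod 2) :
    (wt d : ℕ) = (Finset.univ.filter fun i => d i = 1).card := rfl

theorem wt_degAct (g : Equiv.Perm (Fin k)) (d : Fin k → ZMod 2) : wt (degAct k g d) = wt d := by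
  refine Fin.ext ?_
  rw [coe_wt, coe_wt]
  refine Finset.card_bij (fun i _ => g.symm i) ?_ ?_ ?_
  · exact fun i hi => Finset.mem_filter.mpr ⟨Finset.mem_univ _, (Finset.mem_filter.mp hi).2⟩
  · exact fun i _ j _ h => g.symm.injective h
  · intro i hi
    refine ⟨g i, Finset.mem_filter.mpr ⟨Finset.mem_univ _, ?_⟩, g.symm_apply_apply i⟩
    rw [degAct_apply, g.symm_apply_apply]
    exact (Finset.mem_filter.mp hi).2

/-- The action of permutations on degrees of given weight. -/
def degActWt (k : ℕ) (j : Fin (k + 1)) :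
    Equiv.Perm (Fin k) →* Equiv.Perm {d : Fin k → ZMod 2 // wt d = j} where
  toFun g := (degAct k g).subtypeEquiv fun d => by rw [wt_degAct]
  map_one' := rfl
  map_mul' _ _ := rfl

/-- The exterior powers of the permutation representation. -/
def extPowRep (k : ℕ) (j : Fin (k + 1)) :
    Equiv.Perm (Fin k) →* Matrix {d : Fin k → ZMod 2 // wt d = j} {d : Fin k → ZMod 2 // wt d = j} ℤ :=
  monoRep (degActWt k j) (fun g d => koszulSign g d.1) (fun d => koszulSign_one d.1)
    fun g h d => koszulSign_mul g h d.1

/-- Translation of a degree by a basis vector. -/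
def flip (x : Fin k) : Equiv.Perm (Fin k → ZMod 2) where
  toFun d := Function.update d x (d x + 1)
  invFun d := Function.update d x (d x + 1)
  left_inv d := by
    have : ∀ a : ZMod 2, a + 1 + 1 = a := by decide
    simp [this]
  right_inv d := by
    have : ∀ a : ZMod 2, a + 1 + 1 = a := by decide
    simp [this]

theorem flip_apply (x : Fin k) (d : Fin k → ZMod 2) (i : Fin k) :
    flip x d i = if i = x then d i + 1 else d i := by
  simp only [flip, Equiv.coe_fn_mk, Function.update_apply]
  split_ifs with h
  · rw [h]
  · rfl

/-- The sign of the degrees to the left of a place. -/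
def leftSign (d : Fin k → ZMod 2) (x : Fin k) : ℤˣ := ∏ j, if j < x then degSign (d j) else 1

theorem degSign_add_one (a : ZMod 2) : degSign (a + 1) = -degSign a := by
  revert a; decide

theorem leftSign_flip (d : Fin k → ZMod 2) (x y : Fin k) :
    leftSign (flip y d) x = if y < x then -leftSign d x else leftSign d x := by
  have h : leftSign (flip y d) x = leftSign d x * ∏ j, if j = y then (if j < x then -1 else 1) else 1 := by
    rw [leftSign, leftSign, ← Finset.prod_mul_distrib]
    refine Finset.prod_congr rfl fun j _ => ?_
    rw [flip_apply]
    split_ifs <;> simp [degSign_add_one]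
  rw [h, Finset.prod_ite_eq' Finset.univ y, if_pos (Finset.mem_univ _)]
  split_ifs <;> simp

/-- The Clifford generators acting on the exterior algebra of the permutation representation. -/
def cliff (x : Fin k) : Matrix (Fin k → ZMod 2) (Fin k → ZMod 2) ℤ :=
  mono (flip x) fun d => leftSign d x

theorem cliff_mul_self (x : Fin k) : cliff x * cliff x = 1 := by
  rw [cliff, mono_mul, ← mono_one]
  congr 1
  · exact Equiv.ext fun d => (flip x).left_inv d
  · funext d
    rw [leftSign_flip, if_neg (lt_irrefl x), Int.units_mul_self, Pi.one_apply]

theorem cliff_anticomm {x y : Fin k} (h : x ≠ y) : cliff x * cliff y = -(cliff y * cliff x) := by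
  rw [cliff, cliff, mono_mul, mono_mul, neg_mono]
  congr 1
  · refine Equiv.ext fun d => funext fun i => ?_
    simp only [Equiv.Perm.mul_apply, flip_apply]
    split_ifs <;> rfl
  · funext d
    simp only [Pi.neg_apply, leftSign_flip]
    rcases lt_or_gt_of_ne h with h1 | h1 <;> simp [h1, h1.asymm, mul_comm]

theorem extRep_mul_cliff (g : Equiv.Perm (Fin k)) (x : Fin k) :
    extRep k g * cliff x = cliff (g x) * extRep k g := by
  change mono _ _ * mono _ _ = mono _ _ * mono _ _
  rw [mono_mul, mono_mul]
  congr 1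
  · refine Equiv.ext fun d => funext fun i => ?_
    simp only [Equiv.Perm.mul_apply, degAct_apply, flip_apply, Equiv.symm_apply_eq]
  · funext d
    have h := koszulSign_update g d x
    rw [mul_comm] at h
    refine h.trans (Eq.trans (mul_comm _ _) ?_)
    congr 1
    rw [leftSign]
    refine Eq.trans ?_ (Equiv.prod_comp g _)
    simp [degAct_apply]

theorem sum_cliff_sq (s : Finset (Fin k)) :
    (∑ x ∈ s, cliff x) * ∑ x ∈ s, cliff x = (s.card : ℤ) • (1 : Matrix (Fin k → ZMod 2) _ ℤ) := by
  induction s using Finset.induction_on with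
  | empty => simp
  | insert a s ha ih =>
    have h1 : cliff a * ∑ x ∈ s, cliff x = -((∑ x ∈ s, cliff x) * cliff a) := by
      rw [Finset.mul_sum, Finset.sum_mul, ← Finset.sum_neg_distrib]
      refine Finset.sum_congr rfl fun x hx => cliff_anticomm ?_
      rintro rfl
      exact ha hx
    rw [Finset.sum_insert ha, add_mul, mul_add, mul_add, ih, h1, cliff_mul_self,
      Finset.card_insert_of_notMem ha]
    push_cast
    rw [add_smul, one_smul]
    abel

theorem trace_eq_zero_of_anticomm {X : Type} [Fintype X] [DecidableEq X] {A D : Matrix X X ℤ}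
    {n : ℤ} (hn : n ≠ 0) (hD : D * D = n • 1) (h : D * A = -(A * D)) : A.trace = 0 := by
  have h1 : n * A.trace = -(n * A.trace) := by
    calc n * A.trace = (A * (D * D)).trace := by
          rw [hD, Matrix.mul_smul, Matrix.mul_one, Matrix.trace_smul, smul_eq_mul]
      _ = (D * A * D).trace := by rw [← Matrix.mul_assoc, Matrix.trace_mul_comm,
        Matrix.mul_assoc]
      _ = -(n * A.trace) := by
        rw [h, Matrix.neg_mul, Matrix.mul_assoc, hD, Matrix.trace_neg, Matrix.mul_smul,
          Matrix.mul_one, Matrix.trace_smul, smul_eq_mul]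
  have h2 : n * A.trace = 0 := by linarith
  exact (mul_eq_zero.mp h2).resolve_left hn

/-- The sign of the total degree. -/
def totSign (d : Fin k → ZMod 2) : ℤˣ := ∏ j, degSign (d j)

theorem totSign_eq (d : Fin k → ZMod 2) : totSign d = (-1) ^ (wt d : ℕ) := by
  rw [totSign, wt, ← Finset.prod_const, Finset.prod_filter]
  refine Finset.prod_congr rfl fun j _ => ?_
  have : ∀ a : ZMod 2, degSign a = if a = 1 then -1 else 1 := by decide
  exact this _

theorem totSign_flip (x : Fin k) (d : Fin k → ZMod 2) : totSign (flip x d) = -totSign d := by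
  have h : totSign (flip x d) = totSign d * ∏ j, if j = x then -1 else 1 := by
    rw [totSign, totSign, ← Finset.prod_mul_distrib]
    refine Finset.prod_congr rfl fun j _ => ?_
    rw [flip_apply]
    split_ifs <;> simp [degSign_add_one]
  rw [h, Finset.prod_ite_eq' Finset.univ x, if_pos (Finset.mem_univ _), mul_neg_one]

theorem trace_eq_zero_of_not_sameCycle {g : Equiv.Perm (Fin k)} {x y : Fin k}
    (h : ¬ g.SameCycle y x) :
    (Matrix.diagonal (fun d : Fin k → ZMod 2 => if d x = 1 then (totSign d : ℤ) else 0) *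
      extRep k g).trace = 0 := by
  classical
  let O := Finset.univ.filter fun z => g.SameCycle y z
  have hO : O.card ≠ 0 := Finset.card_ne_zero.mpr
    ⟨y, Finset.mem_filter.mpr ⟨Finset.mem_univ _, Equiv.Perm.SameCycle.refl _ _⟩⟩
  refine trace_eq_zero_of_anticomm (Nat.cast_ne_zero.mpr hO) (sum_cliff_sq O) ?_
  have h1 : (∑ z ∈ O, cliff z) * extRep k g = extRep k g * ∑ z ∈ O, cliff z := by
    rw [Finset.mul_sum, Finset.sum_mul]
    refine (Finset.sum_bij (fun z _ => g z) ?_ ?_ ?_ ?_).symm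
    · intro z hz
      simpa [O] using hz
    · exact fun a _ b _ hab => g.injective hab
    · intro z hz
      refine ⟨g⁻¹ z, ?_, by simp⟩
      simpa [O] using hz
    · exact fun z _ => extRep_mul_cliff g z
  rw [Matrix.mul_assoc, ← h1, ← Matrix.mul_assoc, ← Matrix.mul_assoc, ← Matrix.neg_mul]
  congr 1
  rw [Finset.mul_sum, Finset.sum_mul, ← Finset.sum_neg_distrib]
  refine Finset.sum_congr rfl fun z hz => ?_
  have hzx : x ≠ z := by
    rintro rfl
    exact h (Finset.mem_filter.mp hz).2
  rw [cliff, diagonal_mul_mono, ← Matrix.mul_neg, Matrix.diagonal_neg]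
  congr 2
  funext d
  simp only [Function.comp_apply, totSign_flip, flip_apply, if_neg hzx]
  split_ifs <;> simp

theorem koszulSign_const_one (g : Equiv.Perm (Fin k)) :
    koszulSign g (fun _ => 1) = Equiv.Perm.sign g := by
  rw [Equiv.Perm.sign_eq_prod_prod_Iio, koszulSign, Finset.prod_filter, Fintype.prod_prod_type_right]
  refine Finset.prod_congr rfl fun j _ => ?_
  rw [← Finset.prod_subset (Finset.subset_univ (Finset.Iio j))]
  · refine Finset.prod_congr rfl fun i hi => ?_
    have hij := Finset.mem_Iio.mp hi
    have hne : g i ≠ g j := g.injective.ne hij.ne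
    rcases lt_or_gt_of_ne hne with h | h <;> simp [hij, h, h.asymm, swapSign]
  · intro i _ hi
    rw [Finset.mem_Iio] at hi
    simp [hi]

theorem isConj_finRotate_iff (hk : 0 < k) (g : Equiv.Perm (Fin k)) :
    IsConj g (finRotate k) ↔ ∀ x y, g.SameCycle x y := by
  obtain rfl | h2 : k = 1 ∨ 2 ≤ k := by omega
  · refine ⟨fun _ x y => ?_, fun _ => ?_⟩
    · rw [Subsingleton.elim x y]
    · rw [Subsingleton.elim g (finRotate 1)]
  rw [Equiv.Perm.isConj_iff_cycleType_eq, cycleType_finRotate_of_le h2]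
  constructor
  · intro h x y
    have hc : g.IsCycle := Equiv.Perm.card_cycleType_eq_one.mp (by rw [h]; rfl)
    have hs : g.support.card = k := by
      rw [← Equiv.Perm.sum_cycleType, h]
      rfl
    have hu : g.support = Finset.univ := by
      rw [← Finset.card_eq_iff_eq_univ, hs, Fintype.card_fin]
    have hm : ∀ z, g z ≠ z := fun z => Equiv.Perm.mem_support.mp (hu ▸ Finset.mem_univ z)
    exact hc.sameCycle (hm x) (hm y)
  · intro h
    have hm : ∀ z, g z ≠ z := fun z hz => by
      obtain ⟨w, hw⟩ : ∃ w, w ≠ z := by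
        have : Nontrivial (Fin k) := Fin.nontrivial_iff_two_le.mpr h2
        exact exists_ne z
      exact hw ((Equiv.Perm.SameCycle.eq_of_left (h z w) hz).symm)
    have hc : g.IsCycle := ⟨⟨0, hk⟩, hm _, fun y _ => h _ y⟩
    rw [hc.cycleType]
    have hu : g.support = Finset.univ := by
      ext z
      simp [hm z]
    rw [hu, Finset.card_univ, Fintype.card_fin]

theorem sum_trace_extPowRep (hk : 0 < k) (g : Equiv.Perm (Fin k)) :
    ∑ j : Fin (k + 1), ((-1) ^ ((j : ℕ) + 1) * (j : ℕ) : ℤ) * (extPowRep k j g).trace =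
      if IsConj g (finRotate k) then (k : ℤ) else 0 := by
  have h1 : ∑ j : Fin (k + 1), ((-1) ^ ((j : ℕ) + 1) * (j : ℕ) : ℤ) * (extPowRep k j g).trace =
      ∑ d : Fin k → ZMod 2, if degAct k g d = d then
        -(totSign d : ℤ) * (wt d : ℕ) * koszulSign g d else 0 := by
    rw [← (Equiv.sigmaFiberEquiv (wt (k := k))).sum_comp, Fintype.sum_sigma]
    refine Finset.sum_congr rfl fun j _ => ?_
    change _ * (mono _ _).trace = _
    rw [trace_mono, Finset.mul_sum]
    refine Finset.sum_congr rfl fun d _ => ?_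
    have h2 : degActWt k j g d = d ↔ degAct k g d.1 = d.1 := Subtype.ext_iff
    simp only [h2, mul_ite, mul_zero]
    refine if_congr Iff.rfl ?_ rfl
    change _ = -(totSign d.1 : ℤ) * (wt d.1 : ℕ) * koszulSign g d.1
    rw [totSign_eq, d.2]
    push_cast
    ring
  rw [h1]
  split_ifs with h
  · rw [isConj_finRotate_iff hk] at h
    have hfix : ∀ d : Fin k → ZMod 2, degAct k g d = d → ∀ x y, d x = d y := fun d hd x y => by
      have hg : ∀ z, d (g z) = d z := fun z => by
        conv_lhs => rw [← hd]
        simp [degAct_apply]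
      have hn : ∀ (n : ℤ) z, d ((g ^ n) z) = d z := fun n => by
        induction n using Int.induction_on with
        | zero => simp
        | succ n ih => intro z; rw [zpow_add, zpow_one, Equiv.Perm.mul_apply, ih, hg]
        | pred n ih =>
          intro z
          rw [zpow_sub, zpow_one, Equiv.Perm.mul_apply, ih, ← hg]
          simp
      obtain ⟨n, hn'⟩ := h x y
      rw [← hn', hn]
    rw [Finset.sum_eq_single (fun _ => 1)]
    · rw [if_pos (by rfl), koszulSign_const_one, totSign_eq]
      have hw : ((wt fun _ : Fin k => (1 : ZMod 2)) : ℕ) = k := by simp [wt]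
      rw [hw]
      have hs : Equiv.Perm.sign g = -(-1) ^ k := by
        obtain rfl | h2 : k = 1 ∨ 2 ≤ k := by omega
        · rw [Subsingleton.elim g 1]
          simp
        · rw [← isConj_finRotate_iff hk, Equiv.Perm.isConj_iff_cycleType_eq,
            cycleType_finRotate_of_le h2] at h
          rw [Equiv.Perm.sign_of_cycleType, h]
          simp [pow_succ]
      rw [hs]
      have : ((-1 : ℤ) ^ k) * (-1) ^ k = 1 := by rw [← mul_pow]; simp
      push_cast
      linear_combination (k : ℤ) * this
    · intro d _ hd
      split_ifs with hgd
      · have h0 : wt d = 0 := by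
          refine Fin.ext ?_
          rw [coe_wt]
          refine Finset.card_eq_zero.mpr (Finset.filter_eq_empty_iff.mpr fun x _ hx => ?_)
          exact hd (funext fun y => (hfix d hgd y x).trans hx)
        rw [h0]
        simp
      · rfl
    · simp
  · rw [isConj_finRotate_iff hk] at h
    push Not at h
    obtain ⟨y₀, x₀, hxy⟩ := h
    have hx : ∀ x, ∃ y, ¬ g.SameCycle y x := fun x => by
      by_contra! hc
      exact hxy ((hc y₀).trans (hc x₀).symm)
    have h2 : ∀ d : Fin k → ZMod 2, (if degAct k g d = d then
        -(totSign d : ℤ) * (wt d : ℕ) * koszulSign g d else 0) =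
        -∑ x, if degAct k g d = d then (if d x = 1 then (totSign d : ℤ) else 0) * koszulSign g d
          else 0 := fun d => by
      split_ifs with hd
      · rw [← Finset.sum_mul, ← Finset.sum_filter, Finset.sum_const, nsmul_eq_mul]
        simp only [wt]
        ring
      · simp
    simp only [h2]
    rw [Finset.sum_neg_distrib, Finset.sum_comm, neg_eq_zero]
    refine Finset.sum_eq_zero fun x _ => ?_
    obtain ⟨y, hy⟩ := hx x
    refine Eq.trans ?_ (trace_eq_zero_of_not_sameCycle hy)
    rw [Matrix.trace]
    refine Finset.sum_congr rfl fun d _ => ?_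
    rw [Matrix.diag_apply, Matrix.diagonal_mul]
    change _ = _ * (if d = degAct k g d then _ else _)
    simp only [eq_comm (a := d), mul_ite, mul_zero]

/-- The virtual representation `∑ (-1)^{j+1} j Λʲ`. -/
def extFamily (hk : 0 < k) : CycleFamily k (Fin (k + 1)) where
  ι j := {d : Fin k → ZMod 2 // wt d = j}
  L := extPowRep k
  c j := (-1) ^ ((j : ℕ) + 1) * (j : ℕ)
  sum_trace := sum_trace_extPowRep hk

end Exterior

/-! ## Tensor products of super representations -/

section Tensor

variable {R : Type u} [CommRing R] {G : Type} [Group G]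

/-- The tensor product of super representations. -/
noncomputable abbrev SRep.tensor (A B : SRep R G) : SRep R G where
  toSMod := A.toSMod.tensor B.toSMod
  ρ := A.ρ.tprod B.ρ
  ρ_η g x := by
    change (TensorProduct.map (A.ρ g) (B.ρ g) ∘ₗ TensorProduct.map A.η B.η) x =
      (TensorProduct.map A.η B.η ∘ₗ TensorProduct.map (A.ρ g) (B.ρ g)) x
    rw [← TensorProduct.map_comp, ← TensorProduct.map_comp]
    congr 2
    · exact LinearMap.ext (A.ρ_η g)
    · exact LinearMap.ext (B.ρ_η g)

theorem map_apply_map {M M' M'' N N' N'' : Type u} [AddCommGroup M] [Module R M] [AddCommGroup M']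
    [Module R M'] [AddCommGroup M''] [Module R M''] [AddCommGroup N] [Module R N] [AddCommGroup N']
    [Module R N'] [AddCommGroup N''] [Module R N''] (f : M →ₗ[R] M') (f' : M' →ₗ[R] M'')
    (g : N →ₗ[R] N') (g' : N' →ₗ[R] N'') (x : M ⊗[R] N) :
    TensorProduct.map f' g' (TensorProduct.map f g x) = TensorProduct.map (f' ∘ₗ f) (g' ∘ₗ g) x :=
  (LinearMap.congr_fun (TensorProduct.map_comp _ _ _ _) x).symm

/-- The decomposition of a tensor product. -/
noncomputable def SRep.Splitting.tensor {A A' : SRep R G} {J J' : Type} [Fintype J] [Fintype J']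
    [DecidableEq J] {B : J → SRep R G} {B' : J' → SRep R G} (S : A.Splitting B) (S' : A'.Splitting B') :
    (A.tensor A').Splitting fun p : J × J' => (B p.1).tensor (B' p.2) where
  i p := TensorProduct.map (S.i p.1) (S'.i p.2)
  s p := TensorProduct.map (S.s p.1) (S'.s p.2)
  i_η p x := by
    refine (map_apply_map _ _ _ _ x).trans (Eq.trans ?_ (map_apply_map _ _ _ _ x).symm)
    congr 2
    · exact LinearMap.ext (S.i_η p.1)
    · exact LinearMap.ext (S'.i_η p.2)
  s_η p x := by
    refine (map_apply_map _ _ _ _ x).trans (Eq.trans ?_ (map_apply_map _ _ _ _ x).symm)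
    congr 2
    · exact LinearMap.ext (S.s_η p.1)
    · exact LinearMap.ext (S'.s_η p.2)
  i_ρ p g x := by
    refine (map_apply_map _ _ _ _ x).trans (Eq.trans ?_ (map_apply_map _ _ _ _ x).symm)
    congr 2
    · exact LinearMap.ext (S.i_ρ p.1 g)
    · exact LinearMap.ext (S'.i_ρ p.2 g)
  s_ρ p g x := by
    refine (map_apply_map _ _ _ _ x).trans (Eq.trans ?_ (map_apply_map _ _ _ _ x).symm)
    congr 2
    · exact LinearMap.ext (S.s_ρ p.1 g)
    · exact LinearMap.ext (S'.s_ρ p.2 g)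
  s_i p x := by
    refine (map_apply_map _ _ _ _ x).trans ?_
    rw [show S.s p.1 ∘ₗ S.i p.1 = LinearMap.id from LinearMap.ext (S.s_i p.1),
      show S'.s p.2 ∘ₗ S'.i p.2 = LinearMap.id from LinearMap.ext (S'.s_i p.2),
      TensorProduct.map_id, LinearMap.id_apply]
  s_i_of_ne p q h x := by
    refine (map_apply_map _ _ _ _ x).trans ?_
    by_cases h1 : p.1 = q.1
    · have h2 : p.2 ≠ q.2 := fun h2 => h (Prod.ext h1 h2)
      rw [show S'.s p.2 ∘ₗ S'.i q.2 = 0 from LinearMap.ext (S'.s_i_of_ne _ _ h2),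
        TensorProduct.map_zero_right]
      rfl
    · rw [show S.s p.1 ∘ₗ S.i q.1 = 0 from LinearMap.ext (S.s_i_of_ne _ _ h1),
        TensorProduct.map_zero_left]
      rfl
  sum_i_s x := by
    induction x using TensorProduct.induction_on with
    | zero => simp
    | add x y hx hy =>
      simp only [map_add, Finset.sum_add_distrib]
      exact congrArg₂ (· + ·) hx hy
    | tmul x y =>
      conv_rhs => rw [← S.sum_i_s x, ← S'.sum_i_s y]
      rw [Fintype.sum_prod_type, TensorProduct.sum_tmul]
      refine Finset.sum_congr rfl fun a _ => ?_
      rw [TensorProduct.tmul_sum]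
      rfl

/-- The tensor product of two families of copies of modules. -/
noncomputable def piTensorPi (ι κ : Type) [Fintype ι] [Fintype κ] [DecidableEq ι] [DecidableEq κ]
    (M N : Type u) [AddCommGroup M] [Module R M] [AddCommGroup N] [Module R N] :
    (ι × κ → M ⊗[R] N) ≃ₗ[R] (ι → M) ⊗[R] (κ → N) :=
  LinearEquiv.ofLinearMap
    (∑ p : ι × κ, TensorProduct.map (LinearMap.single R _ p.1) (LinearMap.single R _ p.2) ∘ₗ
      LinearMap.proj p)
    (LinearMap.pi fun p => TensorProduct.map (LinearMap.proj p.1) (LinearMap.proj p.2))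
    (TensorProduct.ext' fun a b => by
      simp only [LinearMap.comp_apply, LinearMap.sum_apply, LinearMap.proj_apply,
        LinearMap.pi_apply, TensorProduct.map_tmul, LinearMap.id_apply]
      rw [Fintype.sum_prod_type]
      simp only [← TensorProduct.tmul_sum, ← TensorProduct.sum_tmul]
      congr 1
      · exact LinearMap.sum_single_apply _ a
      · exact LinearMap.sum_single_apply _ b)
    (by
      refine LinearMap.ext fun a => funext fun p => ?_
      simp only [LinearMap.comp_apply, LinearMap.sum_apply, LinearMap.proj_apply,
        LinearMap.pi_apply, map_sum, LinearMap.id_apply]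
      have h : ∀ q : ι × κ, TensorProduct.map (LinearMap.proj p.1) (LinearMap.proj p.2)
          (TensorProduct.map (LinearMap.single R (fun _ : ι => M) q.1)
            (LinearMap.single R (fun _ : κ => N) q.2) (a q)) = if p = q then a q else 0 := fun q => by
        rw [map_apply_map]
        by_cases h1 : p.1 = q.1
        · by_cases h2 : p.2 = q.2
          · rw [if_pos (Prod.ext h1 h2), h1, h2]
            rw [LinearMap.proj_comp_single_same, LinearMap.proj_comp_single_same,
              TensorProduct.map_id, LinearMap.id_apply]
          · rw [if_neg (fun h => h2 (congrArg Prod.snd h)),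
              LinearMap.proj_comp_single_ne _ _ _ _ h2, TensorProduct.map_zero_right]
            rfl
        · rw [if_neg (fun h => h1 (congrArg Prod.fst h)),
            LinearMap.proj_comp_single_ne _ _ _ _ h1, TensorProduct.map_zero_left]
          rfl
      simp only [h, Finset.sum_ite_eq, Finset.mem_univ, if_true])

/-- The tensor product of twisted trivial representations. -/
noncomputable def splittingTensorTw {ι κ : Type} [Fintype ι] [Fintype κ] [DecidableEq ι]
    [DecidableEq κ] (L : G →* Matrix ι ι ℤ) (L' : G →* Matrix κ κ ℤ) (T T' : SMod R) :
    (((SRep.triv G T).tw L).tensor ((SRep.triv G T').tw L')).Splitting fun _ : Unit =>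
      (SRep.triv G (T.tensor T')).tw (SRep.kron L L') :=
  SRep.Splitting.ofEquiv (piTensorPi ι κ T.carrier T'.carrier)
    (fun x => by
      obtain ⟨x, rfl⟩ := (piTensorPi ι κ T.carrier T'.carrier).symm.surjective x
      rw [LinearEquiv.apply_symm_apply, ← LinearEquiv.eq_symm_apply]
      induction x using TensorProduct.induction_on with
      | zero => simp
      | add x y hx hy => rw [map_add, map_add, map_add, hx, hy, map_add]
      | tmul a b => rfl)
    (fun g x => by
      obtain ⟨x, rfl⟩ := (piTensorPi ι κ T.carrier T'.carrier).symm.surjective x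
      rw [LinearEquiv.apply_symm_apply, ← LinearEquiv.eq_symm_apply]
      induction x using TensorProduct.induction_on with
      | zero => simp
      | add x y hx hy => rw [map_add, map_add, map_add, hx, hy, map_add]
      | tmul a b =>
        funext p
        refine (SRep.tw_ρ _ _ _ _ _).trans ?_
        change _ = (((SRep.triv G T).tw L).ρ g a p.1) ⊗ₜ[R] (((SRep.triv G T').tw L').ρ g b p.2)
        rw [SRep.tw_ρ, SRep.tw_ρ, TensorProduct.sum_tmul, Fintype.sum_prod_type]
        refine Finset.sum_congr rfl fun x _ => ?_
        rw [TensorProduct.tmul_sum]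
        refine Finset.sum_congr rfl fun y _ => ?_
        simp only [← Int.cast_smul_eq_zsmul R, TensorProduct.smul_tmul_smul]
        rw [← Int.cast_mul]
        rfl)

variable {k : ℕ} [Invertible (2 : R)] [Invertible ((k.factorial : ℕ) : R)]

theorem sX_tensor (hk : 0 < k) (A B : SRep R (Equiv.Perm (Fin k))) :
    sX (A.tensor B) = sX A * sX B := by
  classical
  rw [((isotypSplitting A).tensor (isotypSplitting B)).sX_eq]
  have h : ∀ p : Irr k × Irr k, sX (((SRep.triv (Equiv.Perm (Fin k))
      (isotyp A (Quotient.out p.1))).tw (Quotient.out p.1 : IntIrrep k).ρ).tensor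
      ((SRep.triv (Equiv.Perm (Fin k))
      (isotyp B (Quotient.out p.2))).tw (Quotient.out p.2 : IntIrrep k).ρ)) =
      ((Quotient.out p.1 : IntIrrep k).char (finRotate k) • (isotyp A (Quotient.out p.1)).sK) *
      ((Quotient.out p.2 : IntIrrep k).char (finRotate k) • (isotyp B (Quotient.out p.2)).sK) :=
    fun p => by
    rw [(splittingTensorTw _ _ _ _).sX_eq, Fintype.sum_unique, (extFamily hk).sX_tw_triv hk,
      SRep.trace_kron, SMod.sK_tensor, smul_mul_smul_comm]
    rfl
  rw [Finset.sum_congr rfl fun p _ => h p, Fintype.sum_prod_type, sX, sX, Finset.sum_mul_sum]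

/-- The alternating sum of the exterior powers of the permutation representation vanishes. -/
theorem sum_extPow_sK (hk : 0 < k) (B : SRep R (Equiv.Perm (Fin k))) :
    ∑ j : Fin (k + 1), ((-1) ^ (j : ℕ) : ℤ) • (B.tw (extPowRep k j)).fix.sK = 0 := by
  have htr : ∀ g, ∑ j : Fin (k + 1), ((-1) ^ (j : ℕ) : ℤ) * (extPowRep k j g).trace = 0 := fun g => by
    have h1 : (Matrix.diagonal (fun d : Fin k → ZMod 2 => (totSign d : ℤ)) *
        extRep k g).trace = 0 := by
      refine trace_eq_zero_of_anticomm (n := (Finset.univ : Finset (Fin k)).card)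
        (by simpa using hk.ne') (sum_cliff_sq Finset.univ) ?_
      have h1 : (∑ z, cliff z) * extRep k g = extRep k g * ∑ z, cliff z := by
        rw [Finset.mul_sum, Finset.sum_mul]
        simp only [extRep_mul_cliff]
        exact (Equiv.sum_comp g fun z => cliff z * extRep k g).symm
      rw [Matrix.mul_assoc, ← h1, ← Matrix.mul_assoc, ← Matrix.mul_assoc, ← Matrix.neg_mul]
      congr 1
      rw [Finset.mul_sum, Finset.sum_mul, ← Finset.sum_neg_distrib]
      refine Finset.sum_congr rfl fun z hz => ?_
      rw [cliff, diagonal_mul_mono, ← Matrix.mul_neg, Matrix.diagonal_neg]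
      congr 2
      funext d
      simp only [Function.comp_apply, totSign_flip]
      simp
    rw [← h1, Matrix.trace, ← (Equiv.sigmaFiberEquiv (wt (k := k))).sum_comp, Fintype.sum_sigma]
    refine Finset.sum_congr rfl fun j _ => ?_
    change _ * (mono _ _).trace = _
    rw [trace_mono, Finset.mul_sum]
    refine Finset.sum_congr rfl fun d _ => ?_
    rw [Matrix.diag_apply, Matrix.diagonal_mul]
    change _ = (totSign d.1 : ℤ) * (if d.1 = degAct k g d.1 then (koszulSign g d.1 : ℤ) else 0)
    have h2 : degActWt k j g d = d ↔ d.1 = degAct k g d.1 := Subtype.ext_iff.trans eq_comm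
    simp only [h2, mul_ite, mul_zero]
    refine if_congr Iff.rfl ?_ rfl
    rw [totSign_eq, d.2]
    push_cast
    ring
  have h0 : ∀ j : Fin (k + 1), ((-1) ^ (j : ℕ) : ℤ) • (B.tw (extPowRep k j)).fix.sK =
      ∑ q : Irr k, (((-1) ^ (j : ℕ) : ℤ) *
        (SRep.mult (SRep.kron (extPowRep k j) (Quotient.out q : IntIrrep k).ρ) : ℤ)) •
        (isotyp B (Quotient.out q)).sK := fun j => by
    rw [sK_fix_tw, Finset.smul_sum]
    simp only [mul_smul, natCast_zsmul]
  simp only [h0]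
  rw [Finset.sum_comm]
  refine Finset.sum_eq_zero fun q _ => ?_
  rw [← Finset.sum_smul]
  refine Eq.trans (congrArg (· • _) ?_) (zero_smul ℤ _)
  have h0 : (k.factorial : ℤ) ≠ 0 := Nat.cast_ne_zero.mpr k.factorial_ne_zero
  refine mul_left_cancel₀ h0 ?_
  rw [mul_zero, Finset.mul_sum]
  have h1 : ∀ j : Fin (k + 1), (k.factorial : ℤ) * ((-1) ^ (j : ℕ) * (SRep.mult (SRep.kron (extPowRep k j)
      (Quotient.out q : IntIrrep k).ρ) : ℤ)) =
      ∑ g, (-1) ^ (j : ℕ) * (extPowRep k j g).trace * ((Quotient.out q : IntIrrep k).ρ g).trace :=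
    fun j => by
    have h2 := SRep.card_mul_mult (SRep.kron (extPowRep k j) (Quotient.out q : IntIrrep k).ρ)
    rw [Fintype.card_perm, Fintype.card_fin] at h2
    rw [mul_left_comm, h2, Finset.mul_sum]
    simp only [SRep.trace_kron, mul_assoc]
  simp only [h1]
  rw [Finset.sum_comm]
  simp only [← Finset.sum_mul, htr, zero_mul, Finset.sum_const_zero]

end Tensor

/-! ## Idempotents of super modules -/

section Range

variable {R : Type u} [CommRing R]

/-- The image of an even idempotent. -/
abbrev SMod.range (N : SMod R) (p : Module.End R N.carrier) (hp : ∀ x, p (p x) = p x)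
    (hη : ∀ x, p (N.η x) = N.η (p x)) : SMod R :=
  have h1 : p.rangeRestrict ∘ₗ (LinearMap.range p).subtype = LinearMap.id := by
    refine LinearMap.ext fun x => Subtype.ext ?_
    obtain ⟨y, hy⟩ := x.2
    change p x.1 = x.1
    rw [← hy, hp]
  { carrier := LinearMap.range p
    finite := inferInstance
    projective := Module.Projective.of_split _ _ h1
    η := N.η.restrict fun x hx => by
      obtain ⟨y, rfl⟩ := hx
      exact ⟨N.η y, hη y⟩
    η_sq := fun x => Subtype.ext (N.η_sq x.1) }

/-- The same module with the grading multiplied by a sign. -/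
abbrev SMod.signed (N : SMod R) (u : ℤˣ) : SMod R where
  carrier := N.carrier
  η := sgn R u • N.η
  η_sq x := by
    simp only [LinearMap.smul_apply, map_smul, N.η_sq, smul_smul, sgn_mul_self, one_smul]

variable [Invertible (2 : R)]

theorem SMod.sK_signed (N : SMod R) (u : ℤˣ) : (N.signed u).sK = (u : ℤ) • N.sK := by
  have key : ∀ a b, degSign a = u * degSign b → ((N.signed u).part a).cls = (N.part b).cls :=
    fun a b h => by
    refine FGProj.cls_eq_of_equiv (LinearEquiv.ofEq _ _ (Submodule.ext fun x => ?_))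
    rw [SMod.mem_homog, SMod.mem_homog, h, map_mul, mul_smul, LinearMap.smul_apply]
    constructor
    · intro hx
      have := congrArg (sgn R u • ·) hx
      simpa only [smul_smul, sgn_mul_self, one_smul, ← mul_assoc, one_mul] using this
    · intro hx
      rw [hx]
  obtain rfl | rfl := Int.units_eq_one_or u
  · rw [SMod.sK, SMod.sK, key 0 0 (by simp), key 1 1 (by simp)]
    simp
  · rw [SMod.sK, SMod.sK, key 0 1 (by decide), key 1 0 (by decide)]
    simp

theorem SMod.sK_eq_zero_of_odd_bijective (N : SMod R) (e : Module.End R N.carrier)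
    (he : Function.Bijective e) (h : ∀ x, e (N.η x) = -N.η (e x)) : N.sK = 0 := by
  have h2 : ∀ a, sgn R (degSign (a + 1)) = -sgn R (degSign a) := fun a => by
    rw [degSign_add_one]
    simp [sgn]
  have h' : ∀ a b, b = a + 1 → ∀ x, x ∈ N.homog a ↔ e x ∈ N.homog b := fun a b hab x => by
    rw [SMod.mem_homog, SMod.mem_homog, ← he.1.eq_iff, h, map_smul, hab, h2, neg_smul, neg_eq_iff_eq_neg]
  rw [SMod.sK, sub_eq_zero]
  refine FGProj.cls_eq_of_equiv (LinearEquiv.ofBijective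
    (e.restrict fun x hx => (h' 0 1 (by decide) x).mp hx) ⟨fun x y hxy => ?_, fun y => ?_⟩)
  · exact Subtype.ext (he.1 (congrArg Subtype.val hxy))
  · obtain ⟨x, hx⟩ := he.2 y.1
    exact ⟨⟨x, (h' 0 1 (by decide) x).mpr (hx ▸ y.2)⟩, Subtype.ext hx⟩

/-- A bijection which exchanges the summands of opposite signs. -/
theorem SMod.sum_sK_range_eq_zero (N : SMod R) {J : Type} [Fintype J] [DecidableEq J]
    (q : J → Module.End R N.carrier) (hq : ∀ j, q j * q j = q j)
    (hqq : ∀ i j, i ≠ j → q i * q j = 0) (hη : ∀ j x, q j (N.η x) = N.η (q j x)) (u : J → ℤˣ)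
    (D : Module.End R N.carrier) (hD : Function.Bijective D) (hDη : ∀ x, D (N.η x) = N.η (D x))
    (hDq : D * ∑ j, q j = (∑ j, q j) * D)
    (hDu : D * ∑ j, (u j : ℤ) • q j = -((∑ j, (u j : ℤ) • q j) * D)) :
    ∑ j, (u j : ℤ) • (N.range (q j) (fun x => LinearMap.congr_fun (hq j) x) (hη j)).sK = 0 := by
  let e := ∑ j, q j
  let θ := ∑ j, (u j : ℤ) • q j
  have hqe : ∀ i, q i * e = q i := fun i => by
    rw [Finset.mul_sum, Finset.sum_eq_single i (fun j _ h => hqq i j h.symm) (by simp), hq]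
  have heq : ∀ i, e * q i = q i := fun i => by
    rw [Finset.sum_mul, Finset.sum_eq_single i (fun j _ h => hqq j i h) (by simp), hq]
  have hqθ : ∀ i, q i * θ = (u i : ℤ) • q i := fun i => by
    rw [Finset.mul_sum, Finset.sum_eq_single i (fun j _ h => by rw [mul_smul_comm, hqq i j h.symm,
      smul_zero]) (by simp), mul_smul_comm, hq]
  have hθq : ∀ i, θ * q i = (u i : ℤ) • q i := fun i => by
    rw [Finset.sum_mul, Finset.sum_eq_single i (fun j _ h => by rw [smul_mul_assoc, hqq j i h,
      smul_zero]) (by simp), smul_mul_assoc, hq]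
  have hee : e * e = e := by
    conv_lhs => rw [show e * e = ∑ j, q j * e from Finset.sum_mul _ _ _]
    simp [hqe, e]
  have heθ : e * θ = θ := by
    conv_lhs => rw [show e * θ = ∑ j, q j * θ from Finset.sum_mul _ _ _]
    exact Finset.sum_congr rfl fun j _ => hqθ j
  have hθθ : θ * θ = e := by
    conv_lhs => rw [show θ * θ = ∑ j, ((u j : ℤ) • q j) * θ from Finset.sum_mul _ _ _]
    refine Finset.sum_congr rfl fun j _ => ?_
    rw [smul_mul_assoc, hqθ, smul_smul, ← Units.val_mul, Int.units_mul_self, Units.val_one, one_smul]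
  have hηe : ∀ x, e (N.η x) = N.η (e x) := fun x => by
    simp only [e, LinearMap.sum_apply, hη, map_sum]
  have hηθ : ∀ x, θ (N.η x) = N.η (θ x) := fun x => by
    simp only [θ, LinearMap.sum_apply, LinearMap.smul_apply, hη, map_sum, map_zsmul]
  have hmem : ∀ x ∈ LinearMap.range e, e x = x := fun x hx => by
    obtain ⟨y, rfl⟩ := hx
    exact LinearMap.congr_fun hee y
  have hθθ' : ∀ x ∈ LinearMap.range e, θ (θ x) = x := fun x hx =>
    (LinearMap.congr_fun hθθ x).trans (hmem x hx)
  let P := N.range e (fun x => LinearMap.congr_fun hee x) hηe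
  let N' : SMod R :=
    { P with
      η := (N.η * θ).restrict fun x hx => by
        rw [← hmem x hx]
        refine ⟨N.η (θ (e x)), ?_⟩
        rw [hηe]
        exact congrArg N.η (LinearMap.congr_fun heθ (e x))
      η_sq := fun x => Subtype.ext (by
        change N.η (θ (N.η (θ x.1))) = x.1
        rw [hηθ, N.η_sq, hθθ' x.1 x.2]) }
  have h0 : N'.sK = 0 := by
    refine N'.sK_eq_zero_of_odd_bijective (D.restrict fun x hx => ?_) ⟨fun x y hxy => ?_, fun y => ?_⟩
      fun x => Subtype.ext ?_
    · obtain ⟨y, rfl⟩ := hx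
      exact ⟨D y, (LinearMap.congr_fun hDq y).symm⟩
    · exact Subtype.ext (hD.1 (congrArg Subtype.val hxy))
    · obtain ⟨x, hx⟩ := hD.2 y.1
      refine ⟨⟨e x, ⟨x, rfl⟩⟩, Subtype.ext ?_⟩
      change D (e x) = y.1
      refine (LinearMap.congr_fun hDq x).trans ?_
      change e (D x) = y.1
      rw [hx, hmem y.1 y.2]
    · change D (N.η (θ x.1)) = -(N.η (θ (D x.1)))
      rw [hDη, ← map_neg]
      exact congrArg N.η (LinearMap.congr_fun hDu x.1)
  rw [← h0]
  simp only [← SMod.sK_signed]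
  have hqmem : ∀ j, ∀ x ∈ LinearMap.range (q j), q j x = x := fun j x hx => by
    obtain ⟨y, rfl⟩ := hx
    exact LinearMap.congr_fun (hq j) y
  have hzs : ∀ (v : ℤˣ) (x : N.carrier), (v : ℤ) • x = sgn R v • x := fun v x =>
    (Int.cast_smul_eq_zsmul R _ _).symm
  symm
  refine N'.sK_eq_sum
    (fun j => ((N.range (q j) (fun x => LinearMap.congr_fun (hq j) x) (hη j)).signed (u j)))
    (fun j => Submodule.inclusion fun x hx => ⟨x, (by
      rw [← hqmem j x hx]; exact LinearMap.congr_fun (heq j) x)⟩)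
    (fun j => (q j).rangeRestrict ∘ₗ Submodule.subtype _) ?_ ?_ ?_ ?_ ?_
  · intro j x
    refine Subtype.ext ?_
    change sgn R (u j) • N.η x.1 = N.η (θ x.1)
    rw [← map_smul, ← hzs]
    have h3 := LinearMap.congr_fun (hθq j) x.1
    rw [LinearMap.smul_apply, Module.End.mul_apply, hqmem j x.1 x.2] at h3
    rw [h3]
  · intro j x
    refine Subtype.ext ?_
    change q j (N.η (θ x.1)) = sgn R (u j) • N.η (q j x.1)
    rw [hη, ← map_smul, ← hzs]
    exact congrArg N.η (LinearMap.congr_fun (hqθ j) x.1)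
  · exact fun j x => Subtype.ext (hqmem j x.1 x.2)
  · intro j l hjl x
    refine Subtype.ext ?_
    change q j x.1 = 0
    rw [← hqmem l x.1 x.2]
    exact LinearMap.congr_fun (hqq j l hjl) x.1
  · intro x
    refine Subtype.ext ?_
    rw [Submodule.coe_sum]
    refine Eq.trans ?_ (hmem x.1 x.2)
    exact (LinearMap.sum_apply _ _ _).symm

end Range

/-! ## Weighted decompositions -/

section Weighted

variable {R : Type u} [CommRing R] {G : Type} [Group G]

theorem SRep.mem_fix_monoRep {X : Type} [Fintype X] [DecidableEq X] {a : G →* Equiv.Perm X}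
    {s : G → X → ℤˣ} {h1 : ∀ x, s 1 x = 1} {hmul : ∀ g h x, s (g * h) x = s g (a h x) * s h x}
    {B : SRep R G} {t : X → B.carrier} :
    t ∈ (B.tw (monoRep a s h1 hmul)).ρ.invariants ↔
      ∀ g x, t (a g x) = sgn R (s g x) • B.ρ g (t x) := by
  rw [SRep.mem_fix_tw]
  refine forall_congr' fun g => ?_
  have h : ∀ x, ∑ y, monoRep a s h1 hmul g x y • B.ρ g (t y) =
      sgn R (s g ((a g).symm x)) • B.ρ g (t ((a g).symm x)) := fun x => by
    rw [Finset.sum_eq_single ((a g).symm x)]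
    · change (if x = a g ((a g).symm x) then (s g ((a g).symm x) : ℤ) else 0) • _ = _
      rw [if_pos (by simp), ← Int.cast_smul_eq_zsmul R]
      rfl
    · intro y _ hy
      change (if x = a g y then (s g y : ℤ) else 0) • _ = _
      rw [if_neg, zero_smul]
      rintro rfl
      simp at hy
    · simp
  simp only [h]
  constructor
  · intro h x
    rw [← h, Equiv.symm_apply_apply]
  · intro h x
    rw [← h, Equiv.apply_symm_apply]

variable {k : ℕ} [Invertible (2 : R)] [Invertible ((k.factorial : ℕ) : R)]

theorem sX_eq_sum_range (hk : 0 < k) (B : SRep R (Equiv.Perm (Fin k))) {J : Type} [Fintype J]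
    [DecidableEq J] (q : J → Module.End R (B.tw (extRep k)).fix.carrier)
    (hq : ∀ j x, q j (q j x) = q j x) (hqq : ∀ i j, i ≠ j → ∀ x, q i (q j x) = 0)
    (hη : ∀ j x, q j ((B.tw (extRep k)).fix.η x) = (B.tw (extRep k)).fix.η (q j x))
    (hsum : ∀ x, ∑ j, q j x = x) (w : J → ℕ)
    (hw : ∀ j x d, (wt d : ℕ) ≠ w j → (q j x).1 d = 0) :
    sX B = ∑ j, ((-1) ^ (w j + 1) * (w j : ℤ)) •
      ((B.tw (extRep k)).fix.range (q j) (hq j) (hη j)).sK := by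
  have hres : ∀ (i : Fin (k + 1)) (t : (B.tw (extRep k)).ρ.invariants),
      (fun d : {d : Fin k → ZMod 2 // wt d = i} => t.1 d.1) ∈
        (B.tw (extPowRep k i)).ρ.invariants := fun i t => by
    refine SRep.mem_fix_monoRep.mpr fun g d => ?_
    exact SRep.mem_fix_monoRep.mp t.2 g d.1
  have hext : ∀ (i : Fin (k + 1)) (t : (B.tw (extPowRep k i)).ρ.invariants),
      (fun d : Fin k → ZMod 2 => if h : wt d = i then t.1 ⟨d, h⟩ else 0) ∈
        (B.tw (extRep k)).ρ.invariants := fun i t => by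
    refine SRep.mem_fix_monoRep.mpr fun g d => ?_
    by_cases hd : wt d = i
    · have hd' : wt (degAct k g d) = i := (wt_degAct g d).trans hd
      rw [dif_pos hd, dif_pos hd']
      exact SRep.mem_fix_monoRep.mp t.2 g ⟨d, hd⟩
    · have hd' : wt (degAct k g d) ≠ i := fun h => hd ((wt_degAct g d).symm.trans h)
      rw [dif_neg hd, dif_neg hd', map_zero, smul_zero]
  let res : ∀ i : Fin (k + 1), (B.tw (extRep k)).ρ.invariants →ₗ[R]
      (B.tw (extPowRep k i)).ρ.invariants := fun i =>
    { toFun := fun t => ⟨_, hres i t⟩, map_add' := fun _ _ => rfl, map_smul' := fun _ _ => rfl }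
  let ext : ∀ i : Fin (k + 1), (B.tw (extPowRep k i)).ρ.invariants →ₗ[R]
      (B.tw (extRep k)).ρ.invariants := fun i =>
    { toFun := fun t => ⟨_, hext i t⟩
      map_add' := fun x y => Subtype.ext (funext fun d => by
        change (if h : wt d = i then x.1 ⟨d, h⟩ + y.1 ⟨d, h⟩ else 0) =
          (if h : wt d = i then x.1 ⟨d, h⟩ else 0) + if h : wt d = i then y.1 ⟨d, h⟩ else 0
        split_ifs <;> simp)
      map_smul' := fun r x => Subtype.ext (funext fun d => by
        change (if h : wt d = i then r • x.1 ⟨d, h⟩ else 0) =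
          r • (if h : wt d = i then x.1 ⟨d, h⟩ else 0)
        split_ifs <;> simp) }
  have hres_ext : ∀ i t, res i (ext i t) = t := fun i t =>
    Subtype.ext (funext fun d => dif_pos d.2)
  have hext_res : ∀ (i : Fin (k + 1)) j, w j = (i : ℕ) → ∀ t, ext i (res i (q j t)) = q j t := fun i j hij t => by
    refine Subtype.ext (funext fun d => ?_)
    change (if h : wt d = i then (q j t).1 d else 0) = _
    split_ifs with h
    · rfl
    · exact (hw j t d fun h' => h (Fin.ext (h'.trans hij))).symm
  have hres_q : ∀ (i : Fin (k + 1)) j, w j ≠ (i : ℕ) → ∀ t, res i (q j t) = 0 := fun i j hij t => by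
    refine Subtype.ext (funext fun d => ?_)
    exact hw j t d.1 fun h' => hij (by rw [← h', d.2])
  have hmem : ∀ j, ∀ x ∈ LinearMap.range (q j), q j x = x := fun j x hx => by
    obtain ⟨y, rfl⟩ := hx
    exact hq j y
  have key : ∀ i : Fin (k + 1), (B.tw (extPowRep k i)).fix.sK =
      ∑ j : {j // w j = (i : ℕ)}, ((B.tw (extRep k)).fix.range (q j) (hq j) (hη j)).sK := fun i => by
    refine SMod.sK_eq_sum _ _ (fun j => res i ∘ₗ Submodule.subtype _)
      (fun j => (q j).rangeRestrict ∘ₗ ext i) ?_ ?_ ?_ ?_ ?_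
    · exact fun j x => rfl
    · intro j x
      refine Subtype.ext ?_
      refine Eq.trans (congrArg (q j) ?_) (hη j (ext i x))
      refine Subtype.ext (funext fun d => ?_)
      change (if h : wt d = i then B.η (x.1 ⟨d, h⟩) else 0) =
        B.η (if h : wt d = i then x.1 ⟨d, h⟩ else 0)
      split_ifs <;> simp
    · intro j x
      refine Subtype.ext ?_
      change q j (ext i (res i x.1)) = x.1
      rw [← hmem j x.1 x.2, hext_res i j j.2, hq]
    · intro j l hjl x
      refine Subtype.ext ?_
      change q j (ext i (res i x.1)) = 0
      rw [← hmem l x.1 x.2, hext_res i l l.2]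
      exact hqq j l (fun h => hjl (Subtype.ext h)) _
    · intro x
      change ∑ j : {j // w j = (i : ℕ)}, res i (q j (ext i x)) = x
      conv_rhs => rw [← hres_ext i x, ← hsum (ext i x), map_sum]
      rw [← Finset.sum_subtype (Finset.univ.filter fun j => w j = (i : ℕ)) (by simp)
        (fun j => res i (q j (ext i x)))]
      refine Finset.sum_subset (Finset.subset_univ _) fun j _ hj => hres_q i j ?_ _
      simpa using hj
  rw [(extFamily hk).sX_eq hk]
  change ∑ i : Fin (k + 1), ((-1) ^ ((i : ℕ) + 1) * (i : ℕ) : ℤ) • (B.tw (extPowRep k i)).fix.sK = _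
  have h1 : ∀ i : Fin (k + 1), ((-1) ^ ((i : ℕ) + 1) * (i : ℕ) : ℤ) •
      (B.tw (extPowRep k i)).fix.sK = ∑ j, if w j = (i : ℕ) then ((-1) ^ (w j + 1) * (w j : ℤ)) •
      ((B.tw (extRep k)).fix.range (q j) (hq j) (hη j)).sK else 0 := fun i => by
    rw [key, ← Finset.sum_subtype (Finset.univ.filter fun j => w j = (i : ℕ)) (by simp)
        (fun j => ((B.tw (extRep k)).fix.range (q j) (hq j) (hη j)).sK), Finset.smul_sum,
      Finset.sum_filter]
    refine Finset.sum_congr rfl fun j _ => ?_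
    split_ifs with h
    · rw [h]
    · rfl
  simp only [h1]
  rw [Finset.sum_comm]
  refine Finset.sum_congr rfl fun j _ => ?_
  by_cases hj : w j < k + 1
  · rw [Finset.sum_eq_single ⟨w j, hj⟩, if_pos rfl]
    · intro i _ hi
      rw [if_neg fun h => hi (Fin.ext h.symm)]
    · simp
  · have h0 : ∀ x, q j x = 0 := fun x => Subtype.ext (funext fun d =>
      hw j x d fun h => hj (h ▸ (wt d).2))
    have : Subsingleton ((B.tw (extRep k)).fix.range (q j) (hq j) (hη j)).carrier := by
      refine ⟨fun x y => Subtype.ext ?_⟩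
      rw [← hmem j x.1 x.2, ← hmem j y.1 y.2, h0, h0]
    rw [Finset.sum_eq_zero fun i _ => if_neg fun h : w j = (i : Fin (k + 1)) =>
        hj (h.symm ▸ i.2), SMod.sK_eq_zero_of_odd_bijective _
      0 ⟨fun x y _ => Subsingleton.elim _ _, fun y => ⟨y, Subsingleton.elim _ _⟩⟩
      (fun x => Subsingleton.elim _ _), smul_zero]

end Weighted

/-! ## Mixed representations -/

section Mixed

variable {R : Type u} [CommRing R] {X : Type} [Fintype X]
  {M : Type u} [AddCommGroup M] [Module R M]

/-- The action of a matrix on families. -/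
def matAct (A : Matrix X X R) : Module.End R (X → M) :=
  LinearMap.pi fun x => ∑ y, A x y • LinearMap.proj y

theorem matAct_apply (A : Matrix X X R) (t : X → M) (x : X) :
    matAct A t x = ∑ y, A x y • t y := by
  simp [matAct, LinearMap.sum_apply]

theorem matAct_mul (A B : Matrix X X R) (t : X → M) :
    matAct A (matAct B t) = matAct (A * B) t := by
  funext x
  simp only [matAct_apply, Matrix.mul_apply, Finset.smul_sum, Finset.sum_smul, smul_smul]
  exact Finset.sum_comm

theorem matAct_comp (A : Matrix X X R) (f : Module.End R M) (t : X → M) :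
    matAct A (f.compLeft X t) = f.compLeft X (matAct A t) := by
  funext x
  simp [matAct_apply]

theorem matAct_diagonal [DecidableEq X] (w : X → R) (t : X → M) (x : X) :
    matAct (Matrix.diagonal w) t x = w x • t x := by
  rw [matAct_apply, Finset.sum_eq_single x]
  · rw [Matrix.diagonal_apply_eq]
  · intro y _ hy
    rw [Matrix.diagonal_apply_ne _ hy.symm, zero_smul]
  · simp

variable {I : Type} [Fintype I]

/-- The operator given by a family of matrices, one for each summand of a decomposition. -/
def blockAct (δ : I → Module.End R M) (A : I → Matrix X X R) : Module.End R (X → M) :=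
  ∑ s, matAct (A s) ∘ₗ (δ s).compLeft X

theorem blockAct_apply (δ : I → Module.End R M) (A : I → Matrix X X R) (t : X → M) :
    blockAct δ A t = ∑ s, matAct (A s) ((δ s).compLeft X t) := by
  rw [blockAct, LinearMap.sum_apply]
  rfl

theorem blockAct_mul {δ : I → Module.End R M} (hδ : ∀ s x, δ s (δ s x) = δ s x)
    (hδδ : ∀ s s', s ≠ s' → ∀ x, δ s (δ s' x) = 0) (A B : I → Matrix X X R) :
    blockAct δ A * blockAct δ B = blockAct δ (A * B) := by
  refine LinearMap.ext fun t => ?_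
  rw [Module.End.mul_apply, blockAct_apply, blockAct_apply, blockAct_apply]
  refine Finset.sum_congr rfl fun s _ => ?_
  rw [map_sum, Finset.sum_eq_single s]
  · rw [← matAct_comp, matAct_mul]
    exact congrArg _ (funext fun x => hδ s _)
  · intro s' _ hs'
    rw [← matAct_comp]
    have : (δ s).compLeft X ((δ s').compLeft X t) = 0 := funext fun x => hδδ s s' hs'.symm _
    rw [this, map_zero]
  · simp

theorem blockAct_one [DecidableEq X] {δ : I → Module.End R M} (hδ : ∀ x, ∑ s, δ s x = x) :
    blockAct δ (1 : I → Matrix X X R) = 1 := by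
  refine LinearMap.ext fun t => funext fun x => ?_
  rw [blockAct_apply, Finset.sum_apply]
  refine Eq.trans (Finset.sum_congr rfl fun s _ => ?_) (hδ (t x))
  rw [Pi.one_apply, ← Matrix.diagonal_one, matAct_diagonal, one_smul]
  rfl

theorem blockAct_congr {δ : I → Module.End R M} {A B : I → Matrix X X R}
    (h : ∀ s, δ s = 0 ∨ A s = B s) : blockAct δ A = blockAct δ B := by
  refine Finset.sum_congr rfl fun s _ => ?_
  obtain h | h := h s
  · have : (δ s).compLeft X = 0 := by
      rw [h]
      rfl
    rw [this, LinearMap.comp_zero, LinearMap.comp_zero]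
  · rw [h]

theorem blockAct_sum {J : Type} (u : Finset J) (δ : I → Module.End R M)
    (A : J → I → Matrix X X R) :
    blockAct δ (∑ j ∈ u, A j) = ∑ j ∈ u, blockAct δ (A j) := by
  refine LinearMap.ext fun t => funext fun x => ?_
  simp only [LinearMap.sum_apply, blockAct_apply, Finset.sum_apply, matAct_apply, Matrix.sum_apply,
    Finset.sum_smul]
  rw [Finset.sum_comm (s := u)]
  refine Finset.sum_congr rfl fun s _ => Finset.sum_comm

theorem blockAct_smul (δ : I → Module.End R M) (n : ℤ) (A : I → Matrix X X R) :
    blockAct δ (n • A) = n • blockAct δ A := by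
  refine LinearMap.ext fun t => funext fun x => ?_
  simp only [LinearMap.smul_apply, Pi.smul_apply, blockAct_apply, Finset.sum_apply, matAct_apply,
    Matrix.smul_apply, Finset.smul_sum, smul_assoc]

theorem blockAct_neg (δ : I → Module.End R M) (A : I → Matrix X X R) :
    blockAct δ (-A) = -blockAct δ A := by
  have := blockAct_smul δ (-1) A
  simpa using this

/-- The matrix of a representation, with coefficients in a ring. -/
abbrev castM (R : Type u) [CommRing R] [DecidableEq X] : Matrix X X ℤ →+* Matrix X X R :=
  (Int.castRingHom R).mapMatrix

theorem tw_ρ_eq [DecidableEq X] {G : Type} [Group G] (L : G →* Matrix X X ℤ) (B : SRep R G) (g : G)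
    (t : X → B.carrier) : (B.tw L).ρ g t = matAct (castM R (L g)) ((B.ρ g).compLeft X t) := by
  funext x
  rw [SRep.tw_ρ, matAct_apply]
  exact Finset.sum_congr rfl fun y _ => (Int.cast_smul_eq_zsmul R _ _).symm

theorem blockAct_tw [DecidableEq X] {G : Type} [Group G] {L : G →* Matrix X X ℤ} {B : SRep R G}
    {δ : I → Module.End R B.carrier} (a : G → Equiv.Perm I)
    (hδ : ∀ g s x, B.ρ g (δ s x) = δ (a g s) (B.ρ g x)) {A : I → Matrix X X R}
    (hA : ∀ g s, castM R (L g) * A s = A (a g s) * castM R (L g)) (g : G) (t : X → B.carrier) :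
    blockAct δ A ((B.tw L).ρ g t) = (B.tw L).ρ g (blockAct δ A t) := by
  rw [tw_ρ_eq, tw_ρ_eq, blockAct_apply, blockAct_apply, map_sum, map_sum]
  refine (Equiv.sum_comp (a g) _).symm.trans (Finset.sum_congr rfl fun s _ => ?_)
  rw [← matAct_comp, ← matAct_comp, matAct_mul, matAct_mul, hA]
  exact congrArg _ (funext fun x => (hδ g s _).symm)

end Mixed

section Mixed

variable {R : Type u} [CommRing R] {k : ℕ}

/-- A decomposition of a representation of the symmetric group into summands indexed by the
subsets of `Fin k`, and permuted accordingly. -/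
structure SubsetDec (B : SRep R (Equiv.Perm (Fin k))) where
  δ : Finset (Fin k) → Module.End R B.carrier
  idem : ∀ s x, δ s (δ s x) = δ s x
  orth : ∀ s s', s ≠ s' → ∀ x, δ s (δ s' x) = 0
  sum : ∀ x, ∑ s, δ s x = x
  δ_η : ∀ s x, δ s (B.η x) = B.η (δ s x)
  ρ_δ : ∀ g s x, B.ρ g (δ s x) = δ (Equiv.finsetCongr g s) (B.ρ g x)

/-- The degree in the places of a subset. -/
def cwt (s : Finset (Fin k)) (d : Fin k → ZMod 2) : Fin (k + 1) :=
  ⟨(s.filter fun i => d i = 1).card,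
    Nat.lt_succ_of_le ((Finset.card_le_univ _).trans_eq (Fintype.card_fin k))⟩

theorem coe_cwt (s : Finset (Fin k)) (d : Fin k → ZMod 2) :
    (cwt s d : ℕ) = (s.filter fun i => d i = 1).card := rfl

theorem cwt_degAct (g : Equiv.Perm (Fin k)) (s : Finset (Fin k)) (d : Fin k → ZMod 2) :
    cwt (Equiv.finsetCongr g s) (degAct k g d) = cwt s d := by
  refine Fin.ext ?_
  rw [coe_cwt, coe_cwt, Equiv.finsetCongr_apply, Finset.filter_map, Finset.card_map]
  congr 1
  refine Finset.filter_congr fun i _ => ?_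
  change d (g.symm (g i)) = 1 ↔ _
  rw [g.symm_apply_apply]

theorem cwt_add_cwt_compl (s : Finset (Fin k)) (d : Fin k → ZMod 2) :
    (cwt s d : ℕ) + (cwt sᶜ d : ℕ) = wt d := by
  rw [coe_cwt, coe_cwt, coe_wt, ← Finset.card_union_of_disjoint, ← Finset.filter_union,
    Finset.union_compl]
  exact Finset.disjoint_filter_filter disjoint_compl_right

theorem cwt_flip_of_notMem {s : Finset (Fin k)} {x : Fin k} (hx : x ∉ s) (d : Fin k → ZMod 2) :
    cwt s (flip x d) = cwt s d := by
  refine Fin.ext ?_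
  rw [coe_cwt, coe_cwt]
  congr 1
  refine Finset.filter_congr fun i hi => ?_
  rw [flip_apply, if_neg]
  rintro rfl
  exact hx hi

/-- The sign of the degree in the places of a subset. -/
def csign (s : Finset (Fin k)) (d : Fin k → ZMod 2) : ℤˣ := (-1) ^ (cwt s d : ℕ)

theorem csign_eq (s : Finset (Fin k)) (d : Fin k → ZMod 2) :
    csign s d = ∏ j ∈ s, degSign (d j) := by
  rw [csign, coe_cwt, ← Finset.prod_const, Finset.prod_filter]
  refine Finset.prod_congr rfl fun j _ => ?_
  have : ∀ a : ZMod 2, degSign a = if a = 1 then -1 else 1 := by decide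
  exact (this _).symm

theorem csign_flip {s : Finset (Fin k)} {x : Fin k} (hx : x ∈ s) (d : Fin k → ZMod 2) :
    csign s (flip x d) = -csign s d := by
  have h : csign s (flip x d) = csign s d * ∏ j ∈ s, if j = x then -1 else 1 := by
    rw [csign_eq, csign_eq, ← Finset.prod_mul_distrib]
    refine Finset.prod_congr rfl fun j _ => ?_
    rw [flip_apply]
    split_ifs <;> simp [degSign_add_one]
  rw [h, Finset.prod_ite_eq' s x, if_pos hx, mul_neg_one]

/-- The projection on bidegree `(a, b)`. -/
def bideg (a b : Fin (k + 1)) (s : Finset (Fin k)) : Matrix (Fin k → ZMod 2) (Fin k → ZMod 2) ℤ :=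
  Matrix.diagonal fun d => if cwt s d = a ∧ cwt sᶜ d = b then 1 else 0

theorem diagonal_mul_extRep {w w' : (Fin k → ZMod 2) → ℤ} {g : Equiv.Perm (Fin k)}
    (h : ∀ d, w' (degAct k g d) = w d) :
    extRep k g * Matrix.diagonal w = Matrix.diagonal w' * extRep k g := by
  change mono _ _ * _ = _ * mono _ _
  rw [diagonal_mul_mono]
  congr 2
  exact (funext h).symm

theorem extRep_mul_bideg (a b : Fin (k + 1)) (g : Equiv.Perm (Fin k)) (s : Finset (Fin k)) :
    extRep k g * bideg a b s = bideg a b (Equiv.finsetCongr g s) * extRep k g := by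
  refine diagonal_mul_extRep fun d => ?_
  have h : (Equiv.finsetCongr g s)ᶜ = Equiv.finsetCongr g sᶜ := by
    ext i
    simp [Equiv.finsetCongr_apply]
  rw [h, cwt_degAct, cwt_degAct]

theorem diagonal_sum {ι X α : Type} [DecidableEq X] [AddCommMonoid α] (u : Finset ι)
    (f : ι → X → α) : Matrix.diagonal (∑ a ∈ u, f a) = ∑ a ∈ u, Matrix.diagonal (f a) :=
  map_sum (Matrix.diagonalAddMonoidHom X α) f u

theorem sum_bideg (b : Fin (k + 1)) (s : Finset (Fin k)) :
    ∑ a, bideg a b s = Matrix.diagonal fun d => if cwt sᶜ d = b then 1 else 0 := by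
  simp only [bideg]
  rw [← diagonal_sum]
  congr 1
  funext d
  rw [Finset.sum_apply]
  simp [ite_and]

theorem sum_sign_bideg (b : Fin (k + 1)) (s : Finset (Fin k)) :
    ∑ a : Fin (k + 1), (((-1 : ℤˣ) ^ (a : ℕ) : ℤˣ) : ℤ) • bideg a b s =
      Matrix.diagonal fun d => if cwt sᶜ d = b then (csign s d : ℤ) else 0 := by
  simp only [bideg, ← Matrix.diagonal_smul]
  rw [← diagonal_sum]
  congr 1
  funext d
  rw [Finset.sum_apply]
  simp [ite_and, csign]

theorem cliff_mul_diagonal_comm {w : (Fin k → ZMod 2) → ℤ} {x : Fin k}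
    (h : ∀ d, w (flip x d) = w d) : cliff x * Matrix.diagonal w = Matrix.diagonal w * cliff x := by
  rw [cliff, diagonal_mul_mono]
  congr 2
  exact (funext h).symm

theorem cliff_mul_diagonal_anticomm {w : (Fin k → ZMod 2) → ℤ} {x : Fin k}
    (h : ∀ d, w (flip x d) = -w d) :
    cliff x * Matrix.diagonal w = -(Matrix.diagonal w * cliff x) := by
  rw [cliff, diagonal_mul_mono, ← Matrix.mul_neg, Matrix.diagonal_neg]
  congr 2
  funext d
  simp [h]

namespace SubsetDec

variable {B : SRep R (Equiv.Perm (Fin k))} (S : SubsetDec B)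

/-- The complementary decomposition. -/
def compl : SubsetDec B where
  δ s := S.δ sᶜ
  idem s := S.idem sᶜ
  orth s s' h := S.orth _ _ fun h' => h (compl_injective h')
  sum x := (Equiv.sum_comp (compl_involutive (α := Finset (Fin k))).toPerm
    fun s => S.δ s x).trans (S.sum x)
  δ_η s := S.δ_η sᶜ
  ρ_δ g s x := by
    rw [S.ρ_δ]
    congr 2
    ext i
    simp [Equiv.finsetCongr_apply]

/-- The operator on families given by matrices permuted by the symmetric group. -/
noncomputable def op (A : Finset (Fin k) → Matrix (Fin k → ZMod 2) (Fin k → ZMod 2) R)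
    (hA : ∀ g s, castM R (extRep k g) * A s = A (Equiv.finsetCongr g s) * castM R (extRep k g)) :
    Module.End R (B.tw (extRep k)).ρ.invariants :=
  (blockAct S.δ A).restrict fun t ht g => by
    rw [← blockAct_tw (fun g => Equiv.finsetCongr g) S.ρ_δ hA, ht g]

theorem cast_comm {A : Finset (Fin k) → Matrix (Fin k → ZMod 2) (Fin k → ZMod 2) ℤ}
    (hA : ∀ g s, extRep k g * A s = A (Equiv.finsetCongr g s) * extRep k g)
    (g : Equiv.Perm (Fin k)) (s : Finset (Fin k)) :
    castM R (extRep k g) * castM R (A s) =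
      castM R (A (Equiv.finsetCongr g s)) * castM R (extRep k g) := by
  rw [← map_mul, hA, map_mul]

/-- The projection on bidegree `(a, b)` of the invariants. -/
noncomputable def proj (a b : Fin (k + 1)) : Module.End R (B.tw (extRep k)).ρ.invariants :=
  S.op (fun s => castM R (bideg a b s)) (cast_comm (extRep_mul_bideg a b))

/-- The odd operator attached to a decomposition. -/
noncomputable def dirac : Module.End R (B.tw (extRep k)).ρ.invariants :=
  S.op (fun s => castM R (∑ x ∈ s, cliff x)) (cast_comm fun g s => by
    rw [Finset.mul_sum, Finset.sum_mul, Equiv.finsetCongr_apply, Finset.sum_map]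
    exact Finset.sum_congr rfl fun x _ => extRep_mul_cliff g x)

theorem blockAct_η (A : Finset (Fin k) → Matrix (Fin k → ZMod 2) (Fin k → ZMod 2) R)
    (t : (Fin k → ZMod 2) → B.carrier) :
    blockAct S.δ A (B.η.compLeft _ t) = B.η.compLeft _ (blockAct S.δ A t) := by
  rw [blockAct_apply, blockAct_apply, map_sum]
  refine Finset.sum_congr rfl fun s _ => ?_
  rw [← matAct_comp]
  exact congrArg _ (funext fun x => S.δ_η s _)

theorem op_η (A : Finset (Fin k) → Matrix (Fin k → ZMod 2) (Fin k → ZMod 2) R) (hA)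
    (t : (B.tw (extRep k)).ρ.invariants) :
    S.op A hA (⟨B.η.compLeft _ t.1, fun g => by rw [(B.tw (extRep k)).ρ_η, t.2 g]⟩) =
      ⟨B.η.compLeft _ (S.op A hA t).1, fun g => by
        rw [(B.tw (extRep k)).ρ_η, (S.op A hA t).2 g]⟩ :=
  Subtype.ext (S.blockAct_η A t.1)

theorem op_mul {A A' : Finset (Fin k) → Matrix (Fin k → ZMod 2) (Fin k → ZMod 2) R} {hA hA'}
    (C : Finset (Fin k) → Matrix (Fin k → ZMod 2) (Fin k → ZMod 2) R)
    (hC : ∀ s, A s * A' s = C s) (t : (B.tw (extRep k)).ρ.invariants) :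
    (S.op A hA (S.op A' hA' t)).1 = blockAct S.δ C t.1 := by
  have h := LinearMap.congr_fun (blockAct_mul S.idem S.orth A A') t.1
  rw [show A * A' = C from funext hC] at h
  exact h

variable [Invertible ((k.factorial : ℕ) : R)]

theorem dirac_bijective (h0 : S.δ ∅ = 0) : Function.Bijective S.dirac := by
  have hu : ∀ s : Finset (Fin k), s ≠ ∅ → IsUnit ((s.card : ℕ) : R) := fun s hs => by
    refine isUnit_of_dvd_unit (Nat.cast_dvd_cast (Nat.dvd_factorial ?_ ?_))
      (isUnit_of_invertible ((k.factorial : ℕ) : R))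
    · exact Finset.card_pos.mpr (Finset.nonempty_iff_ne_empty.mpr hs)
    · exact (Finset.card_le_univ s).trans_eq (Fintype.card_fin k)
  let A : Finset (Fin k) → Matrix (Fin k → ZMod 2) (Fin k → ZMod 2) R := fun s =>
    castM R (∑ x ∈ s, cliff x)
  let E : Finset (Fin k) → Matrix (Fin k → ZMod 2) (Fin k → ZMod 2) R := fun s =>
    Ring.inverse ((s.card : ℕ) : R) • castM R (∑ x ∈ s, cliff x)
  have hAA : ∀ s, A s * A s = ((s.card : ℕ) : R) • 1 := fun s => by
    simp only [A]
    rw [← map_mul, sum_cliff_sq, map_zsmul, map_one, ← Int.cast_smul_eq_zsmul R, Int.cast_natCast]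
  have hEA : ∀ s, s ≠ ∅ → E s * A s = 1 := fun s hs => by
    change (_ • A s) * A s = 1
    rw [smul_mul_assoc, hAA, smul_smul, Ring.inverse_mul_cancel _ (hu s hs), one_smul]
  have hAE : ∀ s, s ≠ ∅ → A s * E s = 1 := fun s hs => by
    change A s * (_ • A s) = 1
    rw [mul_smul_comm, hAA, smul_smul, Ring.inverse_mul_cancel _ (hu s hs), one_smul]
  have hA : ∀ g s, castM R (extRep k g) * A s =
      A (Equiv.finsetCongr g s) * castM R (extRep k g) := fun g s => by
    simp only [A]
    rw [← map_mul, ← map_mul, Finset.mul_sum, Finset.sum_mul, Equiv.finsetCongr_apply,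
      Finset.sum_map]
    exact congrArg _ (Finset.sum_congr rfl fun x _ => extRep_mul_cliff g x)
  have hE : ∀ g s, castM R (extRep k g) * E s =
      E (Equiv.finsetCongr g s) * castM R (extRep k g) := fun g s => by
    change _ * (_ • A s) = (_ • A _) * _
    rw [mul_smul_comm, hA, smul_mul_assoc, Equiv.finsetCongr_apply, Finset.card_map]
  have hone : ∀ C : Finset (Fin k) → Matrix (Fin k → ZMod 2) (Fin k → ZMod 2) R,
      (∀ s, s ≠ ∅ → C s = 1) → blockAct S.δ C = 1 := fun C hC => by
    rw [← blockAct_one S.sum]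
    refine blockAct_congr fun s => ?_
    by_cases hs : s = ∅
    · left
      rw [hs, h0]
    · exact Or.inr (hC s hs)
  refine Function.bijective_iff_has_inverse.mpr ⟨S.op E hE, fun t => ?_, fun t => ?_⟩
  · refine Subtype.ext ((S.op_mul (fun s => E s * A s) (fun s => rfl) t).trans ?_)
    rw [hone _ hEA]
    rfl
  · refine Subtype.ext ((S.op_mul (fun s => A s * E s) (fun s => rfl) t).trans ?_)
    rw [hone _ hAE]
    rfl

omit [Invertible ((k.factorial : ℕ) : R)] in
theorem proj_mul_proj (p p' : Fin (k + 1) × Fin (k + 1)) :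
    S.proj p.1 p.2 * S.proj p'.1 p'.2 = if p = p' then S.proj p.1 p.2 else 0 := by
  refine LinearMap.ext fun t => Subtype.ext ?_
  refine (S.op_mul (hA := cast_comm (extRep_mul_bideg p.1 p.2))
    (hA' := cast_comm (extRep_mul_bideg p'.1 p'.2))
    (fun s => castM R (if p = p' then bideg p.1 p.2 s else 0)) (fun s => ?_) t).trans ?_
  · rw [← map_mul]
    congr 1
    rw [bideg, bideg, Matrix.diagonal_mul_diagonal]
    split_ifs with h
    · subst h
      congr 1
      funext d
      split_ifs <;> simp
    · rw [← Matrix.diagonal_zero]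
      congr 1
      funext d
      split_ifs with h1 h2 <;> simp
      exact h (Prod.ext (h1.1.symm.trans h2.1) (h1.2.symm.trans h2.2))
  · split_ifs with h
    · rfl
    · have : (fun s : Finset (Fin k) => castM R (0 : Matrix (Fin k → ZMod 2) (Fin k → ZMod 2) ℤ)) =
          (0 : ℤ) • (0 : Finset (Fin k) → Matrix (Fin k → ZMod 2) (Fin k → ZMod 2) R) := by
        funext s
        simp
      rw [this, blockAct_smul, zero_smul]
      rfl

variable [Invertible (2 : R)]

/-- The class of the summand of bidegree `(a, b)`. -/
noncomputable def bK (a b : Fin (k + 1)) : K R :=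
  ((B.tw (extRep k)).fix.range (S.proj a b)
    (fun x => LinearMap.congr_fun ((S.proj_mul_proj (a, b) (a, b)).trans (if_pos rfl)) x)
    (S.op_η _ _)).sK

theorem sum_bK (h0 : S.δ ∅ = 0) (b : Fin (k + 1)) :
    ∑ a : Fin (k + 1), (((-1 : ℤˣ) ^ (a : ℕ) : ℤˣ) : ℤ) • S.bK a b = 0 := by
  have hs : ∀ c : Fin (k + 1) → ℤ, ∀ t : (B.tw (extRep k)).ρ.invariants,
      ((∑ a, c a • S.proj a b) t).1 =
        blockAct S.δ (fun s => castM R (∑ a, c a • bideg a b s)) t.1 := fun c t => by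
    have h1 : (fun s => castM R (∑ a, c a • bideg a b s)) =
        ∑ a, c a • fun s => castM R (bideg a b s) := by
      funext s
      rw [Finset.sum_apply, map_sum]
      simp only [map_zsmul]
      rfl
    rw [h1, blockAct_sum, LinearMap.sum_apply, LinearMap.sum_apply, Submodule.coe_sum]
    refine Finset.sum_congr rfl fun a _ => ?_
    rw [blockAct_smul]
    rfl
  have hmul1 : ∀ (A C : Finset (Fin k) → Matrix (Fin k → ZMod 2) (Fin k → ZMod 2) ℤ)
      (t : (Fin k → ZMod 2) → B.carrier),
      blockAct S.δ (fun s => castM R (A s)) (blockAct S.δ (fun s => castM R (C s)) t) =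
        blockAct S.δ (fun s => castM R (A s * C s)) t := fun A C t => by
    simp only [map_mul]
    exact LinearMap.congr_fun (blockAct_mul S.idem S.orth _ _) t
  refine (B.tw (extRep k)).fix.sum_sK_range_eq_zero (fun a => S.proj a b)
    (fun a => (S.proj_mul_proj (a, b) (a, b)).trans (if_pos rfl))
    (fun i j h => (S.proj_mul_proj (i, b) (j, b)).trans
      (if_neg fun h' => h (congrArg Prod.fst h'))) (fun a => S.op_η _ _)
    (fun a => (-1) ^ (a : ℕ)) S.dirac (S.dirac_bijective h0) (S.op_η _ _) ?_ ?_
  · have hs1 : ∀ t : (B.tw (extRep k)).ρ.invariants, ((∑ a, S.proj a b) t).1 =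
        blockAct S.δ (fun s => castM R (∑ a, bideg a b s)) t.1 := fun t => by
      have := hs 1 t
      simpa only [Pi.one_apply, one_smul] using this
    refine LinearMap.ext fun t => Subtype.ext ?_
    rw [Module.End.mul_apply, Module.End.mul_apply, hs1]
    change blockAct _ _ ((∑ a, S.proj a b) t).1 = blockAct _ _ (blockAct _ _ _)
    rw [hs1, hmul1, hmul1]
    congr 2
    funext s
    congr 1
    rw [sum_bideg, Finset.sum_mul, Finset.mul_sum]
    refine Finset.sum_congr rfl fun x hx => cliff_mul_diagonal_comm fun d => ?_
    rw [cwt_flip_of_notMem (by simpa using hx)]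
  · refine LinearMap.ext fun t => Subtype.ext ?_
    rw [Module.End.mul_apply, LinearMap.neg_apply, Module.End.mul_apply, Submodule.coe_neg, hs]
    change blockAct _ _ ((∑ a, _ • S.proj a b) t).1 = -blockAct _ _ (blockAct _ _ _)
    rw [hs, hmul1, hmul1, ← LinearMap.neg_apply, ← blockAct_neg]
    congr 2
    funext s
    rw [Pi.neg_apply, ← map_neg]
    congr 1
    rw [sum_sign_bideg, Finset.sum_mul, Finset.mul_sum, ← Finset.sum_neg_distrib]
    refine Finset.sum_congr rfl fun x hx => cliff_mul_diagonal_anticomm fun d => ?_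
    rw [cwt_flip_of_notMem (by simpa using hx), csign_flip hx]
    split_ifs <;> simp

theorem compl_bK (a b : Fin (k + 1)) : S.compl.bK a b = S.bK b a := by
  have h : S.compl.proj a b = S.proj b a := by
    refine LinearMap.ext fun t => Subtype.ext ?_
    change blockAct _ _ t.1 = blockAct _ _ t.1
    rw [blockAct_apply, blockAct_apply]
    refine Eq.trans ?_ (Equiv.sum_comp (compl_involutive (α := Finset (Fin k))).toPerm _)
    refine Finset.sum_congr rfl fun s _ => ?_
    change _ = matAct (castM R (bideg b a sᶜ)) _
    have : bideg a b s = bideg b a sᶜ := by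
      simp only [bideg, compl_compl, and_comm]
    rw [this]
    rfl
  simp only [bK, h]

/-- The Adams character vanishes on induced representations. -/
theorem sX_eq_zero (hk : 0 < k) (h0 : S.δ ∅ = 0) (h1 : S.δ Finset.univ = 0) : sX B = 0 := by
  have key := sX_eq_sum_range hk B (fun p : Fin (k + 1) × Fin (k + 1) => S.proj p.1 p.2)
    (fun p x => LinearMap.congr_fun ((S.proj_mul_proj p p).trans (if_pos rfl)) x)
    (fun p p' h x => LinearMap.congr_fun ((S.proj_mul_proj p p').trans (if_neg h)) x)
    (fun p => S.op_η _ _) (fun x => Subtype.ext ?_) (fun p => p.1 + p.2) ?_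
  · rw [key, Fintype.sum_prod_type]
    have e : ∀ a b : Fin (k + 1), ((-1 : ℤ) ^ ((a : ℕ) + b + 1) * (((a : ℕ) + b : ℕ) : ℤ)) • S.bK a b =
        -(((-1) ^ (b : ℕ) * (b : ℤ)) • (((-1 : ℤˣ) ^ (a : ℕ) : ℤˣ) : ℤ) • S.bK a b) -
        ((-1) ^ (a : ℕ) * (a : ℤ)) • (((-1 : ℤˣ) ^ (b : ℕ) : ℤˣ) : ℤ) • S.bK a b := fun a b => by
      rw [smul_smul, smul_smul, ← neg_smul, ← sub_smul]
      congr 1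
      push_cast
      ring
    refine (Finset.sum_congr rfl fun a _ => Finset.sum_congr rfl fun b _ => e a b).trans ?_
    simp only [Finset.sum_sub_distrib, Finset.sum_neg_distrib]
    have h2 : ∀ a : Fin (k + 1), ∑ b : Fin (k + 1), (((-1 : ℤˣ) ^ (b : ℕ) : ℤˣ) : ℤ) • S.bK a b = 0 :=
      fun a => by
      have h3 := S.compl.sum_bK (by change S.δ ∅ᶜ = 0; rw [Finset.compl_empty, h1]) a
      simpa only [compl_bK] using h3
    rw [Finset.sum_comm]
    simp only [← Finset.smul_sum, S.sum_bK h0, h2, smul_zero, Finset.sum_const_zero, neg_zero,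
      sub_zero]
  · rw [Submodule.coe_sum]
    change ∑ p : Fin (k + 1) × Fin (k + 1), blockAct S.δ (fun s => castM R (bideg p.1 p.2 s)) x.1 = x.1
    rw [← LinearMap.sum_apply, ← blockAct_sum]
    refine Eq.trans ?_ (LinearMap.congr_fun (blockAct_one S.sum) x.1)
    congr 2
    funext s
    rw [Finset.sum_apply, ← map_sum, Fintype.sum_prod_type_right, Pi.one_apply,
      ← map_one (castM R)]
    congr 1
    simp only [sum_bideg]
    rw [← diagonal_sum, ← Matrix.diagonal_one]
    congr 1
    funext d
    rw [Finset.sum_apply]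
    simp
  · intro p x d hd
    change blockAct S.δ _ x.1 d = 0
    rw [blockAct_apply, Finset.sum_apply]
    refine Finset.sum_eq_zero fun s _ => ?_
    have : castM R (bideg p.1 p.2 s) = Matrix.diagonal fun d =>
        if cwt s d = p.1 ∧ cwt sᶜ d = p.2 then 1 else 0 := by
      ext d d'
      simp only [bideg, RingHom.mapMatrix_apply, Matrix.map_apply, Matrix.diagonal_apply]
      split_ifs <;> simp
    rw [this, matAct_diagonal, if_neg, zero_smul]
    rintro ⟨ha, hb⟩
    apply hd
    rw [← cwt_add_cwt_compl s, ha, hb]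

end SubsetDec

end Mixed

/-! ## Tensor powers of modules -/

section TensorPower

variable {R : Type u} [CommRing R] [Invertible (2 : R)]

/-- The graded tensor power of a super module. -/
noncomputable abbrev SMod.pow (M : SMod R) (k : ℕ) : SRep R (Equiv.Perm (Fin k)) where
  carrier := PiTensorProduct R fun _ : Fin k => M.carrier
  projective := projective_piTensorProduct M.carrier k
  η := PiTensorProduct.map fun _ => M.η
  η_sq x := by
    rw [← LinearMap.comp_apply, ← PiTensorProduct.map_comp,
      show (fun _ : Fin k => M.η ∘ₗ M.η) = fun _ => LinearMap.id from funext fun _ => M.η_mul,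
      PiTensorProduct.map_id, LinearMap.id_apply]
  ρ := koszulRep M.η M.η_mul k
  ρ_η g x := LinearMap.congr_fun (koszulAct_map M.η_mul g) x

variable (N : FGProj R)

omit [Invertible (2 : R)] in
theorem isHomog_zero {k : ℕ} (m : Fin k → N.carrier) : IsHomog (N.toSMod 0).η 0 m := fun _ => rfl

theorem pow_ρ_tprod {k : ℕ} (g : Equiv.Perm (Fin k)) (m : Fin k → N.carrier) :
    ((N.toSMod 0).pow k).ρ g (PiTensorProduct.tprod R m) =
      PiTensorProduct.tprod R fun i => m (g.symm i) := by
  refine (koszulAct_tprod (isHomog_zero N m) g).trans ?_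
  have h : koszulSign g 0 = 1 := Finset.prod_eq_one fun p _ => by simp [swapSign]
  rw [h, map_one, one_smul]

theorem pow_η {k : ℕ} (x : ((N.toSMod 0).pow k).carrier) : ((N.toSMod 0).pow k).η x = x := by
  have h : (N.toSMod 0).η = LinearMap.id := LinearMap.ext fun x => by
    simp [degSign]
  change PiTensorProduct.map (fun _ => (N.toSMod 0).η) x = x
  rw [h, PiTensorProduct.map_id, LinearMap.id_apply]

/-- The block sum of two permutations. -/
def blockPerm {i j : ℕ} (g : Equiv.Perm (Fin i)) (h : Equiv.Perm (Fin j)) :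
    Equiv.Perm (Fin (i + j)) :=
  finSumFinEquiv.permCongr (Equiv.Perm.sumCongr g h)

theorem blockPerm_castAdd {i j : ℕ} (g : Equiv.Perm (Fin i)) (h : Equiv.Perm (Fin j)) (x : Fin i) :
    blockPerm g h (Fin.castAdd j x) = Fin.castAdd j (g x) := by
  simp [blockPerm, Equiv.permCongr_apply]

theorem blockPerm_natAdd {i j : ℕ} (g : Equiv.Perm (Fin i)) (h : Equiv.Perm (Fin j)) (x : Fin j) :
    blockPerm g h (Fin.natAdd i x) = Fin.natAdd i (h x) := by
  simp [blockPerm, Equiv.permCongr_apply]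

/-- The standard degree of weight `i`. -/
def stdDeg (i j : ℕ) (x : Fin (i + j)) : ZMod 2 := if (x : ℕ) < i then 1 else 0

theorem stdDeg_castAdd {i j : ℕ} (x : Fin i) : stdDeg i j (Fin.castAdd j x) = 1 := by
  simp [stdDeg]

theorem stdDeg_natAdd {i j : ℕ} (x : Fin j) : stdDeg i j (Fin.natAdd i x) = 0 := by
  simp [stdDeg]

theorem wt_stdDeg (i j : ℕ) : (wt (stdDeg i j) : ℕ) = i := by
  rw [coe_wt, Finset.card_filter, Fin.sum_univ_add]
  simp [stdDeg_castAdd, stdDeg_natAdd]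

theorem degAct_blockPerm {i j : ℕ} (g : Equiv.Perm (Fin i)) (h : Equiv.Perm (Fin j)) :
    degAct (i + j) (blockPerm g h) (stdDeg i j) = stdDeg i j := by
  have key : ∀ x, stdDeg i j (blockPerm g h x) = stdDeg i j x := fun x => by
    refine Fin.addCases (fun x => ?_) (fun x => ?_) x
    · rw [blockPerm_castAdd, stdDeg_castAdd, stdDeg_castAdd]
    · rw [blockPerm_natAdd, stdDeg_natAdd, stdDeg_natAdd]
  funext x
  rw [degAct_apply, ← key, Equiv.apply_symm_apply]

theorem koszulSign_blockPerm {i j : ℕ} (g : Equiv.Perm (Fin i)) (h : Equiv.Perm (Fin j)) :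
    koszulSign (blockPerm g h) (stdDeg i j) = Equiv.Perm.sign g := by
  rw [← koszulSign_const_one, koszulSign, koszulSign, Finset.prod_filter, Finset.prod_filter,
    Fintype.prod_prod_type, Fintype.prod_prod_type, Fin.prod_univ_add]
  have h0 : ∀ b, swapSign 0 b = 1 := by decide
  have h0' : ∀ b, swapSign b 0 = 1 := by decide
  simp only [Fin.prod_univ_add, stdDeg_castAdd, stdDeg_natAdd, h0, h0', blockPerm_castAdd, ite_self,
    Finset.prod_const_one, mul_one]
  rfl

theorem exists_degAct_eq {i j : ℕ} (d : Fin (i + j) → ZMod 2) (hd : (wt d : ℕ) = i) :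
    ∃ g, degAct (i + j) g (stdDeg i j) = d := by
  have hcard : Fintype.card {x // stdDeg i j x = 1} = Fintype.card {x // d x = 1} := by
    rw [Fintype.card_subtype, Fintype.card_subtype]
    have h := (wt_stdDeg i j).trans hd.symm
    rw [coe_wt, coe_wt] at h
    exact h
  obtain ⟨e⟩ := Fintype.card_eq.mp hcard
  have h2 : ∀ a b : ZMod 2, (a = 1 ↔ b = 1) → a = b := by decide
  have hg : ∀ x, d (e.extendSubtype x) = stdDeg i j x := fun x => by
    refine h2 _ _ ⟨fun h => ?_, fun h => e.extendSubtype_mem x h⟩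
    by_contra hx
    exact e.extendSubtype_not_mem x hx h
  exact ⟨e.extendSubtype, funext fun x => by
    rw [degAct_apply, ← hg, Equiv.apply_symm_apply]⟩

theorem exists_blockPerm {i j : ℕ} (g : Equiv.Perm (Fin (i + j)))
    (hg : degAct (i + j) g (stdDeg i j) = stdDeg i j) : ∃ g₁ g₂, g = blockPerm g₁ g₂ := by
  have hd : ∀ x, stdDeg i j (g x) = stdDeg i j x := fun x => by
    conv_lhs => rw [← hg]
    rw [degAct_apply, Equiv.symm_apply_apply]
  have hm : Set.MapsTo (finSumFinEquiv.symm.permCongr g) (Set.range (Sum.inl : Fin i → Fin i ⊕ Fin j))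
      (Set.range Sum.inl) := by
    rintro _ ⟨x, rfl⟩
    have h1 := hd (Fin.castAdd j x)
    rw [stdDeg_castAdd] at h1
    have h2 : finSumFinEquiv.symm.permCongr g (Sum.inl x) =
        finSumFinEquiv.symm (g (Fin.castAdd j x)) := by
      simp [Equiv.permCongr_apply]
    rw [h2]
    revert h1
    refine Fin.addCases (fun y => ?_) (fun y => ?_) (g (Fin.castAdd j x))
    · exact fun _ => ⟨y, by simp⟩
    · rw [stdDeg_natAdd]
      exact fun h => absurd h (by decide)
  obtain ⟨⟨g₁, g₂⟩, h⟩ := Equiv.Perm.mem_sumCongrHom_range_of_perm_mapsTo_inl hm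
  refine ⟨g₁, g₂, ?_⟩
  have h' : Equiv.Perm.sumCongr g₁ g₂ = finSumFinEquiv.symm.permCongr g := h
  rw [blockPerm, h']
  ext x
  simp [Equiv.permCongr_apply]

/-- The tensors which are antisymmetric in the first variables and symmetric in the other ones. -/
def mixedTensors (i j : ℕ) : Submodule R ((N.toSMod 0).pow (i + j)).carrier where
  carrier := {t | ∀ g₁ g₂, ((N.toSMod 0).pow (i + j)).ρ (blockPerm g₁ g₂) t =
    sgn R (Equiv.Perm.sign g₁) • t}
  add_mem' ha hb g₁ g₂ := by rw [map_add, ha, hb, smul_add]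
  zero_mem' g₁ g₂ := by rw [map_zero, smul_zero]
  smul_mem' r a ha g₁ g₂ := by rw [map_smul, ha, smul_comm]

theorem exists_extPow_equiv (i j : ℕ) (a : Fin (i + j + 1)) (ha : (a : ℕ) = i) :
    Nonempty (((((N.toSMod 0).pow (i + j)).tw (extPowRep (i + j) a)).ρ.invariants) ≃ₗ[R]
      mixedTensors N i j) := by
  let B := (N.toSMod 0).pow (i + j)
  have hd0 : wt (stdDeg i j) = a := Fin.ext ((wt_stdDeg i j).trans ha.symm)
  have hinv : ∀ t ∈ (B.tw (extPowRep (i + j) a)).ρ.invariants, ∀ g d,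
      t (degActWt _ a g d) = sgn R (koszulSign g d.1) • B.ρ g (t d) := fun t ht =>
    SRep.mem_fix_monoRep.mp ht
  choose γ hγ using fun d : {d : Fin (i + j) → ZMod 2 // wt d = a} =>
    exists_degAct_eq d.1 ((congrArg Fin.val d.2).trans ha)
  have hindep : ∀ t ∈ mixedTensors N i j, ∀ g h, degAct (i + j) g (stdDeg i j) =
      degAct (i + j) h (stdDeg i j) →
      sgn R (koszulSign g (stdDeg i j)) • B.ρ g t = sgn R (koszulSign h (stdDeg i j)) • B.ρ h t := by
    intro t ht g h hgh
    obtain ⟨g₁, g₂, hh⟩ := exists_blockPerm (g⁻¹ * h) (by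
      rw [map_mul, Equiv.Perm.mul_apply, ← hgh, ← Equiv.Perm.mul_apply, ← map_mul, inv_mul_cancel,
        map_one, Equiv.Perm.one_apply])
    have h1 : h = g * blockPerm g₁ g₂ := by rw [← hh, mul_inv_cancel_left]
    have h2 : (fun x => stdDeg i j ((blockPerm g₁ g₂).symm x)) = stdDeg i j := degAct_blockPerm g₁ g₂
    rw [h1, koszulSign_mul, h2, map_mul, map_mul, Module.End.mul_apply, ht g₁ g₂, map_smul,
      smul_smul, koszulSign_blockPerm, mul_assoc, sgn_mul_self, mul_one]
  have hmemF : ∀ t ∈ (B.tw (extPowRep (i + j) a)).ρ.invariants,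
      t ⟨stdDeg i j, hd0⟩ ∈ mixedTensors N i j := by
    intro t ht g₁ g₂
    have h1 := hinv t ht (blockPerm g₁ g₂) ⟨stdDeg i j, hd0⟩
    have h2 : degActWt _ a (blockPerm g₁ g₂) ⟨stdDeg i j, hd0⟩ = ⟨stdDeg i j, hd0⟩ :=
      Subtype.ext (degAct_blockPerm g₁ g₂)
    rw [h2, koszulSign_blockPerm] at h1
    have h3 := congrArg (sgn R (Equiv.Perm.sign g₁) • ·) h1
    simp only [smul_smul, sgn_mul_self, one_smul] at h3
    exact h3.symm
  have hmemG : ∀ t ∈ mixedTensors N i j, (fun d : {d : Fin (i + j) → ZMod 2 // wt d = a} =>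
      sgn R (koszulSign (γ d) (stdDeg i j)) • B.ρ (γ d) t) ∈
        (B.tw (extPowRep (i + j) a)).ρ.invariants := by
    intro t ht
    refine SRep.mem_fix_monoRep.mpr fun g d => ?_
    have h1 : degAct (i + j) (γ (degActWt _ a g d)) (stdDeg i j) =
        degAct (i + j) (g * γ d) (stdDeg i j) := by
      rw [hγ, map_mul, Equiv.Perm.mul_apply, hγ]
      rfl
    have h2 : (fun x => stdDeg i j ((γ d).symm x)) = d.1 := hγ d
    rw [hindep t ht _ _ h1, koszulSign_mul, h2, map_mul, map_mul, Module.End.mul_apply, map_smul,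
      smul_smul]
  refine ⟨LinearEquiv.ofLinearMap
    ((LinearMap.proj (⟨stdDeg i j, hd0⟩ : {d : Fin (i + j) → ZMod 2 // wt d = a})).restrict hmemF)
    ((LinearMap.pi fun d : {d : Fin (i + j) → ZMod 2 // wt d = a} =>
      sgn R (koszulSign (γ d) (stdDeg i j)) • B.ρ (γ d)).restrict hmemG) ?_ ?_⟩
  · refine LinearMap.ext fun t => Subtype.ext ?_
    change sgn R (koszulSign (γ ⟨stdDeg i j, hd0⟩) (stdDeg i j)) • B.ρ (γ ⟨stdDeg i j, hd0⟩) t.1 = t.1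
    rw [hindep t.1 t.2 _ 1 (by rw [hγ, map_one]; rfl), koszulSign_one, map_one, map_one, one_smul,
      Module.End.one_apply]
  · refine LinearMap.ext fun t => Subtype.ext (funext fun d => ?_)
    change sgn R (koszulSign (γ d) (stdDeg i j)) • B.ρ (γ d) (t.1 ⟨stdDeg i j, hd0⟩) = t.1 d
    refine (hinv t.1 t.2 (γ d) ⟨stdDeg i j, hd0⟩).symm.trans ?_
    exact congrArg t.1 (Subtype.ext (hγ d))

/-- The concatenation of tensors. -/
noncomputable def concat (i j : ℕ) :
    ((N.toSMod 0).pow i).carrier ⊗[R] ((N.toSMod 0).pow j).carrier ≃ₗ[R]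
      ((N.toSMod 0).pow (i + j)).carrier :=
  (PiTensorProduct.tmulEquiv R N.carrier).trans
    (PiTensorProduct.reindex R (fun _ => N.carrier) finSumFinEquiv)

theorem concat_tprod {i j : ℕ} (a : Fin i → N.carrier) (b : Fin j → N.carrier) :
    concat N i j (PiTensorProduct.tprod R a ⊗ₜ PiTensorProduct.tprod R b) =
      PiTensorProduct.tprod R fun x => Sum.elim a b (finSumFinEquiv.symm x) := by
  rw [concat, LinearEquiv.trans_apply, PiTensorProduct.tmulEquiv_apply,
    PiTensorProduct.reindex_tprod]

theorem concat_map {i j : ℕ} (g : Equiv.Perm (Fin i)) (h : Equiv.Perm (Fin j))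
    (x : ((N.toSMod 0).pow i).carrier ⊗[R] ((N.toSMod 0).pow j).carrier) :
    concat N i j (TensorProduct.map (((N.toSMod 0).pow i).ρ g) (((N.toSMod 0).pow j).ρ h) x) =
      ((N.toSMod 0).pow (i + j)).ρ (blockPerm g h) (concat N i j x) := by
  refine LinearMap.congr_fun (f := (concat N i j).toLinearMap ∘ₗ
    TensorProduct.map (((N.toSMod 0).pow i).ρ g) (((N.toSMod 0).pow j).ρ h))
    (g := ((N.toSMod 0).pow (i + j)).ρ (blockPerm g h) ∘ₗ (concat N i j).toLinearMap) ?_ x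
  refine TensorProduct.ext (PiTensorProduct.ext (MultilinearMap.ext fun a =>
    PiTensorProduct.ext (MultilinearMap.ext fun b => ?_)))
  change concat N i j (((N.toSMod 0).pow i).ρ g (PiTensorProduct.tprod R a) ⊗ₜ
    ((N.toSMod 0).pow j).ρ h (PiTensorProduct.tprod R b)) =
    ((N.toSMod 0).pow (i + j)).ρ (blockPerm g h) (concat N i j _)
  rw [pow_ρ_tprod, pow_ρ_tprod, concat_tprod]
  refine Eq.trans ?_ (congrArg _ (concat_tprod N a b).symm)
  rw [pow_ρ_tprod]
  congr 1
  funext x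
  obtain ⟨y, rfl⟩ := (blockPerm g h).surjective x
  rw [Equiv.symm_apply_apply]
  refine Fin.addCases (fun y => ?_) (fun y => ?_) y
  · simp [blockPerm_castAdd]
  · simp [blockPerm_natAdd]

/-- The projection of the tensor power on the exterior power. -/
noncomputable def altMap (i : ℕ) :
    ((N.toSMod 0).pow i).carrier →ₗ[R] (N.exteriorPower i).carrier :=
  PiTensorProduct.lift (exteriorPower.ιMulti R i).toMultilinearMap

theorem altMap_tprod {i : ℕ} (a : Fin i → N.carrier) :
    altMap N i (PiTensorProduct.tprod R a) = exteriorPower.ιMulti R i a :=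
  PiTensorProduct.lift.tprod _

theorem toTensorPower_altMap {i : ℕ} (x : ((N.toSMod 0).pow i).carrier) :
    exteriorPower.toTensorPower R N.carrier i (altMap N i x) =
      ∑ g, sgn R (Equiv.Perm.sign g) • ((N.toSMod 0).pow i).ρ g x := by
  refine (LinearMap.congr_fun (f := exteriorPower.toTensorPower R N.carrier i ∘ₗ altMap N i)
    (g := ∑ g, sgn R (Equiv.Perm.sign g) • ((N.toSMod 0).pow i).ρ g)
    (PiTensorProduct.ext (MultilinearMap.ext fun a => ?_)) x).trans
    ((LinearMap.sum_apply _ _ _).trans rfl)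
  change exteriorPower.toTensorPower R N.carrier i (altMap N i (PiTensorProduct.tprod R a)) =
    (∑ g, sgn R (Equiv.Perm.sign g) • ((N.toSMod 0).pow i).ρ g) (PiTensorProduct.tprod R a)
  rw [altMap_tprod, LinearMap.sum_apply]
  refine (exteriorPower.toTensorPower_apply_ιMulti R a).trans ?_
  refine Eq.trans ?_ (Equiv.sum_comp (Equiv.inv (Equiv.Perm (Fin i))) fun g =>
    (sgn R (Equiv.Perm.sign g) • ((N.toSMod 0).pow i).ρ g) (PiTensorProduct.tprod R a))
  refine Finset.sum_congr rfl fun g _ => ?_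
  rw [LinearMap.smul_apply, pow_ρ_tprod, Equiv.inv_apply, Equiv.Perm.sign_inv]
  rcases Int.units_eq_one_or (Equiv.Perm.sign g) with h | h
  · rw [h, map_one, one_smul, one_smul]
    rfl
  · rw [h, Units.neg_smul, one_smul]
    refine Eq.trans ?_ (congrArg (· • _) (show (-1 : R) = sgn R (-1) by simp [sgn]))
    rw [neg_smul, one_smul]
    rfl

end TensorPower

/-! ## Power sums and Adams operations -/

section AdamsPower

variable {R : Type u} [CommRing R] [Invertible (2 : R)] (N : FGProj R)

omit [Invertible (2 : R)] in
theorem sgn_smul_units_smul {M : Type u} [AddCommGroup M] [Module R M] (e : ℤˣ) (x : M) :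
    sgn R e • e • x = x := by
  rcases Int.units_eq_one_or e with rfl | rfl
  · rw [map_one, one_smul, one_smul]
  · rw [Units.neg_smul, one_smul, show sgn R (-1) = -1 by simp [sgn], smul_neg, neg_smul, one_smul,
      neg_neg]

/-- The antisymmetrization of the elements of the exterior power. -/
noncomputable def antisym (i : ℕ) :
    (N.exteriorPower i).carrier →ₗ[R] ((N.toSMod 0).pow i).carrier :=
  exteriorPower.toTensorPower R N.carrier i

theorem antisym_altMap {i : ℕ} (x : ((N.toSMod 0).pow i).carrier) :
    antisym N i (altMap N i x) = ∑ g, sgn R (Equiv.Perm.sign g) • ((N.toSMod 0).pow i).ρ g x :=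
  toTensorPower_altMap N x

theorem ρ_antisym {i : ℕ} (g : Equiv.Perm (Fin i)) (x : (N.exteriorPower i).carrier) :
    ((N.toSMod 0).pow i).ρ g (antisym N i x) =
      sgn R (Equiv.Perm.sign g) • antisym N i x := by
  refine LinearMap.congr_fun (f := ((N.toSMod 0).pow i).ρ g ∘ₗ
      antisym N i)
    (g := sgn R (Equiv.Perm.sign g) • antisym N i)
    (exteriorPower.linearMap_ext (AlternatingMap.ext fun a => ?_)) x
  change ((N.toSMod 0).pow i).ρ g
      (antisym N i (exteriorPower.ιMulti R i a)) =
    sgn R (Equiv.Perm.sign g) •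
      antisym N i (exteriorPower.ιMulti R i a)
  rw [← altMap_tprod, antisym_altMap, map_sum, Finset.smul_sum]
  refine Eq.trans ?_ (Equiv.sum_comp (Equiv.mulLeft g) fun h => sgn R (Equiv.Perm.sign g) •
    sgn R (Equiv.Perm.sign h) • ((N.toSMod 0).pow i).ρ h (PiTensorProduct.tprod R a))
  refine Finset.sum_congr rfl fun h _ => ?_
  rw [Equiv.coe_mulLeft, Equiv.Perm.sign_mul, map_mul, map_mul, map_smul, smul_smul, ← mul_assoc,
    sgn_mul_self, one_mul]
  rfl

theorem altMap_antisym {i : ℕ} (x : (N.exteriorPower i).carrier) :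
    altMap N i (antisym N i x) = ((i.factorial : ℕ) : R) • x := by
  refine LinearMap.congr_fun (f := altMap N i ∘ₗ antisym N i)
    (g := ((i.factorial : ℕ) : R) • LinearMap.id)
    (exteriorPower.linearMap_ext (AlternatingMap.ext fun a => ?_)) x
  change altMap N i
      (antisym N i (exteriorPower.ιMulti R i a)) =
    ((i.factorial : ℕ) : R) • exteriorPower.ιMulti R i a
  rw [← altMap_tprod, antisym_altMap, map_sum]
  have h : ∀ g : Equiv.Perm (Fin i), altMap N i (sgn R (Equiv.Perm.sign g) •
      ((N.toSMod 0).pow i).ρ g (PiTensorProduct.tprod R a)) =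
        altMap N i (PiTensorProduct.tprod R a) := fun g => by
    rw [map_smul, pow_ρ_tprod, altMap_tprod, altMap_tprod]
    have h1 := (exteriorPower.ιMulti R i (M := N.carrier)).map_perm a g.symm
    refine (congrArg (sgn R (Equiv.Perm.sign g) • ·) h1).trans ?_
    rw [Equiv.Perm.sign_symm]
    exact sgn_smul_units_smul _ _
  rw [Finset.sum_congr rfl fun g _ => h g, Finset.sum_const, Finset.card_univ, Fintype.card_perm,
    Fintype.card_fin]
  exact (Nat.cast_smul_eq_nsmul R _ _).symm

omit [Invertible (2 : R)] in
theorem averageMap_eq {k : ℕ} [Invertible ((k.factorial : ℕ) : R)]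
    (B : SRep R (Equiv.Perm (Fin k))) :
    B.ρ.averageMap = ⅟((k.factorial : ℕ) : R) • ∑ g, B.ρ g := by
  rw [Representation.averageMap, GroupAlgebra.average, map_smul, map_sum]
  congr 1
  exact Finset.sum_congr rfl fun g _ => Representation.asAlgebraHom_of _ _

theorem exists_mixedTensors_equiv (i j : ℕ) [Invertible ((i.factorial : ℕ) : R)]
    [Invertible ((j.factorial : ℕ) : R)] :
    Nonempty (((N.exteriorPower i).carrier ⊗[R] ((N.toSMod 0).pow j).fix.carrier) ≃ₗ[R]
      mixedTensors N i j) := by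
  let S := (N.toSMod 0).pow j
  let T := antisym N i
  let avg : S.carrier →ₗ[R] S.fix.carrier :=
    S.ρ.averageMap.codRestrict _ S.ρ.averageMap_invariant
  let f₀ : ((N.exteriorPower i).carrier ⊗[R] S.fix.carrier) →ₗ[R]
      ((N.toSMod 0).pow (i + j)).carrier :=
    (concat N i j).toLinearMap ∘ₗ TensorProduct.map T S.ρ.invariants.subtype
  let f₁ : ((N.toSMod 0).pow (i + j)).carrier →ₗ[R]
      ((N.exteriorPower i).carrier ⊗[R] S.fix.carrier) :=
    TensorProduct.map (⅟((i.factorial : ℕ) : R) • altMap N i) avg ∘ₗ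
      (concat N i j).symm.toLinearMap
  have hf : ∀ y, f₀ y ∈ mixedTensors N i j := fun y g₁ g₂ => by
    change ((N.toSMod 0).pow (i + j)).ρ (blockPerm g₁ g₂) (concat N i j (TensorProduct.map T
      S.ρ.invariants.subtype y)) = sgn R (Equiv.Perm.sign g₁) • concat N i j (TensorProduct.map T
      S.ρ.invariants.subtype y)
    rw [← concat_map, ← map_smul]
    congr 1
    refine LinearMap.congr_fun (f := TensorProduct.map (((N.toSMod 0).pow i).ρ g₁) (S.ρ g₂) ∘ₗ
      TensorProduct.map T S.ρ.invariants.subtype) (g := sgn R (Equiv.Perm.sign g₁) •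
      TensorProduct.map T S.ρ.invariants.subtype) (TensorProduct.ext' fun x s => ?_) y
    change ((N.toSMod 0).pow i).ρ g₁ (T x) ⊗ₜ[R] S.ρ g₂ s.1 =
      sgn R (Equiv.Perm.sign g₁) • T x ⊗ₜ[R] s.1
    rw [s.2 g₂, ρ_antisym, TensorProduct.smul_tmul']
  have h1 : ∀ y, f₁ (f₀ y) = y := fun y => by
    refine LinearMap.congr_fun (f := f₁ ∘ₗ f₀) (g := LinearMap.id)
      (TensorProduct.ext' fun x s => ?_) y
    change TensorProduct.map _ avg ((concat N i j).symm (concat N i j (T x ⊗ₜ s.1))) = x ⊗ₜ s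
    rw [LinearEquiv.symm_apply_apply, TensorProduct.map_tmul, LinearMap.smul_apply,
      altMap_antisym, smul_smul, invOf_mul_self, one_smul]
    congr 1
    exact Subtype.ext (S.ρ.averageMap_id s.1 s.2)
  have h2 : ∀ t ∈ mixedTensors N i j, f₀ (f₁ t) = t := fun t ht => by
    obtain ⟨y, rfl⟩ := (concat N i j).surjective t
    change concat N i j (TensorProduct.map T S.ρ.invariants.subtype (TensorProduct.map _ avg
      ((concat N i j).symm (concat N i j y)))) = _
    rw [LinearEquiv.symm_apply_apply, map_apply_map]
    have e1 : T ∘ₗ (⅟((i.factorial : ℕ) : R) • altMap N i) = ⅟((i.factorial : ℕ) : R) •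
        ∑ g, sgn R (Equiv.Perm.sign g) • ((N.toSMod 0).pow i).ρ g := by
      rw [LinearMap.comp_smul]
      congr 1
      refine LinearMap.ext fun x => ?_
      rw [LinearMap.comp_apply, LinearMap.sum_apply]
      exact antisym_altMap N x
    have e2 : S.ρ.invariants.subtype ∘ₗ avg = ⅟((j.factorial : ℕ) : R) • ∑ g, S.ρ g :=
      averageMap_eq S
    have e3 : TensorProduct.map (T ∘ₗ (⅟((i.factorial : ℕ) : R) • altMap N i))
        (S.ρ.invariants.subtype ∘ₗ avg) = (⅟((j.factorial : ℕ) : R) * ⅟((i.factorial : ℕ) : R)) •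
          ∑ g, ∑ h, sgn R (Equiv.Perm.sign g) •
            TensorProduct.map (((N.toSMod 0).pow i).ρ g) (S.ρ h) := by
      rw [e1, e2, TensorProduct.map_smul_right, TensorProduct.map_smul_left, smul_smul]
      congr 1
      change TensorProduct.mapBilinear (.id R) _ _ _ _ _ _ = _
      rw [map_sum, Finset.sum_comm]
      refine Finset.sum_congr rfl fun h _ => ?_
      rw [map_sum, LinearMap.sum_apply]
      refine Finset.sum_congr rfl fun g _ => ?_
      rw [map_smul, LinearMap.smul_apply]
      rfl
    rw [e3, LinearMap.smul_apply, map_smul, LinearMap.sum_apply, map_sum]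
    have e4 : ∀ g, concat N i j ((∑ h, sgn R (Equiv.Perm.sign g) •
        TensorProduct.map (((N.toSMod 0).pow i).ρ g) (S.ρ h)) y) =
          ((j.factorial : ℕ) : R) • concat N i j y := fun g => by
      rw [LinearMap.sum_apply, map_sum]
      have e5 : ∀ h, concat N i j ((sgn R (Equiv.Perm.sign g) •
          TensorProduct.map (((N.toSMod 0).pow i).ρ g) (S.ρ h)) y) = concat N i j y := fun h => by
        rw [LinearMap.smul_apply, map_smul, concat_map, ht g h, smul_smul, sgn_mul_self, one_smul]
      rw [Finset.sum_congr rfl fun h _ => e5 h, Finset.sum_const, Finset.card_univ,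
        Fintype.card_perm, Fintype.card_fin, Nat.cast_smul_eq_nsmul]
    rw [Finset.sum_congr rfl fun g _ => e4 g, Finset.sum_const, Finset.card_univ,
        Fintype.card_perm, Fintype.card_fin, ← Nat.cast_smul_eq_nsmul R, smul_smul, smul_smul,
        mul_assoc, mul_assoc, invOf_mul_cancel_left', invOf_mul_self, one_smul]
  exact ⟨LinearEquiv.ofLinearMap (f₀.codRestrict _ hf) (f₁ ∘ₗ (mixedTensors N i j).subtype)
    (LinearMap.ext fun t => Subtype.ext (h2 t.1 t.2)) (LinearMap.ext h1)⟩

theorem sK_fix_of_trivial_η {G : Type} [Group G] [Fintype G] [Invertible (Fintype.card G : R)]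
    (B : SRep R G) (h : ∀ x, B.η x = x) :
    B.fix.sK = (FGProj.mk B.fix.carrier : FGProj R).cls := by
  refine (SMod.sK_const _ 0 fun x => Subtype.ext ?_).trans (one_smul _ _)
  refine (h x.1).trans ?_
  simp [degSign]

open Classical in
/-- The class of the symmetric power of a module, for a degree whose factorial is invertible. -/
noncomputable def symK (j : ℕ) : K R :=
  if h : IsUnit ((j.factorial : ℕ) : R) then
    letI := h.invertible
    ((N.toSMod 0).pow j).fix.sK
  else 0

theorem symK_eq (j : ℕ) [h : Invertible ((j.factorial : ℕ) : R)] :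
    symK N j = ((N.toSMod 0).pow j).fix.sK := by
  rw [symK, dif_pos (isUnit_of_invertible _)]

theorem sK_fix_pow_tw_extPowRep (n : ℕ) [h : Invertible ((n.factorial : ℕ) : R)] (a : Fin (n + 1)) :
    (((N.toSMod 0).pow n).tw (extPowRep n a)).fix.sK =
      (N.exteriorPower a).cls * symK N (n - a) := by
  obtain ⟨i, hi⟩ : ∃ i, i = (a : ℕ) := ⟨_, rfl⟩
  obtain ⟨j, rfl⟩ : ∃ j, n = i + j := ⟨n - i, by omega⟩
  let _ : Invertible ((i.factorial : ℕ) : R) := (isUnit_of_dvd_unit (Nat.cast_dvd_cast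
    (Nat.factorial_dvd_factorial (Nat.le_add_right i j))) (isUnit_of_invertible _)).invertible
  let _ : Invertible ((j.factorial : ℕ) : R) := (isUnit_of_dvd_unit (Nat.cast_dvd_cast
    (Nat.factorial_dvd_factorial (Nat.le_add_left j i))) (isUnit_of_invertible _)).invertible
  rw [← hi, Nat.add_sub_cancel_left, symK_eq, sK_fix_of_trivial_η _ fun x => funext fun y =>
    pow_η N _, sK_fix_of_trivial_η _ (pow_η N), ← FGProj.cls_tensor]
  obtain ⟨e⟩ := exists_extPow_equiv N i j a hi.symm
  obtain ⟨e'⟩ := exists_mixedTensors_equiv N i j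
  exact FGProj.cls_eq_of_equiv (e.trans e'.symm)

omit [Invertible (2 : R)] in
theorem cls_exteriorPower_zero : (N.exteriorPower 0).cls = 1 :=
  FGProj.cls_eq_of_equiv (N := FGProj.mk R) (exteriorPower.zeroEquiv R N.carrier)

theorem symK_zero : symK N 0 = 1 := by
  let _ : Invertible ((Nat.factorial 0 : ℕ) : R) := invertibleOne.copy _ (by simp)
  rw [symK_eq, sK_fix_of_trivial_η _ (pow_η N)]
  refine FGProj.cls_eq_of_equiv (N := FGProj.mk R) ?_
  refine (LinearEquiv.ofTop _ (eq_top_iff.mpr fun x _ g => ?_)).trans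
    (PiTensorProduct.isEmptyEquiv (Fin 0))
  rw [Subsingleton.elim g 1, map_one, Module.End.one_apply]

theorem sum_exteriorPower_mul_symK {n : ℕ} (hn : 0 < n) (h : IsUnit ((n.factorial : ℕ) : R)) :
    ∑ i ∈ Finset.range (n + 1), (-1) ^ i * (N.exteriorPower i).cls * symK N (n - i) = 0 := by
  let _ := h.invertible
  rw [Finset.sum_range, ← sum_extPow_sK hn ((N.toSMod 0).pow n)]
  refine Finset.sum_congr rfl fun a _ => ?_
  rw [sK_fix_pow_tw_extPowRep, zsmul_eq_mul, mul_assoc]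
  push_cast
  rfl

theorem sX_pow_eq_sum {n : ℕ} (hn : 0 < n) [Invertible ((n.factorial : ℕ) : R)] :
    sX ((N.toSMod 0).pow n) =
      ∑ i ∈ Finset.range (n + 1), (-1) ^ (i + 1) * (i : K R) * (N.exteriorPower i).cls *
        symK N (n - i) := by
  rw [Finset.sum_range, (extFamily hn).sX_eq hn]
  refine Finset.sum_congr rfl fun a _ => ?_
  change ((-1) ^ ((a : ℕ) + 1) * ((a : ℕ) : ℤ)) •
    (((N.toSMod 0).pow n).tw (extPowRep n a)).fix.sK = _
  rw [sK_fix_pow_tw_extPowRep, zsmul_eq_mul]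
  push_cast
  ring

end AdamsPower

section Newton

open PowerSeries (coeff coeff_mk coeff_mul) in
/-- Newton's formula: the power sums in terms of the elementary and of the complete symmetric
functions. -/
theorem sum_eq_aeval_newton {A : Type u} [CommRing A] {k : ℕ} (hk : 0 < k) (l s : ℕ → A)
    (hl : l 0 = 1) (hs : s 0 = 1)
    (h : ∀ n, 0 < n → n ≤ k → ∑ i ∈ Finset.range (n + 1), (-1) ^ i * l i * s (n - i) = 0) :
    ∑ i ∈ Finset.range (k + 1), (-1) ^ (i + 1) * (i : A) * l i * s (k - i) =
      MvPolynomial.aeval (fun i : Fin k => l (i + 1)) (newton k) := by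
  let L : PowerSeries A := PowerSeries.mk fun i => (-1) ^ i * l i
  let S : PowerSeries A := PowerSeries.mk s
  let D : PowerSeries A := PowerSeries.mk fun i => (-1) ^ (i + 1) * (i : A) * l i
  let p : ℕ → A := fun n => coeff n (D * S)
  have hp : ∀ n, p n =
      ∑ i ∈ Finset.range (n + 1), (-1) ^ (i + 1) * (i : A) * l i * s (n - i) := fun n => by
    change coeff n (D * S) = _
    rw [coeff_mul, Finset.Nat.sum_antidiagonal_eq_sum_range_succ_mk]
    refine Finset.sum_congr rfl fun i _ => ?_
    rw [coeff_mk, coeff_mk]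
  have hLS : ∀ n, n ≤ k → coeff n (L * S) = if n = 0 then 1 else 0 := fun n hn => by
    rw [coeff_mul, Finset.Nat.sum_antidiagonal_eq_sum_range_succ_mk]
    simp only [L, S, coeff_mk]
    split_ifs with h0
    · subst h0
      simp [hl, hs]
    · exact h n (Nat.pos_of_ne_zero h0) hn
  have hrec : ∀ n, n ≤ k → ∑ a ∈ Finset.HasAntidiagonal.antidiagonal n, (-1) ^ a.1 * l a.1 * p a.2 =
      (-1) ^ (n + 1) * (n : A) * l n := fun n hn => by
    have h1 : coeff n (L * (D * S)) = coeff n (D * (L * S)) := by ring_nf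
    rw [coeff_mul, coeff_mul] at h1
    simp only [L, coeff_mk] at h1
    refine h1.trans ?_
    refine (Finset.sum_congr rfl fun a ha => congrArg (_ * ·)
      (hLS a.2 ((Nat.le.intro ((add_comm _ _).trans (Finset.HasAntidiagonal.mem_antidiagonal.mp ha))).trans hn))).trans ?_
    rw [Finset.sum_eq_single (n, 0)]
    · simp [D, coeff_mk]
    · rintro ⟨a, b⟩ hab hne
      have hb : b ≠ 0 := fun hb => hne (by
        rw [Finset.HasAntidiagonal.mem_antidiagonal] at hab
        simp only at hab
        simp [hb, ← hab])
      simp [hb]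
    · intro h0
      exact absurd (Finset.HasAntidiagonal.mem_antidiagonal.mpr (by simp)) h0
  have hp0 : p 0 = 0 := by rw [hp]; simp
  rw [← hp]
  let φ : MvPolynomial.symmetricSubalgebra (Fin k) ℤ →ₐ[ℤ] A :=
    (MvPolynomial.aeval fun i : Fin k => l (i + 1)).comp
      (MvPolynomial.esymmAlgEquiv (Fin k) ℤ (Fintype.card_fin k)).symm.toAlgHom
  have hφ : ∀ m, 0 < m → m ≤ k → φ ⟨MvPolynomial.esymm (Fin k) ℤ m,
      MvPolynomial.esymm_isSymmetric _ _ _⟩ = l m := fun m h0 hm => by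
    obtain ⟨i, rfl⟩ : ∃ i : Fin k, m = i + 1 := ⟨⟨m - 1, by omega⟩, by simp; omega⟩
    change MvPolynomial.aeval _ ((MvPolynomial.esymmAlgEquiv (Fin k) ℤ (Fintype.card_fin k)).symm _)
      = _
    rw [MvPolynomial.esymmAlgEquiv_symm_apply, MvPolynomial.aeval_X]
  have main : ∀ n, 0 < n → n ≤ k → p n = φ ⟨MvPolynomial.psum (Fin k) ℤ n,
      MvPolynomial.psum_isSymmetric _ _ _⟩ := fun n => by
    induction n using Nat.strong_induction_on with
    | _ n ih =>
    intro h0 hn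
    have h1 : (⟨MvPolynomial.psum (Fin k) ℤ n, MvPolynomial.psum_isSymmetric _ _ _⟩ :
        MvPolynomial.symmetricSubalgebra (Fin k) ℤ) = (-1) ^ (n + 1) * (n : _) *
          ⟨MvPolynomial.esymm (Fin k) ℤ n, MvPolynomial.esymm_isSymmetric _ _ _⟩ -
        ∑ a ∈ Finset.HasAntidiagonal.antidiagonal n with a.1 ∈ Set.Ioo 0 n, (-1) ^ a.1 *
          ⟨MvPolynomial.esymm (Fin k) ℤ a.1, MvPolynomial.esymm_isSymmetric _ _ _⟩ *
          ⟨MvPolynomial.psum (Fin k) ℤ a.2, MvPolynomial.psum_isSymmetric _ _ _⟩ := by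
      refine Subtype.ext ((MvPolynomial.psum_eq_mul_esymm_sub_sum (Fin k) ℤ n h0).trans ?_)
      push_cast
      rfl
    rw [h1, map_sub, map_mul, map_mul, map_pow, map_neg, map_one, map_natCast, hφ n h0 hn, map_sum,
      ← hrec n hn, eq_sub_iff_add_eq, ← Finset.sum_filter_add_sum_filter_not (Finset.HasAntidiagonal.antidiagonal n)
        fun a => a.1 ∈ Set.Ioo 0 n, add_comm]
    congr 1
    · refine Finset.sum_congr rfl fun a ha => ?_
      obtain ⟨ha1, ha2, ha3⟩ := Finset.mem_filter.mp ha
      rw [Finset.HasAntidiagonal.mem_antidiagonal] at ha1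
      rw [map_mul, map_mul, map_pow, map_neg, map_one, hφ a.1 ha2 (by omega),
        ih a.2 (by omega) (by omega) (by omega)]
    · symm
      rw [Finset.sum_eq_single (0, n)]
      · simp [hl]
      · rintro ⟨a, b⟩ hab hne
        obtain ⟨ha1, ha2⟩ := Finset.mem_filter.mp hab
        rw [Finset.HasAntidiagonal.mem_antidiagonal] at ha1
        simp only [Set.mem_Ioo, not_and, not_lt] at ha1 ha2
        have ha : a ≠ 0 := fun ha => hne (by simp [ha]; omega)
        have hb : b = 0 := by have := ha2 (Nat.pos_of_ne_zero ha); omega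
        simp [hb, hp0]
      · intro h2
        exact absurd (Finset.mem_filter.mpr ⟨Finset.HasAntidiagonal.mem_antidiagonal.mpr (by simp), by simp⟩) h2
  exact main k hk le_rfl

/-- The Adams character of the tensor power of a module is its Adams operation. -/
theorem sX_pow_eq_adams {R : Type u} [CommRing R] [Invertible (2 : R)] (N : FGProj R) {k : ℕ}
    (hk : 0 < k) [Invertible ((k.factorial : ℕ) : R)] :
    sX ((N.toSMod 0).pow k) = adams k N := by
  rw [sX_pow_eq_sum N hk]
  exact sum_eq_aeval_newton hk (fun i => (N.exteriorPower i).cls) (symK N) (cls_exteriorPower_zero N)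
    (symK_zero N) fun n h0 hn => sum_exteriorPower_mul_symK N h0 (isUnit_of_dvd_unit
      (Nat.cast_dvd_cast (Nat.factorial_dvd_factorial hn)) (isUnit_of_invertible _))

end Newton

/-! ## Morita equivalence -/

section Morita

variable {R V : Type u} [CommRing R] [AddCommGroup V] [Module R V] {Q : QuadraticForm R V}
  {G : Type} [Group G]

theorem GrMod.ε_ε (T : GrMod Q G) (x : T.carrier) : T.ε (T.ε x) = x := LinearMap.congr_fun T.ε_sq x

theorem GrMod.ε_act_apply (T : GrMod Q G) (v : V) (x : T.carrier) :
    T.ε (T.act (ι Q v) x) = -T.act (ι Q v) (T.ε x) := LinearMap.congr_fun (T.ε_act v) x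

theorem GrMod.ρ_ε_apply (T : GrMod Q G) (g : G) (x : T.carrier) : T.ρ g (T.ε x) = T.ε (T.ρ g x) :=
  LinearMap.congr_fun (T.ρ_ε g) x

namespace Spinorial

variable (S : Spinorial Q)

theorem ε_ε (x : S.E) : S.ε (S.ε x) = x := LinearMap.congr_fun S.ε_sq x

theorem ε_φ_apply (v : V) (x : S.E) : S.ε (S.φ (ι Q v) x) = -S.φ (ι Q v) (S.ε x) :=
  LinearMap.congr_fun (S.φ_odd v) x

/-- The element of the Clifford algebra which acts on the spinors as an endomorphism of rank one. -/
def rankOne (f : Module.Dual R S.E) (e : S.E) : CliffordAlgebra Q := S.φ.symm (f.smulRight e)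

theorem φ_rankOne (f : Module.Dual R S.E) (e z : S.E) : S.φ (S.rankOne f e) z = f z • e := by
  rw [rankOne, AlgEquiv.apply_symm_apply]
  rfl

theorem rankOne_φ (f : Module.Dual R S.E) (c : CliffordAlgebra Q) (e : S.E) :
    S.rankOne f (S.φ c e) = c * S.rankOne f e := by
  apply S.φ.injective
  ext z
  rw [φ_rankOne, map_mul, Module.End.mul_apply, φ_rankOne, map_smul]

/-- The map `e ↦ rankOne f e • t`. -/
def rankOneMap (T : GrMod Q G) (f : Module.Dual R S.E) (t : T.carrier) : S.E →ₗ[R] T.carrier where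
  toFun e := T.act (S.rankOne f e) t
  map_add' e e' := by
    rw [← LinearMap.add_apply, ← map_add]
    congr 2
    apply S.φ.injective
    ext z
    rw [φ_rankOne, map_add, LinearMap.add_apply, φ_rankOne, φ_rankOne, smul_add]
  map_smul' r e := by
    rw [RingHom.id_apply, ← LinearMap.smul_apply, ← map_smul]
    congr 2
    apply S.φ.injective
    ext z
    rw [φ_rankOne, map_smul, LinearMap.smul_apply, φ_rankOne, smul_comm]

/-- The linear maps `E → T` compatible with the action of the Clifford algebra. -/
def homSub (T : GrMod Q G) : Submodule R (S.E →ₗ[R] T.carrier) where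
  carrier := {f | ∀ v e, f (S.φ (ι Q v) e) = T.act (ι Q v) (f e)}
  add_mem' ha hb v e := by
    rw [LinearMap.add_apply, ha, hb, LinearMap.add_apply, map_add]
  zero_mem' v e := by simp
  smul_mem' r a ha v e := by rw [LinearMap.smul_apply, ha, LinearMap.smul_apply, map_smul]

variable {S}

theorem apply_φ {T : GrMod Q G} {f : S.E →ₗ[R] T.carrier} (hf : f ∈ S.homSub T)
    (c : CliffordAlgebra Q) (e : S.E) : f (S.φ c e) = T.act c (f e) := by
  induction c using CliffordAlgebra.induction generalizing e with
  | algebraMap r => simp [AlgHom.commutes]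
  | ι v => exact hf v e
  | mul a b ha hb => simp [ha, hb]
  | add a b ha hb => simp [ha, hb]

theorem act_rankOne {T : GrMod Q G} {f : S.E →ₗ[R] T.carrier} (hf : f ∈ S.homSub T)
    (g : Module.Dual R S.E) (e y : S.E) : T.act (S.rankOne g e) (f y) = g y • f e := by
  rw [← apply_φ hf, φ_rankOne, map_smul]

variable (S)

theorem rankOneMap_mem (T : GrMod Q G) (f : Module.Dual R S.E) (t : T.carrier) :
    S.rankOneMap T f t ∈ S.homSub T := fun v e => by
  change T.act (S.rankOne f (S.φ (ι Q v) e)) t = T.act (ι Q v) (T.act (S.rankOne f e) t)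
  rw [rankOne_φ, map_mul, Module.End.mul_apply]

/-- The linear map `T → Hom(E, T)` given by a linear form on the spinors. -/
def toHomSub (T : GrMod Q G) (f : Module.Dual R S.E) : T.carrier →ₗ[R] S.homSub T where
  toFun t := ⟨S.rankOneMap T f t, S.rankOneMap_mem T f t⟩
  map_add' t t' := Subtype.ext (LinearMap.ext fun e => LinearMap.map_add (T.act (S.rankOne f e)) t t')
  map_smul' r t := Subtype.ext (LinearMap.ext fun e => LinearMap.map_smul (T.act (S.rankOne f e)) r t)

theorem coe_toHomSub (T : GrMod Q G) (f : Module.Dual R S.E) (t : T.carrier) (e : S.E) :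
    (S.toHomSub T f t).1 e = T.act (S.rankOne f e) t := rfl

/-- Composition with a linear map compatible with the action of the Clifford algebra. -/
def homMap {H : Type} [Group H] {T : GrMod Q G} {T' : GrMod Q H} (a : T.carrier →ₗ[R] T'.carrier)
    (ha : ∀ v x, a (T.act (ι Q v) x) = T'.act (ι Q v) (a x)) : S.homSub T →ₗ[R] S.homSub T' :=
  (LinearMap.compRight R a).restrict fun f hf v e => by
    rw [LinearMap.compRight_apply, LinearMap.comp_apply, hf, ha]
    rfl

theorem homMap_apply {H : Type} [Group H] {T : GrMod Q G} {T' : GrMod Q H}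
    (a : T.carrier →ₗ[R] T'.carrier) (ha) (f : S.homSub T) (e : S.E) :
    (S.homMap (T' := T') a ha f).1 e = a (f.1 e) := rfl

section

variable [Invertible (2 : R)]

theorem finite_projective_homSub (T : GrMod Q G) :
    Module.Finite R (S.homSub T) ∧ Module.Projective R (S.homSub T) := by
  have := S.finite_clifford
  have := S.projective_clifford
  obtain ⟨h1, h2⟩ := finite_projective_of_isFGProj T.fgProj
  obtain ⟨m, y, h, hy⟩ := exists_sum_dual_eq_one R S.E S.faithful
  let i : S.homSub T →ₗ[R] (Fin m → T.carrier) :=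
    LinearMap.pi fun j => LinearMap.applyₗ (y j) ∘ₗ (S.homSub T).subtype
  let s : (Fin m → T.carrier) →ₗ[R] S.homSub T := ∑ j, S.toHomSub T (h j) ∘ₗ LinearMap.proj j
  have hs : ∀ f, s (i f) = f := fun f => by
    refine Subtype.ext (LinearMap.ext fun e => ?_)
    rw [LinearMap.sum_apply, Submodule.coe_sum, LinearMap.sum_apply]
    refine (Finset.sum_congr rfl fun j _ => act_rankOne f.2 (h j) e (y j)).trans ?_
    rw [← Finset.sum_smul, hy, one_smul]
  have := projective_pi (R := R) fun _ : Fin m => T.carrier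
  exact ⟨Module.Finite.of_surjective s fun f => ⟨i f, hs f⟩,
    Module.Projective.of_split i s (LinearMap.ext hs)⟩

instance finite_homSub (T : GrMod Q G) : Module.Finite R (S.homSub T) :=
  (S.finite_projective_homSub T).1

instance projective_homSub (T : GrMod Q G) : Module.Projective R (S.homSub T) :=
  (S.finite_projective_homSub T).2

/-- The super representation `Hom(E, T)` of a graded module `T` over the Clifford algebra. -/
abbrev hom (T : GrMod Q G) : SRep R G where
  carrier := S.homSub T
  η := (LinearMap.compRight R T.ε ∘ₗ LinearMap.lcomp R T.carrier S.ε).restrict fun f hf v e => by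
    change T.ε (f (S.ε (S.φ (ι Q v) e))) = T.act (ι Q v) (T.ε (f (S.ε e)))
    rw [ε_φ_apply, map_neg, hf, map_neg, T.ε_act_apply, neg_neg]
  η_sq f := Subtype.ext (LinearMap.ext fun e => by
    change T.ε (T.ε (f.1 (S.ε (S.ε e)))) = f.1 e
    rw [S.ε_ε, T.ε_ε])
  ρ :=
    { toFun := fun g => S.homMap (T.ρ g) fun v x => (T.ρ_act_comm g (ι Q v) x).symm
      map_one' := LinearMap.ext fun f => Subtype.ext (LinearMap.ext fun e => by
        rw [homMap_apply, map_one]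
        rfl)
      map_mul' := fun g h => LinearMap.ext fun f => Subtype.ext (LinearMap.ext fun e => by
        rw [homMap_apply, map_mul]
        rfl) }
  ρ_η g f := Subtype.ext (LinearMap.ext fun e => T.ρ_ε_apply g _)

theorem exists_homEquiv {T T' : GrMod Q G} (h : T.Iso T') :
    ∃ e : (S.hom T).carrier ≃ₗ[R] (S.hom T').carrier,
      (∀ x, e ((S.hom T).η x) = (S.hom T').η (e x)) ∧
      ∀ g x, e ((S.hom T).ρ g x) = (S.hom T').ρ g (e x) := by
  obtain ⟨e, h1, h2, h3⟩ := h
  exact ⟨LinearEquiv.ofLinearMap (S.homMap e.toLinearMap h1) (S.homMap e.symm.toLinearMap fun v x => by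
      change e.symm _ = T.act (ι Q v) (e.symm x)
      rw [LinearEquiv.symm_apply_eq, h1, e.apply_symm_apply])
      (LinearMap.ext fun f => Subtype.ext (LinearMap.ext fun x => e.apply_symm_apply _))
      (LinearMap.ext fun f => Subtype.ext (LinearMap.ext fun x => e.symm_apply_apply _)),
    fun f => Subtype.ext (LinearMap.ext fun x => h2 _),
    fun g f => Subtype.ext (LinearMap.ext fun x => h3 g _)⟩

theorem sK_hom_of_iso {T T' : GrMod Q G} (h : T.Iso T') : (S.hom T).sK = (S.hom T').sK := by
  obtain ⟨e, h1, -⟩ := S.exists_homEquiv h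
  exact SMod.sK_congr e h1

theorem sK_hom_of_isSum {L M N : GrMod Q G} (h : L.IsSum M N) :
    (S.hom L).sK = (S.hom M).sK + (S.hom N).sK := by
  rw [← S.sK_hom_of_iso h.iso]
  exact SMod.sK_prod (LinearEquiv.ofLinearMap
    ((S.homMap (LinearMap.inl R _ _) fun v x => by
      change ((M.act (ι Q v) x, 0) : M.carrier × N.carrier) = (M.act (ι Q v) x, N.act (ι Q v) 0)
      rw [map_zero]).coprod
      (S.homMap (LinearMap.inr R _ _) fun v x => by
        change ((0, N.act (ι Q v) x) : M.carrier × N.carrier) = (M.act (ι Q v) 0, N.act (ι Q v) x)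
        rw [map_zero]))
    ((S.homMap (LinearMap.fst R _ _) fun v x => rfl).prod
      (S.homMap (LinearMap.snd R _ _) fun v x => rfl))
    (LinearMap.ext fun f => Subtype.ext (LinearMap.ext fun x =>
      Prod.ext (add_zero (f.1 x).1) (zero_add (f.1 x).2)))
    (LinearMap.ext fun f => Prod.ext
      (Subtype.ext (LinearMap.ext fun x => add_zero (f.1.1 x)))
      (Subtype.ext (LinearMap.ext fun x => zero_add (f.2.1 x)))))
    fun f => Subtype.ext (LinearMap.ext fun x => Prod.ext
      ((add_zero _).trans (congrArg M.ε (add_zero _).symm))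
      ((zero_add _).trans (congrArg N.ε (zero_add _).symm)))

theorem sK_hom_of_isElementary {M : GrMod Q G} (h : M.IsElementary) : (S.hom M).sK = 0 := by
  obtain ⟨e, h1, h2, h3, -⟩ := h
  refine SMod.sK_eq_zero_of_odd _ ((LinearMap.compRight R e ∘ₗ
    LinearMap.lcomp R M.carrier S.ε).restrict fun f hf v x => ?_)
    (fun f => Subtype.ext (LinearMap.ext fun x => ?_))
    (fun f => Subtype.ext (LinearMap.ext fun x => ?_))
  · change e (f (S.ε (S.φ (ι Q v) x))) = M.act (ι Q v) (e (f (S.ε x)))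
    rw [ε_φ_apply, map_neg, hf, map_neg]
    exact neg_eq_iff_eq_neg.mpr (LinearMap.congr_fun (h3 v) _)
  · change e (e (f.1 (S.ε (S.ε x)))) = f.1 x
    rw [S.ε_ε]
    exact LinearMap.congr_fun h1 _
  · exact LinearMap.congr_fun h2 _

/-- The inverse of the Morita map. -/
noncomputable def moritaInv : GrK Q Unit →+ K R :=
  GrK.lift (fun T => (S.hom T).sK) (fun _ _ _ h => S.sK_hom_of_isSum h)
    fun _ h => S.sK_hom_of_isElementary h

theorem moritaInv_cls (T : GrMod Q Unit) : S.moritaInv T.cls = (S.hom T).sK :=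
  GrK.lift_cls _ _ _ T

/-- The graded module `E ⊗ B` of a super representation `B`. -/
noncomputable abbrev moritaRep (B : SRep R G) : GrMod Q G where
  carrier := S.E ⊗[R] B.carrier
  act := (Module.End.rTensorAlgHom R S.E B.carrier).comp S.φ.toAlgHom
  fgProj := isFGProj_of_algEquiv_end S.faithful S.φ _
  ε := TensorProduct.map S.ε B.η
  ε_sq := by rw [← TensorProduct.map_mul, S.ε_sq, B.η_mul, TensorProduct.map_one]
  ε_act v := by
    change TensorProduct.map S.ε B.η * TensorProduct.map (S.φ (ι Q v)) 1 =
      -(TensorProduct.map (S.φ (ι Q v)) 1 * TensorProduct.map S.ε B.η)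
    rw [← TensorProduct.map_mul, ← TensorProduct.map_mul, S.φ_odd, mul_one, one_mul]
    exact TensorProduct.ext' fun x y => TensorProduct.neg_tmul _ _
  ρ :=
    { toFun := fun g => LinearMap.lTensor S.E (B.ρ g)
      map_one' := by
        rw [map_one]
        exact LinearMap.lTensor_id _ _
      map_mul' := fun g h => by rw [map_mul, LinearMap.lTensor_mul] }
  ρ_act g v := TensorProduct.ext' fun x y => rfl
  ρ_ε g := TensorProduct.ext' fun x y => by
    change S.ε x ⊗ₜ[R] B.ρ g (B.η y) = S.ε x ⊗ₜ[R] B.η (B.ρ g y)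
    rw [B.ρ_η]

theorem moritaRep_act_tmul (B : SRep R G) (c : CliffordAlgebra Q) (e : S.E) (b : B.carrier) :
    (S.moritaRep B).act c (e ⊗ₜ b) = S.φ c e ⊗ₜ b := rfl

theorem exists_equiv_hom_moritaRep (B : SRep R G) :
    ∃ e : B.carrier ≃ₗ[R] (S.hom (S.moritaRep B)).carrier,
      (∀ x, e (B.η x) = (S.hom (S.moritaRep B)).η (e x)) ∧
      ∀ g x, e (B.ρ g x) = (S.hom (S.moritaRep B)).ρ g (e x) := by
  obtain ⟨m, y, h, hy⟩ := exists_sum_dual_eq_one R S.E S.faithful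
  let F : B.carrier →ₗ[R] S.homSub (S.moritaRep B) :=
    { toFun := fun b => ⟨(TensorProduct.mk R S.E B.carrier).flip b, fun v e => rfl⟩
      map_add' := fun b b' => Subtype.ext (map_add _ b b')
      map_smul' := fun r b => Subtype.ext (map_smul _ r b) }
  let F' : S.homSub (S.moritaRep B) →ₗ[R] B.carrier :=
    ∑ j, (TensorProduct.lid R B.carrier).toLinearMap ∘ₗ LinearMap.rTensor B.carrier (h j) ∘ₗ
      LinearMap.applyₗ (y j) ∘ₗ (S.homSub (S.moritaRep B)).subtype
  have h1 : ∀ b, F' (F b) = b := fun b => by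
    rw [LinearMap.sum_apply]
    change ∑ j, h j (y j) • b = b
    rw [← Finset.sum_smul, hy, one_smul]
  have h2 : ∀ f, F (F' f) = f := fun f => by
    refine Subtype.ext (LinearMap.ext fun e => ?_)
    change e ⊗ₜ[R] F' f = f.1 e
    have key : ∀ (g : Module.Dual R S.E) (t : S.E ⊗[R] B.carrier),
        e ⊗ₜ[R] TensorProduct.lid R B.carrier (LinearMap.rTensor B.carrier g t) =
          (S.moritaRep B).act (S.rankOne g e) t := fun g t => by
      induction t with
      | zero => simp
      | add a b ha hb => rw [map_add, map_add, TensorProduct.tmul_add, ha, hb, map_add]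
      | tmul a b =>
        rw [moritaRep_act_tmul, φ_rankOne, TensorProduct.smul_tmul]
        rfl
    rw [LinearMap.sum_apply, TensorProduct.tmul_sum]
    refine (Finset.sum_congr rfl fun j _ => (key (h j) (f.1 (y j))).trans
      (act_rankOne f.2 (h j) e (y j))).trans ?_
    rw [← Finset.sum_smul, hy, one_smul]
  refine ⟨LinearEquiv.ofLinearMap F F' (LinearMap.ext h2) (LinearMap.ext h1), fun b => ?_,
    fun g b => rfl⟩
  refine Subtype.ext (LinearMap.ext fun e => ?_)
  change e ⊗ₜ[R] B.η b = S.ε (S.ε e) ⊗ₜ[R] B.η b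
  rw [S.ε_ε]

/-- If `T` is isomorphic to `E ⊗ B`, then `Hom(E, T)` is isomorphic to `B`. -/
theorem nonempty_splitting_hom {T : GrMod Q G} {B : SRep R G} (h : T.Iso (S.moritaRep B)) :
    Nonempty ((S.hom T).Splitting fun _ : Unit => B) := by
  obtain ⟨e, h1, h2⟩ := S.exists_equiv_hom_moritaRep B
  obtain ⟨e', h1', h2'⟩ := S.exists_homEquiv h.symm
  exact ⟨SRep.Splitting.ofEquiv (e.trans e') (fun x => (congrArg e' (h1 x)).trans (h1' _))
    fun g x => (congrArg e' (h2 g x)).trans (h2' g _)⟩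

/-- Every graded module over the Clifford algebra is isomorphic to `E ⊗ Hom(E, T)`. -/
theorem iso_moritaRep_hom (T : GrMod Q G) : T.Iso (S.moritaRep (S.hom T)) := by
  obtain ⟨n, x, g, hx⟩ := exists_dual_basis R S.E
  let F : S.E ⊗[R] S.homSub T →ₗ[R] T.carrier :=
    TensorProduct.lift (LinearMap.flip (S.homSub T).subtype)
  let F' : T.carrier →ₗ[R] S.E ⊗[R] S.homSub T :=
    ∑ j, TensorProduct.mk R S.E (S.homSub T) (x j) ∘ₗ S.toHomSub T (g j)
  have hF : ∀ e f, F (e ⊗ₜ f) = f.1 e := fun e f => rfl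
  have hF' : ∀ t, F' t = ∑ j, x j ⊗ₜ[R] S.toHomSub T (g j) t := fun t => LinearMap.sum_apply _ _ _
  have h1 : ∀ t, F (F' t) = t := fun t => by
    rw [hF', map_sum]
    simp only [hF, coe_toHomSub]
    rw [← LinearMap.sum_apply, ← map_sum]
    have : ∑ j, S.rankOne (g j) (x j) = 1 := by
      apply S.φ.injective
      ext z
      rw [map_sum, LinearMap.sum_apply, map_one, Module.End.one_apply]
      simp only [φ_rankOne]
      exact hx z
    rw [this, map_one, Module.End.one_apply]
  have h2 : ∀ z, F' (F z) = z := fun z => by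
    induction z with
    | zero => simp
    | add a b ha hb => rw [map_add, map_add, ha, hb]
    | tmul e f =>
      rw [hF, hF']
      have : ∀ j, S.toHomSub T (g j) (f.1 e) = g j e • f := fun j =>
        Subtype.ext (LinearMap.ext fun z => act_rankOne f.2 (g j) z e)
      simp only [this, ← TensorProduct.smul_tmul]
      rw [← TensorProduct.sum_tmul, hx]
  refine GrMod.Iso.symm ⟨LinearEquiv.ofLinearMap F F' (LinearMap.ext h1) (LinearMap.ext h2),
    fun v z => ?_, fun z => ?_, fun g z => ?_⟩
  · refine LinearMap.congr_fun (f := F ∘ₗ (S.moritaRep (S.hom T)).act (ι Q v))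
      (g := T.act (ι Q v) ∘ₗ F) (TensorProduct.ext' fun e f => ?_) z
    exact f.2 v e
  · refine LinearMap.congr_fun (f := F ∘ₗ (S.moritaRep (S.hom T)).ε) (g := T.ε ∘ₗ F)
      (TensorProduct.ext' fun e f => ?_) z
    change T.ε (f.1 (S.ε (S.ε e))) = T.ε (f.1 e)
    rw [S.ε_ε]
  · refine LinearMap.congr_fun (f := F ∘ₗ (S.moritaRep (S.hom T)).ρ g) (g := T.ρ g ∘ₗ F)
      (TensorProduct.ext' fun e f => rfl) z

end

end Spinorial

end Morita

section MoritaIso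

variable {R V : Type u} [CommRing R] [AddCommGroup V] [Module R V] {Q : QuadraticForm R V}
  {G : Type} [Group G]

theorem K.hom_ext {A : Type*} [AddCommGroup A] {f g : K R →+ A}
    (h : ∀ N : FGProj R, f N.cls = g N.cls) : f = g := by
  refine AddMonoidHom.ext fun x => ?_
  obtain ⟨x, rfl⟩ := Ideal.Quotient.mk_surjective x
  induction x using FreeAbelianGroup.induction_on with
  | zero => rw [map_zero, map_zero, map_zero]
  | of a =>
    induction a using Quotient.inductionOn with | _ P
    exact h P
  | neg a ha => rw [map_neg, map_neg, map_neg, ha]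
  | add a b ha hb => rw [map_add, map_add, map_add, ha, hb]

theorem GrMod.cls_shift (M : GrMod Q G) : M.shift.cls = -M.cls := by
  rw [eq_comm, neg_eq_iff_add_eq_zero, ← cls_of_isSum (add_isSum M M.shift)]
  exact cls_of_isElementary (add_shift_isElementary M)

variable [Invertible (2 : R)] (S : Spinorial Q)

namespace Spinorial

theorem morita_cls (N : FGProj R) : S.morita N.cls = (S.moritaObj N).cls := K.lift_cls _ _ _ N

theorem moritaObj_iso (N : FGProj R) :
    (S.moritaObj N).Iso (S.moritaRep (SRep.triv Unit (N.toSMod 0))) := by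
  refine ⟨.refl R _, fun v x => rfl, fun x => ?_, fun g x => ?_⟩
  · refine LinearMap.congr_fun (f := LinearMap.rTensor N.carrier S.ε)
      (g := TensorProduct.map S.ε (N.toSMod 0).η) (TensorProduct.ext' fun e y => ?_) x
    change S.ε e ⊗ₜ[R] y = S.ε e ⊗ₜ[R] ((N.toSMod 0).η y)
    congr 1
    simp [degSign]
  · refine (LinearMap.congr_fun (f := LinearMap.id (R := R) (M := S.E ⊗[R] N.carrier))
      (g := LinearMap.lTensor S.E (1 : Module.End R N.carrier)) ?_ x)
    exact (LinearMap.lTensor_id _ _).symm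

theorem moritaInv_morita (x : K R) : S.moritaInv (S.morita x) = x := by
  refine DFunLike.congr_fun (f := S.moritaInv.comp S.morita) (g := AddMonoidHom.id _)
    (K.hom_ext fun N => ?_) x
  change S.moritaInv (S.morita N.cls) = N.cls
  rw [morita_cls, moritaInv_cls, S.sK_hom_of_iso (S.moritaObj_iso N)]
  obtain ⟨e, h, -⟩ := S.exists_equiv_hom_moritaRep (SRep.triv Unit (N.toSMod 0))
  rw [← SMod.sK_congr e h, FGProj.sK_toSMod]
  exact one_smul ℤ _

theorem morita_sK (B : SRep R Unit) : S.morita B.sK = (S.moritaRep B).cls := by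
  rw [SMod.sK, map_sub, morita_cls, morita_cls, sub_eq_add_neg, ← GrMod.cls_shift]
  refine (GrMod.cls_of_isSum ?_).symm
  let i : ∀ a, S.E ⊗[R] (B.homog a) →ₗ[R] S.E ⊗[R] B.carrier := fun a =>
    LinearMap.lTensor S.E (B.homog a).subtype
  let s : ∀ a, S.E ⊗[R] B.carrier →ₗ[R] S.E ⊗[R] (B.homog a) := fun a =>
    LinearMap.lTensor S.E (B.toHomog a)
  have h1 : ∀ a x, s a (i a x) = x := fun a x => by
    refine LinearMap.congr_fun (f := s a ∘ₗ i a) (g := LinearMap.id)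
      (TensorProduct.ext' fun e b => ?_) x
    exact congrArg (e ⊗ₜ[R] ·) (B.toHomog_coe a b)
  have h2 : ∀ a b, a ≠ b → ∀ x, s a (i b x) = 0 := fun a b hab x => by
    refine LinearMap.congr_fun (f := s a ∘ₗ i b) (g := 0) (TensorProduct.ext' fun e y => ?_) x
    refine (congrArg (e ⊗ₜ[R] ·) (B.toHomog_coe_of_ne hab y)).trans ?_
    exact TensorProduct.tmul_zero _ _
  have h3 : ∀ x, i 0 (s 0 x) + i 1 (s 1 x) = x := fun x => by
    refine LinearMap.congr_fun (f := i 0 ∘ₗ s 0 + i 1 ∘ₗ s 1) (g := LinearMap.id)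
      (TensorProduct.ext' fun e b => ?_) x
    change e ⊗ₜ[R] (B.toHomog 0 b : B.carrier) + e ⊗ₜ[R] (B.toHomog 1 b : B.carrier) = e ⊗ₜ b
    rw [← TensorProduct.tmul_add]
    congr 1
    have h := B.sum_toHomog b
    rwa [show (Finset.univ : Finset (ZMod 2)) = {0, 1} from rfl,
      Finset.sum_pair (by decide)] at h
  have h4 : ∀ v a x, i a (LinearMap.rTensor _ (S.φ (ι Q v)) x) =
      (S.moritaRep B).act (ι Q v) (i a x) := fun v a x =>
    LinearMap.congr_fun (f := i a ∘ₗ LinearMap.rTensor _ (S.φ (ι Q v)))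
      (g := (S.moritaRep B).act (ι Q v) ∘ₗ i a) (TensorProduct.ext' fun e b => rfl) x
  have h5 : ∀ a x, i a (sgn R (degSign a) • LinearMap.rTensor _ S.ε x) =
      (S.moritaRep B).ε (i a x) := fun a x => by
    refine LinearMap.congr_fun (f := i a ∘ₗ (sgn R (degSign a) • LinearMap.rTensor _ S.ε))
      (g := (S.moritaRep B).ε ∘ₗ i a) (TensorProduct.ext' fun e b => ?_) x
    change i a (sgn R (degSign a) • S.ε e ⊗ₜ[R] b) = S.ε e ⊗ₜ[R] (B.η b.1)
    rw [SMod.mem_homog.mp b.2, TensorProduct.tmul_smul, map_smul]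
    rfl
  refine ⟨LinearEquiv.ofLinearMap ((i 0).coprod (i 1)) ((s 0).prod (s 1)) (LinearMap.ext h3)
    (LinearMap.ext fun x => Prod.ext ?_ ?_), fun v x => ?_, fun x => ?_, fun g x => ?_⟩
  · change s 0 (i 0 x.1 + i 1 x.2) = x.1
    exact (map_add (s 0) _ _).trans
      ((congrArg₂ (· + ·) (h1 0 x.1) (h2 0 1 (by decide) x.2)).trans (add_zero _))
  · change s 1 (i 0 x.1 + i 1 x.2) = x.2
    exact (map_add (s 1) _ _).trans
      ((congrArg₂ (· + ·) (h2 1 0 (by decide) x.1) (h1 1 x.2)).trans (zero_add _))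
  · exact (congrArg₂ (· + ·) (h4 v 0 x.1) (h4 v 1 x.2)).trans
      (map_add ((S.moritaRep B).act (ι Q v)) _ _).symm
  · refine Eq.trans ?_ (map_add (S.moritaRep B).ε _ _).symm
    refine congrArg₂ (· + ·) ((congrArg (i 0) ?_).trans (h5 0 x.1))
      ((congrArg (i 1) ?_).trans (h5 1 x.2))
    · change _ = sgn R 1 • _
      rw [map_one, one_smul]
      rfl
    · change _ = sgn R (-1) • _
      rw [show sgn R (-1) = -1 by simp [sgn], neg_smul, one_smul]
      rfl
  · have h : B.ρ g = LinearMap.id := by rw [Subsingleton.elim g 1, map_one]; rfl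
    change _ = LinearMap.lTensor S.E (B.ρ g) _
    rw [h, LinearMap.lTensor_id]
    rfl

theorem morita_bijective : Function.Bijective S.morita := by
  refine ⟨Function.LeftInverse.injective S.moritaInv_morita, fun x => ?_⟩
  obtain ⟨T, rfl⟩ := GrMod.cls_surjective x
  exact ⟨(S.hom T).sK, (S.morita_sK _).trans (S.iso_moritaRep_hom T).cls_eq.symm⟩

theorem invFun_morita (x : GrK Q Unit) : Function.invFun S.morita x = S.moritaInv x := by
  obtain ⟨y, rfl⟩ := S.morita_bijective.2 x
  rw [Function.leftInverse_invFun S.morita_bijective.1, moritaInv_morita]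

variable {k : ℕ} [Invertible ((k.factorial : ℕ) : R)]

theorem sK_hom_homObj (π : IntIrrep k) (T : GrMod Q (Equiv.Perm (Fin k))) :
    (S.hom (homObj π T)).sK = (isotyp (S.hom T) π).sK := by
  have hcoe : ∀ (x : Fin π.n → R) (u : (Fin π.n → R) →ₗ[R] T.carrier),
      ∑ z, x z • u (Pi.single z 1) = u x := fun x u => by
    conv_rhs => rw [← Finset.univ_sum_single x, map_sum]
    refine Finset.sum_congr rfl fun z _ => ?_
    rw [← map_smul, ← Pi.single_smul, smul_eq_mul, mul_one]
  have hπ : ∀ g z, π.toRep R g (Pi.single z 1) = fun x => ((π.ρ g x z : ℤ) : R) := fun g z => by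
    funext x
    change ((Int.castRingHom R).mapMatrix (π.ρ g)).mulVec (Pi.single z 1) x = _
    rw [Matrix.mulVec_single_one]
    rfl
  let F : S.homSub (homObj π T) →ₗ[R] (Fin π.n → S.homSub T) := LinearMap.pi fun z =>
    S.homMap (T := homObj π T) (T' := T)
      (LinearMap.applyₗ (Pi.single z 1) ∘ₗ (equivHom (π.toRep R) T.ρ).subtype) fun v x => rfl
  have hF : ∀ f, F f ∈ ((S.hom T).tw π.dual).ρ.invariants := fun f => by
    refine mem_of_ρ_apply fun g z => Subtype.ext (LinearMap.ext fun e => ?_)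
    rw [Submodule.coe_sum, LinearMap.sum_apply]
    change T.ρ g ((f.1 e).1 (Pi.single z 1)) = ∑ x, π.ρ g x z • (f.1 e).1 (Pi.single x 1)
    rw [← (mem_equivHom _ _ _).mp (f.1 e).2, hπ, ← hcoe]
    exact Finset.sum_congr rfl fun x _ => Int.cast_smul_eq_zsmul R _ _
  let u : (Fin π.n → S.homSub T) → S.E → (Fin π.n → R) →ₗ[R] T.carrier := fun a e =>
    ∑ z, (LinearMap.proj z : (Fin π.n → R) →ₗ[R] R).smulRight ((a z).1 e)
  have hu : ∀ a e x, u a e x = ∑ z, x z • (a z).1 e := fun a e x => LinearMap.sum_apply _ _ _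
  have hmem : ∀ a ∈ ((S.hom T).tw π.dual).ρ.invariants, ∀ e, u a e ∈ equivHom (π.toRep R) T.ρ := by
    intro a ha e
    rw [mem_equivHom]
    intro g x
    have h1 : ∀ z, T.ρ g ((a z).1 e) = ∑ x, π.ρ g x z • (a x).1 e := fun z => by
      have h := congrArg (fun f : S.homSub T => f.1 e) (ρ_apply_of_mem ha g z)
      simp only [Submodule.coe_sum, LinearMap.sum_apply] at h
      exact h
    have h2 : ∀ y, π.toRep R g x y = ∑ z, ((π.ρ g y z : ℤ) : R) * x z := fun y => rfl
    rw [hu, hu, map_sum]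
    simp only [map_smul, h1, h2, Finset.smul_sum, Finset.sum_smul]
    rw [Finset.sum_comm]
    refine Finset.sum_congr rfl fun y _ => Finset.sum_congr rfl fun z _ => ?_
    rw [← Int.cast_smul_eq_zsmul R, smul_smul, mul_comm]
  let F' : ((S.hom T).tw π.dual).ρ.invariants →ₗ[R] S.homSub (homObj π T) :=
    { toFun := fun a => ⟨{
          toFun := fun e => ⟨u a.1 e, hmem a.1 a.2 e⟩
          map_add' := fun e e' => Subtype.ext (LinearMap.ext fun x => by
            change u a.1 (e + e') x = u a.1 e x + u a.1 e' x
            simp only [hu, map_add, smul_add, Finset.sum_add_distrib])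
          map_smul' := fun r e => Subtype.ext (LinearMap.ext fun x => by
            change u a.1 (r • e) x = r • u a.1 e x
            simp only [hu, map_smul, Finset.smul_sum, smul_comm r]) },
        fun v e => Subtype.ext (LinearMap.ext fun x => by
          change u a.1 (S.φ (ι Q v) e) x = T.act (ι Q v) (u a.1 e x)
          rw [hu, hu, map_sum]
          refine Finset.sum_congr rfl fun z _ => ?_
          rw [(a.1 z).2, map_smul])⟩
      map_add' := fun a b => Subtype.ext (LinearMap.ext fun e =>
        Subtype.ext (LinearMap.ext fun x => by
          change u (a.1 + b.1) e x = u a.1 e x + u b.1 e x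
          simp only [hu, ← Finset.sum_add_distrib, ← smul_add]
          rfl))
      map_smul' := fun r a => Subtype.ext (LinearMap.ext fun e =>
        Subtype.ext (LinearMap.ext fun x => by
          change u (r • a.1) e x = r • u a.1 e x
          simp only [hu, Finset.smul_sum, smul_comm r]
          rfl)) }
  have hF' : ∀ a e x, ((F' a).1 e).1 x = ∑ z, x z • (a.1 z).1 e := fun a e x => hu a.1 e x
  refine SMod.sK_congr (LinearEquiv.ofLinearMap (F.codRestrict _ hF) F' ?_ ?_) fun f => rfl
  · refine LinearMap.ext fun a => Subtype.ext (funext fun z => Subtype.ext (LinearMap.ext fun e => ?_))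
    refine (hF' a e (Pi.single z 1)).trans ?_
    rw [Finset.sum_eq_single z (fun y _ hy => by rw [Pi.single_eq_of_ne hy, zero_smul]) (by simp),
      Pi.single_eq_same, one_smul]
    rfl
  · refine LinearMap.ext fun f => Subtype.ext (LinearMap.ext fun e =>
      Subtype.ext (LinearMap.ext fun x => ?_))
    exact (hF' _ e x).trans (hcoe x (f.1 e).1)

/-- The Adams character in terms of the super representation `Hom(E, T)`. -/
theorem moritaInv_adamsChar (T : GrMod Q (Equiv.Perm (Fin k))) :
    S.moritaInv (adamsChar T.cls) = sX (S.hom T) := by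
  rw [adamsChar, finsum_eq_sum_of_fintype, map_sum, sX]
  refine Finset.sum_congr rfl fun q _ => ?_
  rw [map_zsmul, homK, GrK.lift_cls, moritaInv_cls, sK_hom_homObj]
  rfl

end Spinorial

end MoritaIso

/-! ## Tensor powers of decompositions -/

section SubsetProj

variable {R M M' : Type u} [CommRing R] [AddCommGroup M] [Module R M] [AddCommGroup M'] [Module R M']
  {k : ℕ}

/-- The projection of a tensor power on the summand of the tensors which belong to the image of an
idempotent in the places of `s`, and to its kernel in the other ones. -/
noncomputable def subsetProj (q : Module.End R M) (s : Finset (Fin k)) :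
    Module.End R (PiTensorProduct R fun _ : Fin k => M) :=
  PiTensorProduct.map fun i => if i ∈ s then q else 1 - q

theorem subsetProj_mul_self {q : Module.End R M} (hq : q * q = q) (s : Finset (Fin k)) :
    subsetProj q s * subsetProj q s = subsetProj q s := by
  rw [subsetProj, ← PiTensorProduct.map_mul]
  congr 1
  funext i
  split_ifs
  · exact hq
  · rw [sub_mul, mul_sub, mul_sub, hq, one_mul, mul_one, one_mul, sub_self, sub_zero]

theorem map_eq_zero (f : Fin k → Module.End R M) (i : Fin k) (hi : f i = 0) :
    PiTensorProduct.map f = (0 : Module.End R (PiTensorProduct R fun _ : Fin k => M)) :=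
  (PiTensorProduct.mapMultilinear R (fun _ : Fin k => M) (fun _ => M)).map_coord_zero i hi

theorem subsetProj_mul_of_ne {q : Module.End R M} (hq : q * q = q) {s s' : Finset (Fin k)}
    (h : s ≠ s') : subsetProj q s * subsetProj q s' = 0 := by
  rw [subsetProj, subsetProj, ← PiTensorProduct.map_mul]
  have h0 : q * (1 - q) = 0 := by rw [mul_sub, hq, mul_one, sub_self]
  have h0' : (1 - q) * q = 0 := by rw [sub_mul, hq, one_mul, sub_self]
  obtain ⟨i, hi⟩ : ∃ i, ¬(i ∈ s ↔ i ∈ s') := by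
    by_contra hc
    push Not at hc
    exact h (Finset.ext hc)
  refine map_eq_zero _ i ?_
  by_cases h1 : i ∈ s <;> by_cases h2 : i ∈ s' <;> simp_all

theorem sum_subsetProj (q : Module.End R M) :
    ∑ s : Finset (Fin k), subsetProj q s = 1 := by
  have h := (PiTensorProduct.mapMultilinear R (fun _ : Fin k => M) (fun _ => M)).map_add_univ
    (fun _ => q) (fun _ => 1 - q)
  have h1 : (fun _ : Fin k => q) + (fun _ => 1 - q) = fun _ => 1 := by
    funext i
    simp
  rw [h1] at h
  refine Eq.trans ?_ (h.symm.trans PiTensorProduct.map_one)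
  refine Finset.sum_congr rfl fun s _ => ?_
  refine congrArg PiTensorProduct.map (funext fun i => ?_)
  simp only [Finset.piecewise]

variable [Invertible (2 : R)]

/-- The functoriality of the action of the symmetric group. -/
theorem map_koszulAct {ε : Module.End R M} {ε' : Module.End R M'} (hε : ε * ε = 1)
    (f : Fin k → M →ₗ[R] M') (hf : ∀ i x, f i (ε x) = ε' (f i x)) (g : Equiv.Perm (Fin k))
    (x : PiTensorProduct R fun _ : Fin k => M) :
    koszulAct ε' g (PiTensorProduct.map f x) =
      PiTensorProduct.map (fun i => f (g.symm i)) (koszulAct ε g x) := by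
  refine LinearMap.congr_fun (f := koszulAct ε' g ∘ₗ PiTensorProduct.map f)
    (g := PiTensorProduct.map (fun i => f (g.symm i)) ∘ₗ koszulAct ε g)
    (ext_homog hε fun d m hm => ?_) x
  have hm' : IsHomog ε' d fun i => f i (m i) := fun i => by rw [← hf, hm, map_smul]
  rw [LinearMap.comp_apply, LinearMap.comp_apply, PiTensorProduct.map_tprod, koszulAct_tprod hm,
    koszulAct_tprod hm', map_smul, PiTensorProduct.map_tprod]

theorem koszulAct_subsetProj {ε q : Module.End R M} (hε : ε * ε = 1) (hq : ∀ x, q (ε x) = ε (q x))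
    (g : Equiv.Perm (Fin k)) (s : Finset (Fin k)) (x : PiTensorProduct R fun _ : Fin k => M) :
    koszulAct ε g (subsetProj q s x) =
      subsetProj q (Equiv.finsetCongr g s) (koszulAct ε g x) := by
  refine (map_koszulAct hε _ (fun i x => ?_) g x).trans ?_
  · split_ifs
    · exact hq x
    · simp [hq]
  · refine congrArg (fun f => PiTensorProduct.map f (koszulAct ε g x)) (funext fun i => ?_)
    refine if_congr ?_ rfl rfl
    rw [Equiv.finsetCongr_apply, Finset.mem_map_equiv]

omit [Invertible (2 : R)] in
/-- The functoriality of the action of `V` on the tensor powers. -/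
theorem map_powMap {V : Type u} [AddCommGroup V] [Module R V] {ε : Module.End R M}
    {ε' : Module.End R M'} {c : V →ₗ[R] Module.End R M} {c' : V →ₗ[R] Module.End R M'}
    (f : Fin k → M →ₗ[R] M') (hf : ∀ i x, f i (ε x) = ε' (f i x))
    (hc : ∀ i v x, f i (c v x) = c' v (f i x)) (v : V) (x : PiTensorProduct R fun _ : Fin k => M) :
    PiTensorProduct.map f (powMap ε c k v x) = powMap ε' c' k v (PiTensorProduct.map f x) := by
  rw [powMap_apply, powMap_apply, LinearMap.sum_apply, LinearMap.sum_apply, map_sum]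
  refine Finset.sum_congr rfl fun i _ => ?_
  rw [← LinearMap.comp_apply, ← LinearMap.comp_apply, ← PiTensorProduct.map_comp,
    ← PiTensorProduct.map_comp]
  refine congrArg (fun f => PiTensorProduct.map f x) (funext fun j => LinearMap.ext fun y => ?_)
  by_cases hj : j = i
  · subst hj
    simp [hc]
  · simp only [LinearMap.comp_apply, Function.update_of_ne hj]
    split_ifs
    · exact hf j y
    · rfl

omit [Invertible (2 : R)] in
theorem powMap_subsetProj {V : Type u} [AddCommGroup V] [Module R V] {ε q : Module.End R M}
    {c : V →ₗ[R] Module.End R M} (hq : ∀ x, q (ε x) = ε (q x))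
    (hc : ∀ v x, q (c v x) = c v (q x)) (s : Finset (Fin k)) (v : V)
    (x : PiTensorProduct R fun _ : Fin k => M) :
    subsetProj q s (powMap ε c k v x) = powMap ε c k v (subsetProj q s x) := by
  refine map_powMap _ (fun i x => ?_) (fun i v x => ?_) v x <;> split_ifs
  · exact hq x
  · simp [hq]
  · exact hc v x
  · simp [hc]

omit [Invertible (2 : R)] in
theorem map_subsetProj {ε q : Module.End R M} (hq : ∀ x, q (ε x) = ε (q x)) (s : Finset (Fin k))
    (x : PiTensorProduct R fun _ : Fin k => M) :
    subsetProj q s (PiTensorProduct.map (fun _ => ε) x) =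
      PiTensorProduct.map (fun _ => ε) (subsetProj q s x) := by
  rw [subsetProj, ← LinearMap.comp_apply, ← LinearMap.comp_apply, ← PiTensorProduct.map_comp,
    ← PiTensorProduct.map_comp]
  refine congrArg (fun f => PiTensorProduct.map f x) (funext fun j => LinearMap.ext fun y => ?_)
  simp only [LinearMap.comp_apply]
  split_ifs
  · exact hq y
  · simp [hq]

/-- The derivation of the tensor power given by an even endomorphism. -/
noncomputable def evenSum (k : ℕ) (b : Module.End R M) :
    Module.End R (PiTensorProduct R fun _ : Fin k => M) :=
  ∑ i, PiTensorProduct.map (Function.update (fun _ => 1) i b)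

omit [Invertible (2 : R)] in
theorem powMap_anticomm {V W : Type u} [AddCommGroup V] [Module R V] [AddCommGroup W] [Module R W]
    {ε : Module.End R M} (hε : ε * ε = 1) {c : V →ₗ[R] Module.End R M} {c' : W →ₗ[R] Module.End R M}
    (hc : ∀ v, ε * c v = -(c v * ε)) (hc' : ∀ v, ε * c' v = -(c' v * ε)) (v : V) (w : W) :
    powMap ε c k v * powMap ε c' k w + powMap ε c' k w * powMap ε c k v =
      evenSum k (c v * c' w + c' w * c v) := by
  let C : Fin k → Module.End R (PiTensorProduct R fun _ : Fin k => M) := fun i =>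
    PiTensorProduct.map (Function.update (fun j => if j < i then ε else 1) i (c v))
  let C' : Fin k → Module.End R (PiTensorProduct R fun _ : Fin k => M) := fun i =>
    PiTensorProduct.map (Function.update (fun j => if j < i then ε else 1) i (c' w))
  have hne : ∀ i j, i ≠ j → C i * C' j + C' j * C i = 0 := fun i j hij => by
    rw [← neg_eq_iff_add_eq_zero, eq_comm]
    simp only [C, C']
    rw [← PiTensorProduct.map_mul, ← PiTensorProduct.map_mul, ← neg_eq_iff_eq_neg, eq_comm]
    rcases lt_or_gt_of_ne hij with h | h
    · refine map_eq_neg _ _ i ?_ fun l hl => ?_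
      · simp [hij, h, hc]
      · by_cases hlj : l = j
        · subst hlj
          simp [hij.symm, h.asymm]
        · simp only [Function.update_of_ne hl, Function.update_of_ne hlj]
          split_ifs <;> simp
    · refine map_eq_neg _ _ j ?_ fun l hl => ?_
      · simp [hij.symm, h, hc']
      · by_cases hlj : l = i
        · subst hlj
          simp [hij, h.asymm]
        · simp only [Function.update_of_ne hl, Function.update_of_ne hlj]
          split_ifs <;> simp
  have hself : ∀ i, C i * C' i + C' i * C i =
      PiTensorProduct.map (Function.update (fun _ => 1) i (c v * c' w + c' w * c v)) := fun i => by
    have h1 : ∀ a b : Module.End R M, (fun l => Function.update (fun j => if j < i then ε else 1) i a l *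
        Function.update (fun j => if j < i then ε else 1) i b l) =
        Function.update (fun _ => (1 : Module.End R M)) i (a * b) := fun a b => by
      funext l
      by_cases hl : l = i
      · subst hl
        simp
      · simp only [Function.update_of_ne hl]
        split_ifs <;> simp [hε]
    simp only [C, C']
    rw [← PiTensorProduct.map_mul, ← PiTensorProduct.map_mul, h1, h1]
    exact (PiTensorProduct.map_update_add _ _ _ _).symm
  rw [powMap_apply, powMap_apply, Finset.sum_mul_sum, Finset.sum_mul_sum, Finset.sum_comm,
    ← Finset.sum_add_distrib, evenSum]
  refine Finset.sum_congr rfl fun j _ => ?_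
  rw [← Finset.sum_add_distrib, Finset.sum_eq_single j (fun i _ hi => hne i j hi) (by simp)]
  exact hself j

omit [Invertible (2 : R)] in
theorem evenSum_zero : evenSum k (0 : Module.End R M) = 0 :=
  Finset.sum_eq_zero fun i _ => map_eq_zero _ i (Function.update_self _ _ _)

omit [Invertible (2 : R)] in
theorem evenSum_add (a b : Module.End R M) : evenSum k (a + b) = evenSum k a + evenSum k b := by
  rw [evenSum, evenSum, evenSum, ← Finset.sum_add_distrib]
  exact Finset.sum_congr rfl fun i _ => PiTensorProduct.map_update_add _ _ _ _

omit [Invertible (2 : R)] in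
theorem evenSum_mul_subsetProj {q : Module.End R M} (hq : q * q = q) (s : Finset (Fin k)) :
    evenSum k q * subsetProj q s = (s.card : R) • subsetProj q s := by
  have h0 : q * (1 - q) = 0 := by rw [mul_sub, hq, mul_one, sub_self]
  have h : ∀ i, PiTensorProduct.map (Function.update (fun _ => 1) i q) * subsetProj q s =
      if i ∈ s then subsetProj q s else 0 := fun i => by
    rw [subsetProj, ← PiTensorProduct.map_mul]
    split_ifs with hi
    · refine congrArg PiTensorProduct.map (funext fun l => ?_)
      by_cases hl : l = i
      · subst hl
        simp [hi, hq]
      · simp [hl]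
    · refine map_eq_zero _ i ?_
      simp [hi, h0]
  rw [evenSum, Finset.sum_mul, Finset.sum_congr rfl fun i _ => h i, Finset.sum_ite_mem,
    Finset.univ_inter, Finset.sum_const, Nat.cast_smul_eq_nsmul]

end SubsetProj

/-! ## Elementary modules -/

section Elementary

variable {R V : Type u} [CommRing R] [AddCommGroup V] [Module R V] {Q : QuadraticForm R V}
  {G : Type} [Group G]

theorem GrMod.mul_act_of_anticomm (T : GrMod Q G) {D : Module.End R T.carrier}
    (hD : ∀ v, D * T.act (ι Q v) = -(T.act (ι Q v) * D)) (x : CliffordAlgebra Q) :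
    D * T.act x = T.act (involute x) * D := by
  induction x using CliffordAlgebra.induction with
  | algebraMap r => simp [Algebra.commutes]
  | ι v => simp [hD]
  | mul a b ha hb => rw [map_mul, ← mul_assoc, ha, mul_assoc, hb, map_mul, map_mul, mul_assoc]
  | add a b ha hb => rw [map_add, mul_add, ha, hb, map_add, map_add, add_mul]

/-- A module over the Clifford algebra of a spinorial module is elementary if it has an odd
automorphism. -/
theorem GrMod.isElementary_of_bijective [Invertible (2 : R)] (S : Spinorial Q) (T : GrMod Q G)
    (D : Module.End R T.carrier) (hb : Function.Bijective D) (hε : D * T.ε = -(T.ε * D))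
    (hv : ∀ v, D * T.act (ι Q v) = -(T.act (ι Q v) * D)) (hρ : ∀ g, D * T.ρ g = T.ρ g * D) :
    T.IsElementary := by
  let E := LinearEquiv.ofBijective D hb
  let D' : Module.End R T.carrier := E.symm.toLinearMap
  have h1 : D * D' = 1 := LinearMap.ext E.apply_symm_apply
  have h2 : D' * D = 1 := LinearMap.ext E.symm_apply_apply
  have hanti : ∀ a : Module.End R T.carrier, D * a = -(a * D) → D' * a = -(a * D') := fun a ha => by
    have h := congrArg (D' * · * D') ha
    simp only [mul_neg, neg_mul, mul_assoc, h1, mul_one] at h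
    rw [← mul_assoc D' D, h2, one_mul] at h
    rw [h, neg_neg]
  let w := T.act S.orientation * T.ε
  have hu : involute S.orientation = S.orientation :=
    Spinorial.involute_of_mem_even S.orientation_even
  have hεu : T.ε * T.act S.orientation = T.act S.orientation * T.ε := by
    rw [T.mul_act_of_anticomm T.ε_act, hu]
  have hw : w * w = 1 := by
    change T.act S.orientation * T.ε * (T.act S.orientation * T.ε) = 1
    rw [mul_assoc, ← mul_assoc T.ε, hεu, mul_assoc, T.ε_sq, mul_one, ← map_mul,
      S.orientation_sq, map_one]
  have hwv : ∀ v, w * T.act (ι Q v) = T.act (ι Q v) * w := fun v => by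
    change T.act S.orientation * T.ε * T.act (ι Q v) = T.act (ι Q v) * (T.act S.orientation * T.ε)
    rw [mul_assoc, T.ε_act, mul_neg, ← mul_assoc, ← map_mul, S.orientation_anticomm, map_neg,
      neg_mul, neg_neg, map_mul, mul_assoc]
  have hwε : w * T.ε = T.ε * w := by
    change T.act S.orientation * T.ε * T.ε = T.ε * (T.act S.orientation * T.ε)
    rw [← mul_assoc, hεu]
  have hwρ : ∀ g, w * T.ρ g = T.ρ g * w := fun g => by
    have : T.act S.orientation * T.ρ g = T.ρ g * T.act S.orientation :=
      LinearMap.ext fun x => T.ρ_act_comm g _ x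
    change T.act S.orientation * T.ε * T.ρ g = T.ρ g * (T.act S.orientation * T.ε)
    rw [mul_assoc, ← T.ρ_ε, ← mul_assoc, this, mul_assoc]
  have hDw : D * w = -(w * D) := by
    change D * (T.act S.orientation * T.ε) = -(T.act S.orientation * T.ε * D)
    rw [← mul_assoc, T.mul_act_of_anticomm hv, hu, mul_assoc, hε, mul_neg, mul_assoc]
  have hD'w := hanti w hDw
  have e1 : (1 + w) * D = D * (1 - w) := by
    rw [add_mul, mul_sub, hDw, one_mul, mul_one, sub_neg_eq_add]
  have e2 : (1 - w) * D = D * (1 + w) := by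
    rw [sub_mul, mul_add, hDw, one_mul, mul_one, ← sub_eq_add_neg]
  have e3 : (1 + w) * D' = D' * (1 - w) := by
    rw [add_mul, mul_sub, hD'w, one_mul, mul_one, sub_neg_eq_add]
  have e4 : (1 - w) * D' = D' * (1 + w) := by
    rw [sub_mul, mul_add, hD'w, one_mul, mul_one, ← sub_eq_add_neg]
  have f1 : (1 - w) * (1 + w) = 0 := by
    rw [sub_mul, mul_add, mul_add, hw]
    noncomm_ring
  have f2 : (1 + w) * (1 - w) = 0 := by
    rw [add_mul, mul_sub, mul_sub, hw]
    noncomm_ring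
  have f3 : (1 - w) * (1 - w) + (1 + w) * (1 + w) = (4 : R) • 1 := by
    simp only [sub_mul, mul_sub, add_mul, mul_add, hw, one_mul, mul_one]
    module
  have h4 : (⅟2 : R) * ⅟2 * 4 = 1 := by
    rw [show (4 : R) = 2 * 2 by norm_num, ← mul_assoc, mul_assoc (⅟2 : R), invOf_mul_self, mul_one,
      invOf_mul_self]
  have hcomm : ∀ a : Module.End R T.carrier, w * a = a * w → D * a = -(a * D) →
      ((⅟2 : R) • (D * (1 + w) + D' * (1 - w))) * a =
        -(a * ((⅟2 : R) • (D * (1 + w) + D' * (1 - w)))) := fun a ha hDa => by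
    have g1 : (1 + w) * a = a * (1 + w) := by rw [add_mul, mul_add, ha, one_mul, mul_one]
    have g2 : (1 - w) * a = a * (1 - w) := by rw [sub_mul, mul_sub, ha, one_mul, mul_one]
    have h : ∀ p q : Module.End R T.carrier, p * a = a * p → q * a = a * q →
        (D * p + D' * q) * a = -(a * (D * p + D' * q)) := fun p q hp hq => by
      rw [add_mul, mul_assoc, mul_assoc, hp, hq, ← mul_assoc, ← mul_assoc, hDa, hanti a hDa, mul_add,
        neg_add, neg_mul, neg_mul, mul_assoc, mul_assoc]
    rw [smul_mul_assoc, mul_smul_comm, ← smul_neg, h _ _ g1 g2]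
  refine ⟨(⅟2 : R) • (D * (1 + w) + D' * (1 - w)), ?_, hcomm _ hwε hε,
    fun v => hcomm _ (hwv v) (hv v), fun g => ?_⟩
  · have h5 : (D * (1 + w) + D' * (1 - w)) * (D * (1 + w) + D' * (1 - w)) = (4 : R) • 1 := by
      have h : ∀ p q : Module.End R T.carrier, p * D = D * q → q * D = D * p → p * D' = D' * q →
          q * D' = D' * p → q * p = 0 → p * q = 0 →
          (D * p + D' * q) * (D * p + D' * q) = q * q + p * p := fun p q k1 k2 k3 k4 k5 k6 => by
        rw [add_mul, mul_add, mul_add, mul_assoc, ← mul_assoc p, k1, mul_assoc D q, k5, mul_zero,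
          mul_zero, zero_add, mul_assoc D, ← mul_assoc p, k3, mul_assoc D' q, ← mul_assoc D D', h1,
          one_mul, mul_assoc D', ← mul_assoc q D, k2, mul_assoc D p, ← mul_assoc D' D, h2, one_mul,
          mul_assoc D', ← mul_assoc q D', k4, mul_assoc D' p, k6, mul_zero, mul_zero, add_zero]
      rw [h _ _ e1 e2 e3 e4 f1 f2, f3]
    rw [smul_mul_smul_comm, h5, smul_smul, h4, one_smul]
  · have g1 : (1 + w) * T.ρ g = T.ρ g * (1 + w) := by rw [add_mul, mul_add, hwρ, one_mul, mul_one]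
    have g2 : (1 - w) * T.ρ g = T.ρ g * (1 - w) := by rw [sub_mul, mul_sub, hwρ, one_mul, mul_one]
    have g3 : D' * T.ρ g = T.ρ g * D' := by
      have h := congrArg (D' * · * D') (hρ g)
      simp only [mul_assoc, h1, mul_one] at h
      rw [← mul_assoc D' D, h2, one_mul] at h
      exact h.symm
    have h : ∀ p q : Module.End R T.carrier, p * T.ρ g = T.ρ g * p → q * T.ρ g = T.ρ g * q →
        (D * p + D' * q) * T.ρ g = T.ρ g * (D * p + D' * q) := fun p q hp hq => by
      rw [add_mul, mul_assoc, mul_assoc, hp, hq, ← mul_assoc, ← mul_assoc, hρ, g3, mul_add,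
        mul_assoc, mul_assoc]
    rw [smul_mul_assoc, mul_smul_comm, h _ _ g1 g2]

end Elementary

/-! ## Decompositions into three summands -/

section Range

variable {R : Type u} [CommRing R] {G : Type} [Group G]

/-- The image of an idempotent of a super representation. -/
abbrev SRep.range (B : SRep R G) (p : Module.End R B.carrier) (hp : ∀ x, p (p x) = p x)
    (hη : ∀ x, p (B.η x) = B.η (p x)) (hρ : ∀ g x, p (B.ρ g x) = B.ρ g (p x)) : SRep R G where
  toSMod := B.toSMod.range p hp hη
  ρ :=
    { toFun := fun g => (B.ρ g).restrict fun x hx => by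
        obtain ⟨y, rfl⟩ := hx
        exact ⟨B.ρ g y, hρ g y⟩
      map_one' := LinearMap.ext fun x => Subtype.ext (LinearMap.congr_fun (map_one B.ρ) x.1)
      map_mul' := fun g h => LinearMap.ext fun x => Subtype.ext (LinearMap.congr_fun (map_mul B.ρ g h) x.1) }
  ρ_η g x := Subtype.ext (B.ρ_η g x.1)

/-- The decomposition given by orthogonal idempotents. -/
def SRep.splittingRange (B : SRep R G) {J : Type} [Fintype J] (p : J → Module.End R B.carrier)
    (hp : ∀ j x, p j (p j x) = p j x) (hη : ∀ j x, p j (B.η x) = B.η (p j x))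
    (hρ : ∀ j g x, p j (B.ρ g x) = B.ρ g (p j x)) (h0 : ∀ j l, j ≠ l → ∀ x, p j (p l x) = 0)
    (h1 : ∀ x, ∑ j, p j x = x) :
    B.Splitting fun j => B.range (p j) (hp j) (hη j) (hρ j) where
  i j := (LinearMap.range (p j)).subtype
  s j := (p j).rangeRestrict
  i_η j x := rfl
  s_η j x := Subtype.ext (hη j x)
  i_ρ j g x := rfl
  s_ρ j g x := Subtype.ext (hρ j g x)
  s_i j x := Subtype.ext (by
    obtain ⟨y, hy⟩ := x.2
    change p j x.1 = x.1
    rw [← hy, hp])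
  s_i_of_ne j l h x := Subtype.ext (by
    obtain ⟨y, hy⟩ := x.2
    change p j x.1 = 0
    rw [← hy, h0 j l h])
  sum_i_s := h1

/-- A retract is isomorphic to the image of the corresponding idempotent. -/
def SRep.splittingRetract (B : SRep R G) {A : SRep R G} (p : Module.End R B.carrier)
    (hp : ∀ x, p (p x) = p x) (hη : ∀ x, p (B.η x) = B.η (p x))
    (hρ : ∀ g x, p (B.ρ g x) = B.ρ g (p x)) (i : A.carrier →ₗ[R] B.carrier)
    (s : B.carrier →ₗ[R] A.carrier) (hsi : ∀ x, s (i x) = x) (his : ∀ x, i (s x) = p x)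
    (i_η : ∀ x, i (A.η x) = B.η (i x)) (i_ρ : ∀ g x, i (A.ρ g x) = B.ρ g (i x)) :
    (B.range p hp hη hρ).Splitting fun _ : Unit => A :=
  SRep.Splitting.ofEquiv (LinearEquiv.ofLinearMap
    (i.codRestrict (LinearMap.range p) fun x => ⟨i x, by rw [← his, hsi]⟩)
    (s ∘ₗ (LinearMap.range p).subtype)
    (LinearMap.ext fun x => Subtype.ext (by
      obtain ⟨y, hy⟩ := x.2
      change i (s x.1) = x.1
      rw [his, ← hy, hp]))
    (LinearMap.ext hsi)) (fun x => Subtype.ext (i_η x)) fun g x => Subtype.ext (i_ρ g x)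

end Range

section Three

variable {R : Type u} [CommRing R] {k : ℕ}

namespace SubsetDec

/-- The type of a subset: empty, full, or neither. -/
def kind (s : Finset (Fin k)) : Fin 3 := if s = ∅ then 0 else if s = Finset.univ then 1 else 2

theorem kind_finsetCongr (g : Equiv.Perm (Fin k)) (s : Finset (Fin k)) :
    kind (Equiv.finsetCongr g s) = kind s := by
  have h0 : Equiv.finsetCongr g s = ∅ ↔ s = ∅ := by
    rw [Equiv.finsetCongr_apply, Finset.map_eq_empty]
  have h1 : Equiv.finsetCongr g s = Finset.univ ↔ s = Finset.univ := by
    rw [Equiv.finsetCongr_apply, Finset.eq_univ_iff_forall, Finset.eq_univ_iff_forall]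
    exact ⟨fun h i => by simpa using h (g i), fun h i => by
      rw [Finset.mem_map_equiv]
      exact h _⟩
  simp only [kind, h0, h1]

theorem kind_eq_zero {s : Finset (Fin k)} : kind s = 0 ↔ s = ∅ := by
  simp only [kind]
  split_ifs with h1 h2 <;> simp [h1]

theorem kind_eq_one (hk : 0 < k) {s : Finset (Fin k)} : kind s = 1 ↔ s = Finset.univ := by
  simp only [kind]
  split_ifs with h1 h2
  · subst h1
    refine ⟨fun h => absurd h (by decide), fun h => ?_⟩
    exact absurd (h ▸ Finset.mem_univ (⟨0, hk⟩ : Fin k)) (Finset.notMem_empty _)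
  · simp [h2]
  · simp [h2]

variable {B : SRep R (Equiv.Perm (Fin k))} (D : SubsetDec B)

/-- The projection on the summands of a given kind. -/
def kindProj (j : Fin 3) : Module.End R B.carrier := ∑ s with kind s = j, D.δ s

theorem kindProj_apply (j : Fin 3) (x : B.carrier) :
    D.kindProj j x = ∑ s, if kind s = j then D.δ s x else 0 := by
  rw [kindProj, LinearMap.sum_apply, Finset.sum_filter]

theorem δ_kindProj (s : Finset (Fin k)) (j : Fin 3) (x : B.carrier) :
    D.δ s (D.kindProj j x) = if kind s = j then D.δ s x else 0 := by
  rw [kindProj_apply, map_sum, Finset.sum_eq_single s]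
  · rw [apply_ite (D.δ s), D.idem, map_zero]
  · intro s' _ h
    rw [apply_ite (D.δ s), map_zero, D.orth s s' h.symm, ite_self]
  · simp

theorem kindProj_δ (s : Finset (Fin k)) (j : Fin 3) (x : B.carrier) :
    D.kindProj j (D.δ s x) = if kind s = j then D.δ s x else 0 := by
  rw [kindProj_apply, Finset.sum_eq_single s]
  · rw [D.idem]
  · intro s' _ h
    rw [D.orth s' s h, ite_self]
  · simp

theorem kindProj_kindProj (j l : Fin 3) (x : B.carrier) :
    D.kindProj j (D.kindProj l x) = if j = l then D.kindProj j x else 0 := by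
  rw [kindProj_apply D j (D.kindProj l x), kindProj_apply D j x]
  simp only [D.δ_kindProj]
  split_ifs with h
  · subst h
    exact Finset.sum_congr rfl fun s _ => by split_ifs <;> rfl
  · exact Finset.sum_eq_zero fun s _ => by
      split_ifs with h1 h2
      · exact absurd (h1.symm.trans h2) h
      · rfl
      · rfl

theorem kindProj_η (j : Fin 3) (x : B.carrier) : D.kindProj j (B.η x) = B.η (D.kindProj j x) := by
  rw [kindProj_apply, kindProj_apply, map_sum]
  exact Finset.sum_congr rfl fun s _ => by rw [apply_ite B.η, D.δ_η, map_zero]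

theorem kindProj_ρ (j : Fin 3) (g : Equiv.Perm (Fin k)) (x : B.carrier) :
    D.kindProj j (B.ρ g x) = B.ρ g (D.kindProj j x) := by
  rw [kindProj_apply, kindProj_apply, map_sum]
  refine (Equiv.sum_comp (Equiv.finsetCongr g) fun s =>
    if kind s = j then D.δ s (B.ρ g x) else 0).symm.trans (Finset.sum_congr rfl fun s _ => ?_)
  rw [kind_finsetCongr, apply_ite (B.ρ g), D.ρ_δ, map_zero]

theorem sum_kindProj (x : B.carrier) : ∑ j, D.kindProj j x = x := by
  simp only [kindProj_apply]
  rw [Finset.sum_comm]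
  conv_rhs => rw [← D.sum x]
  exact Finset.sum_congr rfl fun s _ => by rw [Finset.sum_ite_eq, if_pos (Finset.mem_univ _)]

theorem kindProj_zero : D.kindProj 0 = D.δ ∅ := by
  have h : (Finset.univ.filter fun s : Finset (Fin k) => kind s = 0) = {∅} := by
    ext s
    rw [Finset.mem_filter, Finset.mem_singleton, kind_eq_zero]
    exact and_iff_right (Finset.mem_univ _)
  rw [kindProj, h, Finset.sum_singleton]

theorem kindProj_one (hk : 0 < k) : D.kindProj 1 = D.δ Finset.univ := by
  have h : (Finset.univ.filter fun s : Finset (Fin k) => kind s = 1) = {Finset.univ} := by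
    ext s
    rw [Finset.mem_filter, Finset.mem_singleton, kind_eq_one hk]
    exact and_iff_right (Finset.mem_univ _)
  rw [kindProj, h, Finset.sum_singleton]

variable [Invertible (2 : R)] [Invertible ((k.factorial : ℕ) : R)]

/-- The mixed part of a decomposition does not contribute to the Adams character. -/
theorem sX_eq_add (hk : 0 < k) {A₀ A₁ : SRep R (Equiv.Perm (Fin k))}
    (i₀ : A₀.carrier →ₗ[R] B.carrier) (s₀ : B.carrier →ₗ[R] A₀.carrier)
    (h₀ : ∀ x, s₀ (i₀ x) = x) (h₀' : ∀ x, i₀ (s₀ x) = D.δ ∅ x)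
    (hη₀ : ∀ x, i₀ (A₀.η x) = B.η (i₀ x)) (hρ₀ : ∀ g x, i₀ (A₀.ρ g x) = B.ρ g (i₀ x))
    (i₁ : A₁.carrier →ₗ[R] B.carrier) (s₁ : B.carrier →ₗ[R] A₁.carrier)
    (h₁ : ∀ x, s₁ (i₁ x) = x) (h₁' : ∀ x, i₁ (s₁ x) = D.δ Finset.univ x)
    (hη₁ : ∀ x, i₁ (A₁.η x) = B.η (i₁ x)) (hρ₁ : ∀ g x, i₁ (A₁.ρ g x) = B.ρ g (i₁ x)) :
    sX B = sX A₀ + sX A₁ := by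
  have hidem : ∀ j x, D.kindProj j (D.kindProj j x) = D.kindProj j x := fun j x => by
    rw [kindProj_kindProj, if_pos rfl]
  rw [(B.splittingRange D.kindProj hidem D.kindProj_η D.kindProj_ρ
    (fun j l h x => by rw [kindProj_kindProj, if_neg h]) D.sum_kindProj).sX_eq, Fin.sum_univ_three]
  have e0 := (B.splittingRetract (D.kindProj 0) (hidem 0) (D.kindProj_η 0) (D.kindProj_ρ 0) i₀ s₀ h₀
    (fun x => by rw [h₀', kindProj_zero]) hη₀ hρ₀).sX_eq
  have e1 := (B.splittingRetract (D.kindProj 1) (hidem 1) (D.kindProj_η 1) (D.kindProj_ρ 1) i₁ s₁ h₁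
    (fun x => by rw [h₁', kindProj_one D hk]) hη₁ hρ₁).sX_eq
  let C := B.range (D.kindProj 2) (hidem 2) (D.kindProj_η 2) (D.kindProj_ρ 2)
  let δ' : Finset (Fin k) → Module.End R C.carrier := fun s => (D.δ s).restrict fun x hx => by
    obtain ⟨y, rfl⟩ := hx
    exact ⟨D.δ s y, by rw [kindProj_δ, δ_kindProj]⟩
  let D' : SubsetDec C :=
    { δ := δ'
      idem := fun s x => Subtype.ext (D.idem s x.1)
      orth := fun s s' h x => Subtype.ext (D.orth s s' h x.1)
      sum := fun x => Subtype.ext (by rw [Submodule.coe_sum]; exact D.sum x.1)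
      δ_η := fun s x => Subtype.ext (D.δ_η s x.1)
      ρ_δ := fun g s x => Subtype.ext (D.ρ_δ g s x.1) }
  have h2 : ∀ s, kind s ≠ 2 → D'.δ s = 0 := fun s hs => LinearMap.ext fun x => Subtype.ext (by
    obtain ⟨y, hy⟩ := x.2
    change D.δ s x.1 = 0
    rw [← hy, δ_kindProj, if_neg hs])
  have e2 : sX C = 0 := D'.sX_eq_zero hk
    (h2 _ (by rw [kind_eq_zero.mpr rfl]; decide)) (h2 _ (by rw [(kind_eq_one hk).mpr rfl]; decide))
  rw [Fintype.sum_unique] at e0 e1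
  rw [e0, e1, e2, add_zero]

end SubsetDec

end Three

/-! ## The power map -/

section PowerMap

variable {R V : Type u} [CommRing R] [AddCommGroup V] [Module R V] [Invertible (2 : R)]
  {Q : QuadraticForm R V} (S : Spinorial Q) (k : ℕ) (hk : IsUnit (k : R))

omit [Invertible (2 : R)] in
theorem GrMod.act_ι_mul_self {G : Type} [Group G] (M : GrMod Q G) (v : V) :
    (M.act.toLinearMap ∘ₗ ι Q) v * (M.act.toLinearMap ∘ₗ ι Q) v = algebraMap R _ (Q v) := by
  change M.act (ι Q v) * M.act (ι Q v) = _
  rw [← map_mul, ι_sq_scalar, AlgHom.commutes]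

/-- The graded tensor power of a graded module. -/
noncomputable abbrev powObj (M : GrMod Q Unit) : GrMod ((k : R) • Q) (Equiv.Perm (Fin k)) where
  carrier := PiTensorProduct R fun _ : Fin k => M.carrier
  addCommGroup := inferInstance
  module := inferInstance
  act := CliffordAlgebra.lift ((k : R) • Q)
    ⟨powMap M.ε (M.act.toLinearMap ∘ₗ ι Q) k, powMap_sq M.ε_sq M.ε_act M.act_ι_mul_self⟩
  fgProj := (powerObj S k hk M).fgProj
  ε := PiTensorProduct.map fun _ => M.ε
  ε_sq := (powerObj S k hk M).ε_sq
  ε_act := (powerObj S k hk M).ε_act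
  ρ := koszulRep M.ε M.ε_sq k
  ρ_act := (powerObj S k hk M).ρ_act
  ρ_ε := (powerObj S k hk M).ρ_ε

theorem powerObj_eq (M : GrMod Q Unit) : powerObj S k hk M = powObj S k hk M := rfl

theorem powObj_act (M : GrMod Q Unit) (v : V) :
    (powObj S k hk M).act (ι _ v) = powMap M.ε (M.act.toLinearMap ∘ₗ ι Q) k v :=
  CliffordAlgebra.lift_ι_apply _ _ v

section Retract

variable {S k hk} {L M : GrMod Q Unit} (f : M.carrier →ₗ[R] L.carrier)
  (f_act : ∀ v x, f (M.act (ι Q v) x) = L.act (ι Q v) (f x)) (f_ε : ∀ x, f (M.ε x) = L.ε (f x))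

include f_act f_ε

theorem map_powObj_act (v : V) (x : (powObj S k hk M).carrier) :
    PiTensorProduct.map (fun _ => f) ((powObj S k hk M).act (ι _ v) x) =
      (powObj S k hk L).act (ι _ v) (PiTensorProduct.map (fun _ => f) x) := by
  rw [powObj_act, powObj_act]
  exact map_powMap _ (fun _ => f_ε) (fun _ => f_act) v x

omit f_act in
theorem map_powObj_ε (x : (powObj S k hk M).carrier) :
    PiTensorProduct.map (fun _ => f) ((powObj S k hk M).ε x) =
      (powObj S k hk L).ε (PiTensorProduct.map (fun _ => f) x) := by
  change PiTensorProduct.map (fun _ => f) (PiTensorProduct.map (fun _ => M.ε) x) =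
    PiTensorProduct.map (fun _ => L.ε) (PiTensorProduct.map (fun _ => f) x)
  rw [← LinearMap.comp_apply, ← LinearMap.comp_apply, ← PiTensorProduct.map_comp,
    ← PiTensorProduct.map_comp]
  exact congrArg (fun f => PiTensorProduct.map f x) (funext fun _ => LinearMap.ext f_ε)

omit f_act in
theorem map_powObj_ρ (g : Equiv.Perm (Fin k)) (x : (powObj S k hk M).carrier) :
    PiTensorProduct.map (fun _ => f) ((powObj S k hk M).ρ g x) =
      (powObj S k hk L).ρ g (PiTensorProduct.map (fun _ => f) x) :=
  (map_koszulAct M.ε_sq (fun _ => f) (fun _ => f_ε) g x).symm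

end Retract

omit [Invertible (2 : R)] in
theorem map_const_comp {M M' M'' : Type u} [AddCommGroup M] [Module R M] [AddCommGroup M']
    [Module R M'] [AddCommGroup M''] [Module R M''] (f : M →ₗ[R] M') (g : M' →ₗ[R] M'')
    (h : M →ₗ[R] M'') (hgf : ∀ x, g (f x) = h x) (x : PiTensorProduct R fun _ : Fin k => M) :
    PiTensorProduct.map (fun _ => g) (PiTensorProduct.map (fun _ => f) x) =
      PiTensorProduct.map (fun _ => h) x := by
  rw [← LinearMap.comp_apply, ← PiTensorProduct.map_comp]
  exact congrArg (fun f => PiTensorProduct.map f x) (funext fun _ => LinearMap.ext hgf)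

omit [Invertible (2 : R)] in
theorem map_const_id {M M' : Type u} [AddCommGroup M] [Module R M] [AddCommGroup M']
    [Module R M'] (f : M →ₗ[R] M') (g : M' →ₗ[R] M) (hgf : ∀ x, g (f x) = x)
    (x : PiTensorProduct R fun _ : Fin k => M) :
    PiTensorProduct.map (fun _ => g) (PiTensorProduct.map (fun _ => f) x) = x := by
  rw [map_const_comp k f g LinearMap.id hgf, PiTensorProduct.map_id, LinearMap.id_apply]

theorem iso_powObj {M N : GrMod Q Unit} (h : M.Iso N) :
    (powObj S k hk M).Iso (powObj S k hk N) := by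
  obtain ⟨e, h1, h2, -⟩ := h
  exact ⟨LinearEquiv.ofLinearMap (PiTensorProduct.map fun _ => e.toLinearMap)
    (PiTensorProduct.map fun _ => e.symm.toLinearMap)
    (LinearMap.ext (map_const_id k _ _ e.apply_symm_apply))
    (LinearMap.ext (map_const_id k _ _ e.symm_apply_apply)),
    map_powObj_act e.toLinearMap h1 h2, map_powObj_ε e.toLinearMap h2,
    map_powObj_ρ e.toLinearMap h2⟩

variable [Invertible ((k.factorial : ℕ) : R)]

/-- The additivity of the Adams character of the power map. -/
theorem sX_hom_powObj_add (hk0 : 0 < k) (S' : Spinorial ((k : R) • Q)) {L M N : GrMod Q Unit}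
    (h : L.IsSum M N) : sX (S'.hom (powObj S k hk L)) =
      sX (S'.hom (powObj S k hk M)) + sX (S'.hom (powObj S k hk N)) := by
  obtain ⟨e, h1, h2, -⟩ := h
  let f : M.carrier →ₗ[R] L.carrier := e.toLinearMap ∘ₗ LinearMap.inl R _ _
  let f' : N.carrier →ₗ[R] L.carrier := e.toLinearMap ∘ₗ LinearMap.inr R _ _
  let r : L.carrier →ₗ[R] M.carrier := LinearMap.fst R _ _ ∘ₗ e.symm.toLinearMap
  let r' : L.carrier →ₗ[R] N.carrier := LinearMap.snd R _ _ ∘ₗ e.symm.toLinearMap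
  have hz : ∀ {A A' : Type u} [AddCommGroup A] [Module R A] [AddCommGroup A'] [Module R A']
      (a : A) (g : A' →ₗ[R] A'), (a, (0 : A')) = (a, g 0) := fun a g => by rw [map_zero]
  have hz' : ∀ {A A' : Type u} [AddCommGroup A] [Module R A] [AddCommGroup A'] [Module R A']
      (a : A) (g : A' →ₗ[R] A'), ((0 : A'), a) = (g 0, a) := fun a g => by rw [map_zero]
  have hrf : ∀ x, r (f x) = x := fun x => congrArg Prod.fst (e.symm_apply_apply (x, 0))
  have hrf' : ∀ x, r' (f' x) = x := fun x => congrArg Prod.snd (e.symm_apply_apply (0, x))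
  have hsum : ∀ x, f (r x) + f' (r' x) = x := fun x => by
    change e ((e.symm x).1, 0) + e (0, (e.symm x).2) = x
    rw [← map_add, Prod.mk_add_mk, add_zero, zero_add, Prod.mk.eta, e.apply_symm_apply]
  have hf_act : ∀ v x, f (M.act (ι Q v) x) = L.act (ι Q v) (f x) := fun v x => by
    exact Eq.trans (congrArg e (hz _ _)) (h1 v (x, 0))
  have hf'_act : ∀ v x, f' (N.act (ι Q v) x) = L.act (ι Q v) (f' x) := fun v x => by
    exact Eq.trans (congrArg e (hz' _ _)) (h1 v (0, x))
  have hf_ε : ∀ x, f (M.ε x) = L.ε (f x) := fun x => by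
    exact Eq.trans (congrArg e (hz _ _)) (h2 (x, 0))
  have hf'_ε : ∀ x, f' (N.ε x) = L.ε (f' x) := fun x => by
    exact Eq.trans (congrArg e (hz' _ _)) (h2 (0, x))
  have he : ∀ v x, e.symm (L.act (ι Q v) x) =
      (M.act (ι Q v) (e.symm x).1, N.act (ι Q v) (e.symm x).2) := fun v x => by
    rw [LinearEquiv.symm_apply_eq, h1, e.apply_symm_apply]
  have heε : ∀ x, e.symm (L.ε x) = (M.ε (e.symm x).1, N.ε (e.symm x).2) := fun x => by
    rw [LinearEquiv.symm_apply_eq, h2, e.apply_symm_apply]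
  have hr_act : ∀ v x, r (L.act (ι Q v) x) = M.act (ι Q v) (r x) := fun v x =>
    congrArg Prod.fst (he v x)
  have hr'_act : ∀ v x, r' (L.act (ι Q v) x) = N.act (ι Q v) (r' x) := fun v x =>
    congrArg Prod.snd (he v x)
  have hr_ε : ∀ x, r (L.ε x) = M.ε (r x) := fun x => congrArg Prod.fst (heε x)
  have hr'_ε : ∀ x, r' (L.ε x) = N.ε (r' x) := fun x => congrArg Prod.snd (heε x)
  let q : Module.End R L.carrier := f' ∘ₗ r'
  have hq : q * q = q := LinearMap.ext fun x => congrArg f' (hrf' (r' x))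
  have hq_ε : ∀ x, q (L.ε x) = L.ε (q x) := fun x => (congrArg f' (hr'_ε x)).trans (hf'_ε _)
  have hq_act : ∀ v x, q (L.act (ι Q v) x) = L.act (ι Q v) (q x) := fun v x =>
    (congrArg f' (hr'_act v x)).trans (hf'_act v _)
  have hδ_act : ∀ s v x, subsetProj q s ((powObj S k hk L).act (ι _ v) x) =
      (powObj S k hk L).act (ι _ v) (subsetProj q s x) := fun s v x => by
    rw [powObj_act]
    exact powMap_subsetProj hq_ε hq_act s v x
  let D : SubsetDec (S'.hom (powObj S k hk L)) :=
    { δ := fun s => S'.homMap (subsetProj q s) (hδ_act s)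
      idem := fun s x => Subtype.ext (LinearMap.ext fun y =>
        LinearMap.congr_fun (subsetProj_mul_self hq s) (x.1 y))
      orth := fun s s' h x => Subtype.ext (LinearMap.ext fun y =>
        LinearMap.congr_fun (subsetProj_mul_of_ne hq h) (x.1 y))
      sum := fun x => Subtype.ext (LinearMap.ext fun y => by
        rw [Submodule.coe_sum, LinearMap.sum_apply]
        exact (LinearMap.sum_apply Finset.univ (fun s => subsetProj q s) (x.1 y)).symm.trans
          (LinearMap.congr_fun (sum_subsetProj q) (x.1 y)))
      δ_η := fun s x => Subtype.ext (LinearMap.ext fun y => map_subsetProj hq_ε s _)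
      ρ_δ := fun g s x => Subtype.ext (LinearMap.ext fun y =>
        koszulAct_subsetProj L.ε_sq hq_ε g s (x.1 y)) }
  refine D.sX_eq_add hk0
    (S'.homMap (PiTensorProduct.map fun _ => f) (map_powObj_act f hf_act hf_ε))
    (S'.homMap (PiTensorProduct.map fun _ => r) (map_powObj_act r hr_act hr_ε))
    (fun x => Subtype.ext (LinearMap.ext fun y => map_const_id k f r hrf (x.1 y)))
    (fun x => Subtype.ext (LinearMap.ext fun y => ?_))
    (fun x => Subtype.ext (LinearMap.ext fun y => map_powObj_ε f hf_ε _))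
    (fun g x => Subtype.ext (LinearMap.ext fun y => map_powObj_ρ f hf_ε g _))
    (S'.homMap (PiTensorProduct.map fun _ => f') (map_powObj_act f' hf'_act hf'_ε))
    (S'.homMap (PiTensorProduct.map fun _ => r') (map_powObj_act r' hr'_act hr'_ε))
    (fun x => Subtype.ext (LinearMap.ext fun y => map_const_id k f' r' hrf' (x.1 y)))
    (fun x => Subtype.ext (LinearMap.ext fun y => ?_))
    (fun x => Subtype.ext (LinearMap.ext fun y => map_powObj_ε f' hf'_ε _))
    (fun g x => Subtype.ext (LinearMap.ext fun y => map_powObj_ρ f' hf'_ε g _))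
  · refine (map_const_comp k r f (1 - q) (fun x => eq_sub_of_add_eq (hsum x)) (x.1 y)).trans ?_
    refine congrArg (fun f => PiTensorProduct.map f (x.1 y)) (funext fun i => ?_)
    exact (if_neg (Finset.notMem_empty i)).symm
  · refine (map_const_comp k r' f' q (fun x => rfl) (x.1 y)).trans ?_
    refine congrArg (fun f => PiTensorProduct.map f (x.1 y)) (funext fun i => ?_)
    exact (if_pos (Finset.mem_univ i)).symm

/-- Elementary summands do not contribute to the power map. -/
theorem cls_powObj_of_retract {L M : GrMod Q Unit} (f : M.carrier →ₗ[R] L.carrier)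
    (r : L.carrier →ₗ[R] M.carrier) (e : Module.End R L.carrier) (hrf : ∀ x, r (f x) = x)
    (hfr : ∀ x, f (r x) + e (e x) = x)
    (f_act : ∀ v x, f (M.act (ι Q v) x) = L.act (ι Q v) (f x)) (f_ε : ∀ x, f (M.ε x) = L.ε (f x))
    (e_ε : ∀ x, e (L.ε x) = -L.ε (e x)) (e_act : ∀ v x, e (L.act (ι Q v) x) = -L.act (ι Q v) (e x)) :
    (powObj S k hk L).cls = (powObj S k hk M).cls := by
  let q : Module.End R L.carrier := e * e
  have hqf : ∀ x, q x = x - f (r x) := fun x => eq_sub_of_add_eq' (hfr x)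
  have hq : q * q = q := LinearMap.ext fun x => by
    change q (q x) = q x
    rw [hqf (q x), hqf x, map_sub, hrf, sub_self, map_zero, sub_zero]
  have hq_ε : ∀ x, q (L.ε x) = L.ε (q x) := fun x => by
    change e (e (L.ε x)) = L.ε (e (e x))
    rw [e_ε, map_neg, e_ε, neg_neg]
  have hq_act : ∀ v x, q (L.act (ι Q v) x) = L.act (ι Q v) (q x) := fun v x => by
    change e (e (L.act (ι Q v) x)) = L.act (ι Q v) (e (e x))
    rw [e_act, map_neg, e_act, neg_neg]
  let T := powObj S k hk L
  let c : R →ₗ[R] Module.End R L.carrier := LinearMap.toSpanSingleton R _ e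
  have hc : ∀ a, L.ε * c a = -(c a * L.ε) := fun a => LinearMap.ext fun x => by
    change L.ε (a • e x) = -(a • e (L.ε x))
    rw [e_ε, map_smul, smul_neg, neg_neg]
  have hqc : ∀ a x, q (c a x) = c a (q x) := fun a x => by
    change e (e (a • e x)) = a • e (e (e x))
    rw [map_smul, map_smul]
  have c1 : c 1 = e := one_smul R e
  let D : Module.End R T.carrier := powMap L.ε c k 1
  have hDD : D * D = evenSum k q := by
    have h := powMap_anticomm (k := k) L.ε_sq hc hc 1 1
    rw [c1, evenSum_add] at h
    have h2 := congrArg ((⅟2 : R) • ·) h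
    simp only [half_add_half] at h2
    exact h2
  have hDε : D * T.ε = -(T.ε * D) := (neg_eq_iff_eq_neg.mpr (map_mul_powMap hc (1 : R))).symm
  have hDρ : ∀ g, D * T.ρ g = T.ρ g * D := fun g => (koszulAct_powMap L.ε_sq c hc g 1).symm
  have hDv : ∀ v, D * T.act (ι _ v) = -(T.act (ι _ v) * D) := fun v => by
    rw [powObj_act, eq_neg_iff_add_eq_zero]
    refine (powMap_anticomm L.ε_sq hc L.ε_act 1 v).trans ?_
    have h0 : c 1 * (L.act.toLinearMap ∘ₗ ι Q) v + (L.act.toLinearMap ∘ₗ ι Q) v * c 1 = 0 := by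
      refine LinearMap.ext fun x => ?_
      rw [c1]
      change e (L.act (ι Q v) x) + L.act (ι Q v) (e x) = 0
      rw [e_act, neg_add_cancel]
    rw [h0, evenSum_zero]
  have hDδ : ∀ s x, subsetProj q s (D x) = D (subsetProj q s x) := fun s x =>
    powMap_subsetProj hq_ε hqc s (1 : R) x
  let P : T.Idem :=
    { p := subsetProj q ∅
      idem := LinearMap.congr_fun (subsetProj_mul_self hq ∅)
      p_act := fun v x => by
        rw [powObj_act]
        exact powMap_subsetProj hq_ε hq_act ∅ v x
      p_ε := map_subsetProj hq_ε ∅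
      p_ρ := fun g x => (koszulAct_subsetProj L.ε_sq hq_ε g ∅ x).symm }
  have hJ : ∀ x, D (D x) = ∑ s : Finset (Fin k), (s.card : R) • subsetProj q s x := fun x => by
    have h : D (D x) = evenSum k q x := LinearMap.congr_fun hDD x
    rw [h]
    conv_lhs => rw [← Module.End.one_apply (R := R) x, ← sum_subsetProj q, LinearMap.sum_apply, map_sum]
    exact Finset.sum_congr rfl fun s _ => LinearMap.congr_fun (evenSum_mul_subsetProj hq s) x
  have hunit : ∀ s : Finset (Fin k), s ≠ ∅ → IsUnit (s.card : R) := fun s hs =>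
    isUnit_of_dvd_unit (Nat.cast_dvd_cast (Nat.dvd_factorial
      (Finset.card_pos.mpr (Finset.nonempty_iff_ne_empty.mpr hs))
      ((Finset.card_le_univ s).trans_eq (Fintype.card_fin k))))
      (isUnit_of_invertible ((k.factorial : ℕ) : R))
  have hinv : ∀ s : Finset (Fin k), ∃ a : R, s ≠ ∅ → a * (s.card : R) = 1 := fun s => by
    by_cases hs : s = ∅
    · exact ⟨0, fun h => absurd hs h⟩
    · obtain ⟨a, ha⟩ := (hunit s hs).exists_left_inv
      exact ⟨a, fun _ => ha⟩
  choose a ha using hinv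
  let J' : Module.End R T.carrier := ∑ s : Finset (Fin k), a s • subsetProj q s
  have hJ' : ∀ x, J' x = ∑ s, a s • subsetProj q s x := fun x => LinearMap.sum_apply _ _ _
  have hδδ : ∀ (s s' : Finset (Fin k)) (x : T.carrier), subsetProj q s (subsetProj q s' x) = if s = s' then subsetProj q s x else 0 :=
    fun s s' x => by
    split_ifs with h
    · rw [← h]
      exact LinearMap.congr_fun (subsetProj_mul_self hq s) x
    · exact LinearMap.congr_fun (subsetProj_mul_of_ne hq h) x
  have hδJ : ∀ s x, subsetProj q s (D (D x)) = (s.card : R) • subsetProj q s x := fun s x => by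
    rw [hJ, map_sum]
    simp only [map_smul, hδδ, smul_ite, smul_zero]
    rw [Finset.sum_ite_eq, if_pos (Finset.mem_univ _)]
  have hδJ' : ∀ s x, subsetProj q s (J' x) = a s • subsetProj q s x := fun s x => by
    rw [hJ', map_sum]
    simp only [map_smul, hδδ, smul_ite, smul_zero]
    rw [Finset.sum_ite_eq, if_pos (Finset.mem_univ _)]
  have hfix : ∀ x, P.compl.p x = x → subsetProj q ∅ x = 0 := fun x hx => sub_eq_self.mp hx
  have hsumδ : ∀ x, ∑ s : Finset (Fin k), subsetProj q s x = x := fun x =>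
    (LinearMap.sum_apply _ _ _).symm.trans (LinearMap.congr_fun (sum_subsetProj q) x)
  have h1 : ∀ x, P.compl.p x = x → J' (D (D x)) = x := fun x hx => by
    rw [hJ']
    conv_rhs => rw [← hsumδ x]
    refine Finset.sum_congr rfl fun s _ => ?_
    by_cases hs : s = ∅
    · rw [hδJ, hs, hfix x hx, smul_zero, smul_zero]
    · rw [hδJ, smul_smul, ha s hs, one_smul]
  have h2 : ∀ x, P.compl.p x = x → D (D (J' x)) = x := fun x hx => by
    rw [hJ]
    conv_rhs => rw [← hsumδ x]
    refine Finset.sum_congr rfl fun s _ => ?_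
    by_cases hs : s = ∅
    · rw [hδJ', hs, hfix x hx, smul_zero, smul_zero]
    · rw [hδJ', smul_smul, mul_comm, ha s hs, one_smul]
  have hPD : ∀ x, P.compl.p (D x) = D (P.compl.p x) := fun x => by
    change D x - subsetProj q ∅ (D x) = D (x - subsetProj q ∅ x)
    rw [hDδ, map_sub]
  have hPJ : ∀ x, P.compl.p (J' x) = J' (P.compl.p x) := fun x => by
    change J' x - subsetProj q ∅ (J' x) = J' (x - subsetProj q ∅ x)
    rw [map_sub, hδJ', hJ' (subsetProj q ∅ x)]
    congr 1
    simp only [hδδ, smul_ite, smul_zero]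
    rw [Finset.sum_ite_eq', if_pos (Finset.mem_univ _)]
  have hel : P.compl.image.IsElementary := by
    refine GrMod.isElementary_of_bijective (S.twist (k : R) hk) _ (P.compl.res D hPD) ⟨?_, ?_⟩
      (LinearMap.ext fun x => Subtype.ext (LinearMap.congr_fun hDε x.1))
      (fun v => LinearMap.ext fun x => Subtype.ext (LinearMap.congr_fun (hDv v) x.1))
      (fun g => LinearMap.ext fun x => Subtype.ext (LinearMap.congr_fun (hDρ g) x.1))
    · intro x y hxy
      have h := congrArg (fun z => J' (D z)) (congrArg Subtype.val hxy)
      refine Subtype.ext ?_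
      rw [← h1 x.1 (P.compl.apply_coe x), ← h1 y.1 (P.compl.apply_coe y)]
      exact h
    · intro y
      refine ⟨P.compl.res D hPD (P.compl.res J' hPJ y), Subtype.ext ?_⟩
      exact h2 y.1 (P.compl.apply_coe y)
  have hcls := P.cls_eq (M := powObj S k hk M) (PiTensorProduct.map fun _ => f)
    (PiTensorProduct.map fun _ => r) (map_const_id k f r hrf)
    (fun x => (map_const_comp k r f (1 - q) (fun x => eq_sub_of_add_eq (hfr x)) x).trans
      (congrArg (fun f => PiTensorProduct.map f x)
        (funext fun i => (if_neg (Finset.notMem_empty i)).symm)))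
    (map_powObj_act f f_act f_ε) (map_powObj_ε f f_ε) (map_powObj_ρ f f_ε)
  rw [hcls, GrMod.cls_of_isElementary hel, add_zero]

theorem cls_powObj_add {M T : GrMod Q Unit} (hT : T.IsElementary) :
    (powObj S k hk (M.add T)).cls = (powObj S k hk M).cls := by
  obtain ⟨e, h1, h2, h3, -⟩ := hT
  refine cls_powObj_of_retract S k hk (L := M.add T) (LinearMap.inl R M.carrier T.carrier)
    (LinearMap.fst R M.carrier T.carrier) (LinearMap.prodMap 0 e) (fun x => rfl) (fun x => ?_)
    (fun v x => ?_) (fun x => ?_) (fun x => ?_) (fun v x => ?_)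
  · refine Prod.ext (add_zero _) ((zero_add _).trans ?_)
    exact LinearMap.congr_fun h1 x.2
  · exact Prod.ext rfl (map_zero (T.act (ι Q v))).symm
  · exact Prod.ext rfl (map_zero T.ε).symm
  · refine Prod.ext ?_ (LinearMap.congr_fun h2 x.2)
    change 0 = -M.ε 0
    rw [map_zero, neg_zero]
  · refine Prod.ext ?_ (LinearMap.congr_fun (h3 v) x.2)
    change 0 = -M.act (ι Q v) 0
    rw [map_zero, neg_zero]

/-- The power map is well defined. -/
theorem powerMap_cls (M : GrMod Q Unit) : powerMap S k hk M.cls = (powerObj S k hk M).cls := by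
  rw [powerMap, powerObj_eq, powerObj_eq]
  obtain ⟨A, B, hA, hB, h⟩ := GrMod.stableIso_of_cls_eq (Function.surjInv_eq GrMod.cls_surjective M.cls)
  rw [← cls_powObj_add S k hk hA, ← cls_powObj_add S k hk (M := M) hB]
  exact (iso_powObj S k hk h).cls_eq

end PowerMap

/-! ## The operation `θₖ` -/

section Operation

variable {R V : Type u} [CommRing R] [AddCommGroup V] [Module R V] [Invertible (2 : R)]
  {Q : QuadraticForm R V} (S : Spinorial Q) {k : ℕ} (hk : 0 < k)
  [Invertible ((k.factorial : ℕ) : R)]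

namespace Spinorial

/-- The value of `θₖ` on a class which corresponds to the class of `M`. -/
theorem theta_eq {x : K R} {M : GrMod Q Unit} (h : S.morita x = M.cls) :
    S.theta hk x = sX ((S.twist (k : R) (isUnit_of_factorial hk)).hom
      (powObj S k (isUnit_of_factorial hk) M)) := by
  rw [theta, invFun_morita, h, powerMap_cls]
  exact moritaInv_adamsChar _ _

theorem theta_add (x y : K R) : S.theta hk (x + y) = S.theta hk x + S.theta hk y := by
  obtain ⟨M, hM⟩ := GrMod.cls_surjective (S.morita x)
  obtain ⟨N, hN⟩ := GrMod.cls_surjective (S.morita y)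
  have h := GrMod.add_isSum M N
  rw [S.theta_eq hk hM.symm, S.theta_eq hk hN.symm, S.theta_eq hk (M := M.add N)]
  · exact sX_hom_powObj_add S k _ hk _ h
  · rw [map_add, ← hM, ← hN, GrMod.cls_of_isSum h]

theorem theta_sub (x y : K R) : S.theta hk (x - y) = S.theta hk x - S.theta hk y := by
  rw [eq_sub_iff_add_eq, ← theta_add, sub_add_cancel]

/-- The module of spinors, as a graded module over the Clifford algebra. -/
abbrev spinors : GrMod Q Unit where
  carrier := S.E
  act := S.φ.toAlgHom
  fgProj := isFGProj_of_algEquiv_end S.faithful S.φ _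
  ε := S.ε
  ε_sq := S.ε_sq
  ε_act := S.φ_odd
  ρ := 1
  ρ_act _ _ := rfl
  ρ_ε _ := rfl

theorem spinors_iso : S.spinors.Iso (S.moritaObj ⟨R⟩) :=
  ⟨(TensorProduct.rid R S.E).symm, fun _ _ => rfl, fun _ => rfl, fun _ _ => rfl⟩

/-- The super representation whose Adams character is the hermitian Bott class. -/
noncomputable abbrev bottRep : SRep R (Equiv.Perm (Fin k)) :=
  (S.twist (k : R) (isUnit_of_factorial hk)).hom (powObj S k (isUnit_of_factorial hk) S.spinors)

theorem bott_eq : S.bott hk = sX (S.bottRep hk) := by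
  refine S.theta_eq hk ?_
  rw [← FGProj.cls_self, morita_cls]
  exact S.spinors_iso.cls_eq.symm

theorem theta_cls (N : FGProj R) :
    S.theta hk N.cls = sX ((S.twist (k : R) (isUnit_of_factorial hk)).hom
      (powObj S k (isUnit_of_factorial hk) (S.moritaRep (SRep.triv Unit (N.toSMod 0))))) :=
  S.theta_eq hk ((S.morita_cls N).trans (S.moritaObj_iso N).cls_eq)

end Spinorial

end Operation

/-! ## Tensor powers of tensor products -/

section ShuffleSign

variable {k : ℕ}

/-- The Koszul sign of `a₁ ⊗ b₁ ⊗ ⋯ ⊗ a_k ⊗ b_k ↦ a₁ ⊗ ⋯ ⊗ a_k ⊗ b₁ ⊗ ⋯ ⊗ b_k`. -/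
def shuffleSign (d d' : Fin k → ZMod 2) : ℤˣ :=
  ∏ p : Fin k × Fin k, if p.1 < p.2 then swapSign (d' p.1) (d p.2) else 1

theorem degSign_add (a b : ZMod 2) : degSign (a + b) = degSign a * degSign b := by
  revert a b; decide

theorem shuffleSign_perm (σ : Equiv.Perm (Fin k)) (d d' : Fin k → ZMod 2) :
    koszulSign σ (d + d') * shuffleSign d d' =
      shuffleSign (fun i => d (σ.symm i)) (fun i => d' (σ.symm i)) *
        (koszulSign σ d * koszulSign σ d') := by
  have hk : ∀ f : Fin k × Fin k → ℤˣ,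
      (∏ p : Fin k × Fin k with p.1 < p.2 ∧ σ p.2 < σ p.1, f p) =
        ∏ p, if p.1 < p.2 ∧ σ p.2 < σ p.1 then f p else 1 := fun f => Finset.prod_filter _ _
  have hs : shuffleSign (fun i => d (σ.symm i)) (fun i => d' (σ.symm i)) =
      ∏ p : Fin k × Fin k, if σ p.1 < σ p.2 then swapSign (d' p.1) (d p.2) else 1 := by
    refine (Equiv.prod_comp (Equiv.prodCongr σ σ) _).symm.trans (Finset.prod_congr rfl fun p _ => ?_)
    simp
  have h4 : ∀ a a' b b' : ZMod 2, swapSign (a + a') (b + b') =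
      swapSign a b * swapSign a' b' * swapSign a b' * swapSign a' b := by decide
  have hd : koszulSign σ (d + d') = koszulSign σ d * koszulSign σ d' *
      (∏ p : Fin k × Fin k, if p.2 < p.1 ∧ σ p.1 < σ p.2 then swapSign (d' p.1) (d p.2) else 1) *
      ∏ p : Fin k × Fin k, if p.1 < p.2 ∧ σ p.2 < σ p.1 then swapSign (d' p.1) (d p.2) else 1 := by
    have h5 : (∏ p : Fin k × Fin k,
        if p.2 < p.1 ∧ σ p.1 < σ p.2 then swapSign (d' p.1) (d p.2) else 1) =
        ∏ p : Fin k × Fin k, if p.1 < p.2 ∧ σ p.2 < σ p.1 then swapSign (d p.1) (d' p.2) else 1 := by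
      refine (Equiv.prod_comp (Equiv.prodComm _ _) _).symm.trans
        (Finset.prod_congr rfl fun p _ => ?_)
      rw [swapSign_comm (d p.1)]
      rfl
    rw [h5, koszulSign, koszulSign, koszulSign, hk, hk, hk, ← Finset.prod_mul_distrib,
      ← Finset.prod_mul_distrib, ← Finset.prod_mul_distrib]
    refine Finset.prod_congr rfl fun p _ => ?_
    split_ifs
    · exact h4 _ _ _ _
    · rfl
  rw [hd, mul_assoc, mul_assoc, mul_comm (shuffleSign _ _)]
  congr 1
  rw [hs, shuffleSign, ← Finset.prod_mul_distrib, ← Finset.prod_mul_distrib]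
  refine Finset.prod_congr rfl fun p _ => ?_
  by_cases hp : p.1 = p.2
  · simp [hp]
  have h2 : σ p.1 ≠ σ p.2 := σ.injective.ne hp
  rcases lt_or_gt_of_ne hp with h3 | h3 <;> rcases lt_or_gt_of_ne h2 with h4 | h4 <;>
    simp [h3, h4, h3.asymm, h4.asymm, Int.units_mul_self]

theorem shuffleSign_update_left (d d' : Fin k → ZMod 2) (i : Fin k) :
    shuffleSign (Function.update d i (d i + 1)) d' =
      shuffleSign d d' * ∏ j, if j < i then degSign (d' j) else 1 := by
  rw [shuffleSign, shuffleSign, Fintype.prod_prod_type, Fintype.prod_prod_type,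
    ← Finset.prod_mul_distrib]
  refine Finset.prod_congr rfl fun j _ => ?_
  have h := Finset.prod_ite_eq' Finset.univ i fun _ => if j < i then degSign (d' j) else 1
  rw [if_pos (Finset.mem_univ _)] at h
  rw [← h, ← Finset.prod_mul_distrib]
  refine Finset.prod_congr rfl fun l _ => ?_
  by_cases hl : l = i
  · subst hl
    rw [Function.update_self, if_pos rfl, swapSign_comm, swapSign_add_one, swapSign_comm]
    split_ifs <;> rfl
  · rw [Function.update_of_ne hl, if_neg hl, mul_one]

theorem shuffleSign_update_right (d d' : Fin k → ZMod 2) (i : Fin k) :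
    shuffleSign d (Function.update d' i (d' i + 1)) =
      shuffleSign d d' * ∏ j, if i < j then degSign (d j) else 1 := by
  rw [shuffleSign, shuffleSign, Fintype.prod_prod_type_right, Fintype.prod_prod_type_right,
    ← Finset.prod_mul_distrib]
  refine Finset.prod_congr rfl fun j _ => ?_
  have h := Finset.prod_ite_eq' Finset.univ i fun _ => if i < j then degSign (d j) else 1
  rw [if_pos (Finset.mem_univ _)] at h
  rw [← h, ← Finset.prod_mul_distrib]
  refine Finset.prod_congr rfl fun l _ => ?_
  by_cases hl : l = i
  · subst hl
    rw [Function.update_self, if_pos rfl, swapSign_add_one]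
    split_ifs <;> rfl
  · rw [Function.update_of_ne hl, if_neg hl, mul_one]

theorem prod_degSign_add (d d' : Fin k → ZMod 2) (i : Fin k) :
    (∏ j, if j < i then degSign ((d + d') j) else 1) =
      (∏ j, if j < i then degSign (d j) else 1) * ∏ j, if j < i then degSign (d' j) else 1 := by
  rw [← Finset.prod_mul_distrib]
  refine Finset.prod_congr rfl fun j _ => ?_
  split_ifs
  · exact degSign_add _ _
  · rfl

theorem prod_degSign_split (d : Fin k → ZMod 2) (i : Fin k) :
    (∏ j, degSign (d j)) * (∏ j, if i < j then degSign (d j) else 1) =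
      (∏ j, if j < i then degSign (d j) else 1) * degSign (d i) := by
  have h := Finset.prod_ite_eq' Finset.univ i fun _ => degSign (d i)
  rw [if_pos (Finset.mem_univ _)] at h
  rw [← h, ← Finset.prod_mul_distrib, ← Finset.prod_mul_distrib]
  refine Finset.prod_congr rfl fun j _ => ?_
  rcases lt_trichotomy i j with h1 | h1 | h1
  · rw [if_pos h1, if_neg h1.asymm, if_neg h1.ne', Int.units_mul_self, mul_one]
  · subst h1
    simp
  · rw [if_neg h1.asymm, if_pos h1, if_neg h1.ne]

end ShuffleSign

section Shuffle

variable {R A B : Type u} [CommRing R] [AddCommGroup A] [Module R A] [AddCommGroup B] [Module R B]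
  {k : ℕ}

/-- The linear map `(a₁ ⊗ ⋯ ⊗ a_k) ⊗ (b₁ ⊗ ⋯ ⊗ b_k) ↦ (a₁ ⊗ b₁) ⊗ ⋯ ⊗ (a_k ⊗ b_k)`. -/
noncomputable def zipTensor (R A B : Type u) [CommRing R] [AddCommGroup A] [Module R A]
    [AddCommGroup B] [Module R B] (k : ℕ) :
    (PiTensorProduct R fun _ : Fin k => A) ⊗[R] (PiTensorProduct R fun _ : Fin k => B) →ₗ[R]
      PiTensorProduct R fun _ : Fin k => A ⊗[R] B :=
  TensorProduct.lift (PiTensorProduct.map₂ fun _ => TensorProduct.mk R A B)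

theorem zipTensor_tprod (a : Fin k → A) (b : Fin k → B) :
    zipTensor R A B k (PiTensorProduct.tprod R a ⊗ₜ PiTensorProduct.tprod R b) =
      PiTensorProduct.tprod R fun i => a i ⊗ₜ[R] b i := by
  rw [zipTensor, TensorProduct.lift.tmul, PiTensorProduct.map₂_tprod_tprod]
  rfl

theorem tprod_eq_sum {M : Type u} [AddCommGroup M] [Module R M] {ι : Type} [Fintype ι]
    [DecidableEq ι] {x : ι → M} {g : ι → Module.Dual R M} (h : ∀ z, ∑ j, g j z • x j = z)
    (z : Fin k → M) : ∑ J : Fin k → ι, (∏ i, g (J i) (z i)) •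
      PiTensorProduct.tprod R (fun i => x (J i)) = PiTensorProduct.tprod R z := by
  conv_rhs => rw [← funext fun i => h (z i), MultilinearMap.map_sum]
  exact Finset.sum_congr rfl fun J _ =>
    (MultilinearMap.map_smul_univ (PiTensorProduct.tprod R) _ _).symm

theorem zipTensor_bijective [Module.Finite R A] [Module.Projective R A] [Module.Finite R B]
    [Module.Projective R B] : Function.Bijective (zipTensor R A B k) := by
  obtain ⟨n, x, g, hx⟩ := exists_dual_basis R A
  obtain ⟨m, y, h, hy⟩ := exists_dual_basis R B
  let f : Fin n × Fin m → Module.Dual R (A ⊗[R] B) := fun p =>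
    TensorProduct.lift ((LinearMap.mul R R).compl₁₂ (g p.1) (h p.2))
  have hf : ∀ p a b, f p (a ⊗ₜ b) = g p.1 a * h p.2 b := fun p a b => rfl
  have hfxy : ∀ z, ∑ p, f p z • (x p.1 ⊗ₜ[R] y p.2) = z := fun z => by
    induction z with
    | zero => simp
    | add z w hz hw =>
      simp only [map_add, add_smul, Finset.sum_add_distrib]
      rw [hz, hw]
    | tmul a b =>
      conv_rhs => rw [← hx a, ← hy b, TensorProduct.sum_tmul]
      simp only [TensorProduct.tmul_sum, hf]
      rw [Fintype.sum_prod_type]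
      exact Finset.sum_congr rfl fun i _ => Finset.sum_congr rfl fun j _ =>
        (TensorProduct.smul_tmul_smul _ _ _ _).symm
  let F : (Fin k → Fin n × Fin m) → Module.Dual R (PiTensorProduct R fun _ : Fin k => A ⊗[R] B) :=
    fun J => PiTensorProduct.lift
      ((MultilinearMap.mkPiAlgebra R (Fin k) R).compLinearMap fun i => f (J i))
  have hF : ∀ J z, F J (PiTensorProduct.tprod R z) = ∏ i, f (J i) (z i) := fun J z => by
    rw [PiTensorProduct.lift.tprod, MultilinearMap.compLinearMap_apply,
      MultilinearMap.mkPiAlgebra_apply]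
  let e : (Fin k → Fin n × Fin m) →
      (PiTensorProduct R fun _ : Fin k => A) ⊗[R] (PiTensorProduct R fun _ : Fin k => B) := fun J =>
    PiTensorProduct.tprod R (fun i => x (J i).1) ⊗ₜ PiTensorProduct.tprod R (fun i => y (J i).2)
  let G : (PiTensorProduct R fun _ : Fin k => A ⊗[R] B) →ₗ[R]
      (PiTensorProduct R fun _ : Fin k => A) ⊗[R] (PiTensorProduct R fun _ : Fin k => B) :=
    ∑ J, (F J).smulRight (e J)
  have hG : ∀ z, G (PiTensorProduct.tprod R z) = ∑ J, (∏ i, f (J i) (z i)) • e J := fun z => by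
    refine (LinearMap.sum_apply _ _ _).trans (Finset.sum_congr rfl fun J _ => ?_)
    rw [LinearMap.smulRight_apply, hF]
  have h1 : zipTensor R A B k ∘ₗ G = LinearMap.id :=
    PiTensorProduct.ext (MultilinearMap.ext fun z => by
      change zipTensor R A B k (G (PiTensorProduct.tprod R z)) = PiTensorProduct.tprod R z
      rw [hG, map_sum, ← tprod_eq_sum hfxy z]
      refine Finset.sum_congr rfl fun J _ => ?_
      rw [map_smul, zipTensor_tprod])
  have h2 : G ∘ₗ zipTensor R A B k = LinearMap.id := by
    refine TensorProduct.ext (PiTensorProduct.ext (MultilinearMap.ext fun a =>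
      PiTensorProduct.ext (MultilinearMap.ext fun b => ?_)))
    change G (zipTensor R A B k (PiTensorProduct.tprod R a ⊗ₜ PiTensorProduct.tprod R b)) =
      PiTensorProduct.tprod R a ⊗ₜ PiTensorProduct.tprod R b
    rw [zipTensor_tprod, hG, ← tprod_eq_sum hx a, ← tprod_eq_sum hy b, TensorProduct.sum_tmul]
    simp only [TensorProduct.tmul_sum]
    rw [← Fintype.sum_prod_type']
    refine (Equiv.sum_comp (Equiv.arrowProdEquivProdArrow _ _ _).symm _).symm.trans
      (Finset.sum_congr rfl fun J _ => ?_)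
    rw [TensorProduct.smul_tmul_smul, ← Finset.prod_mul_distrib]
    rfl
  exact ⟨Function.LeftInverse.injective (LinearMap.congr_fun h2),
    Function.RightInverse.surjective (LinearMap.congr_fun h1)⟩

variable [Invertible (2 : R)] {α : Module.End R A} {β : Module.End R B}

theorem ext_homog_tmul (hα : α * α = 1) (hβ : β * β = 1) {N : Type u} [AddCommGroup N] [Module R N]
    {f g : (PiTensorProduct R fun _ : Fin k => A) ⊗[R] (PiTensorProduct R fun _ : Fin k => B) →ₗ[R] N}
    (h : ∀ d d' a b, IsHomog α d a → IsHomog β d' b →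
      f (PiTensorProduct.tprod R a ⊗ₜ PiTensorProduct.tprod R b) =
        g (PiTensorProduct.tprod R a ⊗ₜ PiTensorProduct.tprod R b)) : f = g :=
  TensorProduct.ext (ext_homog hα fun d a ha => ext_homog hβ fun d' b hb => h d d' a b ha hb)

theorem map_gradeProj_tprod {ε : Module.End R A} {d : Fin k → ZMod 2} {m : Fin k → A}
    (hm : IsHomog ε d m) (d' : Fin k → ZMod 2) :
    PiTensorProduct.map (fun i => gradeProj ε (d' i)) (PiTensorProduct.tprod R m) =
      if d' = d then PiTensorProduct.tprod R m else 0 := by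
  rw [PiTensorProduct.map_tprod]
  split_ifs with h
  · congr 1
    funext i
    rw [gradeProj_apply (hm i), if_pos (congrFun h i)]
  · obtain ⟨i, hi⟩ := Function.ne_iff.mp h
    exact MultilinearMap.map_coord_zero _ i (by rw [gradeProj_apply (hm i), if_neg hi])

variable (α β k) in
/-- The multiplication with the Koszul signs of the shuffle. -/
noncomputable def shuffleEnd : Module.End R
    ((PiTensorProduct R fun _ : Fin k => A) ⊗[R] (PiTensorProduct R fun _ : Fin k => B)) :=
  ∑ p : (Fin k → ZMod 2) × (Fin k → ZMod 2), sgn R (shuffleSign p.1 p.2) •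
    TensorProduct.map (PiTensorProduct.map fun i => gradeProj α (p.1 i))
      (PiTensorProduct.map fun i => gradeProj β (p.2 i))

theorem shuffleEnd_tmul {d d' : Fin k → ZMod 2} {a : Fin k → A} {b : Fin k → B}
    (ha : IsHomog α d a) (hb : IsHomog β d' b) :
    shuffleEnd k α β (PiTensorProduct.tprod R a ⊗ₜ PiTensorProduct.tprod R b) =
      sgn R (shuffleSign d d') • PiTensorProduct.tprod R a ⊗ₜ PiTensorProduct.tprod R b := by
  rw [shuffleEnd, LinearMap.sum_apply, Finset.sum_eq_single (d, d')]
  · rw [LinearMap.smul_apply, TensorProduct.map_tmul, map_gradeProj_tprod ha,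
      map_gradeProj_tprod hb, if_pos rfl, if_pos rfl]
  · intro p _ hp
    rw [LinearMap.smul_apply, TensorProduct.map_tmul, map_gradeProj_tprod ha,
      map_gradeProj_tprod hb]
    split_ifs with h1 h2
    · exact absurd (Prod.ext h1 h2) hp
    · rw [TensorProduct.tmul_zero, smul_zero]
    · rw [TensorProduct.zero_tmul, smul_zero]
    · rw [TensorProduct.zero_tmul, smul_zero]
  · simp

variable [Module.Finite R A] [Module.Projective R A] [Module.Finite R B] [Module.Projective R B]

/-- The isomorphism `A^{⊗ k} ⊗ B^{⊗ k} ≃ (A ⊗ B)^{⊗ k}`, with the Koszul signs. -/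
noncomputable def zipEquiv (k : ℕ) (hα : α * α = 1) (hβ : β * β = 1) :
    (PiTensorProduct R fun _ : Fin k => A) ⊗[R] (PiTensorProduct R fun _ : Fin k => B) ≃ₗ[R]
      PiTensorProduct R fun _ : Fin k => A ⊗[R] B :=
  have h : shuffleEnd k α β ∘ₗ shuffleEnd k α β = LinearMap.id :=
    ext_homog_tmul hα hβ fun d d' a b ha hb => by
      rw [LinearMap.comp_apply, shuffleEnd_tmul ha hb, map_smul, shuffleEnd_tmul ha hb, smul_smul,
        sgn_mul_self, one_smul, LinearMap.id_apply]
  let e : ((PiTensorProduct R fun _ : Fin k => A) ⊗[R] (PiTensorProduct R fun _ : Fin k => B)) ≃ₗ[R]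
      ((PiTensorProduct R fun _ : Fin k => A) ⊗[R] (PiTensorProduct R fun _ : Fin k => B)) :=
    LinearEquiv.ofLinearMap _ _ h h
  e.trans (LinearEquiv.ofBijective _ zipTensor_bijective)

variable {hα : α * α = 1} {hβ : β * β = 1}

theorem zipEquiv_tmul {d d' : Fin k → ZMod 2} {a : Fin k → A} {b : Fin k → B}
    (ha : IsHomog α d a) (hb : IsHomog β d' b) :
    zipEquiv k hα hβ (PiTensorProduct.tprod R a ⊗ₜ PiTensorProduct.tprod R b) =
      sgn R (shuffleSign d d') • PiTensorProduct.tprod R fun i => a i ⊗ₜ[R] b i := by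
  change zipTensor R A B k (shuffleEnd k α β _) = _
  rw [shuffleEnd_tmul ha hb, map_smul, zipTensor_tprod]

omit [Invertible (2 : R)] [Module.Finite R A] [Module.Projective R A] [Module.Finite R B]
  [Module.Projective R B] in
theorem IsHomog.tmul {d d' : Fin k → ZMod 2} {a : Fin k → A} {b : Fin k → B}
    (ha : IsHomog α d a) (hb : IsHomog β d' b) :
    IsHomog (TensorProduct.map α β) (d + d') fun i => a i ⊗ₜ[R] b i := fun i => by
  rw [TensorProduct.map_tmul, ha i, hb i, TensorProduct.smul_tmul_smul, Pi.add_apply, degSign_add,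
    map_mul]

theorem koszulAct_zipEquiv (g : Equiv.Perm (Fin k)) (z) :
    koszulAct (TensorProduct.map α β) g (zipEquiv k hα hβ z) =
      zipEquiv k hα hβ (TensorProduct.map (koszulAct α g) (koszulAct β g) z) := by
  refine LinearMap.congr_fun (f := koszulAct (TensorProduct.map α β) g ∘ₗ
    (zipEquiv k hα hβ).toLinearMap) (g := (zipEquiv k hα hβ).toLinearMap ∘ₗ
      TensorProduct.map (koszulAct α g) (koszulAct β g))
    (ext_homog_tmul hα hβ fun d d' a b ha hb => ?_) z
  change koszulAct (TensorProduct.map α β) g (zipEquiv k hα hβ _) = zipEquiv k hα hβ _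
  rw [zipEquiv_tmul ha hb, map_smul, koszulAct_tprod (ha.tmul hb), TensorProduct.map_tmul,
    koszulAct_tprod ha, koszulAct_tprod hb, TensorProduct.smul_tmul_smul, map_smul,
    zipEquiv_tmul (ha.perm g) (hb.perm g), smul_smul, smul_smul, ← map_mul, ← map_mul, ← map_mul,
    mul_comm (shuffleSign d d'), shuffleSign_perm, mul_comm (shuffleSign _ _)]

theorem map_zipEquiv (z) :
    PiTensorProduct.map (fun _ => TensorProduct.map α β) (zipEquiv k hα hβ z) =
      zipEquiv k hα hβ (TensorProduct.map (PiTensorProduct.map fun _ => α)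
        (PiTensorProduct.map fun _ => β) z) := by
  refine LinearMap.congr_fun (f := PiTensorProduct.map (fun _ => TensorProduct.map α β) ∘ₗ
    (zipEquiv k hα hβ).toLinearMap) (g := (zipEquiv k hα hβ).toLinearMap ∘ₗ
      TensorProduct.map (PiTensorProduct.map fun _ => α) (PiTensorProduct.map fun _ => β))
    (ext_homog_tmul hα hβ fun d d' a b ha hb => ?_) z
  change PiTensorProduct.map _ (zipEquiv k hα hβ _) = zipEquiv k hα hβ _
  have h : ∀ {M : Type u} [AddCommGroup M] [Module R M] {ε : Module.End R M} {d : Fin k → ZMod 2}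
      {m : Fin k → M}, IsHomog ε d m →
      PiTensorProduct.map (fun _ => ε) (PiTensorProduct.tprod R m) =
        sgn R (∏ i, degSign (d i)) • PiTensorProduct.tprod R m := fun hm => by
    rw [PiTensorProduct.map_tprod, ← tprod_sgn_smul]
    exact congrArg _ (funext hm)
  rw [zipEquiv_tmul ha hb, map_smul, h (ha.tmul hb), TensorProduct.map_tmul, h ha, h hb,
    TensorProduct.smul_tmul_smul, map_smul, zipEquiv_tmul ha hb, smul_smul, smul_smul, ← map_mul,
    ← map_mul, ← map_mul, mul_comm, ← Finset.prod_mul_distrib]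
  simp only [Pi.add_apply, degSign_add]

variable {V : Type u} [AddCommGroup V] [Module R V]

theorem powMap_zipEquiv_left {c : V →ₗ[R] Module.End R A} (hc : ∀ v, α * c v = -(c v * α))
    {c' : V →ₗ[R] Module.End R (A ⊗[R] B)} (hc' : ∀ v, c' v = TensorProduct.map (c v) 1) (v : V) (z) :
    powMap (TensorProduct.map α β) c' k v (zipEquiv k hα hβ z) =
      zipEquiv k hα hβ (LinearMap.rTensor _ (powMap α c k v) z) := by
  refine LinearMap.congr_fun (f := powMap (TensorProduct.map α β) c' k v ∘ₗ
    (zipEquiv k hα hβ).toLinearMap) (g := (zipEquiv k hα hβ).toLinearMap ∘ₗ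
      LinearMap.rTensor _ (powMap α c k v))
    (ext_homog_tmul hα hβ fun d d' a b ha hb => ?_) z
  change powMap _ c' k v (zipEquiv k hα hβ _) = zipEquiv k hα hβ _
  rw [zipEquiv_tmul ha hb, map_smul, powMap_tprod (ha.tmul hb), LinearMap.rTensor_tmul,
    powMap_tprod ha, TensorProduct.sum_tmul, map_sum, Finset.smul_sum]
  refine Finset.sum_congr rfl fun i _ => ?_
  rw [← TensorProduct.smul_tmul', map_smul, zipEquiv_tmul (ha.update i (hc v)) hb, smul_smul,
    smul_smul, ← map_mul, ← map_mul, shuffleSign_update_left, prod_degSign_add, mul_left_comm]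
  congr 2
  funext j
  by_cases hj : j = i
  · subst hj
    rw [Function.update_self, Function.update_self, hc']
    rfl
  · rw [Function.update_of_ne hj, Function.update_of_ne hj]

theorem powMap_zipEquiv_right {c : V →ₗ[R] Module.End R B} (hc : ∀ v, β * c v = -(c v * β))
    {c' : V →ₗ[R] Module.End R (A ⊗[R] B)} (hc' : ∀ v, c' v = TensorProduct.map α (c v)) (v : V) (z) :
    powMap (TensorProduct.map α β) c' k v (zipEquiv k hα hβ z) =
      zipEquiv k hα hβ (TensorProduct.map (PiTensorProduct.map fun _ => α) (powMap β c k v) z) := by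
  refine LinearMap.congr_fun (f := powMap (TensorProduct.map α β) c' k v ∘ₗ
    (zipEquiv k hα hβ).toLinearMap) (g := (zipEquiv k hα hβ).toLinearMap ∘ₗ
      TensorProduct.map (PiTensorProduct.map fun _ => α) (powMap β c k v))
    (ext_homog_tmul hα hβ fun d d' a b ha hb => ?_) z
  change powMap _ c' k v (zipEquiv k hα hβ _) = zipEquiv k hα hβ _
  have h : PiTensorProduct.map (fun _ => α) (PiTensorProduct.tprod R a) =
      sgn R (∏ i, degSign (d i)) • PiTensorProduct.tprod R a := by
    rw [PiTensorProduct.map_tprod, ← tprod_sgn_smul]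
    exact congrArg _ (funext ha)
  rw [zipEquiv_tmul ha hb, map_smul, powMap_tprod (ha.tmul hb), TensorProduct.map_tmul, h,
    powMap_tprod hb, TensorProduct.tmul_sum, map_sum, Finset.smul_sum]
  refine Finset.sum_congr rfl fun i _ => ?_
  have hi : (fun j => a j ⊗ₜ[R] Function.update b i (c v (b i)) j) =
      Function.update (fun j => a j ⊗ₜ[R] b j) i (a i ⊗ₜ[R] c v (b i)) := by
    funext j
    by_cases hj : j = i
    · subst hj
      rw [Function.update_self, Function.update_self]
    · rw [Function.update_of_ne hj, Function.update_of_ne hj]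
  rw [TensorProduct.smul_tmul_smul, map_smul, zipEquiv_tmul ha (hb.update i (hc v)), hi, hc',
    TensorProduct.map_tmul, ha i, ← TensorProduct.smul_tmul', MultilinearMap.map_update_smul,
    smul_smul, smul_smul, smul_smul, ← map_mul, ← map_mul, ← map_mul, ← map_mul,
    shuffleSign_update_right, prod_degSign_add]
  congr 2
  have h2 := prod_degSign_split d i
  have key : ∀ s x y z w t : ℤˣ, w * t = x * z → s * (x * y) * z = w * y * (s * t) :=
    fun s x y z w t h => by
      rw [show s * (x * y) * z = s * y * (x * z) by ac_rfl, ← h]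
      ac_rfl
  exact key _ _ _ _ _ _ h2

end Shuffle

/-! ## The sign of the interchange of tensor factors -/

section Interchange

variable {R X Y E B F C N : Type u} [CommRing R] [AddCommGroup X] [Module R X] [AddCommGroup Y]
  [Module R Y] [AddCommGroup E] [Module R E] [AddCommGroup B] [Module R B] [AddCommGroup F]
  [Module R F] [AddCommGroup C] [Module R C] [AddCommGroup N] [Module R N] [Invertible (2 : R)]

theorem linearMap_ext_homog {ε : Module.End R X} (hε : ε * ε = 1) {f g : X →ₗ[R] N}
    (h : ∀ a x, ε x = sgn R (degSign a) • x → f x = g x) : f = g :=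
  LinearMap.ext fun x => by
    rw [← gradeProj_sum (ε := ε) x, map_sum, map_sum]
    exact Finset.sum_congr rfl fun a _ => h a _ (gradeProj_homog hε a x)

/-- The endomorphism of `X ⊗ Y` which is `1` on `X₀ ⊗ Y` and `u` on `X₁ ⊗ Y`. -/
noncomputable def condEnd (ε : Module.End R X) (u : Module.End R Y) : Module.End R (X ⊗[R] Y) :=
  TensorProduct.map (gradeProj ε 0) 1 + TensorProduct.map (gradeProj ε 1) u

theorem condEnd_tmul {ε : Module.End R X} (u : Module.End R Y) {a : ZMod 2} {x : X}
    (hx : ε x = sgn R (degSign a) • x) (y : Y) :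
    condEnd ε u (x ⊗ₜ y) = x ⊗ₜ (if a = 0 then y else u y) := by
  rw [condEnd, LinearMap.add_apply, TensorProduct.map_tmul, TensorProduct.map_tmul,
    gradeProj_apply hx, gradeProj_apply hx]
  have ha : ∀ a : ZMod 2, a = 0 ∨ a = 1 := by decide
  rcases ha a with rfl | rfl
  · rw [if_pos rfl, if_pos rfl, if_neg (by decide), TensorProduct.zero_tmul, add_zero]
    rfl
  · rw [if_neg (by decide), if_pos rfl, if_neg (by decide), TensorProduct.zero_tmul, zero_add]

theorem condEnd_comp_condEnd {ε : Module.End R X} (hε : ε * ε = 1) {u u' : Module.End R Y}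
    (h : u * u' = 1) : condEnd ε u ∘ₗ condEnd ε u' = LinearMap.id :=
  TensorProduct.ext (linearMap_ext_homog hε fun a x hx => LinearMap.ext fun y => by
    change condEnd ε u (condEnd ε u' (x ⊗ₜ[R] y)) = x ⊗ₜ[R] y
    rw [condEnd_tmul u' hx, condEnd_tmul u hx]
    split_ifs
    · rfl
    · exact congrArg (x ⊗ₜ[R] ·) (LinearMap.congr_fun h y))

/-- The automorphism of `X ⊗ Y` which is `1` on `X₀ ⊗ Y` and `u` on `X₁ ⊗ Y`. -/
noncomputable def condEquiv {ε : Module.End R X} (hε : ε * ε = 1) {u u' : Module.End R Y}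
    (h : u * u' = 1) (h' : u' * u = 1) : X ⊗[R] Y ≃ₗ[R] X ⊗[R] Y :=
  LinearEquiv.ofLinearMap (condEnd ε u) (condEnd ε u') (condEnd_comp_condEnd hε h)
    (condEnd_comp_condEnd hε h')

variable {η : Module.End R B} {ε : Module.End R F}

omit [Invertible (2 : R)] in
theorem map_one_mul_self (hη : η * η = 1) :
    TensorProduct.map (1 : Module.End R E) η * TensorProduct.map (1 : Module.End R E) η = 1 := by
  rw [← TensorProduct.map_mul, one_mul, hη, TensorProduct.map_one]

omit [Invertible (2 : R)] in
theorem map_mul_self_one (hε : ε * ε = 1) :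
    TensorProduct.map ε (1 : Module.End R C) * TensorProduct.map ε (1 : Module.End R C) = 1 := by
  rw [← TensorProduct.map_mul, one_mul, hε, TensorProduct.map_one]

/-- The interchange `(E ⊗ B) ⊗ (F ⊗ C) ≃ (E ⊗ F) ⊗ (B ⊗ C)`, with the Koszul sign. -/
noncomputable def interchange (E C : Type u) [AddCommGroup E] [Module R E] [AddCommGroup C]
    [Module R C] (hη : η * η = 1) (hε : ε * ε = 1) :
    (E ⊗[R] B) ⊗[R] (F ⊗[R] C) ≃ₗ[R] (E ⊗[R] F) ⊗[R] (B ⊗[R] C) :=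
  (condEquiv (map_one_mul_self (E := E) hη) (map_mul_self_one (C := C) hε)
    (map_mul_self_one (C := C) hε)).trans (TensorProduct.tensorTensorTensorComm R E B F C)

variable {hη : η * η = 1} {hε : ε * ε = 1}

theorem interchange_tmul {a : ZMod 2} {b : B} (hb : η b = sgn R (degSign a) • b) (x : E) (y : F)
    (c : C) : interchange E C hη hε ((x ⊗ₜ b) ⊗ₜ (y ⊗ₜ c)) =
      (x ⊗ₜ (if a = 0 then y else ε y)) ⊗ₜ (b ⊗ₜ c) := by
  have h : ∀ z, interchange E C hη hε z = TensorProduct.tensorTensorTensorComm R E B F C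
      (condEnd (TensorProduct.map (1 : Module.End R E) η)
        (TensorProduct.map ε (1 : Module.End R C)) z) := fun z => rfl
  rw [h, condEnd_tmul (a := a)]
  · split_ifs <;> rfl
  · rw [TensorProduct.map_tmul, hb, TensorProduct.tmul_smul]
    rfl

theorem interchange_ext (hη : η * η = 1) {f g : (E ⊗[R] B) ⊗[R] (F ⊗[R] C) →ₗ[R] N}
    (h : ∀ a x b y c, η b = sgn R (degSign a) • b →
      f ((x ⊗ₜ b) ⊗ₜ (y ⊗ₜ c)) = g ((x ⊗ₜ b) ⊗ₜ (y ⊗ₜ c))) : f = g :=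
  TensorProduct.ext (TensorProduct.ext (LinearMap.ext fun x =>
    linearMap_ext_homog hη fun a b hb => TensorProduct.ext' fun y c => h a x b y c hb))

theorem interchange_map {f : Module.End R E} {g : Module.End R B} {f' : Module.End R F}
    {g' : Module.End R C} (hg : ∀ b, η (g b) = g (η b)) (hf' : ∀ y, ε (f' y) = f' (ε y)) (z) :
    interchange E C hη hε (TensorProduct.map (TensorProduct.map f g) (TensorProduct.map f' g') z) =
      TensorProduct.map (TensorProduct.map f f') (TensorProduct.map g g')
        (interchange E C hη hε z) := by
  refine LinearMap.congr_fun (f := (interchange E C hη hε).toLinearMap ∘ₗ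
    TensorProduct.map (TensorProduct.map f g) (TensorProduct.map f' g'))
    (g := TensorProduct.map (TensorProduct.map f f') (TensorProduct.map g g') ∘ₗ
      (interchange E C hη hε).toLinearMap) (interchange_ext hη fun a x b y c hb => ?_) z
  rw [LinearMap.comp_apply, LinearMap.comp_apply, LinearEquiv.coe_coe, TensorProduct.map_tmul,
    TensorProduct.map_tmul, TensorProduct.map_tmul, interchange_tmul hb, interchange_tmul (a := a) (by rw [hg, hb, map_smul])]
  split_ifs
  · rfl
  · rw [hf']
    rfl

theorem interchange_map_odd {f : Module.End R E} {f' : Module.End R F}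
    (hf' : ∀ y, ε (f' y) = -f' (ε y)) (z) :
    interchange E C hη hε (TensorProduct.map (TensorProduct.map f η)
      (TensorProduct.map f' (1 : Module.End R C)) z) =
      TensorProduct.map (TensorProduct.map f f') 1 (interchange E C hη hε z) := by
  refine LinearMap.congr_fun (f := (interchange E C hη hε).toLinearMap ∘ₗ
    TensorProduct.map (TensorProduct.map f η) (TensorProduct.map f' 1))
    (g := TensorProduct.map (TensorProduct.map f f') 1 ∘ₗ
      (interchange E C hη hε).toLinearMap) (interchange_ext hη fun a x b y c hb => ?_) z
  rw [LinearMap.comp_apply, LinearMap.comp_apply, LinearEquiv.coe_coe, TensorProduct.map_tmul,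
    TensorProduct.map_tmul, TensorProduct.map_tmul, interchange_tmul hb, interchange_tmul (a := a) (by rw [hb, map_smul, hb])]
  have ha : ∀ a : ZMod 2, a = 0 ∨ a = 1 := by decide
  rcases ha a with rfl | rfl
  · rw [hb, show degSign 0 = 1 from rfl, map_one, one_smul]
    rfl
  · rw [hb, show degSign 1 = -1 from rfl, sgn_neg_one, neg_smul, one_smul, if_neg (by decide),
      if_neg (by decide), hf', TensorProduct.tmul_neg, TensorProduct.neg_tmul,
      TensorProduct.neg_tmul, TensorProduct.tmul_neg, neg_neg]
    rfl

end Interchange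

/-! ## The twist of a sum -/

section TwistSum

variable {R V W : Type u} [CommRing R] [AddCommGroup V] [Module R V] [AddCommGroup W] [Module R W]
  [Invertible (2 : R)] {Q : QuadraticForm R V} {Q' : QuadraticForm R W} (S : Spinorial Q)
  (S' : Spinorial Q') (k : R)

namespace Spinorial

theorem twistEnd_apply {a : ZMod 2} {x : S.E} (hx : S.ε x = sgn R (degSign a) • x) :
    S.twistEnd k x = (if a = 0 then 1 else k) • x := by
  have ha : ∀ a : ZMod 2, a = 0 ∨ a = 1 := by decide
  change (⅟2 : R) • ((x + S.ε x) + k • (x - S.ε x)) = _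
  rcases ha a with rfl | rfl
  · rw [hx, show degSign 0 = 1 from rfl, map_one, one_smul, sub_self, smul_zero, add_zero,
      half_add_half, if_pos rfl, one_smul]
  · rw [hx, show degSign 1 = -1 from rfl, sgn_neg_one, neg_smul, one_smul, add_neg_cancel,
      zero_add, sub_neg_eq_add, smul_comm, half_add_half, if_neg (by decide)]

theorem exists_twistEnd_inv (hk : IsUnit k) : ∃ u, S.twistEnd k * u = 1 ∧ u * S.twistEnd k = 1 := by
  obtain ⟨l, hl⟩ := hk.exists_left_inv
  have h : ∀ a b : Module.End R S.E, a * b = k • 1 → (l • a) * b = 1 := fun a b h => by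
    rw [smul_mul_assoc, h, smul_smul, hl, one_smul]
  have h1 := h _ _ (S.twistEnd_mul_twistEnd k)
  refine ⟨_, ?_, h1⟩
  refine linearMap_ext_homog S.ε_sq fun a x hx => ?_
  have hc : ∀ y, S.twistEnd k (S.ε y) = S.ε (S.twistEnd k y) :=
    LinearMap.congr_fun (S.twistEnd_comm k)
  refine Eq.trans ?_ (LinearMap.congr_fun h1 x)
  simp only [Module.End.mul_apply, LinearMap.smul_apply, LinearMap.add_apply, LinearMap.sub_apply,
    Module.End.one_apply, map_smul, map_add, map_sub, hc]

/-- The twist of a sum is conjugate to the sum of the twists. -/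
theorem condEnd_twist (v : V) (w : W) (z : S.E ⊗[R] S'.E) :
    condEnd S.ε (S'.twistEnd k) (TensorProduct.map (S.φ (ι Q v) * S.twistEnd k) 1 z +
      TensorProduct.map S.ε (S'.φ (ι Q' w) * S'.twistEnd k) z) =
    (S.sum S').twistHom k (ι _ (v, w)) (condEnd S.ε (S'.twistEnd k) z) := by
  refine LinearMap.congr_fun (f := condEnd S.ε (S'.twistEnd k) ∘ₗ
      (TensorProduct.map (S.φ (ι Q v) * S.twistEnd k) 1 +
        TensorProduct.map S.ε (S'.φ (ι Q' w) * S'.twistEnd k)))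
    (g := (S.sum S').twistHom k (ι _ (v, w)) ∘ₗ condEnd S.ε (S'.twistEnd k))
    (TensorProduct.ext (linearMap_ext_homog S.ε_sq fun a x hx =>
      linearMap_ext_homog S'.ε_sq fun b y hy => ?_)) z
  change condEnd S.ε (S'.twistEnd k) (S.φ (ι Q v) (S.twistEnd k x) ⊗ₜ[R] y +
      S.ε x ⊗ₜ[R] S'.φ (ι Q' w) (S'.twistEnd k y)) =
    (S.sum S').twistHom k (ι _ (v, w)) (condEnd S.ε (S'.twistEnd k) (x ⊗ₜ[R] y))
  have hodd : ∀ {U : Type u} [AddCommGroup U] [Module R U] {P : QuadraticForm R U}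
      (T : Spinorial P) (u : U) {a : ZMod 2} {x : T.E}, T.ε x = sgn R (degSign a) • x →
      T.ε (T.φ (ι P u) x) = sgn R (degSign (a + 1)) • T.φ (ι P u) x := fun T u a x hx => by
    rw [T.ε_φ_apply, hx, map_smul, degSign_add, show degSign 1 = -1 from rfl, map_mul, sgn_neg_one,
      mul_neg_one, neg_smul]
  have hφ : ∀ x : S.E, ∀ y : S'.E, (S.sum S').φ (ι _ (v, w)) (x ⊗ₜ[R] y) =
      S.φ (ι Q v) x ⊗ₜ[R] y + S.ε x ⊗ₜ[R] S'.φ (ι Q' w) y := fun x y =>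
    LinearMap.congr_fun (S.sumHom_ι S' v w) (x ⊗ₜ[R] y)
  have htw : (S.sum S').twistEnd k (x ⊗ₜ[R] y) = (if a + b = 0 then 1 else k) • x ⊗ₜ[R] y :=
    (S.sum S').twistEnd_apply k (x := x ⊗ₜ[R] y) (by
      change S.ε x ⊗ₜ[R] S'.ε y = _
      rw [hx, hy, TensorProduct.smul_tmul_smul, degSign_add, map_mul]
      rfl)
  have hR : ∀ r : R, (S.sum S').twistHom k (ι _ (v, w)) (r • x ⊗ₜ[R] y) =
      r • (if a + b = 0 then 1 else k) • (S.φ (ι Q v) x ⊗ₜ[R] y +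
        sgn R (degSign a) • x ⊗ₜ[R] S'.φ (ι Q' w) y) := fun r => by
    refine (LinearMap.map_smul ((S.sum S').twistHom k (ι _ (v, w))) r _).trans
      (congrArg (r • ·) ?_)
    refine (LinearMap.congr_fun ((S.sum S').twistHom_ι k (v, w)) (x ⊗ₜ[R] y)).trans
      ((congrArg ((S.sum S').φ (ι _ (v, w))) htw).trans
        ((LinearMap.map_smul ((S.sum S').φ (ι _ (v, w))) _ _).trans (congrArg (_ • ·) ?_)))
    rw [hφ, hx]
    rfl
  have hy' := S'.twistEnd_apply k (hodd S' w hy)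
  rw [S.twistEnd_apply k hx, S'.twistEnd_apply k hy, map_add, condEnd_tmul _ hx, map_smul, map_smul,
    ← TensorProduct.smul_tmul', map_smul, condEnd_tmul _ (hodd S v hx), TensorProduct.tmul_smul,
    map_smul, hx, ← TensorProduct.smul_tmul', map_smul, condEnd_tmul _ hx,
    S'.twistEnd_apply k hy, hy']
  have hc : (if a = 0 then y else (if b = 0 then 1 else k) • y) =
      (if a = 0 then 1 else if b = 0 then 1 else k) • y := by
    split_ifs <;> simp
  rw [hc, TensorProduct.tmul_smul, hR]
  have ha : ∀ a : ZMod 2, a = 0 ∨ a = 1 := by decide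
  have h10 : (1 : ZMod 2) ≠ 0 := by decide
  have h11 : (1 : ZMod 2) + 1 = 0 := by decide
  rcases ha a with rfl | rfl <;> rcases ha b with rfl | rfl <;>
    simp only [h10, h11, if_true, if_false, one_smul, zero_add, add_zero, TensorProduct.tmul_smul,
      smul_add, smul_comm _ k]

end Spinorial

end TwistSum

/-! ## The Bott class -/

section PowerOfTensor

variable {R V W : Type u} [CommRing R] [AddCommGroup V] [Module R V] [AddCommGroup W] [Module R W]

theorem powMap_eq_add {U M : Type u} [AddCommGroup U] [Module R U] [AddCommGroup M] [Module R M]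
    {ε : Module.End R M} {k : ℕ} {c : U →ₗ[R] Module.End R M} {c' : V →ₗ[R] Module.End R M}
    {c'' : W →ₗ[R] Module.End R M} {x : U} {v : V} {w : W} (h : c x = c' v + c'' w) :
    powMap ε c k x = powMap ε c' k v + powMap ε c'' k w := by
  rw [powMap_apply, powMap_apply, powMap_apply, ← Finset.sum_add_distrib]
  refine Finset.sum_congr rfl fun i _ => ?_
  rw [h, PiTensorProduct.map_update_add]

theorem powMap_congr {M : Type u} [AddCommGroup M] [Module R M] {ε : Module.End R M} {k : ℕ}
    {c c' : V →ₗ[R] Module.End R M} {v : V} (h : c v = c' v) : powMap ε c k v = powMap ε c' k v := by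
  rw [powMap_apply, powMap_apply, h]

theorem congr_map {A A' B B' : Type u} [AddCommGroup A] [Module R A] [AddCommGroup A'] [Module R A']
    [AddCommGroup B] [Module R B] [AddCommGroup B'] [Module R B'] (e : A ≃ₗ[R] B) (e' : A' ≃ₗ[R] B')
    {p : Module.End R A} {p' : Module.End R A'} {q : Module.End R B} {q' : Module.End R B'}
    (h : ∀ x, e (p x) = q (e x)) (h' : ∀ x, e' (p' x) = q' (e' x)) (z : A ⊗[R] A') :
    TensorProduct.congr e e' (TensorProduct.map p p' z) =
      TensorProduct.map q q' (TensorProduct.congr e e' z) :=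
  LinearMap.congr_fun (f := (TensorProduct.congr e e').toLinearMap ∘ₗ TensorProduct.map p p')
    (g := TensorProduct.map q q' ∘ₗ (TensorProduct.congr e e').toLinearMap)
    (TensorProduct.ext' fun x y => congrArg₂ (fun a b => a ⊗ₜ[R] b) (h x) (h' y)) z

theorem symm_trans_conj {A A' A'' : Type u} [AddCommGroup A] [Module R A] [AddCommGroup A']
    [Module R A'] [AddCommGroup A''] [Module R A''] (t : A ≃ₗ[R] A') (T : A ≃ₗ[R] A'') {a : A → A}
    {a' : A' → A'} {a'' : A'' → A''} (h : ∀ z, a' (t z) = t (a z)) (h' : ∀ z, T (a z) = a'' (T z))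
    (x : A') : (t.symm.trans T) (a' x) = a'' ((t.symm.trans T) x) := by
  obtain ⟨z, rfl⟩ := t.surjective x
  rw [h, LinearEquiv.trans_apply, LinearEquiv.trans_apply, t.symm_apply_apply, t.symm_apply_apply, h']

section Transfer

variable [Invertible (2 : R)] {E F B C P P' : Type u} [AddCommGroup E] [Module R E] [AddCommGroup F]
  [Module R F] [AddCommGroup B] [Module R B] [AddCommGroup C] [Module R C] [AddCommGroup P]
  [Module R P] [AddCommGroup P'] [Module R P'] (e : P ≃ₗ[R] E ⊗[R] B) (e' : P' ≃ₗ[R] F ⊗[R] C)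
  {η : Module.End R B} {β : Module.End R F} (hη : η * η = 1) (hβ : β * β = 1)
  (c : E ⊗[R] F ≃ₗ[R] E ⊗[R] F)

/-- The isomorphism `P ⊗ P' ≃ (E ⊗ F) ⊗ (B ⊗ C)` given by `P ≃ E ⊗ B` and `P' ≃ F ⊗ C`. -/
noncomputable def tensorTransfer : P ⊗[R] P' ≃ₗ[R] (E ⊗[R] F) ⊗[R] (B ⊗[R] C) :=
  (TensorProduct.congr e e').trans
    ((interchange E C hη hβ).trans (TensorProduct.congr c (.refl R (B ⊗[R] C))))

theorem tensorTransfer_apply (z : P ⊗[R] P') : tensorTransfer e e' hη hβ c z =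
    TensorProduct.congr c (.refl R (B ⊗[R] C))
      (interchange E C hη hβ (TensorProduct.congr e e' z)) := rfl

variable {p : Module.End R P} {p' : Module.End R P'} {f : Module.End R E} {f' : Module.End R F}

theorem tensorTransfer_map {g : Module.End R B} {g' : Module.End R C}
    (h : ∀ x, e (p x) = TensorProduct.map f g (e x))
    (h' : ∀ x, e' (p' x) = TensorProduct.map f' g' (e' x)) (hg : ∀ b, η (g b) = g (η b))
    (hf' : ∀ y, β (f' y) = f' (β y))
    (hc : ∀ x, c (TensorProduct.map f f' x) = TensorProduct.map f f' (c x)) (z : P ⊗[R] P') :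
    tensorTransfer e e' hη hβ c (TensorProduct.map p p' z) =
      TensorProduct.map (TensorProduct.map f f') (TensorProduct.map g g')
        (tensorTransfer e e' hη hβ c z) := by
  rw [tensorTransfer_apply, tensorTransfer_apply, congr_map e e' h h', interchange_map hg hf']
  exact congr_map c (.refl R (B ⊗[R] C)) (p' := TensorProduct.map g g')
    (q' := TensorProduct.map g g') hc (fun _ => rfl) _

theorem tensorTransfer_act {n : Module.End R P} {α : Module.End R E} {a : Module.End R (E ⊗[R] F)}
    (h : ∀ x, e (p x) = TensorProduct.map f 1 (e x))
    (hn : ∀ x, e (n x) = TensorProduct.map α η (e x))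
    (h' : ∀ x, e' (p' x) = TensorProduct.map f' 1 (e' x)) (hf' : ∀ y, β (f' y) = -f' (β y))
    (hc : ∀ x, c (TensorProduct.map f 1 x + TensorProduct.map α f' x) = a (c x)) (z : P ⊗[R] P') :
    tensorTransfer e e' hη hβ c (TensorProduct.map p 1 z + TensorProduct.map n p' z) =
      TensorProduct.map a 1 (tensorTransfer e e' hη hβ c z) := by
  have h1 : ∀ x, e' ((1 : Module.End R P') x) = TensorProduct.map 1 1 (e' x) := fun x => by
    rw [TensorProduct.map_one]
    rfl
  have h2 : ∀ y, interchange E C hη hβ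
      (TensorProduct.map (TensorProduct.map f (1 : Module.End R B))
        (TensorProduct.map (1 : Module.End R F) (1 : Module.End R C)) y) =
      TensorProduct.map (TensorProduct.map f (1 : Module.End R F))
        (TensorProduct.map (1 : Module.End R B) (1 : Module.End R C)) (interchange E C hη hβ y) :=
    fun y => interchange_map (R := R) (E := E) (B := B) (F := F) (C := C) (η := η) (ε := β)
      (hη := hη) (hε := hβ) (f := f) (g := 1) (f' := 1) (g' := 1) (fun _ => rfl) (fun _ => rfl) y
  rw [tensorTransfer_apply, tensorTransfer_apply, map_add, map_add, congr_map e e' h h1,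
    congr_map e e' hn h', h2, interchange_map_odd hf',
    TensorProduct.map_one]
  generalize interchange E C hη hβ (TensorProduct.congr e e' z) = y
  refine Eq.trans ?_ (congr_map c (.refl R _)
    (p := TensorProduct.map f 1 + TensorProduct.map α f') (p' := 1) (q' := 1) hc (fun _ => rfl) y)
  rw [TensorProduct.map_add_left, LinearMap.add_apply]

end Transfer

variable [Invertible (2 : R)] {Q : QuadraticForm R V} {Q' : QuadraticForm R W} (S : Spinorial Q)
  (S' : Spinorial Q') {k : ℕ} (hk : 0 < k) [Invertible ((k.factorial : ℕ) : R)]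

namespace Spinorial

theorem exists_powEquiv :
    ∃ e : (PiTensorProduct R fun _ : Fin k => S.E) ≃ₗ[R] S.E ⊗[R] (S.bottRep hk).carrier,
      (∀ v y, e (powMap S.ε (S.φ.toLinearMap ∘ₗ ι Q) k v y) =
        TensorProduct.map (S.φ (ι Q v) * S.twistEnd (k : R)) 1 (e y)) ∧
      (∀ y, e (PiTensorProduct.map (fun _ => S.ε) y) =
        TensorProduct.map S.ε (S.bottRep hk).η (e y)) ∧
      ∀ g y, e (koszulAct S.ε g y) = TensorProduct.map 1 ((S.bottRep hk).ρ g) (e y) := by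
  have hu := isUnit_of_factorial (R := R) hk
  obtain ⟨e, h1, h2, h3⟩ := (S.twist (k : R) hu).iso_moritaRep_hom (powObj S k hu S.spinors)
  refine ⟨e, fun v y => ?_, h2, h3⟩
  refine Eq.trans (congrArg e ?_) ((h1 v y).trans ?_)
  · exact (LinearMap.congr_fun (powObj_act S k hu S.spinors v) y).symm
  · exact LinearMap.congr_fun (congrArg (LinearMap.rTensor _) (S.twistHom_ι _ v)) (e y)

/-- The graded tensor power of `E ⊗ N`. -/
theorem iso_powObj_moritaRep (N : SMod R) :
    (powObj S k (isUnit_of_factorial hk) (S.moritaRep (SRep.triv Unit N))).Iso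
      ((S.twist (k : R) (isUnit_of_factorial hk)).moritaRep ((S.bottRep hk).tensor (N.pow k))) := by
  obtain ⟨e, h1, h2, h3⟩ := S.exists_powEquiv hk
  let P := PiTensorProduct R fun _ : Fin k => N.carrier
  let T : (PiTensorProduct R fun _ : Fin k => S.E) ⊗[R] P ≃ₗ[R]
      S.E ⊗[R] ((S.bottRep hk).carrier ⊗[R] P) :=
    (TensorProduct.congr e (.refl R P)).trans (TensorProduct.assoc R S.E (S.bottRep hk).carrier P)
  have key : ∀ (p : Module.End R (PiTensorProduct R fun _ : Fin k => S.E)) (p' : Module.End R P)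
      (f : Module.End R S.E) (g : Module.End R (S.bottRep hk).carrier),
      (∀ x, e (p x) = TensorProduct.map f g (e x)) → ∀ z,
      T (TensorProduct.map p p' z) = TensorProduct.map f (TensorProduct.map g p') (T z) :=
    fun p p' f g h z => by
    refine (congrArg (TensorProduct.assoc R S.E (S.bottRep hk).carrier P)
      (congr_map e (.refl R P) (q' := p') h (fun _ => rfl) z)).trans ?_
    exact (TensorProduct.map_map_assoc _ _ _ _).symm
  refine ⟨(zipEquiv (R := R) k S.ε_sq N.η_mul).symm.trans T, fun v => ?_, ?_, fun g => ?_⟩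
  · refine symm_trans_conj _ T (a := TensorProduct.map (powMap S.ε (S.φ.toLinearMap ∘ₗ ι Q) k v) 1)
      (fun z => ?_) fun z => (key _ 1 _ 1 (h1 v) z).trans ?_
    · exact (LinearMap.congr_fun (powObj_act _ _ _ _ _) _).trans
        (powMap_zipEquiv_left (hα := S.ε_sq) (hβ := N.η_mul) (k := k) (c := S.φ.toLinearMap ∘ₗ ι Q)
          (c' := (S.moritaRep (SRep.triv Unit N)).act.toLinearMap ∘ₗ ι Q)
          S.φ_odd (fun v => rfl) v z)
    · rw [TensorProduct.map_one]
      exact LinearMap.congr_fun (congrArg (LinearMap.rTensor _) (S.twistHom_ι _ v)).symm (T z)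
  · exact symm_trans_conj _ T map_zipEquiv (key _ _ _ _ h2)
  · exact symm_trans_conj _ T (koszulAct_zipEquiv g) (key _ _ _ _ (h3 g))

omit [Invertible ((k.factorial : ℕ) : R)] in
theorem powMap_sum (v : V) (w : W) (z) :
    powMap (TensorProduct.map S.ε S'.ε) (S.sumMap S') k (v, w)
      (zipEquiv (R := R) k S.ε_sq S'.ε_sq z) = zipEquiv (R := R) k S.ε_sq S'.ε_sq
        (TensorProduct.map (powMap S.ε (S.φ.toLinearMap ∘ₗ ι Q) k v) 1 z +
          TensorProduct.map (PiTensorProduct.map fun _ => S.ε)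
            (powMap S'.ε (S'.φ.toLinearMap ∘ₗ ι Q') k w) z) := by
  let cl : V →ₗ[R] Module.End R (S.E ⊗[R] S'.E) :=
    (Module.End.rTensorAlgHom R S.E S'.E).toLinearMap ∘ₗ S.φ.toLinearMap ∘ₗ ι Q
  let cr : W →ₗ[R] Module.End R (S.E ⊗[R] S'.E) :=
    LinearMap.mulLeft R (LinearMap.rTensor S'.E S.ε) ∘ₗ
      (Module.End.lTensorAlgHom R S'.E S.E).toLinearMap ∘ₗ S'.φ.toLinearMap ∘ₗ ι Q'
  have hcr : ∀ w, cr w = TensorProduct.map S.ε (S'.φ (ι Q' w)) := fun w =>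
    TensorProduct.ext' fun x y => rfl
  have hl := powMap_zipEquiv_left (hα := S.ε_sq) (hβ := S'.ε_sq) (k := k)
    (c := S.φ.toLinearMap ∘ₗ ι Q) (c' := cl) S.φ_odd (fun v => rfl) v z
  have hr := powMap_zipEquiv_right (hα := S.ε_sq) (hβ := S'.ε_sq) (k := k)
    (c := S'.φ.toLinearMap ∘ₗ ι Q') (c' := cr) S'.φ_odd hcr w z
  have hadd : powMap (TensorProduct.map S.ε S'.ε) (S.sumMap S') k (v, w) =
      powMap (TensorProduct.map S.ε S'.ε) cl k v + powMap (TensorProduct.map S.ε S'.ε) cr k w :=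
    powMap_eq_add ((S.sumMap_apply S' v w).trans (congrArg (_ + ·) (hcr w).symm))
  rw [hadd, LinearMap.add_apply, hl, hr, ← map_add]
  rfl

omit [Invertible ((k.factorial : ℕ) : R)] in
theorem condEnd_map {f : Module.End R S.E} {f' : Module.End R S'.E} (hf : S.ε * f = f * S.ε)
    (hf' : S'.twistEnd (k : R) * f' = f' * S'.twistEnd (k : R)) (x : S.E ⊗[R] S'.E) :
    condEnd S.ε (S'.twistEnd (k : R)) (TensorProduct.map f f' x) =
      TensorProduct.map f f' (condEnd S.ε (S'.twistEnd (k : R)) x) := by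
  refine LinearMap.congr_fun (f := condEnd S.ε (S'.twistEnd (k : R)) ∘ₗ TensorProduct.map f f')
    (g := TensorProduct.map f f' ∘ₗ condEnd S.ε (S'.twistEnd (k : R)))
    (TensorProduct.ext (linearMap_ext_homog S.ε_sq fun a x hx => LinearMap.ext fun y => ?_)) x
  change condEnd S.ε (S'.twistEnd (k : R)) (f x ⊗ₜ[R] f' y) =
    TensorProduct.map f f' (condEnd S.ε (S'.twistEnd (k : R)) (x ⊗ₜ[R] y))
  have hfx : S.ε (f x) = sgn R (degSign a) • f x :=
    (LinearMap.congr_fun hf x).trans ((congrArg f hx).trans (map_smul f _ _))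
  rw [condEnd_tmul _ hx, condEnd_tmul _ hfx, TensorProduct.map_tmul]
  split_ifs
  · rfl
  · exact congrArg (f x ⊗ₜ[R] ·) (LinearMap.congr_fun hf' y)

theorem exists_sumEquiv :
    ∃ T : (PiTensorProduct R fun _ : Fin k => S.E) ⊗[R] (PiTensorProduct R fun _ : Fin k => S'.E)
      ≃ₗ[R] (S.E ⊗[R] S'.E) ⊗[R] ((S.bottRep hk).carrier ⊗[R] (S'.bottRep hk).carrier),
      (∀ v w z, T (TensorProduct.map (powMap S.ε (S.φ.toLinearMap ∘ₗ ι Q) k v) 1 z +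
        TensorProduct.map (PiTensorProduct.map fun _ => S.ε)
          (powMap S'.ε (S'.φ.toLinearMap ∘ₗ ι Q') k w) z) =
        LinearMap.rTensor ((S.bottRep hk).carrier ⊗[R] (S'.bottRep hk).carrier)
          (show Module.End R (S.E ⊗[R] S'.E) from
            (S.sum S').twistHom (k : R) (ι _ (v, w))) (T z)) ∧
      (∀ z, T (TensorProduct.map (PiTensorProduct.map fun _ => S.ε)
        (PiTensorProduct.map fun _ => S'.ε) z) = TensorProduct.map (TensorProduct.map S.ε S'.ε)
          (TensorProduct.map (S.bottRep hk).η (S'.bottRep hk).η) (T z)) ∧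
      ∀ g z, T (TensorProduct.map (koszulAct S.ε g) (koszulAct S'.ε g) z) =
        LinearMap.lTensor (S.E ⊗[R] S'.E)
          (TensorProduct.map ((S.bottRep hk).ρ g) ((S'.bottRep hk).ρ g)) (T z) := by
  obtain ⟨e, h1, h2, h3⟩ := S.exists_powEquiv hk
  obtain ⟨e', h1', h2', h3'⟩ := S'.exists_powEquiv hk
  obtain ⟨u, hu1, hu2⟩ := S'.exists_twistEnd_inv (k : R) (isUnit_of_factorial hk)
  have hodd : ∀ w y, S'.ε ((S'.φ (ι Q' w) * S'.twistEnd (k : R)) y) =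
      -(S'.φ (ι Q' w) * S'.twistEnd (k : R)) (S'.ε y) := fun w y => by
    rw [Module.End.mul_apply, Module.End.mul_apply, S'.ε_φ_apply,
      ← Module.End.mul_apply S'.ε, ← S'.twistEnd_comm, Module.End.mul_apply]
  refine ⟨tensorTransfer (R := R) (E := S.E) (F := S'.E) (B := (S.bottRep hk).carrier)
    (C := (S'.bottRep hk).carrier) e e' (S.bottRep hk).η_mul S'.ε_sq (condEquiv S.ε_sq hu1 hu2),
    fun v w z => ?_, fun z => ?_, fun g z => ?_⟩
  · exact tensorTransfer_act (R := R) (E := S.E) (F := S'.E) e e' _ _ _ (h1 v) h2 (h1' w) (hodd w)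
      (S.condEnd_twist S' (k : R) v w) z
  · exact tensorTransfer_map e e' _ _ _ h2 h2' (fun _ => rfl) (fun _ => rfl)
      (S.condEnd_map S' rfl (S'.twistEnd_comm _)) z
  · have hc := S.condEnd_map S' (k := k) (f := 1) (f' := 1) ((mul_one _).trans (one_mul _).symm)
      ((mul_one _).trans (one_mul _).symm)
    have hB : ∀ b, (S.bottRep hk).η ((S.bottRep hk).ρ g b) =
        (S.bottRep hk).ρ g ((S.bottRep hk).η b) := fun b => ((S.bottRep hk).ρ_η g b).symm
    have h1 : ∀ y, S'.ε ((1 : Module.End R S'.E) y) = (1 : Module.End R S'.E) (S'.ε y) :=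
      fun _ => rfl
    have h := tensorTransfer_map (R := R) (E := S.E) (F := S'.E) (B := (S.bottRep hk).carrier)
      (C := (S'.bottRep hk).carrier) (p := koszulAct S.ε g) (p' := koszulAct S'.ε g) (f := 1)
      (f' := 1) (g := (S.bottRep hk).ρ g) (g' := (S'.bottRep hk).ρ g) e e' (S.bottRep hk).η_mul
      S'.ε_sq (condEquiv S.ε_sq hu1 hu2) (h3 g) (h3' g) hB h1 hc z
    rw [TensorProduct.map_one] at h
    exact h

/-- The graded tensor power of the spinors of a sum. -/
theorem iso_powObj_sum :
    (powObj (S.sum S') k (isUnit_of_factorial hk) (S.sum S').spinors).Iso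
      (((S.sum S').twist (k : R) (isUnit_of_factorial hk)).moritaRep
        ((S.bottRep hk).tensor (S'.bottRep hk))) := by
  obtain ⟨T, hact, hε, hρ⟩ := S.exists_sumEquiv S' hk
  refine ⟨(zipEquiv (R := R) k S.ε_sq S'.ε_sq).symm.trans T, fun v => ?_, ?_, fun g => ?_⟩
  · refine symm_trans_conj _ T (fun z => Eq.trans ?_ (S.powMap_sum S' v.1 v.2 z)) (hact v.1 v.2)
    refine (LinearMap.congr_fun (powObj_act (S.sum S') k _ (S.sum S').spinors v) _).trans ?_
    exact LinearMap.congr_fun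
      (powMap_congr (c' := S.sumMap S') (CliffordAlgebra.lift_ι_apply _ _ v)) _
  · exact symm_trans_conj _ T map_zipEquiv hε
  · exact symm_trans_conj _ T (koszulAct_zipEquiv g) (hρ g)

theorem theta_cls_eq (N : FGProj R) : S.theta hk N.cls = S.bott hk * adams k N := by
  obtain ⟨h⟩ := nonempty_splitting_hom _ (S.iso_powObj_moritaRep hk (N.toSMod 0))
  rw [theta_cls, h.sX_eq, Fintype.sum_unique, sX_tensor hk, sX_pow_eq_adams N hk, bott_eq]

theorem bott_sum : (S.sum S').bott hk = S.bott hk * S'.bott hk := by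
  obtain ⟨h⟩ := nonempty_splitting_hom _ (S.iso_powObj_sum S' hk)
  rw [bott_eq, bott_eq, bott_eq, ← sX_tensor hk]
  exact h.sX_eq.trans (Fintype.sum_unique _)

end Spinorial

end PowerOfTensor

end HermBott

theorem theorem3p1 {R : Type u} [CommRing R] [Invertible (2 : R)] (k : ℕ) (hk : 0 < k)
    [Invertible ((k.factorial : ℕ) : R)] {V : Type u} [AddCommGroup V] [Module R V]
    {Q : QuadraticForm R V} (S : HermBott.Spinorial Q) :
    -- the two Morita maps are isomorphisms and the power map is well defined
    Function.Bijective S.morita ∧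
    Function.Bijective (S.twist (k : R) (HermBott.isUnit_of_factorial hk)).morita ∧
    (∀ M : HermBott.GrMod Q Unit,
      HermBott.powerMap S k (HermBott.isUnit_of_factorial hk) M.cls =
        (HermBott.powerObj S k (HermBott.isUnit_of_factorial hk) M).cls) ∧
    -- the formula for the composite, on modules and on differences of modules
    (∀ M : HermBott.FGProj R, S.theta hk M.cls = S.bott hk * HermBott.adams k M) ∧
    (∀ M N : HermBott.FGProj R, S.theta hk (M.cls - N.cls) =
      S.bott hk * (HermBott.adams k M - HermBott.adams k N)) ∧
    -- multiplicativity of the Bott class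
    (∀ {W : Type u} [AddCommGroup W] [Module R W] {Q' : QuadraticForm R W}
      (S' : HermBott.Spinorial Q'), (S.sum S').bott hk = S.bott hk * S'.bott hk) := by
  refine ⟨S.morita_bijective, HermBott.Spinorial.morita_bijective _, HermBott.powerMap_cls S k _,
    S.theta_cls_eq hk, fun M N => ?_, fun S' => S.bott_sum S' hk⟩
  rw [S.theta_sub hk, S.theta_cls_eq hk, S.theta_cls_eq hk, mul_sub]
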